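/- **Setting.** Let $K$ be a field that is complete with respect to a non-trivial discrete valuation, with valuation ring $\mathcal O_K$ and residue field $k$, and suppose that $\operatorname{char} K=\operatorname{char} k$. Let $N$ be an infinite finitely generated group and let $\phi:N\to PGL(2,K)$ be an injective homomorphism with discrete image. Let $N$ act through $\phi$ on $\mathbf P^1(K)$ and on the Bruhat–Tits tree $\mathcal T$ of $PGL(2,K)$, whose vertices are the similarity classes of rank two $\mathcal O_K$-lattices in $K^2$, two classes being adjacent if they have representatives $L'\subset L$ with $L/L'$ of length one. Assume that the stabilizers in $N$ of the vertices of $\mathcal T$ are finite, and that all fixed points in $\mathbf P^1$ of elements of $\phi(N)$ are defined over $K$ (that is, every matrix representing an element of $\phi(N)$ has its eigenvalues in $K$); in particular $N$ acts without inversions. **Functors.** Let $\mathcal C_K$ be the category of local Artinian $K$-algebras with residue field $K$. For a group $H$ and a homomorphism $\rho:H\to PGL(2,K)$ let $D_{H,\rho}:\mathcal C_K\to\mathrm{Set}$ be the functor that sends $A$ to the set of all homomorphisms $H\to PGL(2,A)$ whose composition with reduction modulo $\mathfrak m_A$ equals $\rho$ (no quotient by conjugation is taken). **The graph of groups.** Let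 $\mathcal L_N\subset\mathbf P^1(K)$ be the set of limit points of $N$, that is, the limits of sequences $\gamma_m q$ with $q\in\mathbf P^1(K)$ and pairwise distinct $\gamma_m\in N$. Let $\mathcal T_N$ be the smallest subtree of $\mathcal T$ containing all apartments $]u,v[$ with $u\ne v$ in $\mathcal L_N$, and let $T_N=N\backslash\mathcal T_N$. Choose a spanning tree $T$ of $T_N$ and a section $\iota:T\to\mathcal T_N$ of the quotient map. Choose an orientation of every edge $e$ of $T_N$. For every $e$ outside $T$ choose a lift $e^+$ of $e$ to $\mathcal T_N$ with $t(e^+)\in\iota(T)$ and an element $\gamma_e\in N$ such that $e^-:=\gamma_e e^+$ satisfies $o(e^-)\in\iota(T)$; for $e$ in $T$ put $e^+=\iota(e)$ and $\gamma_e=1$. For a vertex $v$ and an edge $e$ of $T_N$ let $N_v$ and $N_e$ be the stabilizers in $N$ of $\iota(v)$ and of $e^+$. There are homomorphisms $N_e\to N_{t(e)}$, the inclusion, and $N_e\to N_{o(e)}$, $n\mapsto\gamma_e n\gamma_e^{-1}$. They induce morphisms of functors $$D_{N_{t(e)},\phi|}\to D_{N_e,\phi|},\quad \psi\mapsto\psi|_{N_e},\qquad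 D_{N_{o(e)},\phi|}\to D_{N_e,\phi|},\quad \psi\mapsto\bigl(n\mapsto \phi(\gamma_e)^{-1}\,\psi(\gamma_e n\gamma_e^{-1})\,\phi(\gamma_e)\bigr),$$ where $\phi(\gamma_e)\in PGL(2,K)$ is viewed in $PGL(2,A)$ through $K\to A$. Let $\varprojlim_{T_N}D_{N_\bullet,\phi|_{N_\bullet}}$ be the inverse limit, in the category of functors $\mathcal C_K\to\mathrm{Set}$, of the diagram formed by these functors and morphisms for all vertices and edges of the graph $T_N$. **The splitting.** Let $F_c$ be the free group on the set of edges of $T_N$ outside $T$; $c$ is the cyclomatic number of $T_N$. By Bass–Serre theory there is a split exact sequence $1\to R\to N\to F_c\to 1$, where $R$ is the normal subgroup of $N$ generated by the stabilizers of the vertices of $\mathcal T_N$, and where the image of $\gamma_e$ in $F_c$ is the generator $e$, for every edge $e$ outside $T$. **Proposition.** For every choice of the data above and every splitting $s:F_c\to N$ of this sequence there is an isomorphism of functors $\mathcal C_K\to\mathrm{Set}$ $$D_{N,\phi}\;\cong\;\varprojlim_{T_N}D_{N_\bullet,\phi|_{N_\bullet}}\times D_{F_c,\phi\circ s}.$$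 The product is a direct product of functors, and the limit is taken over the finite graph $T_N$, not over its universal covering. -/

import Mathlib

universe u

open CategoryTheory CategoryTheory.Limits Filter Topology
open scoped MatrixGroups Pointwise LinearAlgebra.Projectivization WithZero Valued

noncomputable section

namespace MumfordDeformation

/-! ### Local Artinian algebras and the deformation functor of a homomorphism to `PGL(2)` -/

/-- The category `C_K`: local Artinian `K`-algebras with residue field `K`. -/
structure ArtAlg (K : Type u) [Field K] where
  carrier : Type u
  [commRing : CommRing carrier]
  [algebra : Algebra K carrier]
  [isLocalRing : IsLocalRing carrier]
  [isArtinianRing : IsArtinianRing carrier]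
  residue_bijective :
    Function.Bijective (algebraMap K (IsLocalRing.ResidueField carrier))

attribute [instance] ArtAlg.commRing ArtAlg.algebra ArtAlg.isLocalRing ArtAlg.isArtinianRing

section Deform

variable {K : Type u} [Field K]

/-- Morphisms of `C_K` are the `K`-algebra homomorphisms (they are automatically local). -/
instance : Category (ArtAlg K) where
  Hom A B := A.carrier →ₐ[K] B.carrier
  id A := AlgHom.id K A.carrier
  comp f g := g.comp f

/-- Any ring homomorphism between local Artinian rings is local. -/
theorem isLocalHom_of_artinian {A B : Type u} [CommRing A] [CommRing B] [IsLocalRing A]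
    [IsArtinianRing A] [IsLocalRing B] (f : A →+* B) : IsLocalHom f := by
  refine ⟨fun a ha => ?_⟩
  by_contra hna
  have hnil : IsNilpotent a := by
    have hmem : a ∈ IsLocalRing.maximalIdeal A := (IsLocalRing.mem_maximalIdeal a).2 hna
    obtain ⟨n, hn⟩ := IsArtinianRing.isNilpotent_jacobson_bot (R := A)
    rw [IsLocalRing.jacobson_eq_maximalIdeal ⊥ bot_ne_top] at hn
    refine ⟨n, ?_⟩
    have h := Ideal.pow_mem_pow hmem n
    rw [hn] at h
    simpa using h
  exact (hnil.map f).not_isUnit ha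

/-- `ψ : H → PGL(2, A)` lifts `ρ : H → PGL(2, K)` if `ψ` composed with reduction modulo the
maximal ideal of `A` equals `ρ`, where `K` is identified with the residue field of `A`. -/
def IsLift {H : Type u} [Group H] (ρ : H →* PGL(2, K)) (A : ArtAlg K)
    (ψ : H →* PGL(2, A.carrier)) : Prop :=
  (Matrix.ProjGenLinGroup.map (IsLocalRing.residue A.carrier)).comp ψ =
    (Matrix.ProjGenLinGroup.map (algebraMap K (IsLocalRing.ResidueField A.carrier))).comp ρ

theorem IsLift.map {H : Type u} [Group H] {ρ : H →* PGL(2, K)} {A B : ArtAlg K}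
    (f : A.carrier →ₐ[K] B.carrier) {ψ : H →* PGL(2, A.carrier)} (h : IsLift ρ A ψ) :
    IsLift ρ B ((Matrix.ProjGenLinGroup.map (f : A.carrier →+* B.carrier)).comp ψ) := by
  have hloc : IsLocalHom (f : A.carrier →+* B.carrier) := isLocalHom_of_artinian _
  have e1 : (IsLocalRing.residue B.carrier).comp (f : A.carrier →+* B.carrier) =
      (IsLocalRing.ResidueField.map (f : A.carrier →+* B.carrier)).comp
        (IsLocalRing.residue A.carrier) := by
    ext a; simp
  have e2 : (IsLocalRing.ResidueField.map (f : A.carrier →+* B.carrier)).comp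
      (algebraMap K (IsLocalRing.ResidueField A.carrier)) =
        algebraMap K (IsLocalRing.ResidueField B.carrier) := by
    ext a
    rw [IsScalarTower.algebraMap_eq K A.carrier (IsLocalRing.ResidueField A.carrier),
      IsScalarTower.algebraMap_eq K B.carrier (IsLocalRing.ResidueField B.carrier)]
    simp [IsLocalRing.ResidueField.algebraMap_eq]
  unfold IsLift at h ⊢
  rw [← MonoidHom.comp_assoc, ← Matrix.ProjGenLinGroup.map_comp, e1,
    Matrix.ProjGenLinGroup.map_comp, MonoidHom.comp_assoc, h, ← MonoidHom.comp_assoc,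
    ← Matrix.ProjGenLinGroup.map_comp, e2]

/-- The deformation functor `D_{H,ρ} : C_K → Set`, sending `A` to the set of liftings of `ρ`
to `PGL(2, A)` (liftings themselves, not conjugacy classes of liftings). -/
def deform {H : Type u} [Group H] (ρ : H →* PGL(2, K)) : ArtAlg K ⥤ Type u where
  obj A := {ψ : H →* PGL(2, A.carrier) // IsLift ρ A ψ}
  map {A B} f := TypeCat.ofHom fun ψ =>
    ⟨(Matrix.ProjGenLinGroup.map ((show A.carrier →ₐ[K] B.carrier from f) :
      A.carrier →+* B.carrier)).comp ψ.1, ψ.2.map _⟩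
  map_id A := by
    apply ConcreteCategory.hom_ext
    intro ψ
    apply Subtype.ext
    change (Matrix.ProjGenLinGroup.map (RingHom.id A.carrier)).comp ψ.1 = ψ.1
    rw [Matrix.ProjGenLinGroup.map_id]
    rfl
  map_comp {A B C} f g := by
    apply ConcreteCategory.hom_ext
    intro ψ
    apply Subtype.ext
    change (Matrix.ProjGenLinGroup.map
      (((show B.carrier →ₐ[K] C.carrier from g) : B.carrier →+* C.carrier).comp
        ((show A.carrier →ₐ[K] B.carrier from f) : A.carrier →+* B.carrier))).comp ψ.1 = _
    rw [Matrix.ProjGenLinGroup.map_comp]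
    rfl

/-- The image in `PGL(2, A)` of an element of `PGL(2, K)`, by means of the structure map
`K → A`. -/
def constPGL (A : ArtAlg K) : PGL(2, K) →* PGL(2, A.carrier) :=
  Matrix.ProjGenLinGroup.map (algebraMap K A.carrier)

theorem residue_constPGL (A : ArtAlg K) (g : PGL(2, K)) :
    Matrix.ProjGenLinGroup.map (IsLocalRing.residue A.carrier) (constPGL A g) =
      Matrix.ProjGenLinGroup.map (algebraMap K (IsLocalRing.ResidueField A.carrier)) g := by
  unfold constPGL
  rw [← MonoidHom.comp_apply, ← Matrix.ProjGenLinGroup.map_comp]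
  rfl

theorem map_constPGL {A B : ArtAlg K} (f : A.carrier →ₐ[K] B.carrier) (g : PGL(2, K)) :
    Matrix.ProjGenLinGroup.map (f : A.carrier →+* B.carrier) (constPGL A g) =
      constPGL B g := by
  unfold constPGL
  rw [← MonoidHom.comp_apply, ← Matrix.ProjGenLinGroup.map_comp]
  congr 2
  exact f.comp_algebraMap

/-- The morphism of functors `D_{H,ρ} → D_{H',ρ'}` induced by a homomorphism `h : H' → H` such
that `ρ'(x) = g ρ(h(x)) g⁻¹` for a constant `g ∈ PGL(2, K)`: it sends a lifting `ψ` of `ρ` to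
the lifting `x ↦ g ψ(h(x)) g⁻¹` of `ρ'`. For `g = 1` it is the restriction along `h`. -/
def induced {H H' : Type u} [Group H] [Group H'] {ρ : H →* PGL(2, K)} {ρ' : H' →* PGL(2, K)}
    (h : H' →* H) (g : PGL(2, K)) (hg : ∀ x, ρ' x = g * ρ (h x) * g⁻¹) :
    deform ρ ⟶ deform ρ' where
  app A := TypeCat.ofHom fun ψ =>
    ⟨((MulAut.conj (constPGL A g)).toMonoidHom.comp ψ.1).comp h, by
      have hψ := ψ.2
      unfold IsLift at hψ ⊢
      refine MonoidHom.ext fun x => ?_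
      have hx := DFunLike.congr_fun hψ (h x)
      simp only [MonoidHom.comp_apply] at hx
      simp only [MonoidHom.comp_apply, MulEquiv.toMonoidHom_eq_coe, MonoidHom.coe_coe,
        MulAut.conj_apply, map_mul, map_inv, residue_constPGL, hx, hg]⟩
  naturality A B f := by
    ext ψ
    apply Subtype.ext
    refine MonoidHom.ext fun x => ?_
    change constPGL B g * Matrix.ProjGenLinGroup.map _ (ψ.1 (h x)) * (constPGL B g)⁻¹ =
      Matrix.ProjGenLinGroup.map _ (constPGL A g * ψ.1 (h x) * (constPGL A g)⁻¹)
    rw [map_mul, map_mul, map_inv, map_constPGL]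

end Deform

/-! ### The Bruhat–Tits tree of `PGL(2, K)` -/

section Tree

variable (K : Type u) [Field K] [Valued K ℤᵐ⁰]

/-- The `O_K`-lattices of rank two in `K²`. -/
def Lattice : Type u := {L : Submodule 𝒪[K] (Fin 2 → K) // L.IsLattice K}

variable {K}

/-- The `O_K`-linear map `x ↦ g x` of `K²`. -/
def mulVecO (g : GL (Fin 2) K) : (Fin 2 → K) →ₗ[𝒪[K]] (Fin 2 → K) :=
  (Matrix.mulVecLin g.1).restrictScalars 𝒪[K]

theorem mulVecO_apply (g : GL (Fin 2) K) (x : Fin 2 → K) : mulVecO g x = g.1.mulVec x := rfl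

theorem isLattice_map (g : GL (Fin 2) K) {L : Submodule 𝒪[K] (Fin 2 → K)}
    (hL : L.IsLattice K) : (L.map (mulVecO g)).IsLattice K where
  fg := hL.fg.map _
  span_eq_top := by
    have h : ((L.map (mulVecO g) : Submodule 𝒪[K] (Fin 2 → K)) : Set (Fin 2 → K)) =
        (Matrix.mulVecLin g.1) '' (L : Set (Fin 2 → K)) := rfl
    rw [h, ← Submodule.map_span, hL.span_eq_top, Submodule.map_top, LinearMap.range_eq_top]
    intro x
    refine ⟨(g⁻¹).1.mulVec x, ?_⟩
    rw [Matrix.mulVecLin_apply, Matrix.mulVec_mulVec, ← Units.val_mul, mul_inv_cancel,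
      Units.val_one, Matrix.one_mulVec]

/-- `GL(2, K)` acts on lattices by `L ↦ g L`. -/
instance : MulAction (GL (Fin 2) K) (Lattice K) where
  smul g L := ⟨L.1.map (mulVecO g), isLattice_map g L.2⟩
  one_smul L := by
    apply Subtype.ext
    change L.1.map (mulVecO 1) = L.1
    have h : mulVecO (1 : GL (Fin 2) K) = LinearMap.id :=
      LinearMap.ext fun x => Matrix.one_mulVec x
    rw [h, Submodule.map_id]
  mul_smul g h L := by
    apply Subtype.ext
    change L.1.map (mulVecO (g * h)) = (L.1.map (mulVecO h)).map (mulVecO g)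
    rw [← Submodule.map_comp]
    congr 1
    refine LinearMap.ext fun x => ?_
    exact (Matrix.mulVec_mulVec x g.1 h.1).symm

/-- Two lattices are similar if one is a multiple of the other by a nonzero scalar. -/
def Similar (L L' : Lattice K) : Prop :=
  ∃ a : Kˣ, Matrix.GeneralLinearGroup.scalar (Fin 2) a • L = L'

variable (K) in
instance similarSetoid : Setoid (Lattice K) where
  r := Similar
  iseqv :=
    { refl := fun L => ⟨1, by rw [map_one, one_smul]⟩
      symm := by
        rintro L _ ⟨a, rfl⟩
        exact ⟨a⁻¹, by rw [map_inv, inv_smul_smul]⟩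
      trans := by
        rintro L _ _ ⟨a, rfl⟩ ⟨b, rfl⟩
        exact ⟨b * a, by rw [map_mul, mul_smul]⟩ }

variable (K) in
/-- The vertices of the Bruhat–Tits tree: similarity classes of lattices. -/
def Vertex : Type u := Quotient (similarSetoid K)

instance : MulAction (GL (Fin 2) K) (Vertex K) where
  smul g := Quotient.map (fun L => g • L) (by
    rintro L _ ⟨a, rfl⟩
    refine ⟨a, ?_⟩
    have hc : Matrix.GeneralLinearGroup.scalar (Fin 2) a ∈ Subgroup.center (GL (Fin 2) K) := by
      rw [Matrix.GeneralLinearGroup.center_eq_range_scalar]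
      exact ⟨a, rfl⟩
    change _ • g • L = g • _ • L
    rw [← mul_smul, ← mul_smul, (Subgroup.mem_center_iff.1 hc g)])
  one_smul := by
    rintro ⟨L⟩
    exact congrArg (Quotient.mk _) (one_smul _ L)
  mul_smul g h := by
    rintro ⟨L⟩
    exact congrArg (Quotient.mk _) (mul_smul g h L)

/-- The left action of `PGL(2, K)` on the vertices of the Bruhat–Tits tree, induced by
`L ↦ g L`. -/
instance : MulAction PGL(2, K) (Vertex K) :=
  Matrix.ProjGenLinGroup.mulActionOfGL fun a => by
    rintro ⟨L⟩
    exact Quotient.sound (Setoid.symm (a := L) ⟨a, rfl⟩)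

variable (K) in
/-- The Bruhat–Tits tree: two classes are adjacent if they have representatives `L' ⊂ L` such
that `L / L'` has length one, i.e. such that `L'` is a maximal proper submodule of `L`. -/
def bruhatTits : SimpleGraph (Vertex K) :=
  SimpleGraph.fromRel fun x y =>
    ∃ L L' : Lattice K, Quotient.mk _ L = x ∧ Quotient.mk _ L' = y ∧ L'.1 ⋖ L.1

/-- The apartment `]u, v[`: the classes of the lattices `O_K x + O_K y` with `x` on the line `u`
and `y` on the line `v`. -/
def apartment (u v : ℙ K (Fin 2 → K)) : Set (Vertex K) :=
  {Λ | ∃ (x y : Fin 2 → K) (hx : x ≠ 0) (hy : y ≠ 0) (L : Lattice K),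
    Projectivization.mk K x hx = u ∧ Projectivization.mk K y hy = v ∧
      L.1 = Submodule.span 𝒪[K] {x, y} ∧ Quotient.mk _ L = Λ}

/-- A set of vertices spans a subtree if the induced subgraph is empty or connected. -/
def IsSubtree (S : Set (Vertex K)) : Prop :=
  ((bruhatTits K).induce S).Preconnected

/-- The vertex set of the tree associated to a subset `ℒ` of `P¹(K)`: the minimal subtree of the
Bruhat–Tits tree containing all apartments `]u, v[` with `u ≠ v` in `ℒ`. -/
def treeOf (ℒ : Set (ℙ K (Fin 2 → K))) : Set (Vertex K) :=
  ⋂₀ {S | IsSubtree S ∧ ∀ u ∈ ℒ, ∀ v ∈ ℒ, u ≠ v → apartment u v ⊆ S}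

/-- The topology of `P¹(K)`, as a quotient of `K² ∖ {0}`. -/
instance : TopologicalSpace (ℙ K (Fin 2 → K)) :=
  TopologicalSpace.coinduced
    (fun x : {x : Fin 2 → K // x ≠ 0} => Projectivization.mk K x.1 x.2) inferInstance

/-- The topology of `PGL(2, K)`, as a quotient of `GL(2, K)`. -/
instance : TopologicalSpace PGL(2, K) :=
  TopologicalSpace.coinduced (Matrix.ProjGenLinGroup.mk : GL (Fin 2) K → PGL(2, K)) inferInstance

end Tree

/-! ### The tree and the graph of groups of a discrete group -/

section Discrete

variable {K : Type u} [Field K] [Valued K ℤᵐ⁰] {N : Type u} [Group N]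

/-- The set `Hom*(N, PGL(2, K))` of injective homomorphisms with discrete image. -/
def IsDiscreteEmbedding (φ : N →* PGL(2, K)) : Prop :=
  Function.Injective φ ∧ DiscreteTopology φ.range

/-- All fixed points in `P¹` of elements of `φ(N)` are defined over `K`, i.e. all eigenvalues of
the matrices that represent these elements lie in `K`. -/
def FixedPointsRational (φ : N →* PGL(2, K)) : Prop :=
  ∀ g : GL (Fin 2) K, Matrix.ProjGenLinGroup.mk g ∈ φ.range →
    (g : Matrix (Fin 2) (Fin 2) K).charpoly.Splits

/-- The stabilizer `N_Λ` in `N` of a vertex `Λ` of the Bruhat–Tits tree. -/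
def stab (φ : N →* PGL(2, K)) (Λ : Vertex K) : Subgroup N :=
  (MulAction.stabilizer PGL(2, K) Λ).comap φ

theorem mem_stab {φ : N →* PGL(2, K)} {Λ : Vertex K} {n : N} :
    n ∈ stab φ Λ ↔ φ n • Λ = Λ := Iff.rfl

/-- The limit points of `N` in `P¹(K)`: the limits of sequences `γ_m q` for a point `q` and
pairwise distinct elements `γ_m` of `N`. -/
def limitSet (φ : N →* PGL(2, K)) : Set (ℙ K (Fin 2 → K)) :=
  {p | ∃ (q : ℙ K (Fin 2 → K)) (γ : ℕ → N), Function.Injective γ ∧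
    Tendsto (fun m => φ (γ m) • q) atTop (𝓝 p)}

/-- The vertices of the tree `𝒯_N` associated to the set of limit points of `N`. -/
def TreeVertex (φ : N →* PGL(2, K)) : Type u := ↥(treeOf (limitSet φ))

/-- The oriented edges of `𝒯_N`. -/
structure TreeEdge (φ : N →* PGL(2, K)) where
  org : TreeVertex φ
  tgt : TreeVertex φ
  adj : (bruhatTits K).Adj org.1 tgt.1

/-- The vertices of the quotient graph `T_N = N \ 𝒯_N`. -/
def QVertex (φ : N →* PGL(2, K)) : Type u :=
  Quot fun x y : TreeVertex φ => ∃ n : N, φ n • x.1 = y.1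

/-- The (geometric, i.e. unoriented) edges of the quotient graph `T_N = N \ 𝒯_N`. -/
def QEdge (φ : N →* PGL(2, K)) : Type u :=
  Quot fun e e' : TreeEdge φ => ∃ n : N,
    (φ n • e.org.1 = e'.org.1 ∧ φ n • e.tgt.1 = e'.tgt.1) ∨
      (φ n • e.org.1 = e'.tgt.1 ∧ φ n • e.tgt.1 = e'.org.1)

/-- The quotient map on vertices. -/
def QVertex.mk {φ : N →* PGL(2, K)} (x : TreeVertex φ) : QVertex φ := Quot.mk _ x

/-- The quotient map on edges. -/
def QEdge.mk {φ : N →* PGL(2, K)} (e : TreeEdge φ) : QEdge φ := Quot.mk _ e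

/-- The choices that turn `T_N` into a graph of groups.

* A spanning tree `T` of `T_N` with a section `ι : T → 𝒯_N` of the quotient map, given by its
  effect on vertices: `ι` picks one vertex in every orbit, and the vertices picked span a subtree
  of `𝒯_N` (which is `ι(T)`; the edges of `T` are the images of the edges of `ι(T)`).
* For every edge `e` of `T_N` a lift `lift e` to `𝒯_N` whose terminal vertex lies in `ι(T)`, and
  an element `γ e` of `N` that moves the origin of `lift e` into `ι(T)`. If `e` lies in `T`,
  then `lift e` is the edge `ι(e)` and `γ e = 1`. If `e` lies outside `T`, then `lift e` is the
  edge `e⁺`, `γ e` is the corresponding stable letter, and `e⁻` is the translate of `e⁺` by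
  `γ e`. -/
structure GraphOfGroups (φ : N →* PGL(2, K)) where
  ι : QVertex φ → TreeVertex φ
  mk_ι : ∀ v, QVertex.mk (ι v) = v
  connected : IsSubtree (Set.range fun v => (ι v).1)
  lift : QEdge φ → TreeEdge φ
  mk_lift : ∀ e, QEdge.mk (lift e) = e
  γ : QEdge φ → N
  tgt_lift : ∀ e, ι (QVertex.mk (lift e).tgt) = (lift e).tgt
  org_lift : ∀ e, (ι (QVertex.mk (lift e).org)).1 = φ (γ e) • (lift e).org.1
  of_mem_spanningTree : ∀ (v w : QVertex φ) (h : (bruhatTits K).Adj (ι v).1 (ι w).1),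
    ι (QVertex.mk (lift (QEdge.mk ⟨ι v, ι w, h⟩)).org) =
        (lift (QEdge.mk ⟨ι v, ι w, h⟩)).org ∧
      γ (QEdge.mk ⟨ι v, ι w, h⟩) = 1

namespace GraphOfGroups

variable {φ : N →* PGL(2, K)} (𝒢 : GraphOfGroups φ)

/-- The edges of the spanning tree `T`. -/
def InSpanningTree (e : QEdge φ) : Prop :=
  ∃ (v w : QVertex φ) (h : (bruhatTits K).Adj (𝒢.ι v).1 (𝒢.ι w).1),
    QEdge.mk ⟨𝒢.ι v, 𝒢.ι w, h⟩ = e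

/-- The free group `F_c` on the edges of `T_N` outside `T`; their number `c = c(T_N)` is the
cyclomatic number of `T_N`. -/
abbrev FreePart : Type u := FreeGroup {e : QEdge φ // ¬ 𝒢.InSpanningTree e}

/-- The vertex group `N_v`, the stabilizer of `ι(v)`. -/
def vertexGroup (v : QVertex φ) : Subgroup N := stab φ (𝒢.ι v).1

/-- The edge group `N_e`, the stabilizer `N_Λ ∩ N_M` of the lift `[Λ, M]` of `e`. -/
def edgeGroup (e : QEdge φ) : Subgroup N :=
  stab φ (𝒢.lift e).org.1 ⊓ stab φ (𝒢.lift e).tgt.1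

/-- The origin of an edge of `T_N`. -/
def o (e : QEdge φ) : QVertex φ := QVertex.mk (𝒢.lift e).org

/-- The terminal vertex of an edge of `T_N`. -/
def t (e : QEdge φ) : QVertex φ := QVertex.mk (𝒢.lift e).tgt

/-- The inclusion of `N_e` in `N_{t(e)}`. -/
def edgeToTgt (e : QEdge φ) : 𝒢.edgeGroup e →* 𝒢.vertexGroup (𝒢.t e) :=
  Subgroup.inclusion (by
    intro n hn
    change n ∈ stab φ (𝒢.ι (QVertex.mk (𝒢.lift e).tgt)).1
    rw [𝒢.tgt_lift e]
    exact hn.2)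

/-- The homomorphism `n ↦ γ_e n γ_e⁻¹` from `N_e` to `N_{o(e)}`. -/
def edgeToOrg (e : QEdge φ) : 𝒢.edgeGroup e →* 𝒢.vertexGroup (𝒢.o e) :=
  ((MulAut.conj (𝒢.γ e)).toMonoidHom.comp (𝒢.edgeGroup e).subtype).codRestrict _ (by
    intro n
    change 𝒢.γ e * n.1 * (𝒢.γ e)⁻¹ ∈ stab φ (𝒢.ι (QVertex.mk (𝒢.lift e).org)).1
    have hn : φ n.1 • (𝒢.lift e).org.1 = (𝒢.lift e).org.1 := n.2.1
    rw [mem_stab, 𝒢.org_lift e, map_mul, map_mul, map_inv, mul_smul, inv_smul_smul, mul_smul, hn])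

/-- The homomorphism `φ|N_v`. -/
def vertexRep (v : QVertex φ) : 𝒢.vertexGroup v →* PGL(2, K) :=
  φ.comp (𝒢.vertexGroup v).subtype

/-- The homomorphism `φ|N_e`. -/
def edgeRep (e : QEdge φ) : 𝒢.edgeGroup e →* PGL(2, K) :=
  φ.comp (𝒢.edgeGroup e).subtype

/-- The diagram of functors `D_{N_•, φ|N_•}` over the graph `T_N`: for every edge `e` the
morphisms `D_{N_{o(e)}} → D_{N_e} ← D_{N_{t(e)}}` induced by the homomorphisms of `N_e` to
`N_{o(e)}` and `N_{t(e)}`. As `N_e → N_{o(e)}` is `n ↦ γ_e n γ_e⁻¹`, a lifting `ψ` of `φ|N_{o(e)}`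
is sent to the lifting `n ↦ φ(γ_e)⁻¹ ψ(γ_e n γ_e⁻¹) φ(γ_e)` of `φ|N_e`. -/
def diagram : MulticospanIndex
    { L := QVertex φ, R := QEdge φ, fst := 𝒢.o, snd := 𝒢.t } (ArtAlg K ⥤ Type u) where
  left v := deform (𝒢.vertexRep v)
  right e := deform (𝒢.edgeRep e)
  fst e := induced (𝒢.edgeToOrg e) (φ (𝒢.γ e))⁻¹ (by
    intro n
    change φ n.1 = (φ (𝒢.γ e))⁻¹ * φ (𝒢.γ e * n.1 * (𝒢.γ e)⁻¹) * ((φ (𝒢.γ e))⁻¹)⁻¹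
    simp [mul_assoc])
  snd e := induced (𝒢.edgeToTgt e) 1 (by
    intro n
    change φ n.1 = 1 * φ n.1 * 1⁻¹
    simp)

/-- The inverse limit over `T_N` of the functors `D_{N_•, φ|N_•}`, in the category of functors. -/
def limitFunctor : ArtAlg K ⥤ Type u := limit 𝒢.diagram.multicospan

/-- The normal subgroup of `N` generated by the stabilizers of all vertices of `𝒯_N`. It is the
kernel of the surjection `N → F_c` in the Bass–Serre sequence; that surjection sends `γ_e` to the
free generator `e`, for the edges `e` outside `T`. -/
def kernel (_ : GraphOfGroups φ) : Subgroup N :=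
  Subgroup.normalClosure {n | ∃ Λ : TreeVertex φ, n ∈ stab φ Λ.1}

/-- `s : F_c → N` splits the Bass–Serre sequence: for each edge `e` outside `T`, the element
`s(e)` has the same image in `F_c = N / kernel` as `γ_e`. -/
def IsSplitting (s : 𝒢.FreePart →* N) : Prop :=
  ∀ e, (𝒢.γ e.1)⁻¹ * s (FreeGroup.of e) ∈ 𝒢.kernel

end GraphOfGroups

end Discrete

end MumfordDeformation

end

set_option linter.unusedSectionVars false

noncomputable section

/-! By Bass–Serre theory a homomorphism on `N` amounts to homomorphisms ψ_v on the vertex groups and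
elements τ_e, with τ_e = 1 for e in T, such that ψ_{o(e)}(γ_e n γ_e⁻¹) = τ_e ψ_{t(e)}(n) τ_e⁻¹ on
every edge group (`exists_extension`, `hom_ext`). A point of the inverse limit is such a family
glued by the constants φ(γ_e) instead of by τ_e. The free factor records the τ_e; it remains to
straighten the family. One looks for vertex elements g_v and edge elements c_e, all congruent to 1,
with c_e centralizing the straightened edge group and φ(γ_e) c_e g_{t(e)} = g_{o(e)} τ_e.
Conjugating ψ_v by g_v then gives a family glued by constants, because c_e drops out
(`Moves.isGlued_iff`).

The straightening must be canonical. Linearized, the equation asks that (X_v), (Z_e) ↦ Γ_e⁻¹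
X_{o(e)} Γ_e − X_{t(e)} − Z_e be onto, with Z_e in a space of infinitesimal centralizers. A right
inverse of this map, fixed once over `K`, supplies coordinates in which the gluing equation becomes
a fixed point equation contracting for the powers of the maximal ideal; it has exactly one solution
(`existsUnique_isSolution`). It can be solved when the original family is given
(`exists_moves_from`) and when the straightened one is given (`exists_moves_to`), which yields a
bijection. As the right inverse is constant, the bijection is natural in `A` (`Moves.map`).

Surjectivity is the heart of the matter. By the trace form, a functional that kills the image is a
family of trace zero matrices Y_e, orthogonal to the chosen centralizers and of sum zero at every
vertex; it has to vanish (`eq_zero_of_harmonic`). In frames of the lattices the Y_e are scaled to be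
integral with some unit entry and then reduced. Equal characteristic enters here: principal units
have no torsion, so a nontrivial element of a finite stabilizer either has distinct eigenvalues
modulo the maximal ideal or is unipotent ("wild"). If no wild element fixes two neighbours of a
vertex, a Riemann–Hurwitz count leaves at most three relevant edge orbits there, and the sum
condition kills the reductions. Otherwise the vertex group fixes a line, and a nonzero reduction at
the vertex propagates across an edge pointing away from that line (`exists_down`). Unipotent
elements at the far end, carried back, are congruent to 1 to one order more. This cannot continue in
a finite stabilizer (`red_eq_zero_of_not_hasDeepElement`).

The geometric input is proved on the way: the Bruhat–Tits graph is a tree, there are no inversions,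
𝒯_N is nonempty and its quotient has finitely many edges. -/

namespace MumfordDeformation

/-! ### Uniformizers of the discrete valuation -/

section Uniformizer

variable {K : Type u} [Field K] [Valued K ℤᵐ⁰]

/-- `ϖ` is a uniformizer: its value is the largest one below `1`. -/
structure IsUniformizer (ϖ : K) : Prop where
  ne_zero : ϖ ≠ 0
  lt_one : Valued.v ϖ < 1
  le_of_lt_one : ∀ x : K, Valued.v x < 1 → Valued.v x ≤ Valued.v ϖ

-- Nonzero values below 1 have the form exp(−n) with n a natural number, so a value with least n
-- exists and is the largest below 1.
variable (K) in
theorem exists_isUniformizer [(Valued.v : Valuation K ℤᵐ⁰).IsNontrivial] :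
    ∃ ϖ : K, IsUniformizer ϖ := by
  obtain ⟨x, hx0, hx1⟩ := (Valuation.isNontrivial_iff_exists_lt_one (Valued.v : Valuation K ℤᵐ⁰)).1
    inferInstance
  let S : Set ℕ := {n | ∃ y : K, y ≠ 0 ∧ Valued.v y < 1 ∧ Valued.v y = WithZero.exp (-(n : ℤ))}
  have key : ∀ y : K, y ≠ 0 → Valued.v y < 1 →
      ∃ n : ℕ, Valued.v y = WithZero.exp (-(n : ℤ)) := by
    intro y hy hy1
    have h0 : Valued.v y ≠ 0 := (Valuation.ne_zero_iff _).2 hy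
    refine ⟨(-(WithZero.log (Valued.v y))).toNat, ?_⟩
    have h1 : WithZero.log (Valued.v y) < 0 := by
      have := (WithZero.log_lt_log h0 one_ne_zero).2 hy1
      simpa using this
    rw [Int.toNat_of_nonneg (by omega), neg_neg, WithZero.exp_log h0]
  have hne : S.Nonempty := by
    obtain ⟨n, hn⟩ := key x hx0 hx1
    exact ⟨n, x, hx0, hx1, hn⟩
  classical
  obtain ⟨y, hy0, hy1, hy⟩ := Nat.sInf_mem hne
  refine ⟨y, hy0, hy1, fun z hz => ?_⟩
  rcases eq_or_ne z 0 with rfl | hz0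
  · simp
  obtain ⟨n, hn⟩ := key z hz0 hz
  have : sInf S ≤ n := Nat.sInf_le ⟨z, hz0, hz, hn⟩
  rw [hy, hn, WithZero.exp_le_exp]
  omega

namespace IsUniformizer

variable {ϖ : K} (hϖ : IsUniformizer ϖ)
include hϖ

theorem v_pos : 0 < Valued.v ϖ := zero_lt_iff.2 ((Valuation.ne_zero_iff _).2 hϖ.ne_zero)

theorem v_div_le {x : K} (hx : Valued.v x < 1) : Valued.v (ϖ⁻¹ * x) ≤ 1 := by
  rw [map_mul, map_inv₀, mul_comm, ← div_eq_mul_inv]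
  exact div_le_one_of_le₀ (hϖ.le_of_lt_one x hx) zero_le

/-- A valuation ring of this kind is principal as soon as the set of values is not densely ordered,
and no value lies strictly between that of `ϖ` and 1. -/
theorem isPrincipalIdealRing : IsPrincipalIdealRing 𝒪[K] := by
  rw [(Valuation.integer.integers (Valued.v : Valuation K ℤᵐ⁰)).isPrincipalIdealRing_iff_not_denselyOrdered]
  intro h
  obtain ⟨⟨_, z, rfl⟩, h1, h2⟩ := h.dense (⟨Valued.v ϖ, ϖ, rfl⟩ : Set.range (Valued.v : K → ℤᵐ⁰))
    ⟨1, 1, map_one _⟩ hϖ.lt_one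
  exact absurd (hϖ.le_of_lt_one z h2) (not_le.2 h1)

end IsUniformizer

end Uniformizer


/-! ### Bases of lattices -/

section LatticeBasis

variable {K : Type u} [Field K] [Valued K ℤᵐ⁰]

theorem mem_spanPair {x y z : Fin 2 → K} :
    z ∈ Submodule.span 𝒪[K] {x, y} ↔
      ∃ a b : K, Valued.v a ≤ 1 ∧ Valued.v b ≤ 1 ∧ a • x + b • y = z := by
  rw [Submodule.mem_span_pair]
  constructor
  · rintro ⟨a, b, h⟩
    exact ⟨a, b, a.2, b.2, h⟩
  · rintro ⟨a, b, ha, hb, h⟩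
    exact ⟨⟨a, ha⟩, ⟨b, hb⟩, h⟩

theorem smul_mem_of_v_le {L : Submodule 𝒪[K] (Fin 2 → K)} {a : K} (ha : Valued.v a ≤ 1)
    {x : Fin 2 → K} (hx : x ∈ L) : a • x ∈ L :=
  L.smul_mem (⟨a, ha⟩ : 𝒪[K]) hx

theorem mem_smul_lattice {L : Submodule 𝒪[K] (Fin 2 → K)} {a : K} (ha : a ≠ 0)
    {x : Fin 2 → K} : x ∈ a • L ↔ a⁻¹ • x ∈ L := by
  rw [Submodule.mem_smul_pointwise_iff_exists]
  constructor
  · rintro ⟨y, hy, rfl⟩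
    rwa [inv_smul_smul₀ ha]
  · intro h
    exact ⟨_, h, smul_inv_smul₀ ha x⟩

theorem smul_lattice_le {L : Submodule 𝒪[K] (Fin 2 → K)} {a : K} (ha : Valued.v a ≤ 1) :
    a • L ≤ L := by
  intro x hx
  obtain ⟨y, hy, rfl⟩ := (Submodule.mem_smul_pointwise_iff_exists _ _ _).1 hx
  exact smul_mem_of_v_le ha hy

/-- `x, y` is an `O_K`-basis of `L`. -/
structure IsBasisOf (x y : Fin 2 → K) (L : Submodule 𝒪[K] (Fin 2 → K)) : Prop where
  lin : LinearIndependent K ![x, y]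
  eq : L = Submodule.span 𝒪[K] {x, y}

namespace IsBasisOf

variable {x y : Fin 2 → K} {L : Submodule 𝒪[K] (Fin 2 → K)}

theorem mem_iff (h : IsBasisOf x y L) {z : Fin 2 → K} :
    z ∈ L ↔ ∃ a b : K, Valued.v a ≤ 1 ∧ Valued.v b ≤ 1 ∧ a • x + b • y = z := by
  rw [h.eq, mem_spanPair]

theorem left_mem (h : IsBasisOf x y L) : x ∈ L := by
  rw [h.eq]; exact Submodule.subset_span (by simp)

theorem right_mem (h : IsBasisOf x y L) : y ∈ L := by
  rw [h.eq]; exact Submodule.subset_span (by simp)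

theorem symm (h : IsBasisOf x y L) : IsBasisOf y x L :=
  ⟨by
    rw [LinearIndependent.pair_iff]
    intro s t hst
    have := LinearIndependent.pair_iff.1 h.lin t s (by rw [← hst, add_comm])
    exact ⟨this.2, this.1⟩, by rw [h.eq, Set.pair_comm]⟩

theorem coord_unique (h : IsBasisOf x y L) {a b a' b' : K}
    (e : a • x + b • y = a' • x + b' • y) : a = a' ∧ b = b' := by
  have := LinearIndependent.pair_iff.1 h.lin (a - a') (b - b') (by
    rw [sub_smul, sub_smul, ← sub_eq_zero.2 e]; abel)
  exact ⟨sub_eq_zero.1 this.1, sub_eq_zero.1 this.2⟩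

theorem exists_coord (h : IsBasisOf x y L) (z : Fin 2 → K) : ∃ a b : K, z = a • x + b • y := by
  have htop := h.lin.span_eq_top_of_card_eq_finrank' (by simp)
  have hz : z ∈ Submodule.span K (Set.range ![x, y]) := by rw [htop]; trivial
  rw [Matrix.range_cons, Matrix.range_cons, Matrix.range_empty, Set.union_empty,
    Set.singleton_union, Submodule.mem_span_pair] at hz
  obtain ⟨a, b, e⟩ := hz
  exact ⟨a, b, e.symm⟩

theorem mem_iff_coord (h : IsBasisOf x y L) {a b : K} :
    a • x + b • y ∈ L ↔ Valued.v a ≤ 1 ∧ Valued.v b ≤ 1 := by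
  rw [h.mem_iff]
  constructor
  · rintro ⟨a', b', ha, hb, e⟩
    obtain ⟨rfl, rfl⟩ := h.coord_unique e
    exact ⟨ha, hb⟩
  · rintro ⟨ha, hb⟩
    exact ⟨a, b, ha, hb, rfl⟩

theorem smul_smul (h : IsBasisOf x y L) {a b : K} (ha : a ≠ 0) (hb : b ≠ 0) :
    IsBasisOf (a • x) (b • y) (Submodule.span 𝒪[K] {a • x, b • y}) := by
  refine ⟨?_, rfl⟩
  rw [LinearIndependent.pair_iff]
  intro s t hst
  rw [_root_.smul_smul, _root_.smul_smul] at hst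
  have := LinearIndependent.pair_iff.1 h.lin _ _ hst
  simpa [ha, hb] using this

theorem smul_lattice (h : IsBasisOf x y L) {a : K} (ha : a ≠ 0) :
    IsBasisOf (a • x) (a • y) (a • L) := by
  refine ⟨(h.smul_smul ha ha).lin, ?_⟩
  ext z
  rw [mem_smul_lattice ha, h.mem_iff, mem_spanPair]
  refine exists_congr fun c => exists_congr fun d => ?_
  rw [eq_inv_smul_iff₀ ha, smul_add, smul_comm a c, smul_comm a d]

/-- A change of basis. -/
theorem change (h : IsBasisOf x y L) {a b : K} (ha : Valued.v a ≤ 1) (hb : Valued.v b = 1) :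
    IsBasisOf x (a • x + b • y) L := by
  have hb0 : b ≠ 0 := by rintro rfl; simp at hb
  refine ⟨?_, ?_⟩
  · rw [LinearIndependent.pair_iff]
    intro s t hst
    have := LinearIndependent.pair_iff.1 h.lin (s + t * a) (t * b) (by
      rw [← hst]; module)
    have ht : t = 0 := by simpa [hb0] using this.2
    subst ht
    simpa using this.1
  · ext z
    rw [h.mem_iff, mem_spanPair]
    constructor
    · rintro ⟨c, d, hc, hd, rfl⟩
      refine ⟨c - d * b⁻¹ * a, d * b⁻¹, ?_, ?_, ?_⟩
      · refine (Valuation.map_sub _ _ _).trans (max_le hc ?_)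
        rw [map_mul, map_mul, map_inv₀, hb, inv_one, mul_one]
        exact mul_le_one' hd ha
      · rw [map_mul, map_inv₀, hb, inv_one, mul_one]; exact hd
      · rw [sub_smul, smul_add, _root_.smul_smul, _root_.smul_smul, inv_mul_cancel_right₀ hb0]; abel
    · rintro ⟨c, d, hc, hd, rfl⟩
      refine ⟨c + d * a, d * b, ?_, ?_, by module⟩
      · refine (Valuation.map_add _ _ _).trans (max_le hc ?_)
        rw [map_mul]; exact mul_le_one' hd ha
      · rw [map_mul, hb, mul_one]; exact hd

theorem isLattice (h : IsBasisOf x y L) : L.IsLattice K where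
  fg := by
    rw [h.eq]
    exact Submodule.fg_span (Set.toFinite _)
  span_eq_top := by
    rw [eq_top_iff]
    intro z _
    obtain ⟨a, b, rfl⟩ := h.exists_coord z
    exact add_mem (Submodule.smul_mem _ _ (Submodule.subset_span h.left_mem))
      (Submodule.smul_mem _ _ (Submodule.subset_span h.right_mem))

theorem mapGL (h : IsBasisOf x y L) (g : GL (Fin 2) K) :
    IsBasisOf (g.1.mulVec x) (g.1.mulVec y) (L.map (mulVecO g)) := by
  constructor
  · rw [LinearIndependent.pair_iff]
    intro s t hst
    refine LinearIndependent.pair_iff.1 h.lin s t ?_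
    have := congrArg (g⁻¹).1.mulVec hst
    rwa [← Matrix.mulVec_smul, ← Matrix.mulVec_smul, ← Matrix.mulVec_add, Matrix.mulVec_mulVec,
      ← Units.val_mul, inv_mul_cancel, Units.val_one, Matrix.one_mulVec, Matrix.mulVec_zero] at this
  · rw [h.eq, Submodule.map_span, Set.image_pair]
    rfl

end IsBasisOf

variable [(Valued.v : Valuation K ℤᵐ⁰).IsNontrivial]

/-- The valuation ring is principal, so the lattice is free, of rank two. Its two generators span
`K²` over `K` and are therefore independent. -/
theorem Lattice.exists_isBasisOf (L : Lattice K) : ∃ x y, IsBasisOf x y L.1 := by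
  obtain ⟨ϖ, hϖ⟩ := exists_isUniformizer K
  have := hϖ.isPrincipalIdealRing
  have hL := L.2
  have : IsFractionRing 𝒪[K] K :=
    (Valuation.integer.integers (Valued.v : Valuation K ℤᵐ⁰)).isFractionRing
  have : Module.IsTorsionFree 𝒪[K] K := inferInstance
  have : Module.Free 𝒪[K] L.1 := Submodule.IsLattice.free K L.1
  have hr : Module.finrank 𝒪[K] L.1 = 2 := by
    simpa using Submodule.IsLattice.finrank_of_pi (K := K) L.1
  have hfin : Module.Finite 𝒪[K] L.1 := Submodule.IsLattice.finite K L.1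
  let b := (Module.finBasisOfFinrankEq 𝒪[K] L.1 hr)
  have heq : L.1 = Submodule.span 𝒪[K] {(b 0 : Fin 2 → K), (b 1 : Fin 2 → K)} := by
    have h1 := b.span_eq
    have h2 := congrArg (Submodule.map L.1.subtype) h1
    rw [Submodule.map_span, Submodule.map_subtype_top] at h2
    refine h2.symm.trans ?_
    congr 1
    ext z
    simp [Fin.exists_fin_two, eq_comm]
  refine ⟨b 0, b 1, ?_, heq⟩
  have hspan := hL.span_eq_top
  rw [heq, Submodule.span_span_of_tower] at hspan
  refine linearIndependent_of_top_le_span_of_card_eq_finrank ?_ (by simp)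
  rw [← hspan]
  apply Submodule.span_mono
  rintro z (rfl | rfl)
  · exact ⟨0, rfl⟩
  · exact ⟨1, rfl⟩

end LatticeBasis


/-! ### Maximal sublattices of a lattice -/

section Neighbour

variable {K : Type u} [Field K] [Valued K ℤᵐ⁰] {ϖ : K}

/-- The sublattice `O_K x + ϖ L` of `L`. -/
def nbr (ϖ : K) (x : Fin 2 → K) (L : Submodule 𝒪[K] (Fin 2 → K)) : Submodule 𝒪[K] (Fin 2 → K) :=
  Submodule.span 𝒪[K] {x} ⊔ ϖ • L

theorem self_mem_nbr {x : Fin 2 → K} {L : Submodule 𝒪[K] (Fin 2 → K)} : x ∈ nbr ϖ x L :=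
  Submodule.mem_sup_left (Submodule.mem_span_singleton_self x)

theorem smul_le_nbr {x : Fin 2 → K} {L : Submodule 𝒪[K] (Fin 2 → K)} : ϖ • L ≤ nbr ϖ x L :=
  le_sup_right

theorem nbr_smul {x : Fin 2 → K} {L : Submodule 𝒪[K] (Fin 2 → K)} (c : K) :
    nbr ϖ (c • x) (c • L) = c • nbr ϖ x L := by
  unfold nbr
  rw [Submodule.smul_sup', Submodule.smul_span, Set.smul_set_singleton, smul_comm]

theorem nbr_map {x : Fin 2 → K} {L : Submodule 𝒪[K] (Fin 2 → K)} (g : GL (Fin 2) K) :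
    nbr ϖ (g.1.mulVec x) (L.map (mulVecO g)) = (nbr ϖ x L).map (mulVecO g) := by
  unfold nbr
  rw [Submodule.map_sup, Submodule.map_span, Set.image_singleton, mulVecO_apply]
  congr 1
  ext z
  simp only [Submodule.mem_smul_pointwise_iff_exists, Submodule.mem_map]
  constructor
  · rintro ⟨_, ⟨y, hy, rfl⟩, rfl⟩
    exact ⟨ϖ • y, ⟨y, hy, rfl⟩, by rw [mulVecO_apply, mulVecO_apply, Matrix.mulVec_smul]⟩
  · rintro ⟨_, ⟨y, hy, rfl⟩, rfl⟩
    exact ⟨_, ⟨y, hy, rfl⟩, by rw [mulVecO_apply, mulVecO_apply, Matrix.mulVec_smul]⟩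

namespace IsBasisOf

variable {x y : Fin 2 → K} {L : Submodule 𝒪[K] (Fin 2 → K)}

theorem nbr (h : IsBasisOf x y L) (hϖ : IsUniformizer ϖ) : IsBasisOf x (ϖ • y) (nbr ϖ x L) := by
  have h1 := h.smul_smul one_ne_zero hϖ.ne_zero
  rw [one_smul] at h1
  refine ⟨h1.lin, ?_⟩
  unfold MumfordDeformation.nbr
  rw [h.eq, Submodule.smul_span, Set.smul_set_insert, Set.smul_set_singleton,
    Submodule.span_insert, Submodule.span_insert, ← sup_assoc]
  congr 1
  rw [sup_eq_left, Submodule.span_singleton_le_iff_mem]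
  exact smul_mem_of_v_le hϖ.lt_one.le (Submodule.mem_span_singleton_self x)

theorem left_notMem_smul (h : IsBasisOf x y L) (hϖ : IsUniformizer ϖ) : x ∉ ϖ • L := by
  rw [mem_smul_lattice hϖ.ne_zero]
  intro hx
  have := (h.mem_iff_coord (a := ϖ⁻¹) (b := 0)).1 (by simpa using hx)
  rw [map_inv₀, inv_le_one₀ hϖ.v_pos] at this
  exact absurd this.1 (not_le.2 hϖ.lt_one)

theorem right_notMem_nbr (h : IsBasisOf x y L) (hϖ : IsUniformizer ϖ) :
    y ∉ MumfordDeformation.nbr ϖ x L := by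
  intro hy
  have h1 : y = (0 : K) • x + ϖ⁻¹ • (ϖ • y) := by
    rw [inv_smul_smul₀ hϖ.ne_zero, zero_smul, zero_add]
  rw [h1, (h.nbr hϖ).mem_iff_coord, map_inv₀, inv_le_one₀ hϖ.v_pos] at hy
  exact absurd hy.2 (not_le.2 hϖ.lt_one)

theorem nbr_lt (h : IsBasisOf x y L) (hϖ : IsUniformizer ϖ) :
    MumfordDeformation.nbr ϖ x L < L := by
  refine lt_of_le_of_ne (sup_le ?_ (smul_lattice_le hϖ.lt_one.le)) fun e => ?_
  · rw [Submodule.span_singleton_le_iff_mem]; exact h.left_mem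
  · exact h.right_notMem_nbr hϖ (e.symm.le h.right_mem)

theorem smul_lt_nbr (h : IsBasisOf x y L) (hϖ : IsUniformizer ϖ) :
    ϖ • L < MumfordDeformation.nbr ϖ x L :=
  lt_of_le_of_ne smul_le_nbr fun e => h.left_notMem_smul hϖ (e ▸ self_mem_nbr)

/-- `O_K x + ϖ L` is maximal in `L`. -/
theorem eq_of_nbr_le (h : IsBasisOf x y L) (hϖ : IsUniformizer ϖ)
    {M : Submodule 𝒪[K] (Fin 2 → K)} (h1 : MumfordDeformation.nbr ϖ x L ≤ M) (h2 : M ≤ L) :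
    M = MumfordDeformation.nbr ϖ x L ∨ M = L := by
  by_cases hM : M ≤ MumfordDeformation.nbr ϖ x L
  · exact Or.inl (le_antisymm hM h1)
  · right
    obtain ⟨z, hz, hzn⟩ := SetLike.not_le_iff_exists.1 hM
    obtain ⟨a, b, ha, hb, rfl⟩ := h.mem_iff.1 (h2 hz)
    have hb1 : Valued.v b = 1 := by
      refine le_antisymm hb (not_lt.1 fun hlt => hzn ?_)
      have : a • x + b • y = a • x + (ϖ⁻¹ * b) • (ϖ • y) := by
        rw [_root_.smul_smul, mul_comm, mul_inv_cancel_left₀ hϖ.ne_zero]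
      rw [this, (h.nbr hϖ).mem_iff_coord]
      exact ⟨ha, hϖ.v_div_le hlt⟩
    refine le_antisymm h2 ?_
    rw [(h.change ha hb1).eq, Submodule.span_le]
    rintro w (rfl | rfl)
    · exact h1 self_mem_nbr
    · exact hz

theorem nbr_covBy (h : IsBasisOf x y L) (hϖ : IsUniformizer ϖ) :
    MumfordDeformation.nbr ϖ x L ⋖ L := by
  refine ⟨h.nbr_lt hϖ, fun M h1 h2 => ?_⟩
  rcases h.eq_of_nbr_le hϖ h1.le h2.le with e | e
  · exact h1.ne' e
  · exact h2.ne e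

/-- One of the two coordinates of a primitive vector is a unit; the vector can replace the
corresponding basis vector. -/
theorem exists_of_notMem_smul (h : IsBasisOf x y L) (hϖ : IsUniformizer ϖ) {z : Fin 2 → K}
    (hz : z ∈ L) (hz' : z ∉ ϖ • L) : ∃ w, IsBasisOf z w L := by
  obtain ⟨a, b, ha, hb, rfl⟩ := h.mem_iff.1 hz
  by_cases hb1 : Valued.v b = 1
  · exact ⟨x, (h.change ha hb1).symm⟩
  · by_cases ha1 : Valued.v a = 1
    · refine ⟨y, ?_⟩
      rw [add_comm]
      exact (h.symm.change hb ha1).symm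
    · refine absurd ?_ hz'
      rw [mem_smul_lattice hϖ.ne_zero, smul_add, _root_.smul_smul, _root_.smul_smul,
        h.mem_iff_coord]
      exact ⟨hϖ.v_div_le (lt_of_le_of_ne ha ha1), hϖ.v_div_le (lt_of_le_of_ne hb hb1)⟩

end IsBasisOf

/-- Homothetic sublattices strictly between `ϖ L` and `L` (with `L` included) are equal. -/
theorem eq_of_smul_eq (hϖ : IsUniformizer ϖ) {L M M' : Submodule 𝒪[K] (Fin 2 → K)} {c : K}
    (hc : c ≠ 0) (h1 : ϖ • L < M) (h2 : M ≤ L) (h1' : ϖ • L < M') (h2' : M' ≤ L)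
    (e : c • M = M') : M = M' := by
  -- A scalar of value below 1 would push the whole sublattice into `ϖ • L`. Applied to `c` and to
  -- its inverse, this shows that `c` is a unit.
  have key : ∀ {M M' : Submodule 𝒪[K] (Fin 2 → K)} {c : K}, c • M = M' → M ≤ L → ϖ • L < M' →
      c ≠ 0 → ¬ Valued.v c < 1 := by
    intro M M' c e h2 h1' hc hlt
    refine h1'.not_ge ?_
    rw [← e]
    intro z hz
    rw [mem_smul_lattice hc] at hz
    rw [mem_smul_lattice hϖ.ne_zero]
    have : ϖ⁻¹ • z = (ϖ⁻¹ * c) • (c⁻¹ • z) := by rw [smul_smul, mul_inv_cancel_right₀ hc]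
    rw [this]
    exact smul_mem_of_v_le (hϖ.v_div_le hlt) (h2 hz)
  have e' : c⁻¹ • M' = M := by rw [← e, inv_smul_smul₀ hc]
  have hv1 := key e h2 h1' hc
  have hv2 := key e' h2' h1 (inv_ne_zero hc)
  rw [map_inv₀, inv_lt_one₀ (zero_lt_iff.2 ((Valuation.ne_zero_iff _).2 hc))] at hv2
  have hv : Valued.v c = 1 := le_antisymm (not_lt.1 hv2) (not_lt.1 hv1)
  refine le_antisymm ?_ (e ▸ smul_lattice_le hv.le)
  calc M = c⁻¹ • M' := e'.symm
    _ ≤ M' := smul_lattice_le (by rw [map_inv₀, hv, inv_one])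

variable [(Valued.v : Valuation K ℤᵐ⁰).IsNontrivial]

theorem Lattice.exists_isBasisOf_of_notMem (hϖ : IsUniformizer ϖ) (L : Lattice K) {x : Fin 2 → K}
    (hx : x ∈ L.1) (hx' : x ∉ ϖ • L.1) : ∃ y, IsBasisOf x y L.1 := by
  obtain ⟨e, f, h⟩ := L.exists_isBasisOf
  exact h.exists_of_notMem_smul hϖ hx hx'

/-- Every line contains a primitive vector of `L`. -/
theorem Lattice.exists_smul_primitive (hϖ : IsUniformizer ϖ) (L : Lattice K) {x : Fin 2 → K}
    (hx : x ≠ 0) : ∃ c : K, c ≠ 0 ∧ c • x ∈ L.1 ∧ c • x ∉ ϖ • L.1 := by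
  obtain ⟨e, f, h⟩ := L.exists_isBasisOf
  obtain ⟨a, b, rfl⟩ := h.exists_coord x
  -- Dividing by the coordinate of larger value makes the vector primitive.
  wlog hab : Valued.v b ≤ Valued.v a generalizing a b e f
  · rw [add_comm] at hx ⊢
    exact this f e h.symm b a hx (not_le.1 hab).le
  have ha : a ≠ 0 := by
    rintro rfl
    rw [map_zero, le_zero_iff, map_eq_zero] at hab
    simp [hab] at hx
  have h1 : a⁻¹ • (a • e + b • f) = (1 : K) • e + (a⁻¹ * b) • f := by
    rw [smul_add, smul_smul, smul_smul, inv_mul_cancel₀ ha]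
  refine ⟨a⁻¹, inv_ne_zero ha, ?_, ?_⟩
  · rw [h1, h.mem_iff_coord, map_mul, map_inv₀, mul_comm, ← div_eq_mul_inv]
    exact ⟨(map_one _).le, div_le_one_of_le₀ hab zero_le⟩
  · rw [h1, mem_smul_lattice hϖ.ne_zero, smul_add, smul_smul, smul_smul, h.mem_iff_coord, mul_one,
      map_inv₀, inv_le_one₀ hϖ.v_pos]
    exact fun h2 => absurd h2.1 (not_le.2 hϖ.lt_one)

/-- Maximal sublattices correspond to lines in the plane `L / ϖL` over the residue field. This turns
the length-one condition of adjacency into explicit bases. -/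
theorem Lattice.covBy_iff (hϖ : IsUniformizer ϖ) (L : Lattice K)
    {M : Submodule 𝒪[K] (Fin 2 → K)} :
    M ⋖ L.1 ↔ ∃ x ∈ L.1, x ∉ ϖ • L.1 ∧ M = nbr ϖ x L.1 := by
  constructor
  · intro hM
    -- If `M` were contained in `ϖ • L`, then any `O_K e + ϖ L` would lie strictly between `M` and
    -- `L`.
    have hex : ¬ M ≤ ϖ • L.1 := by
      intro hle
      obtain ⟨e, f, h⟩ := L.exists_isBasisOf
      exact hM.2 (hle.trans_lt (h.smul_lt_nbr hϖ)) (h.nbr_lt hϖ)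
    obtain ⟨x, hx, hx'⟩ := SetLike.not_le_iff_exists.1 hex
    refine ⟨x, hM.le hx, hx', ?_⟩
    obtain ⟨y, h⟩ := L.exists_isBasisOf_of_notMem hϖ (hM.le hx) hx'
    by_cases hle : M ≤ nbr ϖ x L.1
    · exact ((hM.eq_or_eq hle (h.nbr_lt hϖ).le).resolve_right (h.nbr_lt hϖ).ne).symm
    · exfalso
      obtain ⟨z, hz, hzn⟩ := SetLike.not_le_iff_exists.1 hle
      obtain ⟨a, b, ha, hb, rfl⟩ := h.mem_iff.1 (hM.le hz)
      have hb1 : Valued.v b = 1 := by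
        refine le_antisymm hb (not_lt.1 fun hlt => hzn ?_)
        have : a • x + b • y = a • x + (ϖ⁻¹ * b) • (ϖ • y) := by
          rw [smul_smul, mul_comm, mul_inv_cancel_left₀ hϖ.ne_zero]
        rw [this, (h.nbr hϖ).mem_iff_coord]
        exact ⟨ha, hϖ.v_div_le hlt⟩
      refine hM.lt.not_ge ?_
      rw [(h.change ha hb1).eq, Submodule.span_le]
      rintro w (rfl | rfl)
      · exact hx
      · exact hz
  · rintro ⟨x, hx, hx', rfl⟩
    obtain ⟨y, h⟩ := L.exists_isBasisOf_of_notMem hϖ hx hx'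
    exact h.nbr_covBy hϖ

end Neighbour


/-! ### Vertices, neighbours, and the direction of an end -/

section Vertices

variable {K : Type u} [Field K] [Valued K ℤᵐ⁰]

/-- The vertex given by a lattice. -/
def vtx (L : Lattice K) : Vertex K := Quotient.mk _ L

theorem vtx_surjective : Function.Surjective (vtx : Lattice K → Vertex K) := Quotient.mk_surjective

theorem scalar_smul_val (a : Kˣ) (L : Lattice K) :
    (Matrix.GeneralLinearGroup.scalar (Fin 2) a • L).1 = (a : K) • L.1 := by
  change L.1.map (mulVecO _) = _
  ext z
  rw [Submodule.mem_smul_pointwise_iff_exists, Submodule.mem_map]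
  refine exists_congr fun y => and_congr_right fun _ => ?_
  rw [mulVecO_apply]
  simp

theorem vtx_eq_iff {L L' : Lattice K} : vtx L = vtx L' ↔ ∃ c : K, c ≠ 0 ∧ c • L.1 = L'.1 := by
  refine (Quotient.eq (r := similarSetoid K)).trans ?_
  constructor
  · rintro ⟨a, rfl⟩
    exact ⟨a, a.ne_zero, (scalar_smul_val a L).symm⟩
  · rintro ⟨c, hc, e⟩
    exact ⟨Units.mk0 c hc, Subtype.ext (by rw [scalar_smul_val, Units.val_mk0, e])⟩

theorem mk_smul_vtx (g : GL (Fin 2) K) (L : Lattice K) :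
    Matrix.ProjGenLinGroup.mk g • vtx L = vtx (g • L) := rfl

theorem smul_val (g : GL (Fin 2) K) (L : Lattice K) : (g • L).1 = L.1.map (mulVecO g) := rfl

/-- The lattice `c L`. -/
def Lattice.scale (L : Lattice K) (c : K) (hc : c ≠ 0) : Lattice K :=
  ⟨c • L.1, by
    have := Matrix.GeneralLinearGroup.scalar (Fin 2) (Units.mk0 c hc) • L
    rw [← Units.val_mk0 hc, ← scalar_smul_val]
    exact Subtype.prop _⟩

theorem vtx_scale (L : Lattice K) (c : K) (hc : c ≠ 0) : vtx (L.scale c hc) = vtx L :=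
  (vtx_eq_iff.2 ⟨c, hc, rfl⟩).symm

theorem ne_zero_of_notMem {c : K} {x : Fin 2 → K} {L : Submodule 𝒪[K] (Fin 2 → K)}
    (h : x ∉ c • L) : x ≠ 0 := by
  rintro rfl
  exact h (zero_mem _)

variable {ϖ : K}

/-- The lattice `O_K x + ϖ L`. -/
def nbrLat (hϖ : IsUniformizer ϖ) (x : Fin 2 → K) (L : Lattice K) : Lattice K :=
  ⟨nbr ϖ x L.1, by
    have := (L.scale ϖ hϖ.ne_zero).2
    have hfg : (ϖ • L.1).FG := this.fg
    exact @Submodule.IsLattice.of_le_of_isLattice_of_fg _ _ K _ _ _ _ _ _ _ (ϖ • L.1) _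
      smul_le_nbr this (Submodule.FG.sup (Submodule.fg_span_singleton x) hfg)⟩

theorem nbrLat_val (hϖ : IsUniformizer ϖ) (x : Fin 2 → K) (L : Lattice K) :
    (nbrLat hϖ x L).1 = nbr ϖ x L.1 := rfl

theorem smul_covBy_smul {c : K} (hc : c ≠ 0) {M L : Submodule 𝒪[K] (Fin 2 → K)} (h : M ⋖ L) :
    c • M ⋖ c • L := by
  have hle : ∀ {d : K}, d ≠ 0 → ∀ {A B : Submodule 𝒪[K] (Fin 2 → K)}, A < B → d • A < d • B := by
    intro d hd A B hAB
    refine lt_of_le_of_ne (smul_mono_right d hAB.le) fun e => hAB.ne ?_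
    rw [← inv_smul_smul₀ hd A, e, inv_smul_smul₀ hd]
  refine ⟨hle hc h.1, fun P h1 h2 => ?_⟩
  have h1' := hle (inv_ne_zero hc) h1
  have h2' := hle (inv_ne_zero hc) h2
  rw [inv_smul_smul₀ hc] at h1' h2'
  exact h.2 h1' h2'

variable [(Valued.v : Valuation K ℤᵐ⁰).IsNontrivial]

/-- A similarity class has at most one representative `M` with `ϖ • L < M ≤ L`, so the neighbouring
vertex remembers the sublattice. -/
theorem nbrLat_injective (hϖ : IsUniformizer ϖ) {L : Lattice K} {x x' : Fin 2 → K}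
    (hx : x ∈ L.1) (hx1 : x ∉ ϖ • L.1) (hx' : x' ∈ L.1) (hx1' : x' ∉ ϖ • L.1)
    (h : vtx (nbrLat hϖ x L) = vtx (nbrLat hϖ x' L)) : nbr ϖ x L.1 = nbr ϖ x' L.1 := by
  obtain ⟨c, hc, e⟩ := vtx_eq_iff.1 h
  obtain ⟨y, hb⟩ := L.exists_isBasisOf_of_notMem hϖ hx hx1
  obtain ⟨y', hb'⟩ := L.exists_isBasisOf_of_notMem hϖ hx' hx1'
  exact eq_of_smul_eq hϖ hc (hb.smul_lt_nbr hϖ) (hb.nbr_lt hϖ).le (hb'.smul_lt_nbr hϖ)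
    (hb'.nbr_lt hϖ).le e

theorem vtx_nbrLat_ne (hϖ : IsUniformizer ϖ) {L : Lattice K} {x : Fin 2 → K}
    (hx : x ∈ L.1) (hx1 : x ∉ ϖ • L.1) : vtx (nbrLat hϖ x L) ≠ vtx L := by
  intro h
  obtain ⟨c, hc, e⟩ := vtx_eq_iff.1 h
  obtain ⟨y, hb⟩ := L.exists_isBasisOf_of_notMem hϖ hx hx1
  refine (hb.nbr_lt hϖ).ne (eq_of_smul_eq hϖ hc (hb.smul_lt_nbr hϖ) (hb.nbr_lt hϖ).le
    ((hb.smul_lt_nbr hϖ).trans (hb.nbr_lt hϖ)) le_rfl e)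

theorem adj_iff (hϖ : IsUniformizer ϖ) {L : Lattice K} {Λ : Vertex K} :
    (bruhatTits K).Adj (vtx L) Λ ↔ ∃ x ∈ L.1, x ∉ ϖ • L.1 ∧ Λ = vtx (nbrLat hϖ x L) := by
  unfold bruhatTits
  rw [SimpleGraph.fromRel_adj]
  constructor
  · rintro ⟨-, ⟨L1, L2, h1, h2, h⟩ | ⟨L2, L1, h2, h1, h⟩⟩
    · obtain ⟨c, hc, e⟩ := vtx_eq_iff.1 (show vtx L1 = vtx L from h1)
      have hcov := smul_covBy_smul hc h
      rw [e] at hcov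
      obtain ⟨x, hx, hx1, e'⟩ := (L.covBy_iff hϖ).1 hcov
      refine ⟨x, hx, hx1, h2.symm.trans ?_⟩
      exact vtx_eq_iff.2 ⟨c, hc, e'⟩
    · obtain ⟨c, hc, e⟩ := vtx_eq_iff.1 (show vtx L1 = vtx L from h1)
      have hcov := smul_covBy_smul hc h
      rw [e] at hcov
      obtain ⟨x, hx, hx1, e'⟩ := ((L2.scale c hc).covBy_iff hϖ).1 hcov
      obtain ⟨y, hb⟩ := (L2.scale c hc).exists_isBasisOf_of_notMem hϖ hx hx1
      have hb1 := (hb.nbr hϖ).symm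
      rw [← e'] at hb1
      -- In this case `L` is the smaller lattice: the neighbour is represented by `c L₂ = ⟨x, y⟩`
      -- and `L = ⟨x, ϖ y⟩`. The multiple `⟨ϖ x, ϖ y⟩` lies below `L`, in the direction `ϖ y`.
      refine ⟨ϖ • y, hb1.left_mem, hb1.left_notMem_smul hϖ, h2.symm.trans ?_⟩
      refine vtx_eq_iff.2 ⟨ϖ * c, mul_ne_zero hϖ.ne_zero hc, ?_⟩
      rw [nbrLat_val, (hb1.nbr hϖ).eq, mul_smul]
      exact (hb.smul_lattice hϖ.ne_zero).symm.eq
  · rintro ⟨x, hx, hx1, rfl⟩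
    refine ⟨(vtx_nbrLat_ne hϖ hx hx1).symm, Or.inl ⟨L, nbrLat hϖ x L, rfl, rfl, ?_⟩⟩
    exact (L.covBy_iff hϖ).2 ⟨x, hx, hx1, rfl⟩

/-- The neighbour `O_K x + ϖ L` is independent of the uniformizer, of the lattice in its class and
of the primitive vector on the line, since two primitive vectors on one line differ by a unit. The
existential form allows `dir` to be chosen without fixing these data. -/
theorem exists_dir (q : ℙ K (Fin 2 → K)) (Λ : Vertex K) : ∃ Λ' : Vertex K,
    ∀ (ϖ : K) (hϖ : IsUniformizer ϖ) (L : Lattice K) (x : Fin 2 → K) (hx : x ≠ 0),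
      vtx L = Λ → Projectivization.mk K x hx = q → x ∈ L.1 → x ∉ ϖ • L.1 →
        Λ' = vtx (nbrLat hϖ x L) := by
  obtain ⟨L, rfl⟩ := vtx_surjective Λ
  obtain ⟨ϖ, hϖ⟩ := exists_isUniformizer K
  induction q with | h x0 hx0 =>
  obtain ⟨c, hc, hm, hn⟩ := L.exists_smul_primitive hϖ hx0
  refine ⟨vtx (nbrLat hϖ (c • x0) L), fun ϖ' hϖ' L' x hx hL' hq hxm hxn => ?_⟩
  obtain ⟨d, hd, e⟩ := vtx_eq_iff.1 hL'.symm
  obtain ⟨a, rfl⟩ := (Projectivization.mk_eq_mk_iff' K x x0 hx hx0).1 hq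
  have hϖϖ : Valued.v ϖ = Valued.v ϖ' :=
    le_antisymm (hϖ'.le_of_lt_one _ hϖ.lt_one) (hϖ.le_of_lt_one _ hϖ'.lt_one)
  have hsm : ϖ' • L.1 = ϖ • L.1 := by
    refine le_antisymm ?_ ?_
    · intro z hz
      rw [mem_smul_lattice hϖ'.ne_zero] at hz
      rw [mem_smul_lattice hϖ.ne_zero]
      have : ϖ⁻¹ • z = (ϖ⁻¹ * ϖ') • (ϖ'⁻¹ • z) := by
        rw [smul_smul, mul_inv_cancel_right₀ hϖ'.ne_zero]
      rw [this]
      exact smul_mem_of_v_le (hϖ.v_div_le hϖ'.lt_one) hz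
    · intro z hz
      rw [mem_smul_lattice hϖ.ne_zero] at hz
      rw [mem_smul_lattice hϖ'.ne_zero]
      have : ϖ'⁻¹ • z = (ϖ'⁻¹ * ϖ) • (ϖ⁻¹ • z) := by
        rw [smul_smul, mul_inv_cancel_right₀ hϖ.ne_zero]
      rw [this]
      exact smul_mem_of_v_le (hϖ'.v_div_le hϖ.lt_one) hz
  have ha : a ≠ 0 := by rintro rfl; simp at hx
  refine vtx_eq_iff.2 ⟨d, hd, ?_⟩
  rw [nbrLat_val, nbrLat_val, ← e]
  have hb : ∃ b : K, a • x0 = d • (b • (c • x0)) ∧ b ≠ 0 :=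
    ⟨d⁻¹ * a * c⁻¹, by rw [smul_smul, smul_smul]; congr 1; field_simp, by positivity⟩
  obtain ⟨b, hb, hb0⟩ := hb
  have hbm : b • (c • x0) ∈ L.1 := by
    rw [← e, hb, mem_smul_lattice hd, inv_smul_smul₀ hd] at hxm
    exact hxm
  have hbn : b • (c • x0) ∉ ϖ • L.1 := by
    intro hmem
    apply hxn
    rw [← e, hb, smul_comm, hsm]
    exact (Submodule.mem_smul_pointwise_iff_exists _ _ _).2 ⟨_, hmem, rfl⟩
  have hvb : Valued.v b = 1 := by
    refine le_antisymm (not_lt.1 fun hlt => hn ?_) (not_lt.1 fun hlt => hbn ?_)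
    · rw [mem_smul_lattice hϖ.ne_zero]
      have : ϖ⁻¹ • c • x0 = (ϖ⁻¹ * b⁻¹) • (b • c • x0) := by
        rw [smul_smul, smul_smul, smul_smul]; congr 1; field_simp
      rw [this]
      refine smul_mem_of_v_le (hϖ.v_div_le ?_) hbm
      rw [map_inv₀]
      exact inv_lt_one_of_one_lt₀ hlt
    · rw [mem_smul_lattice hϖ.ne_zero, smul_smul]
      exact smul_mem_of_v_le (hϖ.v_div_le hlt) hm
  rw [hb, nbr_smul]
  congr 1
  unfold nbr
  rw [hsm]
  congr 1
  refine le_antisymm ?_ ?_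
  · rw [Submodule.span_singleton_le_iff_mem]
    have := smul_mem_of_v_le (a := b⁻¹) (by rw [map_inv₀, hvb, inv_one])
      (Submodule.mem_span_singleton_self (R := 𝒪[K]) (b • c • x0))
    rwa [inv_smul_smul₀ hb0] at this
  · rw [Submodule.span_singleton_le_iff_mem]
    exact smul_mem_of_v_le hvb.le (Submodule.mem_span_singleton_self _)

/-- The neighbour of `Λ` in the direction of the end `q`. -/
def dir (q : ℙ K (Fin 2 → K)) (Λ : Vertex K) : Vertex K := (exists_dir q Λ).choose

theorem dir_vtx (hϖ : IsUniformizer ϖ) {L : Lattice K} {x : Fin 2 → K} (hx : x ≠ 0)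
    (hxm : x ∈ L.1) (hxn : x ∉ ϖ • L.1) :
    dir (Projectivization.mk K x hx) (vtx L) = vtx (nbrLat hϖ x L) :=
  (exists_dir _ _).choose_spec ϖ hϖ L x hx rfl rfl hxm hxn

/-- Every end has a representative that is primitive in `L`. -/
theorem exists_primitive (hϖ : IsUniformizer ϖ) (q : ℙ K (Fin 2 → K)) (L : Lattice K) :
    ∃ (x : Fin 2 → K) (hx : x ≠ 0), Projectivization.mk K x hx = q ∧ x ∈ L.1 ∧ x ∉ ϖ • L.1 := by
  induction q with | h x0 hx0 =>
  obtain ⟨c, hc, hm, hn⟩ := L.exists_smul_primitive hϖ hx0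
  exact ⟨c • x0, smul_ne_zero hc hx0, (Projectivization.mk_eq_mk_iff' _ _ _ _ _).2 ⟨c, rfl⟩, hm, hn⟩

theorem adj_dir (q : ℙ K (Fin 2 → K)) (Λ : Vertex K) : (bruhatTits K).Adj Λ (dir q Λ) := by
  obtain ⟨ϖ, hϖ⟩ := exists_isUniformizer K
  obtain ⟨L, rfl⟩ := vtx_surjective Λ
  obtain ⟨x, hx, rfl, hm, hn⟩ := exists_primitive hϖ q L
  exact (adj_iff hϖ).2 ⟨x, hm, hn, dir_vtx hϖ hx hm hn⟩

theorem exists_dir_eq {Λ Λ' : Vertex K} (h : (bruhatTits K).Adj Λ Λ') :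
    ∃ q : ℙ K (Fin 2 → K), dir q Λ = Λ' := by
  obtain ⟨ϖ, hϖ⟩ := exists_isUniformizer K
  obtain ⟨L, rfl⟩ := vtx_surjective Λ
  obtain ⟨x, hm, hn, rfl⟩ := (adj_iff hϖ).1 h
  exact ⟨_, dir_vtx hϖ (ne_zero_of_notMem hn) hm hn⟩

/-- An end lies on one side of each edge. -/
theorem dir_eq_of_ne {q : ℙ K (Fin 2 → K)} {Λ Λ' : Vertex K} (h : (bruhatTits K).Adj Λ Λ')
    (hne : dir q Λ ≠ Λ') : dir q Λ' = Λ := by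
  obtain ⟨ϖ, hϖ⟩ := exists_isUniformizer K
  obtain ⟨L, rfl⟩ := vtx_surjective Λ
  obtain ⟨w, hw, hwn, rfl⟩ := (adj_iff hϖ).1 h
  obtain ⟨x, hx, rfl, hm, hn⟩ := exists_primitive hϖ q L
  rw [dir_vtx hϖ hx hm hn] at hne
  obtain ⟨y, hb⟩ := L.exists_isBasisOf_of_notMem hϖ hw hwn
  obtain ⟨a, b, ha, hb1, rfl⟩ := hb.mem_iff.1 hm
  -- If `b` were not a unit, the end and `w` would give the same line modulo `ϖ`, hence the same
  -- direction.
  have hvb : Valued.v b = 1 := by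
    refine le_antisymm hb1 (not_lt.1 fun hlt => hne ?_)
    have hmem : a • w + b • y ∈ nbr ϖ w L.1 := by
      have : a • w + b • y = a • w + (ϖ⁻¹ * b) • (ϖ • y) := by
        rw [smul_smul, mul_comm, mul_inv_cancel_left₀ hϖ.ne_zero]
      rw [this, (hb.nbr hϖ).mem_iff_coord]
      exact ⟨ha, hϖ.v_div_le hlt⟩
    obtain ⟨z, hz⟩ := L.exists_isBasisOf_of_notMem hϖ hm hn
    have hle : nbr ϖ (a • w + b • y) L.1 ≤ nbr ϖ w L.1 :=
      sup_le ((Submodule.span_singleton_le_iff_mem _ _).2 hmem) smul_le_nbr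
    congr 1
    refine Subtype.ext ?_
    rcases hz.eq_of_nbr_le hϖ hle (hb.nbr_lt hϖ).le with e | e
    · exact e.symm
    · exact absurd e (hb.nbr_lt hϖ).ne
  have hb2 := (hb.change ha hvb)
  have hb3 := (hb2.nbr hϖ).symm
  -- The neighbour has the basis `w`, `ϖ x` with `x = a w + b y`. There `ϖ x` is primitive, and its
  -- direction leads to `⟨ϖ x, ϖ w⟩ = ϖ L`, that is, back.
  have hpx : ϖ • (a • w + b • y) ≠ 0 := smul_ne_zero hϖ.ne_zero hx
  have hq : Projectivization.mk K _ hx = Projectivization.mk K _ hpx :=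
    (Projectivization.mk_eq_mk_iff' _ _ _ _ _).2 ⟨ϖ⁻¹, inv_smul_smul₀ hϖ.ne_zero _⟩
  rw [hq, dir_vtx (L := nbrLat hϖ w L) hϖ hpx hb3.left_mem (hb3.left_notMem_smul hϖ)]
  refine (vtx_eq_iff.2 ⟨ϖ, hϖ.ne_zero, ?_⟩).symm
  rw [nbrLat_val, nbrLat_val, (hb3.nbr hϖ).eq, ((hb2.smul_lattice hϖ.ne_zero).symm).eq]

/-- The vectors `x`, `y`, `x + y` of a basis give three different neighbours, even over a residue
field with two elements; two prescribed vertices cannot exhaust them. -/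
theorem exists_dir_ne_ne (Λ b c : Vertex K) :
    ∃ q : ℙ K (Fin 2 → K), dir q Λ ≠ b ∧ dir q Λ ≠ c := by
  obtain ⟨ϖ, hϖ⟩ := exists_isUniformizer K
  obtain ⟨L, rfl⟩ := vtx_surjective Λ
  obtain ⟨x, y, h⟩ := L.exists_isBasisOf
  have h' : IsBasisOf (x + y) y L.1 := by
    have := (h.symm.change (a := 1) (b := 1) (map_one _).le (map_one _)).symm
    rwa [one_smul, one_smul, add_comm] at this
  have d : ∀ {u v : Fin 2 → K}, IsBasisOf u v L.1 →
      vtx (nbrLat hϖ u L) ≠ vtx (nbrLat hϖ v L) := by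
    intro u v huv e
    have := nbrLat_injective hϖ huv.left_mem (huv.left_notMem_smul hϖ) huv.symm.left_mem
      (huv.symm.left_notMem_smul hϖ) e
    exact huv.right_notMem_nbr hϖ (this ▸ self_mem_nbr)
  have h'' : IsBasisOf x (x + y) L.1 := by
    have := h.change (a := 1) (b := 1) (map_one _).le (map_one _)
    rwa [one_smul, one_smul] at this
  have e1 := dir_vtx hϖ (ne_zero_of_notMem (h.left_notMem_smul hϖ)) h.left_mem
    (h.left_notMem_smul hϖ)
  have e2 := dir_vtx hϖ (ne_zero_of_notMem (h.symm.left_notMem_smul hϖ)) h.symm.left_mem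
    (h.symm.left_notMem_smul hϖ)
  have e3 := dir_vtx hϖ (ne_zero_of_notMem (h'.left_notMem_smul hϖ)) h'.left_mem
    (h'.left_notMem_smul hϖ)
  have d1 := d h
  have d2 := d h'
  have d3 := d h''
  rw [← e1, ← e2] at d1
  rw [← e3, ← e2] at d2
  rw [← e1, ← e3] at d3
  by_contra! hcon
  have hcon' := fun q => or_iff_not_imp_left.2 (hcon q)
  rcases hcon' (Projectivization.mk K x (ne_zero_of_notMem (h.left_notMem_smul hϖ))) with c1 | c1 <;>
  rcases hcon' (Projectivization.mk K y (ne_zero_of_notMem (h.symm.left_notMem_smul hϖ)))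
    with c2 | c2 <;>
  rcases hcon' (Projectivization.mk K (x + y) (ne_zero_of_notMem (h'.left_notMem_smul hϖ)))
    with c3 | c3 <;>
  first
  | exact d1 (c1.trans c2.symm)
  | exact d2 (c3.trans c2.symm)
  | exact d3 (c1.trans c3.symm)

/-- The ends of an apartment lie in different directions. -/
theorem dir_ne_of_mem_apartment {u v : ℙ K (Fin 2 → K)} (huv : u ≠ v) {Λ : Vertex K}
    (h : Λ ∈ apartment u v) : dir u Λ ≠ dir v Λ := by
  obtain ⟨ϖ, hϖ⟩ := exists_isUniformizer K
  obtain ⟨x, y, hx, hy, L, rfl, rfl, hL, rfl⟩ := h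
  have hb : IsBasisOf x y L.1 := by
    refine ⟨?_, hL⟩
    rw [LinearIndependent.pair_iff' hx]
    intro a ha
    exact huv.symm ((Projectivization.mk_eq_mk_iff' _ _ _ _ _).2 ⟨a, ha⟩)
  change dir _ (vtx L) ≠ dir _ (vtx L)
  rw [dir_vtx hϖ hx hb.left_mem (hb.left_notMem_smul hϖ),
    dir_vtx hϖ hy hb.right_mem (hb.symm.left_notMem_smul hϖ)]
  intro e
  have := nbrLat_injective hϖ hb.left_mem (hb.left_notMem_smul hϖ) hb.symm.left_mem
    (hb.symm.left_notMem_smul hϖ) e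
  exact hb.right_notMem_nbr hϖ (this ▸ self_mem_nbr)

theorem smul_dir (g : PGL(2, K)) (q : ℙ K (Fin 2 → K)) (Λ : Vertex K) :
    dir (g • q) (g • Λ) = g • dir q Λ := by
  obtain ⟨ϖ, hϖ⟩ := exists_isUniformizer K
  obtain ⟨L, rfl⟩ := vtx_surjective Λ
  obtain ⟨x, hx, rfl, hm, hn⟩ := exists_primitive hϖ q L
  induction g using Matrix.ProjGenLinGroup.induction_on with | mk g =>
  have hinj : Function.Injective (mulVecO g) := by
    intro a b hab
    have := congrArg (g⁻¹).1.mulVec hab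
    rwa [mulVecO_apply, mulVecO_apply, Matrix.mulVec_mulVec, Matrix.mulVec_mulVec,
      ← Units.val_mul, inv_mul_cancel, Units.val_one, Matrix.one_mulVec, Matrix.one_mulVec] at this
  have hgx : g.1.mulVec x ≠ 0 := fun h0 => hx (hinj (by
    rw [mulVecO_apply, h0, map_zero]))
  have e1 : (Matrix.ProjGenLinGroup.mk g) • Projectivization.mk K x hx =
      Projectivization.mk K (g.1.mulVec x) hgx := rfl
  have h1 : g.1.mulVec x ∈ (g • L).1 := ⟨x, hm, rfl⟩
  have h2 : g.1.mulVec x ∉ ϖ • (g • L).1 := by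
    rw [Submodule.mem_smul_pointwise_iff_exists]
    rintro ⟨_, ⟨z, hz, rfl⟩, e⟩
    apply hn
    rw [mulVecO_apply, ← Matrix.mulVec_smul] at e
    rw [← hinj e]
    exact (Submodule.mem_smul_pointwise_iff_exists _ _ _).2 ⟨z, hz, rfl⟩
  rw [e1, mk_smul_vtx, dir_vtx hϖ hgx h1 h2, dir_vtx hϖ hx hm hn, mk_smul_vtx]
  congr 1
  exact Subtype.ext (nbr_map g)

theorem adj_smul (g : PGL(2, K)) {Λ Λ' : Vertex K} (h : (bruhatTits K).Adj Λ Λ') :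
    (bruhatTits K).Adj (g • Λ) (g • Λ') := by
  obtain ⟨q, rfl⟩ := exists_dir_eq h
  rw [← smul_dir]
  exact adj_dir _ _

/-- The direction at a vertex depends only on a primitive vector modulo `ϖ`. In a basis beginning
with this vector, the congruences "first coordinate 1, second coordinate 0 modulo `ϖ`" describe an
open neighbourhood. -/
theorem isOpen_dir_eq (Λ Λ' : Vertex K) : IsOpen {q : ℙ K (Fin 2 → K) | dir q Λ = Λ'} := by
  obtain ⟨ϖ, hϖ⟩ := exists_isUniformizer K
  obtain ⟨L, rfl⟩ := vtx_surjective Λ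
  rw [isOpen_coinduced, isOpen_iff_mem_nhds]
  rintro ⟨x, hx⟩ hxq
  obtain ⟨c, hc, hm, hn⟩ := L.exists_smul_primitive hϖ hx
  have hcx : c • x ≠ 0 := smul_ne_zero hc hx
  obtain ⟨y, hb⟩ := L.exists_isBasisOf_of_notMem hϖ hm hn
  have hq : ∀ (z : Fin 2 → K) (hz : z ≠ 0), Projectivization.mk K z hz =
      Projectivization.mk K (c • z) (smul_ne_zero hc hz) := fun z hz =>
    (Projectivization.mk_eq_mk_iff' _ _ _ _ _).2 ⟨c⁻¹, inv_smul_smul₀ hc _⟩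
  let B := basisOfLinearIndependentOfCardEqFinrank hb.lin (by simp)
  have hB : ∀ z : Fin 2 → K, B.coord 0 z • (c • x) + B.coord 1 z • y = z := by
    intro z
    have := B.sum_repr z
    rwa [Fin.sum_univ_two, coe_basisOfLinearIndependentOfCardEqFinrank] at this
  have hx01 := hb.coord_unique ((hB (c • x)).trans
    (show c • x = (1 : K) • (c • x) + (0 : K) • y by simp))
  have hopen : IsOpen {t : K | Valued.v (ϖ⁻¹ * t) ≤ 1} :=
    (Valued.isOpen_integer K).preimage (continuous_const.mul continuous_id)
  have hc0 : Continuous fun z : {z : Fin 2 → K // z ≠ 0} => B.coord 0 (c • z.1) - 1 :=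
    (((B.coord 0).continuous_on_pi).comp (continuous_subtype_val.const_smul c)).sub
      continuous_const
  have hc1 : Continuous fun z : {z : Fin 2 → K // z ≠ 0} => B.coord 1 (c • z.1) :=
    ((B.coord 1).continuous_on_pi).comp (continuous_subtype_val.const_smul c)
  have hlt : ∀ {t : K}, Valued.v (ϖ⁻¹ * t) ≤ 1 → Valued.v t < 1 := by
    intro t ht
    have : t = ϖ * (ϖ⁻¹ * t) := (mul_inv_cancel_left₀ hϖ.ne_zero t).symm
    rw [this, map_mul]
    exact mul_lt_one_of_lt_of_le hϖ.lt_one ht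
  filter_upwards [(hopen.preimage hc0).mem_nhds (by
      change Valued.v (ϖ⁻¹ * (B.coord 0 (c • x) - 1)) ≤ 1
      rw [hx01.1]; simp),
    (hopen.preimage hc1).mem_nhds (by
      change Valued.v (ϖ⁻¹ * B.coord 1 (c • x)) ≤ 1
      rw [hx01.2]; simp)] with z hz0 hz1
  have hv1 := hlt hz1
  have hv0 : Valued.v (B.coord 0 (c • z.1)) = 1 := by
    have := Valuation.map_add_eq_of_lt_right (Valued.v : Valuation K ℤᵐ⁰)
      (x := B.coord 0 (c • z.1) - 1) (y := 1) (by rw [map_one]; exact hlt hz0)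
    rwa [sub_add_cancel, map_one] at this
  have hzL : c • z.1 ∈ L.1 := by
    rw [← hB (c • z.1), hb.mem_iff_coord]
    exact ⟨hv0.le, hv1.le⟩
  have hzn : c • z.1 ∉ ϖ • L.1 := by
    have : ϖ⁻¹ • (c • z.1) = (ϖ⁻¹ * B.coord 0 (c • z.1)) • (c • x) +
        (ϖ⁻¹ * B.coord 1 (c • z.1)) • y := by rw [mul_smul, mul_smul, ← smul_add, hB]
    rw [mem_smul_lattice hϖ.ne_zero, this, hb.mem_iff_coord, map_mul, hv0, mul_one, map_inv₀, inv_le_one₀ hϖ.v_pos]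
    exact fun h => absurd h.1 (not_le.2 hϖ.lt_one)
  have hznbr : c • z.1 ∈ nbr ϖ (c • x) L.1 := by
    have : c • z.1 = B.coord 0 (c • z.1) • (c • x) + (ϖ⁻¹ * B.coord 1 (c • z.1)) • (ϖ • y) := by
      rw [smul_smul (ϖ⁻¹ * B.coord 1 (c • z.1)) ϖ, mul_right_comm, inv_mul_cancel₀ hϖ.ne_zero,
        one_mul, hB]
    rw [this, (hb.nbr hϖ).mem_iff_coord]
    exact ⟨hv0.le, hz1⟩
  obtain ⟨w, hw⟩ := L.exists_isBasisOf_of_notMem hϖ hzL hzn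
  have heq : nbr ϖ (c • x) L.1 = nbr ϖ (c • z.1) L.1 :=
    (hw.eq_of_nbr_le hϖ (sup_le ((Submodule.span_singleton_le_iff_mem _ _).2 hznbr) smul_le_nbr)
      (hb.nbr_lt hϖ).le).resolve_right (hb.nbr_lt hϖ).ne
  change dir (Projectivization.mk K x hx) (vtx L) = Λ' at hxq
  change dir (Projectivization.mk K z.1 z.2) (vtx L) = Λ'
  rw [hq z.1 z.2, dir_vtx hϖ _ hzL hzn, ← hxq, hq x hx, dir_vtx hϖ _ hm hn]
  congr 1
  exact Subtype.ext heq.symm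

end Vertices

/-! ### The Bruhat–Tits graph is a tree; subtrees -/

section TreeStructure

variable {K : Type u} [Field K] [Valued K ℤᵐ⁰] [(Valued.v : Valuation K ℤᵐ⁰).IsNontrivial]

/-- A path that starts away from the end `q` keeps going away from it. -/
theorem dir_eq_penultimate {q : ℙ K (Fin 2 → K)} {a b : Vertex K} (p : (bruhatTits K).Walk a b)
    (hp : p.IsPath) (hn : ¬ p.Nil) (hq : dir q a ≠ p.snd) : dir q b = p.penultimate := by
  induction p with
  | nil => simp at hn
  | @cons a w b h p ih =>
    rw [SimpleGraph.Walk.snd_cons] at hq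
    have h1 : dir q w = a := dir_eq_of_ne h hq
    by_cases hnil : p.Nil
    · cases hnil
      rw [h1, SimpleGraph.Walk.penultimate_cons_nil]
    · rw [SimpleGraph.Walk.penultimate_cons_of_not_nil _ _ hnil]
      refine ih hp.of_cons hnil fun e => ?_
      rw [SimpleGraph.Walk.cons_isPath_iff] at hp
      refine hp.2 ?_
      rw [← h1, e]
      exact p.getVert_mem_support 1

-- Given a cycle at `v`, there is an end whose direction at `v` is neither the first nor the last
-- edge of the cycle. Walking around, one moves away from this end all the time, so on returning to
-- `v` its direction should be the last edge.
variable (K) in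
theorem isAcyclic_bruhatTits : (bruhatTits K).IsAcyclic := by
  intro v c hc
  cases c with
  | nil => exact SimpleGraph.Walk.not_isCycle_nil hc
  | @cons _ w _ h p =>
    rw [SimpleGraph.Walk.cons_isCycle_iff] at hc
    have hnil : ¬ p.Nil := fun hn => h.ne hn.eq.symm
    obtain ⟨q, h1, h2⟩ := exists_dir_ne_ne v w p.penultimate
    have h3 : dir q w = v := dir_eq_of_ne h h1
    refine h2 (dir_eq_penultimate p hc.1 hnil fun e => hc.2 ?_)
    have := p.mk_start_snd_mem_edges hnil
    rwa [← e, h3, Sym2.eq_swap] at this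

/-- One step replaces `L` by `L' + ϖ L`, which is `L` itself, a neighbour of `L` or the similar
lattice `ϖ L`, and contains `L'` with exponent one less. -/
theorem reachable_of_le_of_le {ϖ : K} (hϖ : IsUniformizer ϖ) (n : ℕ) :
    ∀ L L' : Lattice K, ϖ ^ n • L.1 ≤ L'.1 → L'.1 ≤ L.1 →
      (bruhatTits K).Reachable (vtx L) (vtx L') := by
  induction n with
  | zero =>
    intro L L' h1 h2
    rw [pow_zero, one_smul] at h1
    rw [show L = L' from Subtype.ext (le_antisymm h1 h2)]
  | succ n ih =>
    intro L L' h1 h2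
    let M : Lattice K := ⟨L'.1 ⊔ ϖ • L.1,
      @Submodule.IsLattice.sup _ _ K _ _ _ _ _ _ _ _ _ L'.2 (L.scale ϖ hϖ.ne_zero).2⟩
    have hML : M.1 ≤ L.1 := sup_le h2 (smul_lattice_le hϖ.lt_one.le)
    have hstep : (bruhatTits K).Reachable (vtx L) (vtx M) := by
      by_cases hle : M.1 ≤ ϖ • L.1
      · have : vtx L = vtx M :=
          vtx_eq_iff.2 ⟨ϖ, hϖ.ne_zero, le_antisymm le_sup_right hle⟩
        rw [this]
      · obtain ⟨x, hx, hxn⟩ := SetLike.not_le_iff_exists.1 hle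
        obtain ⟨y, hb⟩ := L.exists_isBasisOf_of_notMem hϖ (hML hx) hxn
        have hnb : nbr ϖ x L.1 ≤ M.1 :=
          sup_le ((Submodule.span_singleton_le_iff_mem _ _).2 hx) le_sup_right
        rcases hb.eq_of_nbr_le hϖ hnb hML with e | e
        · refine ((adj_iff hϖ).2 ⟨x, hML hx, hxn, ?_⟩).reachable
          exact congrArg vtx (Subtype.ext e)
        · rw [show M = L from Subtype.ext e]
    refine hstep.trans (ih M L' ?_ le_sup_left)
    change ϖ ^ n • (L'.1 ⊔ ϖ • L.1) ≤ L'.1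
    rw [Submodule.smul_sup', ← mul_smul, ← pow_succ]
    exact sup_le (smul_lattice_le (by rw [map_pow]; exact pow_le_one' hϖ.lt_one.le n)) h1

omit [(Valued.v : Valuation K ℤᵐ⁰).IsNontrivial] in
theorem IsUniformizer.exists_pow_mul_le {ϖ : K} (hϖ : IsUniformizer ϖ) (a : K) :
    ∃ n : ℕ, ∀ m, n ≤ m → Valued.v (ϖ ^ m * a) ≤ 1 := by
  have h1 : 1 < (Valued.v ϖ)⁻¹ := (one_lt_inv₀ hϖ.v_pos).2 hϖ.lt_one
  obtain ⟨n, hn⟩ := MulArchimedean.arch (Valued.v a) h1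
  refine ⟨n, fun m hm => ?_⟩
  have h2 : Valued.v (ϖ ^ m) ≤ Valued.v ϖ ^ n := by
    rw [map_pow]; exact pow_le_pow_right_of_le_one' hϖ.lt_one.le hm
  rw [map_mul]
  refine (mul_le_mul' h2 hn).trans ?_
  rw [inv_pow, mul_inv_cancel₀ (pow_ne_zero _ hϖ.v_pos.ne')]

theorem Lattice.exists_pow_smul_le {ϖ : K} (hϖ : IsUniformizer ϖ) (L L' : Lattice K) :
    ∃ n : ℕ, ϖ ^ n • L.1 ≤ L'.1 := by
  obtain ⟨x, y, h⟩ := L.exists_isBasisOf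
  obtain ⟨x', y', h'⟩ := L'.exists_isBasisOf
  have key : ∀ z : Fin 2 → K, ∃ n : ℕ, ∀ m, n ≤ m → ϖ ^ m • z ∈ L'.1 := by
    intro z
    obtain ⟨a, b, rfl⟩ := h'.exists_coord z
    obtain ⟨n1, h1⟩ := hϖ.exists_pow_mul_le a
    obtain ⟨n2, h2⟩ := hϖ.exists_pow_mul_le b
    refine ⟨max n1 n2, fun m hm => ?_⟩
    rw [smul_add, smul_smul, smul_smul, h'.mem_iff_coord]
    exact ⟨h1 m (le_of_max_le_left hm), h2 m (le_of_max_le_right hm)⟩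
  obtain ⟨n1, h1⟩ := key x
  obtain ⟨n2, h2⟩ := key y
  refine ⟨max n1 n2, ?_⟩
  rw [(h.smul_lattice (pow_ne_zero _ hϖ.ne_zero)).eq, Submodule.span_le]
  rintro w (rfl | rfl)
  · exact h1 _ (le_max_left _ _)
  · exact h2 _ (le_max_right _ _)

variable (K) in
theorem preconnected_bruhatTits : (bruhatTits K).Preconnected := by
  obtain ⟨ϖ, hϖ⟩ := exists_isUniformizer K
  intro a b
  obtain ⟨L, rfl⟩ := vtx_surjective a
  obtain ⟨L', rfl⟩ := vtx_surjective b
  obtain ⟨n, hn⟩ := L'.exists_pow_smul_le hϖ L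
  obtain ⟨m, hm⟩ := L.exists_pow_smul_le hϖ (L'.scale (ϖ ^ n) (pow_ne_zero _ hϖ.ne_zero))
  have := reachable_of_le_of_le hϖ m L (L'.scale (ϖ ^ n) (pow_ne_zero _ hϖ.ne_zero)) hm hn
  rwa [vtx_scale] at this

variable (K) in
theorem exists_path (a b : Vertex K) : ∃ p : (bruhatTits K).Walk a b, p.IsPath := by
  classical
  obtain ⟨w⟩ := preconnected_bruhatTits K a b
  exact ⟨w.toPath, w.toPath.2⟩

/-- The path between two vertices of a subtree stays in the subtree. -/
theorem IsSubtree.support_subset {S : Set (Vertex K)} (hS : IsSubtree S) {a b : Vertex K}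
    (ha : a ∈ S) (hb : b ∈ S) (p : (bruhatTits K).Walk a b) (hp : p.IsPath) :
    ∀ x ∈ p.support, x ∈ S := by
  classical
  obtain ⟨w⟩ := hS ⟨a, ha⟩ ⟨b, hb⟩
  let f := (SimpleGraph.Embedding.induce (G := bruhatTits K) S)
  have hw : (w.toPath.1.map f.toHom).IsPath :=
    w.toPath.2.map f.injective
  have e : p = w.toPath.1.map f.toHom :=
    congrArg Subtype.val
      (((isAcyclic_bruhatTits K).subsingleton_path a b).elim ⟨p, hp⟩ ⟨_, hw⟩)
  intro x hx
  rw [e] at hx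
  obtain ⟨y, -, rfl⟩ := List.mem_map.1 ((SimpleGraph.Walk.support_map f.toHom w.toPath.1) ▸ hx)
  exact y.2

/-- Paths in a tree are unique, so a path between two points of an intersection of subtrees lies in
each of them. -/
theorem isSubtree_treeOf (ℒ : Set (ℙ K (Fin 2 → K))) : IsSubtree (treeOf ℒ) := by
  rintro ⟨a, ha⟩ ⟨b, hb⟩
  obtain ⟨p, hp⟩ := exists_path K a b
  have hsub : ∀ x ∈ p.support, x ∈ treeOf ℒ := by
    intro x hx
    rw [treeOf, Set.mem_sInter] at ha hb ⊢
    intro S hS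
    exact hS.1.support_subset (ha S hS) (hb S hS) p hp x hx
  exact ⟨p.induce _ hsub⟩

omit [(Valued.v : Valuation K ℤᵐ⁰).IsNontrivial] in
theorem apartment_subset_treeOf {ℒ : Set (ℙ K (Fin 2 → K))} {u v : ℙ K (Fin 2 → K)}
    (hu : u ∈ ℒ) (hv : v ∈ ℒ) (huv : u ≠ v) : apartment u v ⊆ treeOf ℒ := by
  intro x hx
  rw [treeOf, Set.mem_sInter]
  exact fun S hS => hS.2 u hu v hv huv hx

omit [(Valued.v : Valuation K ℤᵐ⁰).IsNontrivial] in
theorem smul_mem_apartment (g : PGL(2, K)) {u v : ℙ K (Fin 2 → K)} {Λ : Vertex K}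
    (h : Λ ∈ apartment u v) : g • Λ ∈ apartment (g • u) (g • v) := by
  obtain ⟨x, y, hx, hy, L, rfl, rfl, hL, rfl⟩ := h
  induction g using Matrix.ProjGenLinGroup.induction_on with | mk g =>
  refine ⟨g • x, g • y, smul_ne_zero_iff_ne g |>.2 hx, smul_ne_zero_iff_ne g |>.2 hy, g • L,
    rfl, rfl, ?_, rfl⟩
  rw [smul_val, hL, Submodule.map_span, Set.image_pair]
  rfl

theorem IsSubtree.smul {S : Set (Vertex K)} (hS : IsSubtree S) (g : PGL(2, K)) :
    IsSubtree (g • S) := by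
  let f : (bruhatTits K).induce S →g (bruhatTits K).induce (g • S) :=
    ⟨fun x => ⟨g • x.1, Set.smul_mem_smul_set x.2⟩, fun h => adj_smul g h⟩
  rintro ⟨_, a, ha, rfl⟩ ⟨_, b, hb, rfl⟩
  exact (hS ⟨a, ha⟩ ⟨b, hb⟩).map f

/-- An element that preserves `ℒ` preserves its tree. -/
theorem smul_mem_treeOf {ℒ : Set (ℙ K (Fin 2 → K))} (g : PGL(2, K)) (hg : ∀ u ∈ ℒ, g • u ∈ ℒ)
    {Λ : Vertex K} (h : Λ ∈ treeOf ℒ) : g • Λ ∈ treeOf ℒ := by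
  rw [treeOf, Set.mem_sInter] at h ⊢
  rintro S ⟨hS1, hS2⟩
  have := h (g⁻¹ • S) ⟨hS1.smul _, fun u hu v hv huv x hx => ?_⟩
  · rwa [Set.mem_smul_set_iff_inv_smul_mem, inv_inv] at this
  · rw [Set.mem_smul_set_iff_inv_smul_mem, inv_inv]
    exact hS2 _ (hg u hu) _ (hg v hv) (fun e => huv (MulAction.injective g e))
      (smul_mem_apartment g hx)

end TreeStructure

/-! ### The action on limit points and on 𝒯_N -/

section LimitSet

variable {K : Type u} [Field K] [Valued K ℤᵐ⁰] {N : Type u} [Group N] (φ : N →* PGL(2, K))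

theorem continuous_smul_proj (g : PGL(2, K)) :
    Continuous fun q : ℙ K (Fin 2 → K) => g • q := by
  induction g using Matrix.ProjGenLinGroup.induction_on with | mk g =>
  rw [continuous_coinduced_dom]
  have : Continuous fun x : {x : Fin 2 → K // x ≠ 0} =>
      (⟨g.1.mulVec x.1, (smul_ne_zero_iff_ne g).2 x.2⟩ : {x : Fin 2 → K // x ≠ 0}) := by
    refine Continuous.subtype_mk ?_ _
    exact Continuous.matrix_mulVec continuous_const continuous_subtype_val
  exact continuous_coinduced_rng.comp this

theorem smul_mem_limitSet (n : N) {u : ℙ K (Fin 2 → K)} (hu : u ∈ limitSet φ) :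
    φ n • u ∈ limitSet φ := by
  obtain ⟨q, γ, hγ, hlim⟩ := hu
  refine ⟨q, fun m => n * γ m, fun a b h => hγ (mul_left_cancel h), ?_⟩
  have := ((continuous_smul_proj (φ n)).tendsto u).comp hlim
  refine this.congr fun m => ?_
  rw [Function.comp_apply, map_mul, mul_smul]

variable [(Valued.v : Valuation K ℤᵐ⁰).IsNontrivial]

/-- The action of `N` on the vertices of its tree. -/
instance : MulAction N (TreeVertex φ) where
  smul n x := ⟨φ n • x.1, smul_mem_treeOf _ (fun _ => smul_mem_limitSet φ n) x.2⟩
  one_smul x := Subtype.ext (by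
    change φ 1 • x.1 = x.1
    rw [map_one, one_smul])
  mul_smul a b x := Subtype.ext (by
    change φ (a * b) • x.1 = φ a • φ b • x.1
    rw [map_mul, mul_smul])

end LimitSet


/-! ### Elements with rational eigenvalues: no inversions, elliptic and hyperbolic elements -/

section FixedVertices

variable {K : Type u} [Field K]

theorem exists_eigenvector {g : Matrix (Fin 2) (Fin 2) K} (hg : g.charpoly.Splits) :
    ∃ (l : K) (w : Fin 2 → K), w ≠ 0 ∧ g.mulVec w = l • w := by
  obtain ⟨l, hl⟩ := hg.exists_eval_eq_zero (by
    rw [Matrix.charpoly_degree_eq_dim]; simp)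
  rw [Matrix.eval_charpoly] at hl
  obtain ⟨w, hw, hw'⟩ := Matrix.exists_mulVec_eq_zero_iff.2 hl
  refine ⟨l, w, hw, ?_⟩
  rw [Matrix.sub_mulVec, sub_eq_zero] at hw'
  rw [← hw']
  ext i
  simp [Matrix.mulVec_diagonal, Matrix.scalar_apply]

variable [Valued K ℤᵐ⁰] {ϖ : K}

theorem le_one_of_primitive (hϖ : IsUniformizer ϖ) {L : Submodule 𝒪[K] (Fin 2 → K)} {a : K}
    {w : Fin 2 → K} (hw : w ∉ ϖ • L) (ha : a • w ∈ L) : Valued.v a ≤ 1 := by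
  by_contra! h
  have ha0 : a ≠ 0 := by rintro rfl; simp at h
  refine hw ((mem_smul_lattice hϖ.ne_zero).2 ?_)
  have : ϖ⁻¹ • w = (ϖ⁻¹ * a⁻¹) • (a • w) := by
    rw [smul_smul, mul_assoc, inv_mul_cancel₀ ha0, mul_one]
  rw [this]
  refine smul_mem_of_v_le (hϖ.v_div_le ?_) ha
  rw [map_inv₀]
  exact inv_lt_one_of_one_lt₀ h

theorem v_eq_one_of_primitive (hϖ : IsUniformizer ϖ) {L : Submodule 𝒪[K] (Fin 2 → K)} {a : K}
    {w : Fin 2 → K} (hwm : w ∈ L) (hw : w ∉ ϖ • L) (ha : a • w ∈ L) (ha' : a • w ∉ ϖ • L) :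
    Valued.v a = 1 := by
  refine le_antisymm (le_one_of_primitive hϖ hw ha) ?_
  have ha0 : a ≠ 0 := by rintro rfl; simp at ha'
  have := le_one_of_primitive (a := a⁻¹) hϖ ha' (by rwa [smul_smul, inv_mul_cancel₀ ha0, one_smul])
  rw [map_inv₀] at this
  exact (inv_le_one₀ (zero_lt_iff.2 ((Valuation.ne_zero_iff _).2 ha0))).1 this

variable [(Valued.v : Valuation K ℤᵐ⁰).IsNontrivial]

omit [(Valued.v : Valuation K ℤᵐ⁰).IsNontrivial] in
theorem mulVec_mem_map_iff (g : GL (Fin 2) K) {L : Submodule 𝒪[K] (Fin 2 → K)} {w : Fin 2 → K} :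
    g.1.mulVec w ∈ L.map (mulVecO g) ↔ w ∈ L := by
  refine ⟨?_, fun h => ⟨w, h, rfl⟩⟩
  rintro ⟨z, hz, e⟩
  have : z = w := by
    have h2 : (g⁻¹).1.mulVec (g.1.mulVec z) = (g⁻¹).1.mulVec (g.1.mulVec w) :=
      congrArg (fun v => (g⁻¹).1.mulVec v) e
    rwa [Matrix.mulVec_mulVec, Matrix.mulVec_mulVec, ← Units.val_mul, inv_mul_cancel, Units.val_one,
      Matrix.one_mulVec, Matrix.one_mulVec] at h2
  exact this ▸ hz

/-- An element with eigenvalues in `K` does not invert an edge. -/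
theorem not_inversion {g : GL (Fin 2) K} (hg : g.1.charpoly.Splits) {Λ Λ' : Vertex K}
    (hadj : (bruhatTits K).Adj Λ Λ') (h1 : Matrix.ProjGenLinGroup.mk g • Λ = Λ')
    (h2 : Matrix.ProjGenLinGroup.mk g • Λ' = Λ) : False := by
  obtain ⟨ϖ, hϖ⟩ := exists_isUniformizer K
  obtain ⟨L, rfl⟩ := vtx_surjective Λ
  obtain ⟨x, hx, hxn, rfl⟩ := (adj_iff hϖ).1 hadj
  obtain ⟨y, hb⟩ := L.exists_isBasisOf_of_notMem hϖ hx hxn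
  set L1 := nbrLat hϖ x L with hL1
  have hL1L : L1.1 < L.1 := hb.nbr_lt hϖ
  have hLL1 : ϖ • L.1 < L1.1 := hb.smul_lt_nbr hϖ
  -- Choose scalars with `c g L = L₁` and `d g L₁ = L`. With an eigenvalue `l` of `g`, the map `(d
  -- g)(c g)` preserves `L`, so `d c l²` is a unit, while `c / d` has the value of `ϖ`. Hence `v(c
  -- l)² = v(ϖ)`, which no value satisfies.
  rw [mk_smul_vtx, vtx_eq_iff] at h1 h2
  obtain ⟨c, hc, hcL⟩ := h1
  obtain ⟨d, hd, hdL⟩ := h2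
  rw [smul_val] at hcL hdL
  -- membership transfer
  have t1 : ∀ w, c • g.1.mulVec w ∈ L1.1 ↔ w ∈ L.1 := fun w => by
    rw [← hcL, mem_smul_lattice hc, smul_smul, inv_mul_cancel₀ hc, one_smul, mulVec_mem_map_iff]
  have t2 : ∀ w, d • g.1.mulVec w ∈ L.1 ↔ w ∈ L1.1 := fun w => by
    rw [← hdL, mem_smul_lattice hd, smul_smul, inv_mul_cancel₀ hd, one_smul, mulVec_mem_map_iff]
  obtain ⟨l, w0, hw0, hlw0⟩ := exists_eigenvector hg
  obtain ⟨a, ha, hm, hn⟩ := L.exists_smul_primitive hϖ hw0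
  set w := a • w0 with hw
  have hlw : g.1.mulVec w = l • w := by rw [hw, Matrix.mulVec_smul, hlw0, smul_comm]
  clear_value w
  have hl0 : l ≠ 0 := by
    rintro rfl
    have hz : ϖ⁻¹ • w ∈ L.1 := by
      rw [← t1, Matrix.mulVec_smul, hlw, zero_smul, smul_zero, smul_zero]; exact zero_mem _
    exact hn ((mem_smul_lattice hϖ.ne_zero).2 hz)
  -- `v(d c l²) = 1`
  have e1 : Valued.v (d * l * (c * l)) = 1 := by
    have key : ∀ b : K, (d * l * (c * l)) • b • w = d • g.1.mulVec (c • g.1.mulVec (b • w)) := by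
      intro b
      simp only [Matrix.mulVec_smul, hlw]
      simp only [smul_smul]; congr 1; ring
    refine v_eq_one_of_primitive hϖ hm hn ?_ ?_
    · have := key 1
      rw [one_smul] at this
      rw [this, t2, t1]; exact hm
    · rw [mem_smul_lattice hϖ.ne_zero] at hn ⊢
      rw [smul_comm, key, t2, t1]; exact hn
  -- `v(c) = v(ϖ d)`
  have e2 : Valued.v (c * d⁻¹) = Valued.v ϖ := by
    -- `z ∈ L1 → (c/d) z ∈ L1` up to the swap
    have u1 : ∀ z ∈ L.1, (c * d⁻¹) • z ∈ L1.1 := by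
      intro z hz
      -- z = d g z', z' ∈ L1
      obtain ⟨z', hz', rfl⟩ := (Submodule.mem_smul_pointwise_iff_exists _ _ _).1 (hdL ▸ hz)
      obtain ⟨z', hz', rfl⟩ := hz'
      rw [mulVecO_apply, smul_smul, mul_assoc, inv_mul_cancel₀ hd, mul_one, t1]
      exact hL1L.le hz'
    have u2 : ∀ z ∈ L1.1, (ϖ * (d * c⁻¹)) • z ∈ L.1 := by
      intro z hz
      obtain ⟨z', hz', rfl⟩ := (Submodule.mem_smul_pointwise_iff_exists _ _ _).1 (hcL ▸ hz)
      obtain ⟨z', hz', rfl⟩ := hz'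
      rw [mulVecO_apply, smul_smul, mul_assoc, mul_assoc, inv_mul_cancel₀ hc, mul_one, ← smul_smul,
        smul_comm, ← Matrix.mulVec_smul, t2]
      exact hLL1.le ((mem_smul_lattice hϖ.ne_zero).2 (by
        rwa [smul_smul, inv_mul_cancel₀ hϖ.ne_zero, one_smul]))
    apply le_antisymm
    · refine hϖ.le_of_lt_one _ ?_
      refine lt_of_le_of_ne (le_one_of_primitive hϖ hn (hL1L.le (u1 w hm))) fun e => ?_
      refine hL1L.not_ge fun z hz => ?_
      have h := u1 z hz
      have h3 := smul_mem_of_v_le (a := (c * d⁻¹)⁻¹) (by rw [map_inv₀, e, inv_one]) h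
      rwa [smul_smul, inv_mul_cancel₀ (mul_ne_zero hc (inv_ne_zero hd)), one_smul] at h3
    · have h := le_one_of_primitive hϖ hxn (u2 x self_mem_nbr)
      rw [map_mul] at h
      have : Valued.v ϖ * Valued.v (d * c⁻¹) ≤ 1 := h
      rw [show c * d⁻¹ = (d * c⁻¹)⁻¹ by rw [mul_inv, inv_inv, mul_comm], map_inv₀]
      have hpos : 0 < Valued.v (d * c⁻¹) :=
        zero_lt_iff.2 ((Valuation.ne_zero_iff _).2 (mul_ne_zero hd (inv_ne_zero hc)))
      rwa [← one_div, le_div_iff₀ hpos]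
  have e3 : Valued.v (c * l) * Valued.v (c * l) = Valued.v ϖ := by
    rw [← map_mul, show c * l * (c * l) = c * d⁻¹ * (d * l * (c * l)) by field_simp, map_mul, e1, e2,
      mul_one]
  rcases lt_or_ge (Valued.v (c * l)) 1 with h | h
  · have h3 := hϖ.le_of_lt_one _ h
    have : Valued.v (c * l) * Valued.v (c * l) < Valued.v ϖ := by
      calc _ ≤ Valued.v (c * l) * Valued.v ϖ := by gcongr
        _ < 1 * Valued.v ϖ := mul_lt_mul_of_pos_right h hϖ.v_pos
        _ = _ := one_mul _
    exact this.ne e3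
  · have : 1 ≤ Valued.v (c * l) * Valued.v (c * l) := one_le_mul h h
    rw [e3] at this
    exact this.not_gt hϖ.lt_one

omit [(Valued.v : Valuation K ℤᵐ⁰).IsNontrivial] in
/-- If the two eigenvalues have the same absolute value, then a vertex is fixed. -/
theorem exists_fixed_vertex {g : GL (Fin 2) K} {w y : Fin 2 → K} {l m b : K}
    (hlin : LinearIndependent K ![w, y]) (hw : g.1.mulVec w = l • w)
    (hy : g.1.mulVec y = m • y + b • w) (hm : m ≠ 0) (hlm : Valued.v l = Valued.v m) :
    ∃ Λ : Vertex K, Matrix.ProjGenLinGroup.mk g • Λ = Λ := by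
  -- Replacing `w` by `s w` multiplies the off-diagonal coefficient by `s⁻¹`; with `s = b / m` the
  -- matrix of `m⁻¹ g` in the basis `s w, y` is integral with unit diagonal entries.
  obtain ⟨s, hs0, hs⟩ : ∃ s : K, s ≠ 0 ∧ Valued.v (b * s⁻¹ * m⁻¹) ≤ 1 := by
    by_cases hb : b = 0
    · exact ⟨1, one_ne_zero, by simp [hb]⟩
    · refine ⟨b * m⁻¹, mul_ne_zero hb (inv_ne_zero hm), ?_⟩
      rw [mul_inv, inv_inv, mul_comm b⁻¹, ← mul_assoc, mul_comm b m, mul_assoc m, mul_inv_cancel₀ hb,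
        mul_one, mul_inv_cancel₀ hm, map_one]
  have hb0 : IsBasisOf w y (Submodule.span 𝒪[K] {w, y}) := ⟨hlin, rfl⟩
  have hb1 := hb0.smul_smul hs0 one_ne_zero
  rw [one_smul] at hb1
  set M := Submodule.span 𝒪[K] {s • w, y} with hM
  let M' : Lattice K := ⟨M, hb1.isLattice⟩
  refine ⟨vtx M', ?_⟩
  rw [mk_smul_vtx]
  refine (vtx_eq_iff.2 ⟨m, hm, ?_⟩).symm
  rw [smul_val]
  change m • M = M.map (mulVecO g)
  have hl : l ≠ 0 := by
    rintro rfl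
    rw [map_zero] at hlm
    exact hm ((Valuation.zero_iff _).1 hlm.symm)
  have hlm1 : Valued.v (l * m⁻¹) = 1 := by
    rw [map_mul, map_inv₀, hlm, mul_inv_cancel₀ ((Valuation.ne_zero_iff _).2 hm)]
  have h1 := (hb1.symm.smul_lattice hm)
  have h2 := (hb1.mapGL g)
  apply le_antisymm
  · have hsw : s • w = (l⁻¹) • g.1.mulVec (s • w) := by
      rw [Matrix.mulVec_smul, hw, smul_comm, smul_smul l⁻¹, inv_mul_cancel₀ hl, one_smul]
    intro z hz
    obtain ⟨p, q, hp, hq, rfl⟩ := h1.mem_iff.1 hz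
    rw [h2.mem_iff]
    refine ⟨(m * l⁻¹) * q - (m * l⁻¹) * (b * s⁻¹ * m⁻¹) * p, p, ?_, hp, ?_⟩
    · have h3 : Valued.v (m * l⁻¹) = 1 := by
        rw [map_mul, map_inv₀, hlm, mul_inv_cancel₀ ((Valuation.ne_zero_iff _).2 hm)]
      refine (Valuation.map_sub _ _ _).trans (max_le ?_ ?_)
      · rw [map_mul, h3, one_mul]; exact hq
      · rw [map_mul, map_mul, h3, one_mul]; exact mul_le_one' hs hp
    · rw [Matrix.mulVec_smul, hw, hy]
      simp only [smul_add, smul_smul]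
      have e1 : m * l⁻¹ * q * (s * l) = q * (m * s) := by field_simp
      have e2 : m * l⁻¹ * (b * s⁻¹ * m⁻¹) * p * (s * l) = p * b := by field_simp
      rw [sub_mul, e1, e2, sub_smul]; abel
  · intro z hz
    obtain ⟨p, q, hp, hq, rfl⟩ := h2.mem_iff.1 hz
    rw [h1.mem_iff]
    refine ⟨q, p * (l * m⁻¹) + q * (b * s⁻¹ * m⁻¹), hq, ?_, ?_⟩
    · refine (Valuation.map_add _ _ _).trans (max_le ?_ ?_)
      · rw [map_mul, hlm1, mul_one]; exact hp
      · rw [map_mul]; exact mul_le_one' hq hs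
    · rw [Matrix.mulVec_smul, hw, hy]
      simp only [smul_add, smul_smul]
      have e1 : p * (l * m⁻¹) * (m * s) = p * (s * l) := by field_simp
      have e2 : q * (b * s⁻¹ * m⁻¹) * (m * s) = q * b := by field_simp
      rw [add_mul, e1, e2, add_smul]; abel

omit [Valued K ℤᵐ⁰] [(Valued.v : Valuation K ℤᵐ⁰).IsNontrivial] in
theorem mulVec_pow_eigen {g : GL (Fin 2) K} {w : Fin 2 → K} {l : K} (hw : g.1.mulVec w = l • w)
    (k : ℕ) : (g ^ k).1.mulVec w = l ^ k • w := by
  induction k with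
  | zero => simp
  | succ k ih =>
    rw [pow_succ, Units.val_mul, ← Matrix.mulVec_mulVec, hw, Matrix.mulVec_smul, ih, smul_smul,
      pow_succ, mul_comm]

variable {N : Type u} [Group N] {φ : N →* PGL(2, K)}

omit [(Valued.v : Valuation K ℤᵐ⁰).IsNontrivial] in
/-- The attracting fixed point of a hyperbolic element is a limit point. -/
theorem mk_mem_limitSet {g : GL (Fin 2) K} {n : N} (hn : φ n = Matrix.ProjGenLinGroup.mk g)
    {w y : Fin 2 → K} {l m : K} (hlin : LinearIndependent K ![w, y])
    (hw : g.1.mulVec w = l • w) (hy : g.1.mulVec y = m • y) (hlm : Valued.v m < Valued.v l)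
    (hw0 : w ≠ 0) (hinj : ¬ IsOfFinOrder n) :
    Projectivization.mk K w hw0 ∈ limitSet φ := by
  have hl : l ≠ 0 := by rintro rfl; simp at hlm
  have hne : ∀ c : K, w + c • y ≠ 0 := fun c h => by
    have := LinearIndependent.pair_iff.1 hlin 1 c (by rwa [one_smul])
    exact one_ne_zero this.1
  -- Up to the factor `l ^ k`, the `k`-th power sends `w + y` to `w + (m / l) ^ k y`, which tends to
  -- `w`.
  refine ⟨Projectivization.mk K (w + (1 : K) • y) (hne 1), fun k => n ^ k,
    injective_pow_iff_not_isOfFinOrder.2 hinj, ?_⟩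
  have hc : Valued.v (m * l⁻¹) < 1 := by
    rw [map_mul, map_inv₀, ← div_eq_mul_inv]
    exact (div_lt_one₀ (zero_lt_iff.2 ((Valuation.ne_zero_iff _).2 hl))).2 hlm
  have hcont : Continuous (fun x : {x : Fin 2 → K // x ≠ 0} => Projectivization.mk K x.1 x.2) :=
    continuous_coinduced_rng
  have hlim : Tendsto (fun k : ℕ => (⟨w + (m * l⁻¹) ^ k • y, hne _⟩ : {x : Fin 2 → K // x ≠ 0}))
      atTop (𝓝 ⟨w, hw0⟩) := by
    rw [tendsto_subtype_rng]
    have h0 : Tendsto (fun k : ℕ => (m * l⁻¹) ^ k) atTop (𝓝 0) :=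
      Valued.tendsto_zero_pow_of_v_lt_one hc
    have := (h0.smul_const y).const_add w
    simpa using this
  refine ((hcont.tendsto _).comp hlim).congr fun k => ?_
  rw [Function.comp_apply, map_pow, hn, ← map_pow]
  symm
  refine (Projectivization.mk_eq_mk_iff' _ _ _ _ _).2 ⟨l ^ k, ?_⟩
  change _ = (g ^ k).1.mulVec _
  rw [Matrix.mulVec_add, one_smul, mulVec_pow_eigen hw, mulVec_pow_eigen hy, smul_add, smul_smul,
    mul_pow, mul_comm, mul_assoc, ← mul_pow, inv_mul_cancel₀ hl, one_pow, mul_one]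

/-- An element of `N` fixes a vertex of the tree, or it has infinite order and two limit points. -/
theorem fixes_vertex_or_limit_points (hfix : FixedPointsRational φ) (n : N) :
    (∃ Λ : Vertex K, φ n • Λ = Λ) ∨ ∃ u ∈ limitSet φ, ∃ v ∈ limitSet φ, u ≠ v := by
  obtain ⟨g, hg⟩ := Matrix.ProjGenLinGroup.mk_surjective (φ n)
  have hsplit := hfix g ⟨n, hg.symm⟩
  obtain ⟨l, w, hw0, hw⟩ := exists_eigenvector hsplit
  obtain ⟨ϖ, hϖ⟩ := exists_isUniformizer K
  have hstd : IsBasisOf (K := K) ![1, 0] ![0, 1] (Submodule.span 𝒪[K] {![1, 0], ![0, 1]}) := by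
    refine ⟨LinearIndependent.pair_iff.2 fun s t h => ?_, rfl⟩
    have h0 := congrFun h 0
    have h1 := congrFun h 1
    simp at h0 h1
    exact ⟨h0, h1⟩
  -- The lattice serves only to complete the eigenvector to a basis of `K²`.
  let L0 : Lattice K := ⟨_, hstd.isLattice⟩
  obtain ⟨a, ha, hm', hn'⟩ := L0.exists_smul_primitive hϖ hw0
  obtain ⟨y, hb⟩ := L0.exists_isBasisOf_of_notMem hϖ hm' hn'
  set w1 := a • w with hw1
  have hw' : g.1.mulVec w1 = l • w1 := by rw [hw1, Matrix.mulVec_smul, hw, smul_comm]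
  obtain ⟨b, m, hbm⟩ := hb.exists_coord (g.1.mulVec y)
  have hw10 : w1 ≠ 0 := smul_ne_zero ha hw0
  clear_value w1
  have hinv : ∀ z, g.1.mulVec z = 0 → z = 0 := fun z hz => by
    by_contra h
    exact (smul_ne_zero_iff_ne g).2 h hz
  have hl : l ≠ 0 := by
    rintro rfl
    rw [zero_smul] at hw'
    exact hw10 (hinv _ hw')
  have hm : m ≠ 0 := by
    rintro rfl
    rw [zero_smul, add_zero] at hbm
    have h1 : g.1.mulVec (y - (b * l⁻¹) • w1) = 0 := by
      rw [Matrix.mulVec_sub, Matrix.mulVec_smul, hw', hbm, smul_smul, mul_assoc, inv_mul_cancel₀ hl,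
        mul_one, sub_self]
    have h2 := hinv _ h1
    have := LinearIndependent.pair_iff.1 hb.lin (-(b * l⁻¹)) 1 (by
      rw [neg_smul, one_smul, ← h2]; abel)
    exact one_ne_zero this.2
  by_cases hlm : Valued.v l = Valued.v m
  · left
    rw [← hg]
    exact exists_fixed_vertex hb.lin hw' (by rw [hbm, add_comm]) hm hlm
  · right
    have hne : m - l ≠ 0 := fun h => hlm (by rw [sub_eq_zero.1 h])
    set y1 := y + (b * (m - l)⁻¹) • w1 with hy1
    have hy' : g.1.mulVec y1 = m • y1 := by
      rw [hy1, Matrix.mulVec_add, Matrix.mulVec_smul, hw', hbm, smul_add, smul_smul, smul_smul,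
        add_comm (b • w1), add_assoc, ← add_smul]
      congr 2
      field_simp; ring
    have hlin : LinearIndependent K ![w1, y1] := by
      rw [LinearIndependent.pair_iff]
      intro s t hst
      have := LinearIndependent.pair_iff.1 hb.lin (s + t * (b * (m - l)⁻¹)) t (by
        rw [← hst, hy1, smul_add, smul_smul, add_smul]; abel)
      refine ⟨?_, this.2⟩
      simpa [this.2] using this.1
    have hlin' : LinearIndependent K ![y1, w1] := by
      rw [LinearIndependent.pair_iff] at hlin ⊢
      intro s t hst
      exact (hlin t s (by rw [← hst]; abel)).symm
    have hy10 : y1 ≠ 0 := fun h => by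
      have := LinearIndependent.pair_iff.1 hlin 0 1 (by simp [h])
      exact one_ne_zero this.2
    -- If a power were scalar, the two eigenvalues would have the same power and hence the same
    -- absolute value.
    have hord : ¬ IsOfFinOrder n := by
      intro h
      obtain ⟨k, hk, hk1⟩ := isOfFinOrder_iff_pow_eq_one.1 h
      have h1 : Matrix.ProjGenLinGroup.mk (g ^ k) = Matrix.ProjGenLinGroup.mk 1 := by
        rw [map_pow, hg, ← map_pow, hk1, map_one, map_one]
      obtain ⟨u, hu⟩ := Matrix.ProjGenLinGroup.mk_eq_mk_iff.1 h1
      have key : ∀ z : Fin 2 → K, ∀ c : K, g.1.mulVec z = c • z → z ≠ 0 → c ^ k = (u⁻¹ : Kˣ) := by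
        intro z c hz hz0
        have h2 := mulVec_pow_eigen hz k
        rw [← mul_inv_eq_iff_eq_mul.2 hu.symm, one_mul, ← map_inv] at h2
        have h3 : (Matrix.GeneralLinearGroup.scalar (Fin 2) u⁻¹).1.mulVec z = ((u⁻¹ : Kˣ) : K) • z := by
          ext i
          fin_cases i <;> simp [Matrix.GeneralLinearGroup.scalar, Matrix.scalar]
        rw [h3] at h2
        exact (smul_left_injective K hz0 h2).symm
      have h4 := (key _ _ hw' hw10).trans (key _ _ hy' hy10).symm
      have h5 := congrArg Valued.v h4
      rw [map_pow, map_pow] at h5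
      exact hlm ((pow_left_inj₀ zero_le zero_le hk.ne').1 h5)
    have hne2 : Projectivization.mk K w1 hw10 ≠ Projectivization.mk K y1 hy10 := by
      intro h
      obtain ⟨c, hc⟩ := (Projectivization.mk_eq_mk_iff' _ _ _ _ _).1 h
      have := LinearIndependent.pair_iff.1 hlin 1 (-c) (by
        rw [neg_smul, hc, one_smul, add_neg_cancel])
      exact one_ne_zero this.1
    have hinvn : φ n⁻¹ = Matrix.ProjGenLinGroup.mk g⁻¹ := by rw [map_inv, map_inv, hg]
    have hordi : ¬ IsOfFinOrder n⁻¹ := by rwa [isOfFinOrder_inv_iff]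
    have hinve : ∀ (z : Fin 2 → K) (c : K), c ≠ 0 → g.1.mulVec z = c • z →
        (g⁻¹).1.mulVec z = c⁻¹ • z := by
      intro z c hc hz
      have : z = g.1.mulVec (c⁻¹ • z) := by
        rw [Matrix.mulVec_smul, hz, smul_smul, inv_mul_cancel₀ hc, one_smul]
      conv_lhs => rw [this]
      rw [Matrix.mulVec_mulVec, ← Units.val_mul, inv_mul_cancel, Units.val_one, Matrix.one_mulVec]
    rcases lt_or_gt_of_ne hlm with h | h
    · have h' : Valued.v m⁻¹ < Valued.v l⁻¹ := by
        rw [map_inv₀, map_inv₀]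
        exact inv_strictAnti₀ (zero_lt_iff.2 ((Valuation.ne_zero_iff _).2 hl)) h
      exact ⟨_, mk_mem_limitSet hg.symm hlin' hy' hw' h hy10 hord, _,
        mk_mem_limitSet hinvn hlin (hinve _ _ hl hw') (hinve _ _ hm hy') h' hw10 hordi, hne2.symm⟩
    · have h' : Valued.v l⁻¹ < Valued.v m⁻¹ := by
        rw [map_inv₀, map_inv₀]
        exact inv_strictAnti₀ (zero_lt_iff.2 ((Valuation.ne_zero_iff _).2 hm)) h
      exact ⟨_, mk_mem_limitSet hg.symm hlin hw' hy' h hw10 hord, _,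
        mk_mem_limitSet hinvn hlin' (hinve _ _ hm hy') (hinve _ _ hl hw') h' hy10 hordi, hne2⟩

end FixedVertices

/-! ### Fixed vertices of torsion groups; 𝒯_N is nonempty -/

section GlobalFixedPoint

variable {K : Type u} [Field K] [Valued K ℤᵐ⁰] [(Valued.v : Valuation K ℤᵐ⁰).IsNontrivial]
  {N : Type u} [Group N] {φ : N →* PGL(2, K)}

omit [Valued K ℤᵐ⁰] [(Valued.v : Valuation K ℤᵐ⁰).IsNontrivial] in
theorem pow_smul_ping {g : PGL(2, K)} {Z W : Set (ℙ K (Fin 2 → K))} (hWZ : W ⊆ Z)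
    (h : ∀ q ∈ Z, g • q ∈ W) {k : ℕ} (hk : 0 < k) : ∀ q ∈ Z, g ^ k • q ∈ W := by
  induction k, hk using Nat.le_induction with
  | base => simpa using h
  | succ k hk ih =>
    intro q hq
    rw [pow_succ', mul_smul]
    exact h _ (hWZ (ih q hq))

/-- If `H` and `s` fix vertices and every element of `N` has finite order, then `H` and `s` have a
common fixed vertex. -/
theorem exists_common_fixed (hfin : ∀ n : N, IsOfFinOrder n) (H : Subgroup N) (s : N)
    (hH : ∃ Λ : Vertex K, ∀ h ∈ H, φ h • Λ = Λ) (hs : ∃ Λ : Vertex K, φ s • Λ = Λ) :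
    ∃ Λ : Vertex K, (∀ h ∈ H, φ h • Λ = Λ) ∧ φ s • Λ = Λ := by
  -- A ping-pong argument: join a vertex `a` fixed by `H` to a vertex `b` fixed by `s` by a path of
  -- minimal length. By minimality some `h ∈ H` moves the first edge at `a`, and `s` moves the last
  -- edge at `b`.
  by_contra! hno
  let P : ℕ → Prop := fun d => ∃ a b : Vertex K, (∀ h ∈ H, φ h • a = a) ∧ φ s • b = b ∧
    (bruhatTits K).dist a b = d
  have hP : ∃ d, P d := by
    obtain ⟨a, ha⟩ := hH
    obtain ⟨b, hb⟩ := hs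
    exact ⟨_, a, b, ha, hb, rfl⟩
  classical
  obtain ⟨a, b, ha, hb, hd⟩ := Nat.find_spec hP
  have hmin : ∀ a' b' : Vertex K, (∀ h ∈ H, φ h • a' = a') → φ s • b' = b' →
      (bruhatTits K).dist a b ≤ (bruhatTits K).dist a' b' := fun a' b' h1 h2 => by
    rw [hd]
    exact Nat.find_min' hP ⟨a', b', h1, h2, rfl⟩
  obtain ⟨p, hp⟩ := (preconnected_bruhatTits K a b).exists_walk_length_eq_dist
  have hpp := p.isPath_of_length_eq_dist hp
  have hnil : ¬ p.Nil := by
    intro h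
    have := h.eq
    exact hno a ha (this ▸ hb)
  have h1 : ∃ h ∈ H, φ h • p.snd ≠ p.snd := by
    by_contra! h
    have h2 := hmin _ _ h hb
    have h3 := SimpleGraph.dist_le p.tail
    have h4 := SimpleGraph.Walk.length_tail_add_one hnil
    omega
  have h2 : φ s • p.penultimate ≠ p.penultimate := by
    intro h
    have h2 := hmin _ _ ha h
    have h3 := SimpleGraph.dist_le p.dropLast
    have h4 := SimpleGraph.Walk.length_dropLast_add_one hnil
    omega
  obtain ⟨h, hhH, hh⟩ := h1
  obtain ⟨k, hk, hk1⟩ := isOfFinOrder_iff_pow_eq_one.1 (hfin (h * s))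
  -- Ends at `a` that do not point along the path are seen from `b` behind the path. Then `s` moves
  -- them off the path at `b`, so that from `a` they point along it, and `h` turns them into the
  -- direction `φ h • p.snd`, which again is off the path. A power of `h s` equal to 1 would do the
  -- same, although a third direction exists.
  have key := pow_smul_ping (g := φ (h * s)) (Z := {q | dir q a ≠ p.snd})
    (W := {q | dir q a = φ h • p.snd})
    (fun q (hq : dir q a = φ h • p.snd) => show dir q a ≠ p.snd by rw [hq]; exact hh)
    (by
      intro q hq
      have e1 := dir_eq_penultimate p hpp hnil hq
      have e2 : dir (φ s • q) b = φ s • p.penultimate := by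
        rw [← e1, ← smul_dir, hb]
      have hnil' : ¬ p.reverse.Nil := by rwa [SimpleGraph.Walk.nil_reverse]
      have e3 : dir (φ s • q) a = p.snd := by
        rw [dir_eq_penultimate p.reverse hpp.reverse hnil'
          (by rw [SimpleGraph.Walk.snd_reverse, e2]; exact h2), SimpleGraph.Walk.penultimate_reverse]
      change dir (φ (h * s) • q) a = φ h • p.snd
      rw [map_mul, mul_smul, ← e3, ← smul_dir, ha h hhH]) hk
  rw [← map_pow, hk1, map_one] at key
  obtain ⟨q, hq1, hq2⟩ := exists_dir_ne_ne a p.snd (φ h • p.snd)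
  have := key q hq1
  rw [one_smul] at this
  exact hq2 this

/-- Adjoining generators one at a time, `exists_common_fixed` keeps a common fixed vertex. -/
theorem exists_global_fixed [Group.FG N] (hfin : ∀ n : N, IsOfFinOrder n)
    (hn : ∀ n : N, ∃ Λ : Vertex K, φ n • Λ = Λ) : ∃ Λ : Vertex K, ∀ n, φ n • Λ = Λ := by
  obtain ⟨S, hS, hSf⟩ := Group.fg_iff.1 (inferInstance : Group.FG N)
  have : ∃ Λ : Vertex K, ∀ n ∈ Subgroup.closure S, φ n • Λ = Λ := by
    clear hS
    induction S, hSf using Set.Finite.induction_on with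
    | empty =>
      obtain ⟨Λ, -⟩ := hn 1
      refine ⟨Λ, fun n h => ?_⟩
      rw [Subgroup.closure_empty, Subgroup.mem_bot] at h
      rw [h, map_one, one_smul]
    | @insert s S _ _ ih =>
      obtain ⟨Λ, h1, h2⟩ := exists_common_fixed hfin (Subgroup.closure S) s ih (hn s)
      refine ⟨Λ, fun n hn => ?_⟩
      have hle : Subgroup.closure (insert s S) ≤ stab φ Λ := by
        rw [Subgroup.closure_le, Set.insert_subset_iff]
        exact ⟨h2, fun x hx => h1 x (Subgroup.subset_closure hx)⟩
      exact hle hn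
  obtain ⟨Λ, h⟩ := this
  exact ⟨Λ, fun n => h n (hS ▸ Subgroup.mem_top n)⟩

variable (hstab : ∀ Λ : Vertex K, Finite (stab φ Λ))
include hstab

theorem isOfFinOrder_of_fixed {n : N} {Λ : Vertex K} (h : φ n • Λ = Λ) : IsOfFinOrder n := by
  have := hstab Λ
  have h1 : IsOfFinOrder (⟨n, h⟩ : stab φ Λ) := isOfFinOrder_of_finite _
  exact MonoidHom.isOfFinOrder (stab φ Λ).subtype h1

/-- An infinite finitely generated group with finite stabilizers has at least two limit points. -/
theorem exists_two_limit_points [Group.FG N] [Infinite N] (hfix : FixedPointsRational φ) :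
    ∃ u ∈ limitSet φ, ∃ v ∈ limitSet φ, u ≠ v := by
  by_contra hno
  have hn : ∀ n : N, ∃ Λ : Vertex K, φ n • Λ = Λ := fun n =>
    (fixes_vertex_or_limit_points hfix n).resolve_right hno
  obtain ⟨Λ, h⟩ := exists_global_fixed
    (fun n => (hn n).elim fun Λ h => isOfFinOrder_of_fixed hstab h) hn
  have htop : stab φ Λ = ⊤ := top_unique fun n _ => h n
  have h2 := hstab Λ
  rw [htop] at h2
  have : Finite N := Finite.of_equiv _ Subgroup.topEquiv.toEquiv
  exact not_finite N

/-- Two limit points span an apartment, and any two vectors on the two lines give one of its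
vertices. -/
theorem nonempty_treeVertex [Group.FG N] [Infinite N] (hfix : FixedPointsRational φ) :
    Nonempty (TreeVertex φ) := by
  obtain ⟨u, hu, v, hv, huv⟩ := exists_two_limit_points hstab hfix
  induction u with | h x hx =>
  induction v with | h y hy =>
  have hlin : LinearIndependent K ![x, y] := by
    rw [LinearIndependent.pair_iff' hx]
    intro a ha
    refine huv ((Projectivization.mk_eq_mk_iff' _ _ _ _ _).2 ⟨a⁻¹, ?_⟩)
    have ha0 : a ≠ 0 := by rintro rfl; exact hy (by rw [← ha, zero_smul])
    rw [← ha, smul_smul, inv_mul_cancel₀ ha0, one_smul]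
  have hb : IsBasisOf x y (Submodule.span 𝒪[K] {x, y}) := ⟨hlin, rfl⟩
  exact ⟨⟨vtx ⟨_, hb.isLattice⟩, apartment_subset_treeOf hu hv huv
    ⟨x, y, hx, hy, ⟨_, hb.isLattice⟩, rfl, rfl, rfl, rfl⟩⟩⟩

end GlobalFixedPoint

/-! ### Finiteness of the quotient graph -/

section FiniteQuotient

variable {K : Type u} [Field K] [Valued K ℤᵐ⁰] [(Valued.v : Valuation K ℤᵐ⁰).IsNontrivial]
  {N : Type u} [Group N] {φ : N →* PGL(2, K)}

/-- The subgraph of the tree whose edges are the translates of a given set of edges. -/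
def translateGraph (φ : N →* PGL(2, K)) (F : Set (Sym2 (Vertex K))) :
    SimpleGraph (Vertex K) where
  Adj a b := (bruhatTits K).Adj a b ∧ ∃ n : N, ∃ f ∈ F, f.map (fun x => φ n • x) = s(a, b)
  symm := ⟨fun a b h => ⟨h.1.symm, by rw [Sym2.eq_swap]; exact h.2⟩⟩
  loopless := ⟨fun a h => h.1.ne rfl⟩

theorem translateGraph_le {F : Set (Sym2 (Vertex K))} : translateGraph φ F ≤ bruhatTits K :=
  fun _ _ h => h.1

theorem translateGraph_smul {F : Set (Sym2 (Vertex K))} (n : N) {a b : Vertex K}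
    (h : (translateGraph φ F).Adj a b) : (translateGraph φ F).Adj (φ n • a) (φ n • b) := by
  obtain ⟨h1, m, f, hf, e⟩ := h
  refine ⟨adj_smul _ h1, n * m, f, hf, ?_⟩
  rw [← Sym2.map_mk, ← e, Sym2.map_map]
  congr 1
  funext x
  simp [mul_smul]

theorem translateGraph_reachable_smul {F : Set (Sym2 (Vertex K))} (n : N) {a b : Vertex K}
    (h : (translateGraph φ F).Reachable a b) :
    (translateGraph φ F).Reachable (φ n • a) (φ n • b) := by
  obtain ⟨p⟩ := h
  induction p with
  | nil => exact SimpleGraph.Reachable.refl _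
  | cons h _ ih => exact (translateGraph_smul n h).reachable.trans ih

/-- For `F` take the edges on the paths from `x` to its images under a finite set of generators.
Translating these paths links `x` to its whole orbit. -/
theorem exists_translateGraph [Group.FG N] (x : Vertex K) : ∃ F : Set (Sym2 (Vertex K)),
    F.Finite ∧ ∀ n : N, (translateGraph φ F).Reachable x (φ n • x) := by
  obtain ⟨S, hS, hSf⟩ := Group.fg_iff.1 (inferInstance : Group.FG N)
  choose p hp using fun s : N => exists_path K x (φ s • x)
  refine ⟨⋃ s ∈ S, {e | e ∈ (p s).edges}, hSf.biUnion fun s _ => List.finite_toSet _, fun n => ?_⟩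
  set F := ⋃ s ∈ S, {e | e ∈ (p s).edges} with hF
  have hgen : ∀ s ∈ S, (translateGraph φ F).Reachable x (φ s • x) := by
    intro s hs
    have key : ∀ (a b : Vertex K) (q : (bruhatTits K).Walk a b), (∀ e ∈ q.edges, e ∈ F) →
        (translateGraph φ F).Reachable a b := by
      intro a b q hq
      induction q with
      | nil => exact SimpleGraph.Reachable.refl _
      | cons h q ih =>
        rw [SimpleGraph.Walk.edges_cons] at hq
        refine SimpleGraph.Reachable.trans (SimpleGraph.Adj.reachable ⟨h, 1, _, hq _ List.mem_cons_self, ?_⟩)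
          (ih fun e he => hq e (List.mem_cons_of_mem _ he))
        simp
    exact key _ _ (p s) fun e he => Set.mem_biUnion hs he
  have hn : n ∈ Subgroup.closure S := hS ▸ Subgroup.mem_top n
  induction hn using Subgroup.closure_induction with
  | mem s hs => exact hgen s hs
  | one => rw [map_one, one_smul]
  | mul a b _ _ ha hb =>
    rw [map_mul, mul_smul]
    exact ha.trans (translateGraph_reachable_smul a hb)
  | inv a _ ha =>
    have := translateGraph_reachable_smul a⁻¹ ha
    rw [map_inv, inv_smul_smul] at this
    exact (map_inv φ a ▸ this).symm

/-- Walk along the path from `z` into `Y`. The end `w` stays behind, so at the first vertex of `Y`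
its direction points back to a vertex outside `Y`. -/
theorem exists_exit {Y : Set (Vertex K)} {w : ℙ K (Fin 2 → K)} {z x : Vertex K}
    (p : (bruhatTits K).Walk z x) (hp : p.IsPath) (hz : z ∉ Y) (hx : x ∈ Y)
    (hw : dir w z ≠ p.snd) : ∃ y ∈ Y, dir w y ∉ Y := by
  induction p with
  | nil => exact absurd hx hz
  | @cons z a x h p ih =>
    rw [SimpleGraph.Walk.snd_cons] at hw
    have h1 := dir_eq_of_ne h hw
    by_cases ha : a ∈ Y
    · exact ⟨a, ha, h1 ▸ hz⟩
    · refine ih hp.of_cons ha hx ?_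
      rw [SimpleGraph.Walk.cons_isPath_iff] at hp
      intro e
      exact hp.2 (h1 ▸ e ▸ p.getVert_mem_support 1)

/-- Let an end leave `Y` at `y`. Along a path from `y` to another vertex of `Y` one moves away from
the end, so there its direction is the last edge of the path, which is inside `Y`. -/
theorem exit_unique {Y : Set (Vertex K)} (hY : IsSubtree Y) {q : ℙ K (Fin 2 → K)} {y y' : Vertex K}
    (hy : y ∈ Y) (hy' : y' ∈ Y) (h : dir q y ∉ Y) (h' : dir q y' ∉ Y) : y = y' := by
  obtain ⟨p, hp⟩ := exists_path K y y'
  have hsup := hY.support_subset hy hy' p hp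
  by_contra hne
  have hnil : ¬ p.Nil := fun hn => hne hn.eq
  have h1 := dir_eq_penultimate p hp hnil fun e => h (e ▸ hsup _ (p.getVert_mem_support 1))
  exact h' (h1 ▸ hsup _ (p.getVert_mem_support _))

/-- An invariant subtree contains the tree spanned by the limit points. -/
theorem treeOf_subset (hstab : ∀ Λ : Vertex K, Finite (stab φ Λ)) {Y : Set (Vertex K)}
    (hY : IsSubtree Y) (hne : Y.Nonempty) (hinv : ∀ (n : N), ∀ y ∈ Y, φ n • y ∈ Y) :
    treeOf (limitSet φ) ⊆ Y := by
  refine Set.sInter_subset_of_mem ⟨hY, fun u hu v hv huv z hz => ?_⟩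
  -- At a vertex of the apartment outside `Y`, one of the two ends, `w`, does not point towards `Y`,
  -- so it leaves `Y` at some vertex `y`.
  by_contra hzY
  obtain ⟨x, hx⟩ := hne
  obtain ⟨p, hp⟩ := exists_path K z x
  obtain ⟨w, hw, hwz⟩ : ∃ w ∈ limitSet φ, dir w z ≠ p.snd := by
    by_cases h : dir u z = p.snd
    · exact ⟨v, hv, fun h' => dir_ne_of_mem_apartment huv hz (h.trans h'.symm)⟩
    · exact ⟨u, hu, h⟩
  obtain ⟨y, hy, hyY⟩ := exists_exit p hp hzY hx hwz
  obtain ⟨q, γ, hγ, hlim⟩ := hw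
  have hev := hlim.eventually ((isOpen_dir_eq y (dir w y)).mem_nhds rfl)
  obtain ⟨M, hM⟩ := eventually_atTop.1 hev
  -- Let `w` be the limit of `γ_m q`. Late terms leave `Y` at `y` too, so `q` leaves `Y` at `γ_m⁻¹
  -- y`. As the exit is unique, these vertices coincide, which puts infinitely many elements `γ_m
  -- γ_M⁻¹` into the finite stabilizer of `y`.
  have hexit : ∀ m ≥ M, φ (γ m)⁻¹ • y ∈ Y ∧ dir q (φ (γ m)⁻¹ • y) ∉ Y := by
    intro m hm
    refine ⟨hinv _ _ hy, fun h => hyY ?_⟩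
    have h1 : dir (φ (γ m) • q) y = dir w y := hM m hm
    have h2 := hinv (γ m) _ h
    rwa [← smul_dir, map_inv, smul_inv_smul, h1] at h2
  have hconst : ∀ m ≥ M, γ m * (γ M)⁻¹ ∈ stab φ y := by
    intro m hm
    have h := exit_unique hY (hexit m hm).1 (hexit M le_rfl).1 (hexit m hm).2 (hexit M le_rfl).2
    rw [mem_stab, map_mul, mul_smul, ← h, ← mul_smul, ← map_mul, mul_inv_cancel, map_one, one_smul]
  have := hstab y
  have hinj : Function.Injective fun m : ℕ =>
      (⟨γ (M + m) * (γ M)⁻¹, hconst _ (Nat.le_add_right _ _)⟩ : stab φ y) := by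
    intro a b h
    have h1 := mul_right_cancel (congrArg Subtype.val h)
    exact Nat.add_left_cancel (hγ h1)
  exact not_injective_infinite_finite _ hinj

theorem isSubtree_reachable {G : SimpleGraph (Vertex K)} (hG : G ≤ bruhatTits K) (x : Vertex K) :
    IsSubtree {y | G.Reachable x y} := by
  have key : ∀ (y : Vertex K) (hy : G.Reachable x y),
      ((bruhatTits K).induce {y | G.Reachable x y}).Reachable ⟨x, SimpleGraph.Reachable.refl x⟩
        ⟨y, hy⟩ := by
    have : ∀ (a b : Vertex K) (p : G.Walk a b) (ha : G.Reachable x a) (hb : G.Reachable x b),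
        ((bruhatTits K).induce {y | G.Reachable x y}).Reachable ⟨a, ha⟩ ⟨b, hb⟩ := by
      intro a b p
      induction p with
      | nil => exact fun _ _ => SimpleGraph.Reachable.refl _
      | cons h p ih =>
        intro ha hb
        have hc := ha.trans h.reachable
        have h1 : ((bruhatTits K).induce {y | G.Reachable x y}).Adj ⟨_, ha⟩ ⟨_, hc⟩ := hG h
        exact h1.reachable.trans (ih hc hb)
    rintro y ⟨p⟩
    exact this _ _ p _ _
  exact fun a b => (key a.1 a.2).symm.trans (key b.1 b.2)

/-- In a tree the edge is the only path between its two ends, so a path in the subgraph has to be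
this edge. -/
theorem adj_of_reachable {G : SimpleGraph (Vertex K)} (hG : G ≤ bruhatTits K) {a b : Vertex K}
    (hr : G.Reachable a b) (hab : (bruhatTits K).Adj a b) : G.Adj a b := by
  classical
  obtain ⟨p⟩ := hr
  have hp := p.toPath.2.mapLe hG
  have h2 : (hab.toWalk).IsPath := hab.isPath_toWalk
  have e := congrArg Subtype.val
    (((isAcyclic_bruhatTits K).subsingleton_path a b).elim ⟨_, hp⟩ ⟨_, h2⟩)
  have h3 : s(a, b) ∈ (p.toPath.1.mapLe hG).edges := by
    rw [show p.toPath.1.mapLe hG = hab.toWalk from e]; simp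
  rw [SimpleGraph.Walk.edges_mapLe_eq_edges] at h3
  exact SimpleGraph.Walk.edges_subset_edgeSet _ h3

/-- The quotient graph is finite. -/
theorem finite_qEdge [Group.FG N] (hstab : ∀ Λ : Vertex K, Finite (stab φ Λ)) :
    Finite (QEdge φ) := by
  by_cases hne : Nonempty (TreeVertex φ)
  swap
  · have : IsEmpty (QEdge φ) := ⟨fun e => by
      induction e using Quot.ind with
      | mk e => exact hne ⟨e.org⟩⟩
    infer_instance
  obtain ⟨x⟩ := hne
  obtain ⟨F, hF, hr⟩ := exists_translateGraph (φ := φ) x.1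
  -- The component of `x` in the graph of translates of `F` is an invariant subtree, hence contains
  -- 𝒯_N. So each edge of 𝒯_N is a translate of one of the finitely many edges in `F`.
  have hsub : treeOf (limitSet φ) ⊆ {y | (translateGraph φ F).Reachable x.1 y} :=
    treeOf_subset hstab (isSubtree_reachable translateGraph_le _) ⟨x.1, SimpleGraph.Reachable.refl _⟩
      fun n y hy => (hr n).trans (translateGraph_reachable_smul n hy)
  have hadj : ∀ e : TreeEdge φ, ∃ n : N, ∃ f ∈ F, f.map (fun x => φ n • x) = s(e.org.1, e.tgt.1) :=
    fun e => (adj_of_reachable translateGraph_le ((hsub e.org.2).symm.trans (hsub e.tgt.2))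
      e.adj).2
  choose n f hfF hf using hadj
  have := hF.to_subtype
  refine Finite.of_injective (fun e : QEdge φ => (⟨f (Quot.out e), hfF _⟩ : F)) fun e e' h => ?_
  have h1 : f (Quot.out e) = f (Quot.out e') := congrArg Subtype.val h
  rw [← Quot.out_eq e, ← Quot.out_eq e']
  generalize Quot.out e = e at *
  generalize Quot.out e' = e' at *
  refine Quot.sound ⟨n e' * (n e)⁻¹, ?_⟩
  have h2 : (s(e.org.1, e.tgt.1)).map (fun x => φ (n e' * (n e)⁻¹) • x) = s(e'.org.1, e'.tgt.1) := by
    rw [← hf e, ← hf e', ← h1, Sym2.map_map]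
    congr 1
    funext z
    simp [mul_smul]
  rw [Sym2.map_mk, Sym2.eq_iff] at h2
  exact h2

end FiniteQuotient

/-! ### Potentials on a tree with values in a group -/

section TreePotential

variable {X Γ : Type*} [Group Γ] {G : SimpleGraph X}

/-- The product of the values of `c` along a walk. -/
def walkProd (c : X → X → Γ) : ∀ {a b : X}, G.Walk a b → Γ
  | _, _, .nil => 1
  | _, _, .cons (u := u) (v := v) _ p => c u v * walkProd c p

/-- On a tree every antisymmetric function of the oriented edges is a coboundary. -/
theorem exists_potential (hconn : G.Preconnected) (hac : G.IsAcyclic) (c : X → X → Γ)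
    (hc : ∀ a b, G.Adj a b → c b a = (c a b)⁻¹) (x : X) :
    ∃ F : X → Γ, F x = 1 ∧ ∀ a b, G.Adj a b → F a = c a b * F b := by
  classical
  have hex : ∀ y, ∃ p : G.Walk y x, p.IsPath := fun y => by
    obtain ⟨p⟩ := hconn y x
    exact ⟨p.toPath, p.toPath.2⟩
  choose p hp using hex
  have huniq : ∀ {y : X} (q : G.Walk y x), q.IsPath → p y = q := fun {y} q hq =>
    congrArg Subtype.val ((hac.subsingleton_path y x).elim ⟨p y, hp y⟩ ⟨q, hq⟩)
  -- The potential at `y` is the ordered product of `c` along the path from `y` to the base point;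
  -- for adjacent vertices one of the two paths extends the other by the edge between them.
  refine ⟨fun y => walkProd c (p y), ?_, fun a b hab => ?_⟩
  · change walkProd c (p x) = 1
    rw [huniq .nil SimpleGraph.Walk.IsPath.nil]
    rfl
  · have key : ∀ {a b : X} (hab : G.Adj a b), a ∉ (p b).support →
        walkProd c (p a) = c a b * walkProd c (p b) := by
      intro a b hab h
      rw [huniq (.cons hab (p b)) ((SimpleGraph.Walk.cons_isPath_iff _ _).2 ⟨hp b, h⟩)]
      rfl
    by_cases h : a ∈ (p b).support
    · have h2 : b ∉ (p a).support := by
        have := hac.ne_mem_support_of_support_of_adj_of_isPath (hp b).reverse (hp a).reverse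
          hab.symm (by rwa [SimpleGraph.Walk.support_reverse, List.mem_reverse])
        rwa [SimpleGraph.Walk.support_reverse, List.mem_reverse] at this
      change walkProd c (p a) = c a b * walkProd c (p b)
      rw [key hab.symm h2, hc a b hab, mul_inv_cancel_left]
    · exact key hab h

end TreePotential

/-! ### The quotient graph and generators of `N` -/

section BassSerre

variable {K : Type u} [Field K] [Valued K ℤᵐ⁰] [(Valued.v : Valuation K ℤᵐ⁰).IsNontrivial]
  {N : Type u} [Group N] {φ : N →* PGL(2, K)}

variable (φ) in
/-- The tree `𝒯_N` as a graph. -/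
def treeGraph : SimpleGraph (TreeVertex φ) := (bruhatTits K).induce (treeOf (limitSet φ))

theorem treeGraph_adj {x y : TreeVertex φ} :
    (treeGraph φ).Adj x y ↔ (bruhatTits K).Adj x.1 y.1 := Iff.rfl

theorem preconnected_treeGraph : (treeGraph φ).Preconnected := isSubtree_treeOf _

theorem isAcyclic_treeGraph : (treeGraph φ).IsAcyclic := (isAcyclic_bruhatTits K).induce _

theorem treeGraph_smul (n : N) {x y : TreeVertex φ} (h : (treeGraph φ).Adj x y) :
    (treeGraph φ).Adj (n • x) (n • y) := adj_smul (φ n) h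

theorem mk_eq_iff {x y : TreeVertex φ} : QVertex.mk x = QVertex.mk y ↔ ∃ n : N, n • x = y := by
  constructor
  · intro h
    have := Quot.eqvGen_exact h
    induction this with
    | rel x y h1 => exact h1.imp fun n hn => Subtype.ext hn
    | refl x => exact ⟨1, one_smul _ _⟩
    | symm x y _ ih =>
      obtain ⟨n, hn⟩ := ih (Quot.eqvGen_sound ‹_›)
      exact ⟨n⁻¹, by rw [← hn, inv_smul_smul]⟩
    | trans x y z _ _ ih1 ih2 =>
      obtain ⟨n, hn⟩ := ih1 (Quot.eqvGen_sound ‹_›)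
      obtain ⟨m, hm⟩ := ih2 (Quot.eqvGen_sound ‹_›)
      exact ⟨m * n, by rw [mul_smul, hn, hm]⟩
  · rintro ⟨n, rfl⟩
    exact Quot.sound ⟨n, rfl⟩

theorem mk_smul (n : N) (x : TreeVertex φ) : QVertex.mk (n • x) = QVertex.mk x :=
  (mk_eq_iff.2 ⟨n, rfl⟩).symm

theorem qEdge_mk_eq_iff {e e' : TreeEdge φ} : QEdge.mk e = QEdge.mk e' ↔
    ∃ n : N, (n • e.org = e'.org ∧ n • e.tgt = e'.tgt) ∨
      (n • e.org = e'.tgt ∧ n • e.tgt = e'.org) := by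
  constructor
  · intro h
    have := Quot.eqvGen_exact h
    induction this with
    | rel x y h1 =>
      exact h1.imp fun n hn => hn.imp (fun h => ⟨Subtype.ext h.1, Subtype.ext h.2⟩)
        fun h => ⟨Subtype.ext h.1, Subtype.ext h.2⟩
    | refl x => exact ⟨1, Or.inl ⟨one_smul _ _, one_smul _ _⟩⟩
    | symm x y _ ih =>
      obtain ⟨n, hn⟩ := ih (Quot.eqvGen_sound ‹_›)
      refine ⟨n⁻¹, ?_⟩
      rcases hn with ⟨h1, h2⟩ | ⟨h1, h2⟩
      · exact Or.inl ⟨by rw [← h1, inv_smul_smul], by rw [← h2, inv_smul_smul]⟩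
      · exact Or.inr ⟨by rw [← h2, inv_smul_smul], by rw [← h1, inv_smul_smul]⟩
    | trans x y z _ _ ih1 ih2 =>
      obtain ⟨n, hn⟩ := ih1 (Quot.eqvGen_sound ‹_›)
      obtain ⟨m, hm⟩ := ih2 (Quot.eqvGen_sound ‹_›)
      refine ⟨m * n, ?_⟩
      simp only [mul_smul]
      rcases hn with ⟨h1, h2⟩ | ⟨h1, h2⟩ <;> rcases hm with ⟨h3, h4⟩ | ⟨h3, h4⟩ <;>
        simp only [h1, h2, h3, h4, and_self, true_or, or_true]
  · rintro ⟨n, h⟩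
    refine Quot.sound ⟨n, h.imp (fun h => ?_) fun h => ?_⟩ <;>
      exact ⟨congrArg Subtype.val h.1, congrArg Subtype.val h.2⟩

namespace GraphOfGroups

variable (𝒢 : GraphOfGroups φ)

theorem mem_vertexGroup {v : QVertex φ} {n : N} : n ∈ 𝒢.vertexGroup v ↔ n • 𝒢.ι v = 𝒢.ι v :=
  ⟨fun h => Subtype.ext h, fun h => congrArg Subtype.val h⟩

theorem mem_edgeGroup {e : QEdge φ} {n : N} : n ∈ 𝒢.edgeGroup e ↔
    n • (𝒢.lift e).org = (𝒢.lift e).org ∧ n • (𝒢.lift e).tgt = (𝒢.lift e).tgt :=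
  ⟨fun h => ⟨Subtype.ext h.1, Subtype.ext h.2⟩,
    fun h => ⟨congrArg Subtype.val h.1, congrArg Subtype.val h.2⟩⟩

theorem γ_smul_org (e : QEdge φ) : 𝒢.γ e • (𝒢.lift e).org = 𝒢.ι (𝒢.o e) :=
  Subtype.ext (𝒢.org_lift e).symm

theorem ι_t (e : QEdge φ) : 𝒢.ι (𝒢.t e) = (𝒢.lift e).tgt := 𝒢.tgt_lift e

theorem org_eq (e : QEdge φ) : (𝒢.lift e).org = (𝒢.γ e)⁻¹ • 𝒢.ι (𝒢.o e) := by
  rw [← γ_smul_org, inv_smul_smul]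

/-- An element of `N` that moves `ι(v)` to a given vertex over `v`. -/
theorem exists_transport : ∃ r : TreeVertex φ → N,
    (∀ x, r x • 𝒢.ι (QVertex.mk x) = x) ∧ ∀ v, r (𝒢.ι v) = 1 := by
  classical
  have h : ∀ x : TreeVertex φ, ∃ n : N, n • 𝒢.ι (QVertex.mk x) = x := fun x =>
    mk_eq_iff.1 (𝒢.mk_ι _)
  choose r hr using h
  refine ⟨fun x => if 𝒢.ι (QVertex.mk x) = x then 1 else r x, fun x => ?_, fun v => ?_⟩
  · by_cases hx : 𝒢.ι (QVertex.mk x) = x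
    · simp only [hx, if_true, one_smul]
    · simp only [hx, if_false, hr]
  · simp only [𝒢.mk_ι, if_true]

/-- Every oriented edge of the tree is a translate of a unique lift, up to orientation. -/
theorem exists_translate {x y : TreeVertex φ} (h : (treeGraph φ).Adj x y) :
    ∃ (e : QEdge φ) (n : N), (n • (𝒢.lift e).org = x ∧ n • (𝒢.lift e).tgt = y) ∨
      (n • (𝒢.lift e).org = y ∧ n • (𝒢.lift e).tgt = x) := by
  refine ⟨QEdge.mk ⟨x, y, h⟩, ?_⟩
  exact qEdge_mk_eq_iff.1 (𝒢.mk_lift (QEdge.mk ⟨x, y, h⟩))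

/-- Two lifts with a common translate represent the same edge of the quotient. If the orientations
disagreed, an element of `N` would invert this edge, against `not_inversion`. This makes a function
defined on translates of the lifts well defined on oriented edges. -/
theorem translate_unique (hfix : FixedPointsRational φ) {x y : TreeVertex φ} {e e' : QEdge φ}
    {n n' : N} (h1 : n • (𝒢.lift e).org = x) (h2 : n • (𝒢.lift e).tgt = y)
    (h : (n' • (𝒢.lift e').org = x ∧ n' • (𝒢.lift e').tgt = y) ∨
      (n' • (𝒢.lift e').org = y ∧ n' • (𝒢.lift e').tgt = x)) :
    e = e' ∧ n' • (𝒢.lift e').org = x ∧ n' • (𝒢.lift e').tgt = y := by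
  have he : e = e' := by
    rw [← 𝒢.mk_lift e, ← 𝒢.mk_lift e', qEdge_mk_eq_iff]
    refine ⟨n'⁻¹ * n, ?_⟩
    rw [mul_smul, mul_smul, h1, h2]
    rcases h with ⟨rfl, rfl⟩ | ⟨rfl, rfl⟩
    · exact Or.inl ⟨inv_smul_smul _ _, inv_smul_smul _ _⟩
    · exact Or.inr ⟨inv_smul_smul _ _, inv_smul_smul _ _⟩
  refine ⟨he, h.resolve_right ?_⟩
  subst he
  rintro ⟨h3, h4⟩
  obtain ⟨g, hg⟩ := Matrix.ProjGenLinGroup.mk_surjective (φ (n'⁻¹ * n))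
  refine not_inversion (hfix g ⟨_, hg.symm⟩) (𝒢.lift e).adj ?_ ?_
  · rw [hg]
    have : (n'⁻¹ * n) • (𝒢.lift e).org = (𝒢.lift e).tgt := by rw [mul_smul, h1, ← h4, inv_smul_smul]
    exact congrArg Subtype.val this
  · rw [hg]
    have : (n'⁻¹ * n) • (𝒢.lift e).tgt = (𝒢.lift e).org := by rw [mul_smul, h2, ← h3, inv_smul_smul]
    exact congrArg Subtype.val this

/-- Walk in the tree from a chosen representative to its translate by `n`. At each vertex of the
walk an element of the subgroup carries the representative there; crossing an edge changes it by an
element of a vertex group and some `γ_e`. At the end it differs from `n` by an element of a vertex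
group. -/
theorem mem_closure_generators [Nonempty (TreeVertex φ)] (n : N) :
    n ∈ Subgroup.closure ((⋃ v, (𝒢.vertexGroup v : Set N)) ∪ Set.range 𝒢.γ) := by
  set H := Subgroup.closure ((⋃ v, (𝒢.vertexGroup v : Set N)) ∪ Set.range 𝒢.γ) with hH
  have hv : ∀ v, ∀ m ∈ 𝒢.vertexGroup v, m ∈ H := fun v m hm =>
    Subgroup.subset_closure (Or.inl (Set.mem_iUnion.2 ⟨v, hm⟩))
  have hγ : ∀ e, 𝒢.γ e ∈ H := fun e => Subgroup.subset_closure (Or.inr ⟨e, rfl⟩)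
  have key : ∀ (a b : TreeVertex φ) (_ : (treeGraph φ).Walk a b),
      (∃ h ∈ H, h • 𝒢.ι (QVertex.mk a) = a) → ∃ h ∈ H, h • 𝒢.ι (QVertex.mk b) = b := by
    intro a b p
    induction p with
    | nil => exact id
    | @cons a c b hac p ih =>
      refine fun ⟨h, hh, ha⟩ => ih ?_
      obtain ⟨e, n, ⟨h1, h2⟩ | ⟨h1, h2⟩⟩ := 𝒢.exists_translate (treeGraph_smul h⁻¹ hac)
      · have ho : h⁻¹ • a = 𝒢.ι (QVertex.mk a) := by rw [inv_smul_eq_iff, ha]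
        have hmk : 𝒢.o e = QVertex.mk a := by
          have := congrArg QVertex.mk h1
          rwa [mk_smul, mk_smul] at this
        rw [ho, org_eq, ← mul_smul, hmk, ← mem_vertexGroup] at h1
        have hn : n ∈ H := by simpa using mul_mem (hv _ _ h1) (hγ e)
        refine ⟨h * n, mul_mem hh hn, ?_⟩
        have hmk2 : 𝒢.t e = QVertex.mk c := by
          have := congrArg QVertex.mk h2
          rwa [mk_smul, mk_smul] at this
        rw [← hmk2, ι_t, mul_smul, h2, smul_inv_smul]
      · have ho : h⁻¹ • a = 𝒢.ι (QVertex.mk a) := by rw [inv_smul_eq_iff, ha]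
        have hmk : 𝒢.t e = QVertex.mk a := by
          have := congrArg QVertex.mk h2
          rwa [mk_smul, mk_smul] at this
        rw [ho, ← ι_t, hmk, ← mem_vertexGroup] at h2
        have hmk2 : 𝒢.o e = QVertex.mk c := by
          have := congrArg QVertex.mk h1
          rwa [mk_smul, mk_smul] at this
        refine ⟨h * (n * (𝒢.γ e)⁻¹), mul_mem hh (mul_mem (hv _ _ h2) (inv_mem (hγ e))), ?_⟩
        rw [← hmk2, mul_smul, mul_smul, ← org_eq, h1, smul_inv_smul]
  obtain ⟨x⟩ := ‹Nonempty (TreeVertex φ)›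
  obtain ⟨p⟩ := preconnected_treeGraph (𝒢.ι (QVertex.mk x)) (n • 𝒢.ι (QVertex.mk x))
  obtain ⟨h, hh, hx⟩ := key _ _ p ⟨1, one_mem _, by rw [𝒢.mk_ι, one_smul]⟩
  rw [mk_smul, 𝒢.mk_ι] at hx
  have h1 : h⁻¹ * n ∈ 𝒢.vertexGroup (QVertex.mk x) := by
    rw [mem_vertexGroup, mul_smul, ← hx, inv_smul_smul]
  simpa using mul_mem hh (hv _ _ h1)

/-- A homomorphism on `N` is determined by its values on the vertex groups and the `γ_e`. -/
theorem hom_ext [Nonempty (TreeVertex φ)] {Γ : Type*} [Group Γ] {ψ ψ' : N →* Γ}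
    (hv : ∀ v, ∀ n ∈ 𝒢.vertexGroup v, ψ n = ψ' n) (hγ : ∀ e, ψ (𝒢.γ e) = ψ' (𝒢.γ e)) : ψ = ψ' := by
  refine MonoidHom.eq_of_eqOn_dense (s := (⋃ v, (𝒢.vertexGroup v : Set N)) ∪ Set.range 𝒢.γ)
    (top_unique fun n _ => 𝒢.mem_closure_generators n) ?_
  rintro n (hn | ⟨e, rfl⟩)
  · obtain ⟨v, hn⟩ := Set.mem_iUnion.1 hn
    exact hv v n hn
  · exact hγ e

theorem γ_eq_one {e : QEdge φ} (he : 𝒢.InSpanningTree e) : 𝒢.γ e = 1 := by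
  obtain ⟨v, w, h, rfl⟩ := he
  exact (𝒢.of_mem_spanningTree v w h).2

theorem lift_of_mem {e : QEdge φ} (he : 𝒢.InSpanningTree e) :
    (𝒢.lift e).org = 𝒢.ι (𝒢.o e) := by
  obtain ⟨v, w, h, rfl⟩ := he
  exact (𝒢.of_mem_spanningTree v w h).1.symm

end GraphOfGroups

end BassSerre

/-! ### Extension of glued homomorphisms to `N` -/

section BassSerreExtension

variable {K : Type u} [Field K] [Valued K ℤᵐ⁰] [(Valued.v : Valuation K ℤᵐ⁰).IsNontrivial]
  {N : Type u} [Group N] {φ : N →* PGL(2, K)}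

/-- A homomorphism on a subgroup, extended by `1`. -/
def extendOne {Γ : Type*} [Group Γ] (H : Subgroup N) (f : H →* Γ) (n : N) : Γ :=
  open Classical in if h : n ∈ H then f ⟨n, h⟩ else 1

theorem extendOne_of_mem {Γ : Type*} [Group Γ] {H : Subgroup N} (f : H →* Γ) {n : N} (h : n ∈ H) :
    extendOne H f n = f ⟨n, h⟩ := dif_pos h

theorem extendOne_mul {Γ : Type*} [Group Γ] {H : Subgroup N} (f : H →* Γ) {m n : N} (hm : m ∈ H)
    (hn : n ∈ H) : extendOne H f (m * n) = extendOne H f m * extendOne H f n := by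
  rw [extendOne_of_mem f hm, extendOne_of_mem f hn, extendOne_of_mem f (mul_mem hm hn), ← map_mul]
  rfl

theorem extendOne_one {Γ : Type*} [Group Γ] {H : Subgroup N} (f : H →* Γ) :
    extendOne H f 1 = 1 := by
  rw [extendOne_of_mem f (one_mem H)]
  exact map_one f

theorem extendOne_inv {Γ : Type*} [Group Γ] {H : Subgroup N} (f : H →* Γ) {n : N}
    (hn : n ∈ H) : extendOne H f n⁻¹ = (extendOne H f n)⁻¹ := by
  rw [extendOne_of_mem f hn, extendOne_of_mem f (inv_mem hn), ← map_inv]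
  rfl

namespace GraphOfGroups

variable (𝒢 : GraphOfGroups φ)

/-- The universal property of the fundamental group of the graph of groups. -/
theorem exists_extension [Nonempty (TreeVertex φ)] (hfix : FixedPointsRational φ)
    {Γ : Type*} [Group Γ] (ψ : ∀ v, 𝒢.vertexGroup v →* Γ) (τ : QEdge φ → Γ)
    (hτ : ∀ e, 𝒢.InSpanningTree e → τ e = 1)
    (hψ : ∀ e (n : 𝒢.edgeGroup e),
      ψ (𝒢.o e) (𝒢.edgeToOrg e n) = τ e * ψ (𝒢.t e) (𝒢.edgeToTgt e n) * (τ e)⁻¹) :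
    ∃ Ψ : N →* Γ, (∀ v (n : 𝒢.vertexGroup v), Ψ n = ψ v n) ∧ ∀ e, Ψ (𝒢.γ e) = τ e := by
  classical
  -- If the extension `Ψ` exists, then `F x = Ψ(r x)⁻¹` satisfies `Ψ m = F(m x)⁻¹ θ_m(x) F(x)`,
  -- where `θ_m(x)` is the value of `ψ` at the element `r(m x)⁻¹ m r(x)` of a vertex group. The
  -- proof reconstructs `F` from its differences along edges and defines `Ψ` by this formula.
  obtain ⟨r, hr, hrι⟩ := 𝒢.exists_transport
  let E : QVertex φ → N → Γ := fun v n => extendOne (𝒢.vertexGroup v) (ψ v) n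
  -- the basic membership facts
  have hrr : ∀ (m : N) (x : TreeVertex φ), (r (m • x))⁻¹ * m * r x ∈ 𝒢.vertexGroup (QVertex.mk x) := by
    intro m x
    have := hr (m • x)
    rw [mk_smul] at this
    rw [mem_vertexGroup, mul_smul, mul_smul, hr x, inv_smul_eq_iff, this]
  have hmo : ∀ (e : QEdge φ) (n : N), QVertex.mk (n • (𝒢.lift e).org) = 𝒢.o e := fun e n => mk_smul _ _
  have hmt : ∀ (e : QEdge φ) (n : N), QVertex.mk (n • (𝒢.lift e).tgt) = 𝒢.t e := fun e n => mk_smul _ _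
  have hro : ∀ (e : QEdge φ) (n : N),
      (r (n • (𝒢.lift e).org))⁻¹ * n * (𝒢.γ e)⁻¹ ∈ 𝒢.vertexGroup (𝒢.o e) := by
    intro e n
    have := hr (n • (𝒢.lift e).org)
    rw [hmo] at this
    rw [mem_vertexGroup, mul_smul, mul_smul, ← org_eq, inv_smul_eq_iff, this]
  have hrt : ∀ (e : QEdge φ) (n : N),
      (r (n • (𝒢.lift e).tgt))⁻¹ * n ∈ 𝒢.vertexGroup (𝒢.t e) := by
    intro e n
    have := hr (n • (𝒢.lift e).tgt)
    rw [hmt] at this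
    rw [← 𝒢.ι_t e] at this ⊢
    rw [mem_vertexGroup, mul_smul, inv_smul_eq_iff, this]
  have hE : ∀ e, ∀ n ∈ 𝒢.edgeGroup e,
      n ∈ 𝒢.vertexGroup (𝒢.t e) ∧ 𝒢.γ e * n * (𝒢.γ e)⁻¹ ∈ 𝒢.vertexGroup (𝒢.o e) ∧
      E (𝒢.o e) (𝒢.γ e * n * (𝒢.γ e)⁻¹) = τ e * E (𝒢.t e) n * (τ e)⁻¹ := by
    intro e n hn
    have h1 : n ∈ 𝒢.vertexGroup (𝒢.t e) := (𝒢.edgeToTgt e ⟨n, hn⟩).2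
    have h2 : 𝒢.γ e * n * (𝒢.γ e)⁻¹ ∈ 𝒢.vertexGroup (𝒢.o e) := (𝒢.edgeToOrg e ⟨n, hn⟩).2
    refine ⟨h1, h2, ?_⟩
    have := hψ e ⟨n, hn⟩
    change extendOne _ _ _ = τ e * extendOne _ _ _ * (τ e)⁻¹
    rw [extendOne_of_mem _ h1, extendOne_of_mem _ h2]
    exact this
  -- This is the value forced on `Ψ(r(x)⁻¹ r(y))` for the edge from `x` to `y` that is the
  -- `n`-translate of the lift of `e`: write `r(x)⁻¹ r(y) = (r(x)⁻¹ n γ_e⁻¹) γ_e (r(y)⁻¹ n)⁻¹`.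
  let c0 : QEdge φ → N → Γ := fun e n =>
    E (𝒢.o e) ((r (n • (𝒢.lift e).org))⁻¹ * n * (𝒢.γ e)⁻¹) * τ e *
      (E (𝒢.t e) ((r (n • (𝒢.lift e).tgt))⁻¹ * n))⁻¹
  -- Two choices of `n` differ by an element of the edge group, and the gluing hypothesis makes its
  -- two contributions cancel.
  have hc0 : ∀ e n n', n • (𝒢.lift e).org = n' • (𝒢.lift e).org →
      n • (𝒢.lift e).tgt = n' • (𝒢.lift e).tgt → c0 e n' = c0 e n := by
    intro e n n' h1 h2
    have hh : n⁻¹ * n' ∈ 𝒢.edgeGroup e := by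
      rw [mem_edgeGroup, mul_smul, mul_smul, ← h1, ← h2]
      exact ⟨inv_smul_smul _ _, inv_smul_smul _ _⟩
    obtain ⟨k1, k2, k3⟩ := hE e _ hh
    obtain ⟨h, rfl⟩ : ∃ h, n' = n * h := ⟨n⁻¹ * n', by group⟩
    rw [inv_mul_cancel_left] at k1 k2 k3
    change E _ ((r ((n * h) • (𝒢.lift e).org))⁻¹ * (n * h) * (𝒢.γ e)⁻¹) * τ e *
      (E _ ((r ((n * h) • (𝒢.lift e).tgt))⁻¹ * (n * h)))⁻¹ = _
    rw [← h1, ← h2]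
    have e1 : (r (n • (𝒢.lift e).org))⁻¹ * (n * h) * (𝒢.γ e)⁻¹ =
        ((r (n • (𝒢.lift e).org))⁻¹ * n * (𝒢.γ e)⁻¹) * (𝒢.γ e * h * (𝒢.γ e)⁻¹) := by group
    have e2 : (r (n • (𝒢.lift e).tgt))⁻¹ * (n * h) = ((r (n • (𝒢.lift e).tgt))⁻¹ * n) * h := by group
    have e3 := extendOne_mul (ψ (𝒢.o e)) (hro e n) k2
    have e4 := extendOne_mul (ψ (𝒢.t e)) (hrt e n) k1
    rw [← e1] at e3
    rw [← e2] at e4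
    change E _ _ = E _ _ * E _ _ at e3
    change E _ _ = E _ _ * E _ _ at e4
    rw [e3, e4, k3]
    change _ = E _ _ * τ e * (E _ _)⁻¹
    group
  -- An edge is oriented as a translate of its lift; the opposite orientation receives the inverse.
  -- The value 1 occurs only for nonadjacent vertices.
  let c : TreeVertex φ → TreeVertex φ → Γ := fun x y =>
    if h : ∃ (e : QEdge φ) (n : N), n • (𝒢.lift e).org = x ∧ n • (𝒢.lift e).tgt = y then
      c0 h.choose h.choose_spec.choose
    else if h : ∃ (e : QEdge φ) (n : N), n • (𝒢.lift e).org = y ∧ n • (𝒢.lift e).tgt = x then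
      (c0 h.choose h.choose_spec.choose)⁻¹ else 1
  have hc1 : ∀ e n, c (n • (𝒢.lift e).org) (n • (𝒢.lift e).tgt) = c0 e n := by
    intro e n
    have h : ∃ (e' : QEdge φ) (n' : N), n' • (𝒢.lift e').org = n • (𝒢.lift e).org ∧
        n' • (𝒢.lift e').tgt = n • (𝒢.lift e).tgt := ⟨e, n, rfl, rfl⟩
    change dite _ _ _ = _
    rw [dif_pos h]
    obtain ⟨h1, h2⟩ := h.choose_spec.choose_spec
    generalize h.choose_spec.choose = n' at *
    generalize h.choose = e' at *
    obtain ⟨rfl, -⟩ := 𝒢.translate_unique hfix h1 h2 (Or.inl ⟨rfl, rfl⟩)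
    exact (hc0 _ _ _ h1 h2).symm
  have hc2 : ∀ e n, c (n • (𝒢.lift e).tgt) (n • (𝒢.lift e).org) = (c0 e n)⁻¹ := by
    intro e n
    have h : ∃ (e' : QEdge φ) (n' : N), n' • (𝒢.lift e').org = n • (𝒢.lift e).org ∧
        n' • (𝒢.lift e').tgt = n • (𝒢.lift e).tgt := ⟨e, n, rfl, rfl⟩
    have h' : ¬ ∃ (e' : QEdge φ) (n' : N), n' • (𝒢.lift e').org = n • (𝒢.lift e).tgt ∧
        n' • (𝒢.lift e').tgt = n • (𝒢.lift e).org := by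
      rintro ⟨e', n', h1, h2⟩
      obtain ⟨-, h3, h4⟩ := 𝒢.translate_unique hfix (x := n • (𝒢.lift e).org)
        (y := n • (𝒢.lift e).tgt) rfl rfl (Or.inr ⟨h1, h2⟩)
      exact (adj_smul (φ n) (𝒢.lift e).adj).ne (congrArg Subtype.val (h3.symm.trans h1))
    change dite _ _ _ = _
    rw [dif_neg h', dif_pos h]
    obtain ⟨h1, h2⟩ := h.choose_spec.choose_spec
    generalize h.choose_spec.choose = n' at *
    generalize h.choose = e' at *
    obtain ⟨rfl, -⟩ := 𝒢.translate_unique hfix h1 h2 (Or.inl ⟨rfl, rfl⟩)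
    rw [hc0 _ _ _ h1 h2]
  have hanti : ∀ x y, (treeGraph φ).Adj x y → c y x = (c x y)⁻¹ := by
    intro x y h
    obtain ⟨e, n, ⟨rfl, rfl⟩ | ⟨rfl, rfl⟩⟩ := 𝒢.exists_translate h
    · rw [hc1, hc2]
    · rw [hc1, hc2, inv_inv]
  let θ : N → TreeVertex φ → Γ := fun m x => E (QVertex.mk x) ((r (m • x))⁻¹ * m * r x)
  have hθ : ∀ m n x, θ (m * n) x = θ m (n • x) * θ n x := by
    intro m n x
    have h1 := hrr m (n • x)
    rw [mk_smul] at h1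
    change E _ _ = E (QVertex.mk (n • x)) _ * E _ _
    rw [mk_smul]
    refine Eq.trans ?_ (extendOne_mul (ψ (QVertex.mk x)) h1 (hrr n x))
    rw [← mul_smul]
    change extendOne _ _ _ = _
    congr 1
    group
  have hequiv0 : ∀ m e n, c0 e (m * n) =
      θ m (n • (𝒢.lift e).org) * c0 e n * (θ m (n • (𝒢.lift e).tgt))⁻¹ := by
    intro m e n
    have h1 := hrr m (n • (𝒢.lift e).org)
    have h2 := hrr m (n • (𝒢.lift e).tgt)
    rw [hmo] at h1
    rw [hmt] at h2
    have e1 := extendOne_mul (ψ (𝒢.o e)) h1 (hro e n)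
    have e2 := extendOne_mul (ψ (𝒢.t e)) h2 (hrt e n)
    change E _ _ * τ e * (E _ _)⁻¹ = E (QVertex.mk _) _ * (E _ _ * τ e * (E _ _)⁻¹) *
      (E (QVertex.mk _) _)⁻¹
    rw [hmo, hmt]
    rw [mul_smul, mul_smul]
    have e3 : (r (m • n • (𝒢.lift e).org))⁻¹ * (m * n) * (𝒢.γ e)⁻¹ =
        (r (m • n • (𝒢.lift e).org))⁻¹ * m * r (n • (𝒢.lift e).org) *
          ((r (n • (𝒢.lift e).org))⁻¹ * n * (𝒢.γ e)⁻¹) := by group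
    have e4 : (r (m • n • (𝒢.lift e).tgt))⁻¹ * (m * n) =
        (r (m • n • (𝒢.lift e).tgt))⁻¹ * m * r (n • (𝒢.lift e).tgt) *
          ((r (n • (𝒢.lift e).tgt))⁻¹ * n) := by group
    rw [e3, e4]
    change E _ _ = E _ _ * E _ _ at e1
    change E _ _ = E _ _ * E _ _ at e2
    rw [e1, e2]
    group
  have hequiv : ∀ m x y, (treeGraph φ).Adj x y →
      c (m • x) (m • y) = θ m x * c x y * (θ m y)⁻¹ := by
    intro m x y h
    obtain ⟨e, n, ⟨rfl, rfl⟩ | ⟨rfl, rfl⟩⟩ := 𝒢.exists_translate h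
    · rw [hc1, ← mul_smul, ← mul_smul, hc1, hequiv0]
    · rw [hc2, ← mul_smul, ← mul_smul, hc2, hequiv0]
      group
  obtain ⟨x⟩ := ‹Nonempty (TreeVertex φ)›
  set x0 := 𝒢.ι (QVertex.mk x) with hx0
  obtain ⟨F, hF0, hF⟩ := exists_potential preconnected_treeGraph isAcyclic_treeGraph c hanti x0
  -- `F` is trivial on the lift of the spanning tree
  have hcT : ∀ v w, (treeGraph φ).Adj (𝒢.ι v) (𝒢.ι w) → c (𝒢.ι v) (𝒢.ι w) = 1 := by
    intro v w h
    have hin : 𝒢.InSpanningTree (QEdge.mk ⟨𝒢.ι v, 𝒢.ι w, h⟩) := ⟨v, w, h, rfl⟩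
    set e := QEdge.mk ⟨𝒢.ι v, 𝒢.ι w, h⟩ with he
    have h1 := 𝒢.lift_of_mem hin
    have h2 := 𝒢.ι_t e
    have h3 : c0 e 1 = 1 := by
      change E _ _ * τ e * (E _ _)⁻¹ = 1
      rw [one_smul, one_smul, h1, ← h2, hrι, hrι, hτ e hin, 𝒢.γ_eq_one hin]
      simp only [inv_one, mul_one]
      rw [show E (𝒢.o e) 1 = 1 from extendOne_one _, show E (𝒢.t e) 1 = 1 from extendOne_one _]
      simp
    obtain ⟨m, hm⟩ := qEdge_mk_eq_iff.1 (𝒢.mk_lift e)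
    have h4 := hc1 e 1
    have h5 := hc2 e 1
    rw [h3, one_smul, one_smul, h1, ← h2] at h4 h5
    rw [h1, ← h2] at hm
    rcases hm with ⟨k1, k2⟩ | ⟨k1, k2⟩
    · have l1 := congrArg QVertex.mk k1
      have l2 := congrArg QVertex.mk k2
      rw [mk_smul, 𝒢.mk_ι, 𝒢.mk_ι] at l1 l2
      rwa [l1, l2] at h4
    · have l1 := congrArg QVertex.mk k1
      have l2 := congrArg QVertex.mk k2
      rw [mk_smul, 𝒢.mk_ι, 𝒢.mk_ι] at l1 l2
      rwa [l1, l2, inv_one] at h5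
  have hFι : ∀ v, F (𝒢.ι v) = 1 := by
    intro v
    obtain ⟨p⟩ := 𝒢.connected ⟨(𝒢.ι v).1, v, rfl⟩ ⟨x0.1, _, rfl⟩
    have key : ∀ (a b : Set.range fun v => (𝒢.ι v).1)
        (_ : ((bruhatTits K).induce (Set.range fun v => (𝒢.ι v).1)).Walk a b) (v w : QVertex φ),
        (𝒢.ι v).1 = a.1 → (𝒢.ι w).1 = b.1 → F (𝒢.ι v) = F (𝒢.ι w) := by
      intro a b p
      induction p with
      | nil => exact fun v w h1 h2 => congrArg F (Subtype.ext (h1.trans h2.symm))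
      | @cons a d b h p ih =>
        intro v w h1 h2
        obtain ⟨_, z, rfl⟩ := d
        rw [← ih z w rfl h2]
        have hadj : (treeGraph φ).Adj (𝒢.ι v) (𝒢.ι z) := by
          rw [treeGraph_adj, h1]; exact h
        rw [hF _ _ hadj, hcT _ _ hadj, one_mul]
    rw [key _ _ p v (QVertex.mk x) rfl rfl, ← hx0, hF0]
  -- the homomorphism
  have hindep : ∀ m x y, (F (m • x))⁻¹ * θ m x * F x = (F (m • y))⁻¹ * θ m y * F y := by
    intro m x y
    obtain ⟨p⟩ := preconnected_treeGraph x y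
    induction p with
    | nil => rfl
    | cons h p ih =>
      rw [← ih, hF _ _ h, hF _ _ (treeGraph_smul m h), hequiv _ _ _ h]
      group
  let Ψ : N →* Γ := MonoidHom.mk' (fun m => (F (m • x0))⁻¹ * θ m x0 * F x0) (by
    intro m n
    rw [hindep m x0 (n • x0), hθ, mul_smul]
    group)
  have hΨ : ∀ m y, Ψ m = (F (m • y))⁻¹ * θ m y * F y := fun m y => hindep m x0 y
  refine ⟨Ψ, fun v n => ?_, fun e => ?_⟩
  · have hn := (𝒢.mem_vertexGroup).1 n.2
    rw [hΨ n (𝒢.ι v), hn, hFι, inv_one, one_mul, mul_one]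
    change E _ _ = _
    rw [hn, hrι, 𝒢.mk_ι, inv_one, one_mul, mul_one]
    exact extendOne_of_mem _ n.2
  · rw [hΨ _ (𝒢.lift e).org, γ_smul_org, hFι, inv_one, one_mul]
    have h1 := hF _ _ (show (treeGraph φ).Adj (𝒢.lift e).org (𝒢.lift e).tgt from (𝒢.lift e).adj)
    have h2 := hc1 e 1
    rw [one_smul, one_smul] at h2
    rw [h1, h2, ← 𝒢.ι_t, hFι, mul_one]
    change E _ _ * (E _ _ * τ e * (E _ _)⁻¹) = τ e
    have h3 := hro e 1
    rw [one_smul, mul_one] at h3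
    rw [γ_smul_org, hrι, one_smul, one_smul, ← 𝒢.ι_t, hrι, mul_one, inv_one, one_mul, mul_one]
    change E (𝒢.o e) _ * _ = _
    rw [show E (𝒢.t e) 1 = 1 from extendOne_one _, inv_one, mul_one, ← mul_assoc]
    have h4 : 𝒢.γ e * r (𝒢.lift e).org = ((r (𝒢.lift e).org)⁻¹ * (𝒢.γ e)⁻¹)⁻¹ := by group
    rw [h4, show E (𝒢.o e) ((r (𝒢.lift e).org)⁻¹ * (𝒢.γ e)⁻¹)⁻¹ = _ from extendOne_inv _ h3]
    change (E _ _)⁻¹ * E _ _ * τ e = τ e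
    rw [inv_mul_cancel, one_mul]

end GraphOfGroups

end BassSerreExtension

/-! ### The standard vertex and reduction modulo the maximal ideal -/

section StandardVertex

variable {K : Type u} [Field K] [Valued K ℤᵐ⁰]

variable (K) in
theorem isBasisOf_std : IsBasisOf (K := K) ![1, 0] ![0, 1]
    (Submodule.span 𝒪[K] {![1, 0], ![0, 1]}) := by
  refine ⟨LinearIndependent.pair_iff.2 fun s t h => ?_, rfl⟩
  have h0 := congrFun h 0
  have h1 := congrFun h 1
  simp at h0 h1
  exact ⟨h0, h1⟩

variable (K) in
/-- The lattice `O_K²`. -/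
def stdLattice : Lattice K := ⟨_, (isBasisOf_std K).isLattice⟩

variable (K) in
/-- The class of `O_K²`. -/
def stdVertex : Vertex K := vtx (stdLattice K)

theorem mem_stdLattice {x : Fin 2 → K} :
    x ∈ (stdLattice K).1 ↔ ∀ i, Valued.v (x i) ≤ 1 := by
  have : x = x 0 • ![1, 0] + x 1 • ![0, 1] := by
    ext i; fin_cases i <;> simp
  rw [this]
  change _ ∈ Submodule.span 𝒪[K] {![1, 0], ![0, 1]} ↔ _
  rw [(isBasisOf_std K).mem_iff_coord, Fin.forall_fin_two, ← this]

/-- The vector of `K²` with given integral coordinates. -/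
def ofInt (X : Fin 2 → 𝒪[K]) : Fin 2 → K := fun i => (X i : K)

/-- Reduction of an integral vector. -/
def redVec (X : Fin 2 → 𝒪[K]) : Fin 2 → 𝓀[K] := fun i => IsLocalRing.residue 𝒪[K] (X i)

theorem ofInt_mem (X : Fin 2 → 𝒪[K]) : ofInt X ∈ (stdLattice K).1 :=
  mem_stdLattice.2 fun i => (X i).2

theorem exists_ofInt {x : Fin 2 → K} (h : x ∈ (stdLattice K).1) : ∃ X, ofInt X = x :=
  ⟨fun i => ⟨x i, mem_stdLattice.1 h i⟩, rfl⟩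

theorem redVec_surjective : Function.Surjective (redVec : (Fin 2 → 𝒪[K]) → _) := fun x =>
  ⟨fun i => (IsLocalRing.residue_surjective (x i)).choose, funext fun i =>
    (IsLocalRing.residue_surjective (x i)).choose_spec⟩

theorem residue_eq_zero_iff_v_lt (a : 𝒪[K]) :
    IsLocalRing.residue 𝒪[K] a = 0 ↔ Valued.v (a : K) < 1 := by
  rw [IsLocalRing.residue_eq_zero_iff, IsLocalRing.mem_maximalIdeal, mem_nonunits_iff,
    (Valuation.integer.integers (Valued.v : Valuation K ℤᵐ⁰)).isUnit_iff_valuation_eq_one]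
  exact ⟨fun h => lt_of_le_of_ne a.2 h, fun h => h.ne⟩

theorem residue_eq_zero_iff_mul {ϖ : K} (hϖ : IsUniformizer ϖ) (a : 𝒪[K]) :
    IsLocalRing.residue 𝒪[K] a = 0 ↔ ∃ b : 𝒪[K], (a : K) = ϖ * b := by
  rw [residue_eq_zero_iff_v_lt]
  constructor
  · intro h
    refine ⟨⟨ϖ⁻¹ * a, hϖ.v_div_le h⟩, ?_⟩
    change (a : K) = ϖ * (ϖ⁻¹ * a)
    rw [mul_inv_cancel_left₀ hϖ.ne_zero]
  · rintro ⟨b, hb⟩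
    rw [hb, map_mul]
    exact mul_lt_one_of_lt_of_le hϖ.lt_one b.2

theorem ofInt_mem_smul_iff {ϖ : K} (hϖ : IsUniformizer ϖ) (X : Fin 2 → 𝒪[K]) :
    ofInt X ∈ ϖ • (stdLattice K).1 ↔ redVec X = 0 := by
  rw [mem_smul_lattice hϖ.ne_zero, mem_stdLattice, funext_iff]
  refine forall_congr' fun i => ?_
  change Valued.v (ϖ⁻¹ * (X i : K)) ≤ 1 ↔ IsLocalRing.residue 𝒪[K] (X i) = 0
  rw [residue_eq_zero_iff_mul hϖ]
  constructor
  · intro h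
    refine ⟨⟨_, h⟩, ?_⟩
    change (X i : K) = ϖ * (ϖ⁻¹ * X i)
    rw [mul_inv_cancel_left₀ hϖ.ne_zero]
  · rintro ⟨b, hb⟩
    rw [hb, inv_mul_cancel_left₀ hϖ.ne_zero]
    exact b.2

theorem redVec_add (X X' : Fin 2 → 𝒪[K]) : redVec (X + X') = redVec X + redVec X' :=
  funext fun _ => map_add _ _ _

theorem redVec_smul (a : 𝒪[K]) (X : Fin 2 → 𝒪[K]) :
    redVec (a • X) = IsLocalRing.residue 𝒪[K] a • redVec X :=
  funext fun _ => map_mul _ _ _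

theorem redVec_mulVec (A : Matrix (Fin 2) (Fin 2) 𝒪[K]) (X : Fin 2 → 𝒪[K]) :
    redVec (A.mulVec X) = (A.map (IsLocalRing.residue 𝒪[K])).mulVec (redVec X) := by
  funext i
  exact RingHom.map_mulVec (IsLocalRing.residue 𝒪[K]) A X i

theorem ofInt_mulVec (A : Matrix (Fin 2) (Fin 2) 𝒪[K]) (X : Fin 2 → 𝒪[K]) :
    ofInt (A.mulVec X) = (A.map (algebraMap 𝒪[K] K)).mulVec (ofInt X) := by
  funext i
  exact RingHom.map_mulVec (algebraMap 𝒪[K] K) A X i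

theorem ofInt_injective : Function.Injective (ofInt : (Fin 2 → 𝒪[K]) → _) := fun _ _ h =>
  funext fun i => Subtype.ext (congrFun h i)

theorem ofInt_ne_zero {X : Fin 2 → 𝒪[K]} (h : redVec X ≠ 0) : ofInt X ≠ 0 := by
  intro h0
  refine h ?_
  have : X = 0 := ofInt_injective (h0.trans rfl)
  rw [this]
  exact funext fun i => map_zero _

variable [(Valued.v : Valuation K ℤᵐ⁰).IsNontrivial]

/-- The neighbour of the standard vertex in the direction `x`. -/
def nb (x : Fin 2 → 𝓀[K]) : Vertex K :=
  open Classical in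
  if h : redVec (redVec_surjective x).choose ≠ 0 then
    dir (Projectivization.mk K (ofInt (redVec_surjective x).choose) (ofInt_ne_zero h)) (stdVertex K)
  -- This value is taken only at the zero vector, which gives no direction.
  else stdVertex K

/-- The sublattice `O_K X + ϖ O_K²` determines, and is determined by, the line of the reduction of
`X`. Neighbours of the standard vertex thus become points of the projective line over the residue
field. -/
theorem dir_eq_iff {X X' : Fin 2 → 𝒪[K]} (hX : redVec X ≠ 0) (hX' : redVec X' ≠ 0) :
    dir (Projectivization.mk K (ofInt X) (ofInt_ne_zero hX)) (stdVertex K) =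
      dir (Projectivization.mk K (ofInt X') (ofInt_ne_zero hX')) (stdVertex K) ↔
    ∃ c : 𝓀[K], redVec X' = c • redVec X := by
  obtain ⟨ϖ, hϖ⟩ := exists_isUniformizer K
  have hn := mt (ofInt_mem_smul_iff hϖ X).1 hX
  have hn' := mt (ofInt_mem_smul_iff hϖ X').1 hX'
  unfold stdVertex
  rw [dir_vtx hϖ _ (ofInt_mem X) hn, dir_vtx hϖ _ (ofInt_mem X') hn']
  constructor
  · intro h
    have h1 := nbrLat_injective hϖ (ofInt_mem X) hn (ofInt_mem X') hn' h
    have h2 : ofInt X' ∈ nbr ϖ (ofInt X) (stdLattice K).1 := h1 ▸ self_mem_nbr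
    obtain ⟨a, ha, b, hb, e⟩ := Submodule.mem_sup.1 h2
    obtain ⟨c, rfl⟩ := Submodule.mem_span_singleton.1 ha
    refine ⟨IsLocalRing.residue 𝒪[K] c, ?_⟩
    obtain ⟨B, rfl⟩ := exists_ofInt (smul_lattice_le hϖ.lt_one.le hb)
    rw [ofInt_mem_smul_iff hϖ] at hb
    have : X' = c • X + B := ofInt_injective e.symm
    rw [this, redVec_add, hb, add_zero, redVec_smul]
  · rintro ⟨c, hc⟩
    obtain ⟨c, rfl⟩ := IsLocalRing.residue_surjective c
    have hc0 : IsLocalRing.residue 𝒪[K] c ≠ 0 := by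
      intro h; rw [h, zero_smul] at hc; exact hX' hc
    congr 1
    apply Subtype.ext
    rw [nbrLat_val, nbrLat_val]
    obtain ⟨y, hb⟩ := (stdLattice K).exists_isBasisOf_of_notMem hϖ (ofInt_mem X) hn
    refine ((hb.eq_of_nbr_le hϖ (M := nbr ϖ (ofInt X') (stdLattice K).1) ?_ ?_).resolve_right
      ?_).symm
    · refine sup_le ?_ smul_le_nbr
      rw [Submodule.span_singleton_le_iff_mem]
      have hcu : IsUnit c := by rwa [IsLocalRing.residue_ne_zero_iff_isUnit] at hc0
      obtain ⟨d, hd⟩ := hcu.exists_left_inv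
      have h3 : ofInt (X - d • X') ∈ ϖ • (stdLattice K).1 := by
        rw [ofInt_mem_smul_iff hϖ, sub_eq_add_neg, redVec_add, ← neg_one_smul 𝒪[K], redVec_smul,
          redVec_smul, hc, smul_smul, smul_smul, map_neg, map_one, neg_one_mul, neg_mul, ← map_mul,
          hd, map_one, neg_one_smul, add_neg_cancel]
      have h4 : ofInt X = d • ofInt X' + ofInt (X - d • X') := by
        have : X = d • X' + (X - d • X') := by abel
        conv_lhs => rw [this]
        rfl
      rw [h4]
      exact add_mem (Submodule.smul_mem _ _ self_mem_nbr) (smul_le_nbr h3)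
    · refine sup_le ?_ (smul_lattice_le hϖ.lt_one.le)
      rw [Submodule.span_singleton_le_iff_mem]
      exact ofInt_mem X'
    · obtain ⟨y', hb'⟩ := (stdLattice K).exists_isBasisOf_of_notMem hϖ (ofInt_mem X') hn'
      exact (hb'.nbr_lt hϖ).ne

theorem nb_redVec {X : Fin 2 → 𝒪[K]} (hX : redVec X ≠ 0) :
    nb (redVec X) = dir (Projectivization.mk K (ofInt X) (ofInt_ne_zero hX)) (stdVertex K) := by
  have h := (redVec_surjective (redVec X)).choose_spec
  have h' : redVec (redVec_surjective (redVec X)).choose ≠ 0 := by rwa [h]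
  unfold nb
  rw [dif_pos h', dir_eq_iff h' hX]
  exact ⟨1, by rw [h, one_smul]⟩

theorem nb_eq_iff {x x' : Fin 2 → 𝓀[K]} (hx : x ≠ 0) (hx' : x' ≠ 0) :
    nb x = nb x' ↔ ∃ c : 𝓀[K], x' = c • x := by
  obtain ⟨X, rfl⟩ := redVec_surjective x
  obtain ⟨X', rfl⟩ := redVec_surjective x'
  rw [nb_redVec hx, nb_redVec hx', dir_eq_iff hx hx']

theorem adj_nb {x : Fin 2 → 𝓀[K]} (hx : x ≠ 0) : (bruhatTits K).Adj (stdVertex K) (nb x) := by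
  obtain ⟨X, rfl⟩ := redVec_surjective x
  rw [nb_redVec hx]
  exact adj_dir _ _

theorem exists_redVec_dir (q : ℙ K (Fin 2 → K)) : ∃ (X : Fin 2 → 𝒪[K]) (hX : redVec X ≠ 0),
    q = Projectivization.mk K (ofInt X) (ofInt_ne_zero hX) ∧ dir q (stdVertex K) = nb (redVec X) := by
  obtain ⟨ϖ, hϖ⟩ := exists_isUniformizer K
  obtain ⟨x, hx, rfl, hm, hn⟩ := exists_primitive hϖ q (stdLattice K)
  obtain ⟨X, rfl⟩ := exists_ofInt hm
  rw [ofInt_mem_smul_iff hϖ] at hn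
  exact ⟨X, hn, rfl, (nb_redVec hn).symm⟩

theorem exists_nb {Λ : Vertex K} (h : (bruhatTits K).Adj (stdVertex K) Λ) :
    ∃ x : Fin 2 → 𝓀[K], x ≠ 0 ∧ nb x = Λ := by
  obtain ⟨q, rfl⟩ := exists_dir_eq h
  obtain ⟨X, hX, -, e⟩ := exists_redVec_dir q
  exact ⟨_, hX, e.symm⟩

/-- The inclusion of `GL(2, O_K)` in `GL(2, K)`. -/
def intGL : GL (Fin 2) 𝒪[K] →* GL (Fin 2) K := Matrix.GeneralLinearGroup.map (algebraMap 𝒪[K] K)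

/-- The reduction of an integral matrix. -/
def redMat (A : Matrix (Fin 2) (Fin 2) 𝒪[K]) : Matrix (Fin 2) (Fin 2) 𝓀[K] :=
  A.map (IsLocalRing.residue 𝒪[K])

theorem intGL_val (A : GL (Fin 2) 𝒪[K]) : (intGL A).1 = A.1.map (algebraMap 𝒪[K] K) := rfl

theorem redMat_mulVec_ne_zero (A : GL (Fin 2) 𝒪[K]) {x : Fin 2 → 𝓀[K]} (hx : x ≠ 0) :
    (redMat A.1).mulVec x ≠ 0 := by
  have : redMat A.1 = (Matrix.GeneralLinearGroup.map (IsLocalRing.residue 𝒪[K]) A).1 := rfl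
  rw [this]
  exact (smul_ne_zero_iff_ne (Matrix.GeneralLinearGroup.map (IsLocalRing.residue 𝒪[K]) A)).2 hx

theorem mk_smul_std (A : GL (Fin 2) 𝒪[K]) :
    Matrix.ProjGenLinGroup.mk (intGL A) • stdVertex K = stdVertex K := by
  unfold stdVertex
  rw [mk_smul_vtx]
  congr 1
  have key : ∀ A : GL (Fin 2) 𝒪[K], (intGL A • stdLattice K).1 ≤ (stdLattice K).1 := by
    intro A
    rw [smul_val]
    rintro _ ⟨x, hx, rfl⟩
    obtain ⟨X, rfl⟩ := exists_ofInt hx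
    rw [mulVecO_apply, intGL_val, ← ofInt_mulVec]
    exact ofInt_mem _
  refine Subtype.ext (le_antisymm (key A) ?_)
  intro x hx
  have h1 : (intGL A)⁻¹.1.mulVec x ∈ (stdLattice K).1 := by
    rw [← map_inv]
    exact key A⁻¹ ⟨x, hx, rfl⟩
  refine (⟨_, h1, ?_⟩ : x ∈ (stdLattice K).1.map (mulVecO (intGL A)))
  rw [mulVecO_apply, Matrix.mulVec_mulVec, ← Units.val_mul, mul_inv_cancel, Units.val_one,
    Matrix.one_mulVec]

theorem mk_smul_nb (A : GL (Fin 2) 𝒪[K]) {x : Fin 2 → 𝓀[K]} (hx : x ≠ 0) :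
    Matrix.ProjGenLinGroup.mk (intGL A) • nb x = nb ((redMat A.1).mulVec x) := by
  have h2 := redMat_mulVec_ne_zero A hx
  obtain ⟨X, rfl⟩ := redVec_surjective x
  have e : redVec (A.1.mulVec X) = (redMat A.1).mulVec (redVec X) := redVec_mulVec _ _
  rw [← e] at h2 ⊢
  rw [nb_redVec hx, nb_redVec h2, ← smul_dir, mk_smul_std]
  congr 1

/-- A suitable multiple of a representative maps `O_K²` onto itself. Then both this matrix and its
inverse have integral entries, as one sees on the standard basis vectors. -/
theorem exists_intGL {h : PGL(2, K)} (hh : h • stdVertex K = stdVertex K) :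
    ∃ A : GL (Fin 2) 𝒪[K], h = Matrix.ProjGenLinGroup.mk (intGL A) := by
  obtain ⟨g, rfl⟩ := Matrix.ProjGenLinGroup.mk_surjective h
  unfold stdVertex at hh
  rw [mk_smul_vtx, vtx_eq_iff] at hh
  obtain ⟨c, hc, e⟩ := hh
  rw [smul_val] at e
  set M : GL (Fin 2) K := g * Matrix.GeneralLinearGroup.scalar (Fin 2) (Units.mk0 c hc) with hM
  have hMv : ∀ x, M.1.mulVec x = c • g.1.mulVec x := by
    intro x
    rw [hM, Units.val_mul, ← Matrix.mulVec_mulVec, ← Matrix.mulVec_smul]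
    congr 1
    ext i
    fin_cases i <;> simp [Matrix.GeneralLinearGroup.scalar, Matrix.scalar]
  have h1 : ∀ x ∈ (stdLattice K).1, M.1.mulVec x ∈ (stdLattice K).1 := by
    intro x hx
    rw [hMv]
    have h3 : c • g.1.mulVec x ∈ c • (stdLattice K).1.map (mulVecO g) := (mem_smul_lattice hc).2 (by
      rw [smul_smul, inv_mul_cancel₀ hc, one_smul]; exact ⟨x, hx, rfl⟩)
    rwa [e] at h3
  have h2 : ∀ x ∈ (stdLattice K).1, (M⁻¹).1.mulVec x ∈ (stdLattice K).1 := by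
    intro x hx
    rw [← e] at hx
    obtain ⟨z, ⟨y, hy, rfl⟩, rfl⟩ := (Submodule.mem_smul_pointwise_iff_exists _ _ _).1 hx
    rw [mulVecO_apply, ← hMv, Matrix.mulVec_mulVec, ← Units.val_mul, inv_mul_cancel, Units.val_one,
      Matrix.one_mulVec]
    exact hy
  have hint : ∀ B : Matrix (Fin 2) (Fin 2) K,
      (∀ x ∈ (stdLattice K).1, B.mulVec x ∈ (stdLattice K).1) → ∀ i j, Valued.v (B i j) ≤ 1 := by
    intro B hB i j
    have hs : Pi.single j (1 : K) ∈ (stdLattice K).1 := mem_stdLattice.2 fun l => by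
      by_cases hl : l = j
      · subst hl; simp
      · simp [hl]
    have := mem_stdLattice.1 (hB _ hs) i
    rwa [Matrix.mulVec_single_one] at this
  have hMi := hint _ h1
  have hMi' := hint _ h2
  have hinj : Function.Injective (fun A : Matrix (Fin 2) (Fin 2) 𝒪[K] => A.map (algebraMap 𝒪[K] K)) :=
    Matrix.map_injective (Subtype.val_injective)
  let A : GL (Fin 2) 𝒪[K] :=
    ⟨Matrix.of fun i j => ⟨M.1 i j, hMi i j⟩, Matrix.of fun i j => ⟨(M⁻¹).1 i j, hMi' i j⟩, by
      apply hinj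
      simp only [Matrix.map_mul]
      have : M.1 * (M⁻¹).1 = 1 := by rw [← Units.val_mul, mul_inv_cancel, Units.val_one]
      rw [Matrix.map_one _ (map_zero _) (map_one _)]
      exact this, by
      apply hinj
      simp only [Matrix.map_mul]
      have : (M⁻¹).1 * M.1 = 1 := by rw [← Units.val_mul, inv_mul_cancel, Units.val_one]
      rw [Matrix.map_one _ (map_zero _) (map_one _)]
      exact this⟩
  refine ⟨A, Matrix.ProjGenLinGroup.mk_eq_mk_iff.2 ⟨Units.mk0 c hc, ?_⟩⟩
  exact Units.ext rfl

end StandardVertex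

/-! ### Counting fixed points of finite groups -/

section OrbitCounting

variable {G X : Type*} [Group G] [Fintype G] [MulAction G X]

open Classical in
/-- The orbit of a point, as a finite set. -/
def orbitFin (G : Type*) {X : Type*} [Group G] [Fintype G] [MulAction G X] (w : X) : Finset X :=
  Finset.univ.image fun g : G => g • w

theorem mem_orbitFin {w x : X} : x ∈ orbitFin G w ↔ ∃ g : G, g • w = x := by
  simp [orbitFin]

open Classical in
theorem card_fiber_eq (w : X) (h : G) :
    (Finset.univ.filter fun g : G => g • w = h • w).card =
      (Finset.univ.filter fun g : G => g • w = w).card := by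
  refine (Finset.card_bij (fun g _ => h * g) ?_ ?_ ?_).symm
  · intro g hg
    simp only [Finset.mem_filter, Finset.mem_univ, true_and] at hg ⊢
    rw [mul_smul, hg]
  · intro a _ b _ e
    exact mul_left_cancel e
  · intro g hg
    simp only [Finset.mem_filter, Finset.mem_univ, true_and] at hg
    exact ⟨h⁻¹ * g, by simp [mul_smul, hg], by group⟩

open Classical in
theorem card_stabilizer_smul (w : X) (h : G) :
    (Finset.univ.filter fun g : G => g • h • w = h • w).card =
      (Finset.univ.filter fun g : G => g • w = w).card := by
  rw [← card_fiber_eq w h]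
  refine Finset.card_bij (fun g _ => g * h) ?_ ?_ ?_
  · intro g hg
    simp only [Finset.mem_filter, Finset.mem_univ, true_and] at hg ⊢
    rw [mul_smul, hg]
  · intro a _ b _ e
    exact mul_right_cancel e
  · intro g hg
    simp only [Finset.mem_filter, Finset.mem_univ, true_and] at hg
    exact ⟨g * h⁻¹, by simp [mul_smul, hg], by group⟩

open Classical in
theorem card_orbitFin_mul (w : X) :
    (orbitFin G w).card * (Finset.univ.filter fun g : G => g • w = w).card = Fintype.card G := by
  have h := Finset.card_eq_sum_card_fiberwise (s := (Finset.univ : Finset G)) (t := orbitFin G w)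
    (f := fun g => g • w) (fun g _ => mem_orbitFin.2 ⟨g, rfl⟩)
  rw [Finset.card_univ] at h
  rw [h, Finset.sum_const_nat (m := (Finset.univ.filter fun g : G => g • w = w).card)]
  intro x hx
  obtain ⟨k, rfl⟩ := mem_orbitFin.1 hx
  exact card_fiber_eq w k

-- Burnside's count on one orbit: counting pairs of an element and a point fixed by it, each point
-- contributes the order of its stabilizer.
open Classical in
theorem sum_card_fixed_orbitFin (w : X) :
    ∑ g : G, ((orbitFin G w).filter fun x => g • x = x).card = Fintype.card G := by
  have h := Finset.sum_card_bipartiteAbove_eq_sum_card_bipartiteBelow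
    (s := (Finset.univ : Finset G)) (t := orbitFin G w) (r := fun g x => g • x = x)
  unfold Finset.bipartiteAbove Finset.bipartiteBelow at h
  rw [h, ← card_orbitFin_mul (G := G) w, Finset.sum_const_nat]
  intro x hx
  obtain ⟨k, rfl⟩ := mem_orbitFin.1 hx
  exact card_stabilizer_smul w k

theorem two_mul_card_orbitFin_le {w : X} {g : G} (hg : g ≠ 1) (h : g • w = w) :
    2 * (orbitFin G w).card ≤ Fintype.card G := by
  classical
  rw [← card_orbitFin_mul (G := G) w, mul_comm]
  refine Nat.mul_le_mul_left _ (Finset.one_lt_card.2 ⟨g, by simpa using h, 1, by simp, hg⟩)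

variable {ι : Type*} [Fintype ι] {w : ι → X} (hw : ∀ i j, i ≠ j → ∀ g : G, g • w i ≠ w j)
include hw

open Classical in
theorem sum_card_fixed_iUnion :
    ∑ g : G, ((Finset.univ.biUnion fun i => orbitFin G (w i)).filter fun x => g • x = x).card =
      Fintype.card ι * Fintype.card G := by
  have hdis : ∀ i j, i ≠ j → Disjoint (orbitFin G (w i)) (orbitFin G (w j)) := by
    intro i j hij
    rw [Finset.disjoint_left]
    intro x h1 h2
    obtain ⟨a, rfl⟩ := mem_orbitFin.1 h1
    obtain ⟨b, hb⟩ := mem_orbitFin.1 h2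
    exact hw i j hij (b⁻¹ * a) (by rw [mul_smul, ← hb, inv_smul_smul])
  have : ∀ g : G, ((Finset.univ.biUnion fun i => orbitFin G (w i)).filter fun x => g • x = x).card =
      ∑ i, ((orbitFin G (w i)).filter fun x => g • x = x).card := by
    intro g
    rw [Finset.filter_biUnion, Finset.card_biUnion]
    intro i _ j _ hij
    exact (hdis i j hij).mono (Finset.filter_subset _ _) (Finset.filter_subset _ _)
  simp_rw [this]
  rw [Finset.sum_comm]
  simp_rw [sum_card_fixed_orbitFin]
  rw [Finset.sum_const, Finset.card_univ, smul_eq_mul]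

/-- The number of orbits times the order of the group is the total number of fixed points. Elements
of `Z` are charged with all points, any other `g` with at most `b g`. -/
theorem card_orbits_le_sum [DecidableEq G] (Z : Finset G) (b : G → ℕ)
    (hb : ∀ g ∉ Z, ∀ F : Finset X, (∀ x ∈ F, g • x = x) →
      (∀ x ∈ F, ∃ (i : ι) (h : G), h • w i = x) → F.card ≤ b g) :
    Fintype.card ι * Fintype.card G ≤ Z.card * ∑ i, (orbitFin G (w i)).card + ∑ g ∈ Zᶜ, b g := by
  classical
  rw [← sum_card_fixed_iUnion hw, ← Finset.sum_add_sum_compl Z]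
  refine Nat.add_le_add ?_ (Finset.sum_le_sum fun g hg => ?_)
  · rw [← smul_eq_mul, ← Finset.sum_const]
    refine Finset.sum_le_sum fun g _ => ?_
    exact (Finset.card_filter_le _ _).trans Finset.card_biUnion_le
  · refine hb g (Finset.mem_compl.1 hg) _ (fun x hx => (Finset.mem_filter.1 hx).2) fun x hx => ?_
    obtain ⟨i, -, hx⟩ := Finset.mem_biUnion.1 (Finset.mem_filter.1 hx).1
    obtain ⟨k, rfl⟩ := mem_orbitFin.1 hx
    exact ⟨i, k, rfl⟩

variable {P : X → Prop} (hP : ∀ i (g : G), P (g • w i))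
include hP

/-- If every nontrivial element fixes at most two points, then at most three orbits have nontrivial
stabilizers. -/
theorem card_orbits_le_three
    (h2 : ∀ g : G, g ≠ 1 → ∀ a b c, P a → P b → P c → g • a = a → g • b = b → g • c = c →
      a = b ∨ a = c ∨ b = c)
    (hnt : ∀ i, ∃ g : G, g ≠ 1 ∧ g • w i = w i) : Fintype.card ι ≤ 3 := by
  classical
  have h := card_orbits_le_sum hw {1} (fun _ => 2) (by
    intro g hg F hF hF'
    by_contra! hlt
    obtain ⟨a, ha, b, hb, c, hc, h1, h3, h4⟩ := Finset.two_lt_card.1 hlt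
    have hPF : ∀ x ∈ F, P x := fun x hx => by
      obtain ⟨i, k, rfl⟩ := hF' x hx
      exact hP i k
    rcases h2 g (by simpa using hg) a b c (hPF a ha) (hPF b hb) (hPF c hc) (hF a ha) (hF b hb)
      (hF c hc) with e | e | e <;> contradiction)
  -- With r orbits, each of size at most |G|/2, the count gives r|G| ≤ r|G|/2 + 2(|G| − 1), so r <
  -- 4: the Riemann–Hurwitz inequality in genus zero.
  rw [Finset.sum_const, Finset.card_compl, Finset.card_singleton, one_mul, smul_eq_mul] at h
  have h3 : 2 * ∑ i, (orbitFin G (w i)).card ≤ Fintype.card ι * Fintype.card G := by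
    rw [Finset.mul_sum, ← smul_eq_mul (Fintype.card ι), ← Finset.card_univ (α := ι),
      ← Finset.sum_const]
    refine Finset.sum_le_sum fun i _ => ?_
    obtain ⟨g, hg, hgw⟩ := hnt i
    exact two_mul_card_orbitFin_le hg hgw
  have hpos : 0 < Fintype.card G := Fintype.card_pos
  by_contra! hlt
  have h4 : 4 * Fintype.card G ≤ Fintype.card ι * Fintype.card G := Nat.mul_le_mul_right _ hlt
  omega

variable {W : G → Prop} (hW1 : ¬ W 1) (hWc : ∀ g h, W g → W (h * g * h⁻¹))
  (h2 : ∀ g : G, g ≠ 1 → ∀ a b c, P a → P b → P c → g • a = a → g • b = b → g • c = c →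
      a = b ∨ a = c ∨ b = c)
  (h1 : ∀ g : G, W g → ∀ a b, P a → P b → g • a = a → g • b = b → a = b)
include hW1 hWc h2 h1

/-- If wild elements fix at most one point, then at most one orbit has wild stabilizers; if there
is such an orbit, then at most one further orbit has nontrivial stabilizers. -/
theorem card_orbits_le_of_wild (J : Finset ι) (hJ : J.Nonempty)
    (hJW : ∀ i ∈ J, ∃ g : G, W g ∧ g • w i = w i)
    (hnt : ∀ i, ∃ g : G, g ≠ 1 ∧ g • w i = w i) : Fintype.card ι + J.card < 4 := by
  classical
  have h := card_orbits_le_sum hw {1} (fun g => if W g then 1 else 2) (by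
    intro g hg F hF hF'
    have hPF : ∀ x ∈ F, P x := fun x hx => by
      obtain ⟨i, k, rfl⟩ := hF' x hx
      exact hP i k
    by_cases hg1 : W g
    · rw [if_pos hg1]
      by_contra! hlt
      obtain ⟨a, ha, b, hb, hab⟩ := Finset.one_lt_card.1 hlt
      exact hab (h1 g hg1 a b (hPF a ha) (hPF b hb) (hF a ha) (hF b hb))
    · rw [if_neg hg1]
      by_contra! hlt
      obtain ⟨a, ha, b, hb, c, hc, h1, h3, h4⟩ := Finset.two_lt_card.1 hlt
      rcases h2 g (by simpa using hg) a b c (hPF a ha) (hPF b hb) (hPF c hc) (hF a ha) (hF b hb)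
        (hF c hc) with e | e | e <;> contradiction)
  rw [Finset.card_singleton, one_mul] at h
  set Wf : Finset G := Finset.univ.filter W with hWf
  have hsum : ∑ g ∈ ({1} : Finset G)ᶜ, (if W g then 1 else 2) + Wf.card =
      2 * (Fintype.card G - 1) := by
    have hc : (({1} : Finset G)ᶜ).card = Fintype.card G - 1 := by
      rw [Finset.card_compl, Finset.card_singleton]
    have hsub : Wf = ({1} : Finset G)ᶜ.filter W := by
      ext g
      simp only [hWf, Finset.mem_filter, Finset.mem_univ, true_and, Finset.mem_compl,
        Finset.mem_singleton]
      exact ⟨fun h => ⟨fun e => hW1 (e ▸ h), h⟩, fun h => h.2⟩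
    rw [hsub, Finset.card_filter, ← Finset.sum_add_distrib, ← hc, mul_comm, ← smul_eq_mul,
      ← Finset.sum_const]
    refine Finset.sum_congr rfl fun g _ => ?_
    split_ifs <;> rfl
  -- Each point in an orbit of `J` has a wild element fixing it and no other point, so the orbits of
  -- `J` together have at most as many points as there are wild elements. In the count they are
  -- absorbed by the saving of 1 for each wild element; the remaining r − |J| orbits contribute at
  -- most |G|/2 each, so r + |J| < 4.
  have hJcard : ∑ i ∈ J, (orbitFin G (w i)).card ≤ Wf.card := by
    have hdis : ∀ i ∈ J, ∀ j ∈ J, i ≠ j → Disjoint (orbitFin G (w i)) (orbitFin G (w j)) := by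
      intro i _ j _ hij
      rw [Finset.disjoint_left]
      intro x h1 h2
      obtain ⟨a, rfl⟩ := mem_orbitFin.1 h1
      obtain ⟨b, hb⟩ := mem_orbitFin.1 h2
      exact hw i j hij (b⁻¹ * a) (by rw [mul_smul, ← hb, inv_smul_smul])
    rw [← Finset.card_biUnion hdis]
    have hex : ∀ x ∈ J.biUnion fun i => orbitFin G (w i), ∃ g, W g ∧ g • x = x ∧ P x := by
      intro x hx
      obtain ⟨i, hi, hx⟩ := Finset.mem_biUnion.1 hx
      obtain ⟨k, rfl⟩ := mem_orbitFin.1 hx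
      obtain ⟨g, hg, hgw⟩ := hJW i hi
      refine ⟨k * g * k⁻¹, hWc g k hg, ?_, hP i k⟩
      rw [mul_smul, inv_smul_smul, mul_smul, hgw]
    choose! f hf using hex
    refine Finset.card_le_card_of_injOn f (fun x hx => ?_) fun x hx y hy e => ?_
    · simpa [hWf] using (hf x hx).1
    · exact h1 (f x) (hf x hx).1 x y (hf x hx).2.2 (hf y hy).2.2 (hf x hx).2.1
        (e ▸ (hf y hy).2.1)
  have h3 : 2 * ∑ i ∈ Jᶜ, (orbitFin G (w i)).card ≤ Jᶜ.card * Fintype.card G := by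
    rw [Finset.mul_sum, ← smul_eq_mul Jᶜ.card, ← Finset.sum_const]
    refine Finset.sum_le_sum fun i _ => ?_
    obtain ⟨g, hg, hgw⟩ := hnt i
    exact two_mul_card_orbitFin_le hg hgw
  rw [← Finset.sum_add_sum_compl J] at h
  rw [Finset.card_compl] at h3
  have hJle : J.card ≤ Fintype.card ι := Finset.card_le_univ J
  have hpos : 0 < Fintype.card G := Fintype.card_pos
  have hJpos : 0 < J.card := hJ.card_pos
  obtain ⟨m, hm⟩ := Nat.exists_eq_add_of_le hJle
  rw [hm, Nat.add_sub_cancel_left] at h3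
  rw [hm] at h ⊢
  by_contra! hlt
  have h4 : 4 * Fintype.card G ≤ (J.card + m + J.card) * Fintype.card G :=
    Nat.mul_le_mul_right _ hlt
  have e1 : (J.card + m + J.card) * Fintype.card G =
    J.card * Fintype.card G + m * Fintype.card G + J.card * Fintype.card G := by ring
  have e2 : (J.card + m) * Fintype.card G = J.card * Fintype.card G + m * Fintype.card G := by ring
  omega

end OrbitCounting

/-! ### Counting orbits relative to a subgroup -/

section OrbitCounting

variable {G X : Type*} [Group G] [Fintype G] [MulAction G X]

/-- If elements outside a subgroup `Z` fix at most one point, then two points whose stabilizers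
properly contain `Z` lie in the same orbit. -/
theorem same_orbit_of_fixed_le_one {P : X → Prop} (hP : ∀ (g : G) x, P x → P (g • x))
    (Z : Subgroup G) (h1 : ∀ g ∉ Z, ∀ a b, P a → P b → g • a = a → g • b = b → a = b)
    {a b : X} (ha : P a) (hb : P b) (hZa : ∀ z ∈ Z, z • a = a) (hZb : ∀ z ∈ Z, z • b = b)
    (ha' : ∃ s ∉ Z, s • a = a) (hb' : ∃ s ∉ Z, s • b = b) : ∃ g : G, g • a = b := by
  classical
  by_contra! hno
  let w : Fin 2 → X := ![a, b]
  have hw : ∀ i j, i ≠ j → ∀ g : G, g • w i ≠ w j := by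
    intro i j hij g
    fin_cases i <;> fin_cases j
    · exact absurd rfl hij
    · exact hno g
    · exact fun h => hno g⁻¹ (inv_smul_eq_iff.2 h.symm)
    · exact absurd rfl hij
  set Zf : Finset G := Finset.univ.filter (· ∈ Z) with hZf
  have hPw : ∀ i, P (w i) := by
    intro i; fin_cases i
    · exact ha
    · exact hb
  have h := card_orbits_le_sum hw Zf (fun _ => 1) (by
    intro g hg F hF hF'
    have hPF : ∀ x ∈ F, P x := fun x hx => by
      obtain ⟨i, k, rfl⟩ := hF' x hx
      exact hP k _ (hPw i)
    by_contra! hlt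
    obtain ⟨x, hx, y, hy, hxy⟩ := Finset.one_lt_card.1 hlt
    exact hxy (h1 g (by simpa [hZf] using hg) x y (hPF x hx) (hPF y hy) (hF x hx) (hF y hy)))
  -- The stabilizer contains `Z` and a further coset of it, so its order is at least 2|Z|. For two
  -- orbits the count then reads 2|G| ≤ |G|/2 + |G|/2 + (|G| − |Z|), which is absurd.
  have key : ∀ x : X, (∀ z ∈ Z, z • x = x) → (∃ s ∉ Z, s • x = x) →
      2 * (Zf.card * (orbitFin G x).card) ≤ Fintype.card G := by
    intro x hx ⟨s, hs, hsx⟩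
    rw [← card_orbitFin_mul (G := G) x, mul_comm Zf.card, mul_left_comm]
    refine Nat.mul_le_mul_left _ ?_
    have hdis : Disjoint Zf (Zf.image fun z => s * z) := by
      rw [Finset.disjoint_left]
      intro z hz hz'
      obtain ⟨y, hy, rfl⟩ := Finset.mem_image.1 hz'
      simp only [hZf, Finset.mem_filter, Finset.mem_univ, true_and] at hz hy
      exact hs (by simpa using mul_mem hz (inv_mem hy))
    have hcard : (Zf ∪ Zf.image fun z => s * z).card = 2 * Zf.card := by
      rw [Finset.card_union_of_disjoint hdis, Finset.card_image_of_injective _ (mul_right_injective s),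
        two_mul]
    rw [← hcard]
    refine Finset.card_le_card fun z hz => ?_
    simp only [hZf, Finset.mem_union, Finset.mem_image, Finset.mem_filter, Finset.mem_univ,
      true_and] at hz ⊢
    rcases hz with hz | ⟨y, hy, rfl⟩
    · exact hx z hz
    · rw [mul_smul, hx y hy, hsx]
  have k1 := key a hZa ha'
  have k2 := key b hZb hb'
  rw [Fin.sum_univ_two, Finset.sum_const, Finset.card_compl, Fintype.card_fin, smul_eq_mul, mul_one,
    mul_add] at h
  change _ ≤ Zf.card * (orbitFin G a).card + Zf.card * (orbitFin G b).card + _ at h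
  have hpos : 0 < Zf.card := Finset.card_pos.2 ⟨1, by simp [hZf, one_mem]⟩
  have hle : Zf.card ≤ Fintype.card G := Finset.card_le_univ _
  omega

end OrbitCounting

/-! ### Linear algebra of the plane -/

section PlaneAlgebra

variable {F : Type*} [Field F]

/-- The determinant of two vectors of the plane. -/
def dt {R : Type*} [CommRing R] (x y : Fin 2 → R) : R := x 0 * y 1 - x 1 * y 0

theorem dt_eq_zero_iff {x y : Fin 2 → F} (hx : x ≠ 0) : dt x y = 0 ↔ ∃ c : F, y = c • x := by
  constructor
  · intro h
    unfold dt at h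
    by_cases h0 : x 0 = 0
    · have h1 : x 1 ≠ 0 := fun h1 => hx (funext fun i => by fin_cases i <;> assumption)
      refine ⟨y 1 / x 1, funext fun i => ?_⟩
      fin_cases i
      · have : y 0 = 0 := by
          rw [h0, zero_mul, zero_sub, neg_eq_zero] at h
          exact (mul_eq_zero.1 h).resolve_left h1
        simp [h0, this]
      · simp [h1]
    · refine ⟨y 0 / x 0, funext fun i => ?_⟩
      fin_cases i
      · simp [h0]
      · simp only [Fin.mk_one, Pi.smul_apply, smul_eq_mul]
        field_simp
        linear_combination h
  · rintro ⟨c, rfl⟩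
    simp only [dt, Pi.smul_apply, smul_eq_mul]
    ring

theorem exists_coord_of_dt_ne {x y : Fin 2 → F} (h : dt x y ≠ 0) (z : Fin 2 → F) :
    z = (dt z y / dt x y) • x + (dt x z / dt x y) • y := by
  funext i
  have : dt z y / dt x y * x i + dt x z / dt x y * y i =
    (dt z y * x i + dt x z * y i) / dt x y := by ring
  simp only [Pi.add_apply, Pi.smul_apply, smul_eq_mul]
  rw [this, eq_div_iff h]
  unfold dt
  fin_cases i <;> simp <;> ring

theorem eq_smul_one_of_basis {M : Matrix (Fin 2) (Fin 2) F} {x y : Fin 2 → F} (h : dt x y ≠ 0)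
    {a : F} (hx : M.mulVec x = a • x) (hy : M.mulVec y = a • y) : M = a • 1 := by
  have key : ∀ z, M.mulVec z = (a • (1 : Matrix (Fin 2) (Fin 2) F)).mulVec z := by
    intro z
    rw [exists_coord_of_dt_ne h z, Matrix.mulVec_add, Matrix.mulVec_smul, Matrix.mulVec_smul, hx, hy,
      Matrix.smul_mulVec, Matrix.one_mulVec, smul_add, smul_comm a, smul_comm a]
  exact Matrix.ext_of_mulVec_single fun i => key _

/-- A matrix with three pairwise independent eigenvectors is scalar. -/
theorem scalar_of_three_eigenvectors {M : Matrix (Fin 2) (Fin 2) F} {x y z : Fin 2 → F}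
    (hxy : dt x y ≠ 0) (hxz : dt x z ≠ 0) (hyz : dt y z ≠ 0) (hx : ∃ a : F, M.mulVec x = a • x)
    (hy : ∃ a : F, M.mulVec y = a • y) (hz : ∃ a : F, M.mulVec z = a • z) : ∃ a : F, M = a • 1 := by
  obtain ⟨a, ha⟩ := hx
  obtain ⟨b, hb⟩ := hy
  obtain ⟨c, hc⟩ := hz
  have e := exists_coord_of_dt_ne hxy z
  have e2 := hc
  rw [e, Matrix.mulVec_add, Matrix.mulVec_smul, Matrix.mulVec_smul, ha, hb] at e2
  set s := dt z y / dt x y with hs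
  set t := dt x z / dt x y with ht
  have hs0 : s ≠ 0 := div_ne_zero (fun h => hyz (by unfold dt at h ⊢; linear_combination -h)) hxy
  have ht0 : t ≠ 0 := div_ne_zero hxz hxy
  have h1 : dt (s • a • x + t • b • y) y = dt (c • (s • x + t • y)) y := by rw [e2]
  have h2 : dt x (s • a • x + t • b • y) = dt x (c • (s • x + t • y)) := by rw [e2]
  have h3 : s * (a - c) * dt x y = 0 := by
    simp only [dt, Pi.add_apply, Pi.smul_apply, smul_eq_mul] at h1 ⊢
    linear_combination h1
  have h4 : t * (b - c) * dt x y = 0 := by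
    simp only [dt, Pi.add_apply, Pi.smul_apply, smul_eq_mul] at h2 ⊢
    linear_combination h2
  have ea : a = c := by
    rcases mul_eq_zero.1 ((mul_eq_zero.1 h3).resolve_right hxy) with h | h
    · exact absurd h hs0
    · exact sub_eq_zero.1 h
  have eb : b = c := by
    rcases mul_eq_zero.1 ((mul_eq_zero.1 h4).resolve_right hxy) with h | h
    · exact absurd h ht0
    · exact sub_eq_zero.1 h
  rw [ea] at ha
  rw [eb] at hb
  exact ⟨c, eq_smul_one_of_basis hxy ha hb⟩

theorem trace_eq_zero_of_sq {M : Matrix (Fin 2) (Fin 2) F} (h : M * M = 0) :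
    M.trace = 0 ∧ M.det = 0 := by
  have hd : M.det = 0 := by
    have := congrArg Matrix.det h
    rw [Matrix.det_mul, Matrix.det_zero] at this
    exact mul_self_eq_zero.1 this
  refine ⟨?_, hd⟩
  have h0 := congrFun₂ h 0 0
  have h1 := congrFun₂ h 1 1
  simp only [Matrix.mul_apply, Fin.sum_univ_two, Matrix.zero_apply] at h0 h1
  rw [Matrix.det_fin_two] at hd
  rw [Matrix.trace_fin_two]
  have : (M 0 0 + M 1 1) ^ 2 = 0 := by linear_combination h0 + h1 + 2 * hd
  exact pow_eq_zero_iff two_ne_zero |>.1 this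

theorem sq_eq_zero_of_trace_det {R : Type*} [CommRing R] {M : Matrix (Fin 2) (Fin 2) R}
    (ht : M.trace = 0) (hd : M.det = 0) : M * M = 0 := by
  rw [Matrix.trace_fin_two] at ht
  rw [Matrix.det_fin_two] at hd
  ext i j
  fin_cases i <;> fin_cases j <;>
    simp only [Matrix.mul_apply, Fin.sum_univ_two, Matrix.zero_apply, Fin.zero_eta, Fin.mk_one]
  · linear_combination M 0 0 * ht - hd
  · linear_combination M 0 1 * ht
  · linear_combination M 1 0 * ht
  · linear_combination M 1 1 * ht - hd

end PlaneAlgebra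

/-! ### Elements of finite order: tame and wild -/

section Discriminant

variable {K : Type u} [Field K] [Valued K ℤᵐ⁰]

/-- The discriminant of the characteristic polynomial of a matrix of size two. -/
def disc {R : Type*} [CommRing R] (M : Matrix (Fin 2) (Fin 2) R) : R := M.trace ^ 2 - 4 * M.det

/-- Principal units have no torsion in equal characteristic. If k is nonzero in the residue field,
then z^k − 1 is z − 1 times a unit. Otherwise a factor p is removed from k, since z^{pm} = 1 gives
(z^m − 1)^p = 0 in characteristic p. -/
theorem eq_one_of_pow_eq_one (hchar : ringChar 𝓀[K] = ringChar K) {k : ℕ} :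
    0 < k → ∀ z : 𝒪[K], IsLocalRing.residue 𝒪[K] z = 1 → z ^ k = 1 → z = 1 := by
  induction k using Nat.strong_induction_on with
  | _ k ih =>
  intro hk z hz h
  by_cases hk0 : (k : 𝓀[K]) = 0
  · obtain ⟨m, hm⟩ := (ringChar.spec 𝓀[K] k).1 hk0
    set p := ringChar 𝓀[K] with hp
    have hp0 : p ≠ 0 := by rintro h0; rw [h0, zero_mul] at hm; omega
    have hpp : p.Prime := (CharP.char_is_prime_or_zero 𝓀[K] p).resolve_right hp0
    have hm0 : 0 < m := Nat.pos_of_ne_zero (by rintro rfl; omega)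
    have hCK : CharP K p := by rw [hchar]; infer_instance
    have hfact := Fact.mk hpp
    refine ih m (by rw [hm]; exact lt_mul_of_one_lt_left hm0 hpp.one_lt) hm0 z hz ?_
    have h1 : ((z : K) ^ m) ^ p = 1 := by
      rw [← pow_mul, mul_comm, ← hm]
      exact_mod_cast congrArg (Subtype.val) h
    have h2 : ((z : K) ^ m - 1) ^ p = 0 := by
      rw [sub_pow_char, h1, one_pow, sub_self]
    have h3 := sub_eq_zero.1 (pow_eq_zero_iff hp0 |>.1 h2)
    exact Subtype.ext (by simpa using h3)
  · have h1 := mul_geom_sum z k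
    rw [h, sub_self] at h1
    have h2 : IsLocalRing.residue 𝒪[K] (∑ i ∈ Finset.range k, z ^ i) = k := by
      simp [hz]
    rcases mul_eq_zero.1 h1 with h3 | h3
    · exact sub_eq_zero.1 h3
    · rw [h3, map_zero] at h2
      exact absurd h2.symm hk0

theorem eigenvalue_pow_eq {g : GL (Fin 2) K} {k : ℕ}
    (hg : Matrix.ProjGenLinGroup.mk g ^ k = 1) :
    ∃ c : K, c ≠ 0 ∧ ∀ (z : Fin 2 → K) (l : K), z ≠ 0 → g.1.mulVec z = l • z → l ^ k = c := by
  rw [← map_pow, ← map_one Matrix.ProjGenLinGroup.mk] at hg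
  obtain ⟨u, hu⟩ := Matrix.ProjGenLinGroup.mk_eq_mk_iff.1 hg
  refine ⟨(u⁻¹ : Kˣ), Units.ne_zero _, fun z c hz0 hz => ?_⟩
  have h2 := mulVec_pow_eigen hz k
  rw [← mul_inv_eq_iff_eq_mul.2 hu.symm, one_mul, ← map_inv] at h2
  have h3 : (Matrix.GeneralLinearGroup.scalar (Fin 2) u⁻¹).1.mulVec z = ((u⁻¹ : Kˣ) : K) • z := by
    ext i
    fin_cases i <;> simp [Matrix.GeneralLinearGroup.scalar, Matrix.scalar]
  rw [h3] at h2
  exact (smul_left_injective K hz0 h2).symm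

theorem le_one_of_quadratic {l t d : K} (ht : Valued.v t ≤ 1) (hd : Valued.v d ≤ 1)
    (h : l ^ 2 - t * l + d = 0) : Valued.v l ≤ 1 := by
  by_contra! hl
  have e : l * l = t * l - d := by linear_combination h
  have h1 : Valued.v (t * l - d) ≤ Valued.v l := by
    refine (Valuation.map_sub _ _ _).trans (max_le ?_ (hd.trans hl.le))
    rw [map_mul]
    exact mul_le_of_le_one_left zero_le ht
  rw [← e, map_mul] at h1
  have h2 : Valued.v l * 1 < Valued.v l * Valued.v l :=
    mul_lt_mul_of_pos_left hl (zero_lt_one.trans hl)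
  rw [mul_one] at h2
  exact h1.not_gt h2

/-- Elements of finite order that fix a vertex: the two eigenvalues are distinct modulo the maximal
ideal, or they coincide. -/
theorem disc_dichotomy (hchar : ringChar 𝓀[K] = ringChar K) {A : GL (Fin 2) 𝒪[K]} {k : ℕ} (hk : 0 < k)
    (hA : Matrix.ProjGenLinGroup.mk (intGL A) ^ k = 1) (hs : (intGL A).1.charpoly.Splits) :
    IsLocalRing.residue 𝒪[K] (disc A.1) ≠ 0 ∨
      ∃ l : K, l ≠ 0 ∧ ((intGL A).1 - l • 1) * ((intGL A).1 - l • 1) = 0 := by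
  obtain ⟨l, hl⟩ := hs.exists_eval_eq_zero (by
    rw [Matrix.charpoly_degree_eq_dim]; simp)
  set a := (intGL A).1 with ha
  have htr : a.trace = (A.1.trace : K) := by
    rw [Matrix.trace_fin_two, Matrix.trace_fin_two]; rfl
  have hdet : a.det = (A.1.det : K) := by
    rw [Matrix.det_fin_two, Matrix.det_fin_two]; rfl
  rw [Matrix.charpoly_fin_two] at hl
  simp only [Polynomial.eval_add, Polynomial.eval_sub, Polynomial.eval_pow, Polynomial.eval_X,
    Polynomial.eval_mul, Polynomial.eval_C] at hl
  rw [htr, hdet] at hl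
  have hl1 := le_one_of_quadratic A.1.trace.2 A.1.det.2 hl
  let L : 𝒪[K] := ⟨l, hl1⟩
  set M : 𝒪[K] := A.1.trace - L with hM
  have hLM : L * M = A.1.det := Subtype.ext (by
    change l * ((A.1.trace : K) - l) = _
    linear_combination -hl)
  have hdisc : disc A.1 = (L - M) ^ 2 := by
    unfold disc
    rw [← hLM, hM]; ring
  have hdu : IsUnit (L * M) := by
    rw [hLM]
    exact (Matrix.isUnit_iff_isUnit_det A.1).1 A.isUnit
  by_cases hres : IsLocalRing.residue 𝒪[K] (disc A.1) = 0
  swap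
  · exact Or.inl hres
  right
  have hl0 : l ≠ 0 := by
    rintro rfl
    exact (isUnit_of_mul_isUnit_left hdu).ne_zero rfl
  refine ⟨l, hl0, ?_⟩
  -- The two eigenvalues have the same `k`-th power because a power of the matrix is scalar. Their
  -- quotient is a root of unity congruent to 1, hence equal to 1.
  have hLMeq : L = M := by
    by_contra hne
    obtain ⟨c, hc, hcl⟩ := eigenvalue_pow_eq hA
    have heig : ∀ x : K, x ^ 2 - (A.1.trace : K) * x + (A.1.det : K) = 0 → x ^ k = c := by
      intro x hx
      have hdet0 : (Matrix.scalar (Fin 2) x - a).det = 0 := by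
        rw [← Matrix.eval_charpoly, Matrix.charpoly_fin_two, htr, hdet]
        simpa using hx
      obtain ⟨w, hw, hw'⟩ := Matrix.exists_mulVec_eq_zero_iff.2 hdet0
      refine hcl w x hw ?_
      rw [Matrix.sub_mulVec, sub_eq_zero] at hw'
      rw [← ha, ← hw']
      ext i
      simp [Matrix.mulVec_diagonal, Matrix.scalar_apply]
    have h1 := heig l hl
    have h2 := heig (M : K) (by
      have e1 : (M : K) = A.1.trace - l := rfl
      have e2 : (A.1.det : K) = l * M := by rw [e1]; linear_combination hl
      rw [e2, e1]; ring)
    obtain ⟨Mi, hMi⟩ := (isUnit_of_mul_isUnit_right hdu).exists_right_inv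
    have h3 : (L * Mi) ^ k = 1 := by
      have h4 : L ^ k = M ^ k := Subtype.ext (by
        push_cast
        exact h1.trans h2.symm)
      rw [mul_pow, h4, ← mul_pow, hMi, one_pow]
    have hres' : IsLocalRing.residue 𝒪[K] L = IsLocalRing.residue 𝒪[K] M := by
      rw [hdisc, map_pow, pow_eq_zero_iff two_ne_zero, map_sub, sub_eq_zero] at hres
      exact hres
    have h5 := eq_one_of_pow_eq_one hchar hk (L * Mi) (by
      rw [map_mul, hres', ← map_mul, hMi, map_one]) h3
    refine hne ?_
    calc L = L * (M * Mi) := by rw [hMi, mul_one]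
      _ = L * Mi * M := by ring
      _ = M := by rw [h5, one_mul]
  have ht : (A.1.trace : K) = 2 * l := by
    have e1 : (M : K) = A.1.trace - l := rfl
    rw [← hLMeq] at e1
    have e2 : (L : K) = l := rfl
    linear_combination e2 - e1
  apply sq_eq_zero_of_trace_det
  · rw [Matrix.trace_sub, htr, ht, Matrix.trace_smul, Matrix.trace_one]
    simp; ring
  · rw [Matrix.det_fin_two]
    rw [Matrix.det_fin_two] at hdet
    rw [Matrix.trace_fin_two] at htr
    simp only [Matrix.sub_apply, Matrix.smul_apply, Matrix.one_apply_eq, smul_eq_mul, mul_one, ne_eq,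
      zero_ne_one, not_false_eq_true, Matrix.one_apply_ne, mul_zero, sub_zero, one_ne_zero]
    linear_combination hdet - l * htr + hl

/-- An element of `PGL(2, K)` represented by a nontrivial unipotent matrix. -/
def IsWild (h : PGL(2, K)) : Prop :=
  ∃ g : GL (Fin 2) K, Matrix.ProjGenLinGroup.mk g = h ∧ (g.1 - 1) * (g.1 - 1) = 0 ∧ g.1 ≠ 1

theorem not_isWild_one : ¬ IsWild (1 : PGL(2, K)) := by
  rintro ⟨g, hg, hsq, hne⟩
  rw [← map_one Matrix.ProjGenLinGroup.mk] at hg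
  obtain ⟨u, hu⟩ := Matrix.ProjGenLinGroup.mk_eq_mk_iff.1 hg
  have h1 : g.1 = (u⁻¹ : Kˣ).1 • 1 := by
    rw [← mul_inv_eq_iff_eq_mul.2 hu.symm, one_mul, ← map_inv]
    ext i j
    fin_cases i <;> fin_cases j <;> simp [Matrix.GeneralLinearGroup.scalar, Matrix.scalar]
  have h2 := congrFun₂ hsq 0 0
  rw [h1] at h2 hne
  simp only [Matrix.mul_apply, Fin.sum_univ_two, Matrix.sub_apply, Matrix.smul_apply,
    Matrix.one_apply_eq, smul_eq_mul, mul_one, ne_eq, zero_ne_one, not_false_eq_true,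
    Matrix.one_apply_ne, mul_zero, sub_zero, one_ne_zero, add_zero, Matrix.zero_apply,
    mul_self_eq_zero, sub_eq_zero] at h2
  rw [h2, one_smul] at hne
  exact hne rfl

theorem IsWild.conj {h : PGL(2, K)} (hh : IsWild h) (k : PGL(2, K)) : IsWild (k * h * k⁻¹) := by
  obtain ⟨g, rfl, hsq, hne⟩ := hh
  obtain ⟨b, rfl⟩ := Matrix.ProjGenLinGroup.mk_surjective k
  have e : (b * g * b⁻¹).1 - 1 = b.1 * (g.1 - 1) * (b⁻¹).1 := by
    rw [mul_sub, sub_mul, mul_one, ← Units.val_mul b, ← Units.val_mul, ← Units.val_mul b,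
      mul_inv_cancel, Units.val_one]
  have hb : (b⁻¹).1 * b.1 = 1 := by rw [← Units.val_mul, inv_mul_cancel, Units.val_one]
  have hb' : b.1 * (b⁻¹).1 = 1 := by rw [← Units.val_mul, mul_inv_cancel, Units.val_one]
  refine ⟨b * g * b⁻¹, by simp, ?_, fun h1 => hne ?_⟩
  · rw [e]
    calc _ = b.1 * (g.1 - 1) * ((b⁻¹).1 * b.1) * (g.1 - 1) * (b⁻¹).1 := by noncomm_ring
      _ = b.1 * ((g.1 - 1) * (g.1 - 1)) * (b⁻¹).1 := by rw [hb]; noncomm_ring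
      _ = 0 := by rw [hsq]; simp
  · rw [h1, sub_self] at e
    have : g.1 - 1 = (b⁻¹).1 * (b.1 * (g.1 - 1) * (b⁻¹).1) * b.1 := by
      calc g.1 - 1 = ((b⁻¹).1 * b.1) * (g.1 - 1) * ((b⁻¹).1 * b.1) := by rw [hb]; simp
        _ = _ := by noncomm_ring
    rw [← e] at this
    simpa [sub_eq_zero] using this

/-- In the case of a double eigenvalue, division by it produces a unipotent representative. -/
theorem disc_or_wild (hchar : ringChar 𝓀[K] = ringChar K) {A : GL (Fin 2) 𝒪[K]} {k : ℕ} (hk : 0 < k)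
    (hA : Matrix.ProjGenLinGroup.mk (intGL A) ^ k = 1) (hs : (intGL A).1.charpoly.Splits) :
    IsLocalRing.residue 𝒪[K] (disc A.1) ≠ 0 ∨ IsWild (Matrix.ProjGenLinGroup.mk (intGL A)) ∨
      Matrix.ProjGenLinGroup.mk (intGL A) = 1 := by
  refine (disc_dichotomy hchar hk hA hs).imp_right fun ⟨l, hl, hsq⟩ => ?_
  set u := Units.mk0 l hl with hu
  set g : GL (Fin 2) K := intGL A * Matrix.GeneralLinearGroup.scalar (Fin 2) u⁻¹ with hg
  have hmk : Matrix.ProjGenLinGroup.mk g = Matrix.ProjGenLinGroup.mk (intGL A) :=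
    (Matrix.ProjGenLinGroup.mk_eq_mk_iff.2 ⟨u⁻¹, rfl⟩).symm
  have hgv : g.1 = l⁻¹ • (intGL A).1 := by
    rw [hg, Units.val_mul]
    ext i j
    fin_cases i <;> fin_cases j <;>
      simp [Matrix.GeneralLinearGroup.scalar, Matrix.scalar, hu, Matrix.mul_apply, mul_comm]
  by_cases h1 : g.1 = 1
  · right
    rw [← hmk, show g = 1 from Units.ext h1, map_one]
  · left
    refine ⟨g, hmk, ?_, h1⟩
    have e : g.1 - 1 = l⁻¹ • ((intGL A).1 - l • 1) := by
      rw [hgv, smul_sub, smul_smul, inv_mul_cancel₀ hl, one_smul]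
    rw [e, Matrix.smul_mul, Matrix.mul_smul, hsq, smul_zero, smul_zero]

variable [(Valued.v : Valuation K ℤᵐ⁰).IsNontrivial]

/-- A unipotent representative of an element fixing the standard vertex is itself integral. It is a
scalar multiple of an integral invertible matrix, and comparing determinants shows that the scalar
is a unit. -/
theorem IsWild.exists_int {h : PGL(2, K)} (hw : IsWild h) (hh : h • stdVertex K = stdVertex K) :
    ∃ (A : GL (Fin 2) 𝒪[K]) (P : Matrix (Fin 2) (Fin 2) 𝒪[K]), A.1 = 1 + P ∧ P ≠ 0 ∧ P * P = 0 ∧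
      h = Matrix.ProjGenLinGroup.mk (intGL A) := by
  obtain ⟨B, hB⟩ := exists_intGL hh
  obtain ⟨g, hg, hsq, hne⟩ := hw
  obtain ⟨u, hu⟩ := Matrix.ProjGenLinGroup.mk_eq_mk_iff.1 (hg.trans hB)
  obtain ⟨ht, hd⟩ := trace_eq_zero_of_sq hsq
  have hsc : (Matrix.GeneralLinearGroup.scalar (Fin 2) u).1 = (u : K) • 1 := by
    ext i j
    fin_cases i <;> fin_cases j <;> simp [Matrix.GeneralLinearGroup.scalar, Matrix.scalar]
  have hBv : (intGL B).1 = (u : K) • g.1 := by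
    rw [← hu, Units.val_mul, hsc, Matrix.mul_smul, mul_one]
  have hgdet : g.1.det = 1 := by
    rw [Matrix.trace_fin_two] at ht
    rw [Matrix.det_fin_two] at hd ⊢
    simp only [Matrix.sub_apply, Matrix.one_apply_eq, ne_eq, zero_ne_one, not_false_eq_true,
      Matrix.one_apply_ne, sub_zero, one_ne_zero] at ht hd
    linear_combination ht + hd
  have hdetB : (B.1.det : K) = (u : K) ^ 2 := by
    have : (intGL B).1.det = (B.1.det : K) := by
      rw [Matrix.det_fin_two, Matrix.det_fin_two]; rfl
    rw [← this, hBv, Matrix.det_smul, hgdet, mul_one, Fintype.card_fin]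
  have hBu : IsUnit B.1.det := (Matrix.isUnit_iff_isUnit_det B.1).1 B.isUnit
  have hv : Valued.v (u : K) = 1 := by
    have h1 := (Valuation.integer.integers (Valued.v : Valuation K ℤᵐ⁰)).isUnit_iff_valuation_eq_one.1
      hBu
    have h2 : Valued.v (B.1.det : K) = 1 := h1
    rw [hdetB, map_pow] at h2
    rw [← one_pow 2] at h2
    exact (pow_left_inj₀ zero_le zero_le two_ne_zero).1 h2
  have hu0 : IsUnit (⟨u, hv.le⟩ : 𝒪[K]) :=
    (Valuation.integer.integers (Valued.v : Valuation K ℤᵐ⁰)).isUnit_iff_valuation_eq_one.2 hv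
  obtain ⟨U, hU⟩ := hu0
  have hUu : Units.map (algebraMap 𝒪[K] K).toMonoidHom U = u := by
    apply Units.ext
    change ((U : 𝒪[K]) : K) = u
    rw [hU]
  set A : GL (Fin 2) 𝒪[K] := B * Matrix.GeneralLinearGroup.scalar (Fin 2) U⁻¹ with hA
  have hAg : intGL A = g := by
    rw [hA, map_mul, ← hu, mul_assoc]
    have : intGL (Matrix.GeneralLinearGroup.scalar (Fin 2) U⁻¹) =
        Matrix.GeneralLinearGroup.scalar (Fin 2) u⁻¹ := by
      rw [← hUu]
      apply Units.ext
      ext i j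
      fin_cases i <;> fin_cases j <;>
        simp [Matrix.GeneralLinearGroup.scalar, Matrix.scalar, intGL, Matrix.GeneralLinearGroup.map]
    rw [this, ← map_mul, mul_inv_cancel, map_one, mul_one]
  have hinj : Function.Injective (fun A : Matrix (Fin 2) (Fin 2) 𝒪[K] => A.map (algebraMap 𝒪[K] K)) :=
    Matrix.map_injective (Subtype.val_injective)
  have hmap : (A.1 - 1).map (algebraMap 𝒪[K] K) = g.1 - 1 := by
    rw [← hAg, intGL_val, Matrix.map_sub _ (map_sub _), Matrix.map_one _ (map_zero _) (map_one _)]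
  refine ⟨A, A.1 - 1, by abel, fun h0 => hne ?_, hinj ?_, ?_⟩
  · rw [h0, Matrix.map_zero _ (map_zero _)] at hmap
    exact sub_eq_zero.1 hmap.symm
  · simp only [Matrix.map_mul]
    rw [hmap, hsq, Matrix.map_zero _ (map_zero _)]
  · rw [hAg, hg]

end Discriminant

/-! ### Symmetric forms attached to trace zero matrices; nilpotent matrices -/

section PlaneBilinear

variable {F : Type*} [Field F]

theorem dt_mulVec_add {R : Type*} [CommRing R] (M : Matrix (Fin 2) (Fin 2) R) (x y : Fin 2 → R) :
    dt (M.mulVec x) y + dt x (M.mulVec y) = M.trace * dt x y := by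
  simp only [dt, Matrix.mulVec, dotProduct, Fin.sum_univ_two, Matrix.trace_fin_two]
  ring

theorem dt_self {R : Type*} [CommRing R] (x : Fin 2 → R) : dt x x = 0 := by unfold dt; ring

theorem dt_swap {R : Type*} [CommRing R] (x y : Fin 2 → R) : dt x y = -dt y x := by unfold dt; ring

theorem dt_smul_left {R : Type*} [CommRing R] (c : R) (x y : Fin 2 → R) :
    dt (c • x) y = c * dt x y := by
  simp only [dt, Pi.smul_apply, smul_eq_mul]; ring

theorem dt_smul_right {R : Type*} [CommRing R] (c : R) (x y : Fin 2 → R) :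
    dt x (c • y) = c * dt x y := by
  simp only [dt, Pi.smul_apply, smul_eq_mul]; ring

theorem dt_add_left {R : Type*} [CommRing R] (x x' y : Fin 2 → R) :
    dt (x + x') y = dt x y + dt x' y := by
  simp only [dt, Pi.add_apply]; ring

theorem dt_add_right {R : Type*} [CommRing R] (x y y' : Fin 2 → R) :
    dt x (y + y') = dt x y + dt x y' := by
  simp only [dt, Pi.add_apply]; ring

theorem dt_zero_left {R : Type*} [CommRing R] (x : Fin 2 → R) : dt 0 x = 0 := by simp [dt]

theorem exists_dt_ne_zero {x : Fin 2 → F} (hx : x ≠ 0) : ∃ y, dt x y ≠ 0 := by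
  by_contra! h
  refine hx (funext fun i => ?_)
  have h0 := h ![0, 1]
  have h1 := h ![1, 0]
  simp [dt] at h0 h1
  fin_cases i <;> simpa

/-- The form `(x, y) ↦ det(Mx, y)` is symmetric if `M` has trace zero. -/
theorem dt_symm {R : Type*} [CommRing R] {M : Matrix (Fin 2) (Fin 2) R} (hM : M.trace = 0)
    (x y : Fin 2 → R) : dt (M.mulVec x) y = dt (M.mulVec y) x := by
  have := dt_mulVec_add M x y
  rw [hM, zero_mul] at this
  rw [dt_swap (M.mulVec y) x]
  linear_combination this

theorem eq_zero_of_dt {x y z : Fin 2 → F} (h : dt x y ≠ 0) (hx : dt z x = 0) (hy : dt z y = 0) :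
    z = 0 := by
  rw [exists_coord_of_dt_ne h z, hy, dt_swap x z, hx]
  simp

theorem matrix_eq_zero_of_basis {M : Matrix (Fin 2) (Fin 2) F} {x y : Fin 2 → F} (h : dt x y ≠ 0)
    (hx : M.mulVec x = 0) (hy : M.mulVec y = 0) : M = 0 := by
  have := eq_smul_one_of_basis (a := (0 : F)) h (by rw [hx, zero_smul]) (by rw [hy, zero_smul])
  rw [this, zero_smul]

theorem exists_coord_of_eigenvector {M : Matrix (Fin 2) (Fin 2) F} {w y : Fin 2 → F} {a : F}
    (hw : w ≠ 0) (hM : M.mulVec w = a • w) :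
    ∃ c : F, M.mulVec y = (M.trace - a) • y + c • w := by
  have h1 := dt_mulVec_add M w y
  rw [hM, dt_smul_left] at h1
  have h2 : dt w (M.mulVec y - (M.trace - a) • y) = 0 := by
    rw [sub_eq_add_neg, dt_add_right, ← neg_smul, dt_smul_right]
    linear_combination h1
  obtain ⟨c, hc⟩ := (dt_eq_zero_iff hw).1 h2
  exact ⟨c, by rw [← hc]; abel⟩

/-- With a common eigenvector both matrices are triangular in one basis, so the diagonal entries of
the product multiply. -/
theorem trace_mul_of_eigenvector {M Y : Matrix (Fin 2) (Fin 2) F} {w : Fin 2 → F} {a b : F}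
    (hw : w ≠ 0) (hM : M.mulVec w = a • w) (hY : Y.mulVec w = b • w) :
    (Y * M).trace = a * b + (Y.trace - b) * (M.trace - a) := by
  obtain ⟨y, hy⟩ := exists_dt_ne_zero hw
  obtain ⟨c, hc⟩ := exists_coord_of_eigenvector (y := y) hw hM
  have h1 := dt_mulVec_add (Y * M) w y
  have h2 := dt_mulVec_add Y w y
  rw [← Matrix.mulVec_mulVec, ← Matrix.mulVec_mulVec, hc, hM, Matrix.mulVec_smul, hY,
    Matrix.mulVec_add, Matrix.mulVec_smul, Matrix.mulVec_smul, hY, dt_add_right, dt_smul_left,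
    dt_smul_left, dt_smul_right, dt_smul_right, dt_smul_right, dt_self] at h1
  rw [hY, dt_smul_left] at h2
  refine mul_right_cancel₀ hy ?_
  rw [← h1]
  linear_combination (M.trace - a) * h2

theorem eigenvalue_eq {M : Matrix (Fin 2) (Fin 2) F} {w : Fin 2 → F} {a : F} (hw : w ≠ 0)
    (hM : M.mulVec w = a • w) : a ^ 2 - M.trace * a + M.det = 0 := by
  have : (M - a • 1).mulVec w = 0 := by
    rw [Matrix.sub_mulVec, hM, Matrix.smul_mulVec, Matrix.one_mulVec, sub_self]
  have h := Matrix.exists_mulVec_eq_zero_iff.1 ⟨w, hw, this⟩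
  rw [Matrix.det_fin_two] at h ⊢
  rw [Matrix.trace_fin_two]
  simp only [Matrix.sub_apply, Matrix.smul_apply, Matrix.one_apply_eq, smul_eq_mul, mul_one, ne_eq,
      zero_ne_one, not_false_eq_true, Matrix.one_apply_ne, mul_zero, sub_zero, one_ne_zero] at h
  linear_combination h

theorem disc_eq_sq {M : Matrix (Fin 2) (Fin 2) F} {w : Fin 2 → F} {a : F} (hw : w ≠ 0)
    (hM : M.mulVec w = a • w) : disc M = (2 * a - M.trace) ^ 2 := by
  have := eigenvalue_eq hw hM
  unfold disc
  linear_combination -4 * this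

theorem disc_smul_one (a : F) : disc (a • (1 : Matrix (Fin 2) (Fin 2) F)) = 0 := by
  unfold disc
  rw [Matrix.trace_smul, Matrix.det_smul, Matrix.trace_one, Matrix.det_one]
  simp; ring

/-- A nilpotent matrix that kills `u`. -/
theorem nilpotent_mulVec {P : Matrix (Fin 2) (Fin 2) F} (hP : P ≠ 0) (hsq : P * P = 0)
    {u : Fin 2 → F} (hu : u ≠ 0) (hPu : P.mulVec u = 0) :
    ∃ c : F, c ≠ 0 ∧ (∀ z, P.mulVec z = (c * dt u z) • u) ∧
      ∀ M, (P * M).trace = c * dt u (M.mulVec u) := by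
  obtain ⟨y, hy⟩ := exists_dt_ne_zero hu
  have h1 : dt u (P.mulVec y) = 0 := by
    have := dt_mulVec_add P u y
    rwa [hPu, dt_zero_left, zero_add, (trace_eq_zero_of_sq hsq).1, zero_mul] at this
  obtain ⟨c, hc⟩ := (dt_eq_zero_iff hu).1 h1
  have hc0 : c ≠ 0 := by
    rintro rfl
    rw [zero_smul] at hc
    exact hP (matrix_eq_zero_of_basis hy hPu hc)
  have hz : ∀ z, P.mulVec z = (c / dt u y * dt u z) • u := by
    intro z
    conv_lhs => rw [exists_coord_of_dt_ne hy z]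
    rw [Matrix.mulVec_add, Matrix.mulVec_smul, Matrix.mulVec_smul, hPu, hc, smul_zero, zero_add,
      smul_smul]
    congr 1
    ring
  refine ⟨c / dt u y, div_ne_zero hc0 hy, hz, fun M => ?_⟩
  set d := c / dt u y with hd
  have e : ∀ i j, P i j = d * dt u (Pi.single j 1) * u i := fun i j => by
    have := congrFun (hz (Pi.single j 1)) i
    rwa [Matrix.mulVec_single_one] at this
  rw [Matrix.trace_fin_two]
  simp only [Matrix.mul_apply, Fin.sum_univ_two, e]
  simp [dt, Matrix.mulVec, dotProduct, Fin.sum_univ_two]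
  ring

theorem exists_kernel_of_sq {P : Matrix (Fin 2) (Fin 2) F} (hsq : P * P = 0) :
    ∃ u, u ≠ 0 ∧ P.mulVec u = 0 :=
  Matrix.exists_mulVec_eq_zero_iff.2 (trace_eq_zero_of_sq hsq).2

end PlaneBilinear

/-! ### Finite groups fixing the standard vertex -/

section LocalAction

variable {K : Type u} [Field K] [Valued K ℤᵐ⁰] [(Valued.v : Valuation K ℤᵐ⁰).IsNontrivial]
  {G : Type*} [Group G] [Finite G] {ρ : G →* PGL(2, K)}

/-- A finite group that acts faithfully on `P¹` and fixes the standard vertex, such that all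
eigenvalues are rational. -/
structure IsLocalAction (ρ : G →* PGL(2, K)) : Prop where
  injective : Function.Injective ρ
  fixes : ∀ n, ρ n • stdVertex K = stdVertex K
  splits : ∀ n g, Matrix.ProjGenLinGroup.mk g = ρ n →
    (g : Matrix (Fin 2) (Fin 2) K).charpoly.Splits

theorem fixes_nb_iff {h : PGL(2, K)} {A : GL (Fin 2) 𝒪[K]}
    (hA : h = Matrix.ProjGenLinGroup.mk (intGL A)) {x : Fin 2 → 𝓀[K]} (hx : x ≠ 0) :
    h • nb x = nb x ↔ ∃ c : 𝓀[K], (redMat A.1).mulVec x = c • x := by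
  rw [hA, mk_smul_nb A hx, eq_comm, nb_eq_iff hx (redMat_mulVec_ne_zero A hx)]

theorem nb_ne_iff {x y : Fin 2 → 𝓀[K]} (hx : x ≠ 0) (hy : y ≠ 0) : nb x ≠ nb y ↔ dt x y ≠ 0 := by
  rw [Ne, nb_eq_iff hx hy, ← dt_eq_zero_iff hx]

theorem fixes_all_of_three {h : PGL(2, K)}
    {x y z : Fin 2 → 𝓀[K]} (hx : x ≠ 0) (hy : y ≠ 0) (hz : z ≠ 0) (hxy : nb x ≠ nb y)
    (hxz : nb x ≠ nb z) (hyz : nb y ≠ nb z) (h1 : h • nb x = nb x) (h2 : h • nb y = nb y)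
    (h3 : h • nb z = nb z) {A : GL (Fin 2) 𝒪[K]} (hA : h = Matrix.ProjGenLinGroup.mk (intGL A)) :
    ∃ a : 𝓀[K], redMat A.1 = a • 1 := by
  rw [fixes_nb_iff hA hx] at h1
  rw [fixes_nb_iff hA hy] at h2
  rw [fixes_nb_iff hA hz] at h3
  exact scalar_of_three_eigenvectors ((nb_ne_iff hx hy).1 hxy) ((nb_ne_iff hx hz).1 hxz)
    ((nb_ne_iff hy hz).1 hyz) h1 h2 h3

theorem residue_disc (A : Matrix (Fin 2) (Fin 2) 𝒪[K]) :
    IsLocalRing.residue 𝒪[K] (disc A) = disc (redMat A) := by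
  unfold disc redMat
  rw [Matrix.trace_fin_two, Matrix.trace_fin_two, Matrix.det_fin_two, Matrix.det_fin_two]
  simp [map_ofNat]

variable (hchar : ringChar 𝓀[K] = ringChar K) (hρ : IsLocalAction ρ)
include hchar hρ

/-- Nontrivial tame elements keep distinct eigenvalues after reduction. In particular they do not
reduce to scalars, so they fix at most two neighbours. -/
theorem IsLocalAction.disc_ne {n : G} (hn : n ≠ 1) (hw : ¬ IsWild (ρ n)) {A : GL (Fin 2) 𝒪[K]}
    (hA : ρ n = Matrix.ProjGenLinGroup.mk (intGL A)) : disc (redMat A.1) ≠ 0 := by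
  have hfin := isOfFinOrder_of_finite n
  obtain ⟨k, hk, hk1⟩ := isOfFinOrder_iff_pow_eq_one.1 hfin
  rw [← residue_disc]
  rcases disc_or_wild hchar hk (A := A) (by rw [← hA, ← map_pow, hk1, map_one])
    (hρ.splits n _ hA.symm) with h | h | h
  · exact h
  · exact absurd (hA ▸ h) hw
  · exact absurd (hρ.injective ((hA.trans h).trans (map_one ρ).symm)) hn

/-- Two elements that fix an edge commute in `GL(2)` if no wild element fixes the edge. -/
theorem IsLocalAction.commute_of_no_wild {w : Fin 2 → 𝓀[K]} (hw : w ≠ 0)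
    (hno : ∀ n, ρ n • nb w = nb w → ¬ IsWild (ρ n)) {n m : G} (hn : ρ n • nb w = nb w)
    (hm : ρ m • nb w = nb w) {g h : GL (Fin 2) K} (hg : Matrix.ProjGenLinGroup.mk g = ρ n)
    (hh : Matrix.ProjGenLinGroup.mk h = ρ m) : g * h = h * g := by
  obtain ⟨A, hA⟩ := exists_intGL (hρ.fixes n)
  obtain ⟨B, hB⟩ := exists_intGL (hρ.fixes m)
  -- The reduced commutator fixes `w` and has determinant 1, so both its eigenvalues are 1 and its
  -- discriminant vanishes. As no wild element fixes the edge, the commutator is trivial in the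
  -- group, so `C` is scalar.
  set C := A * B * A⁻¹ * B⁻¹ with hC
  have hρC : ρ (n * m * n⁻¹ * m⁻¹) = Matrix.ProjGenLinGroup.mk (intGL C) := by
    simp only [hC, map_mul, map_inv, hA, hB]
  have hfixC : ρ (n * m * n⁻¹ * m⁻¹) • nb w = nb w := by
    have hn' : (ρ n)⁻¹ • nb w = nb w := by rw [inv_smul_eq_iff, hn]
    have hm' : (ρ m)⁻¹ • nb w = nb w := by rw [inv_smul_eq_iff, hm]
    rw [map_mul, map_mul, map_mul, map_inv, map_inv, mul_smul, mul_smul, mul_smul, hm', hn', hm, hn]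
  have hCw : (redMat C.1).mulVec w = w := by
    obtain ⟨a, ha⟩ := (fixes_nb_iff hA hw).1 hn
    obtain ⟨b, hb⟩ := (fixes_nb_iff hB hw).1 hm
    have ha0 : a ≠ 0 := by
      rintro rfl; rw [zero_smul] at ha; exact redMat_mulVec_ne_zero A hw ha
    have hb0 : b ≠ 0 := by
      rintro rfl; rw [zero_smul] at hb; exact redMat_mulVec_ne_zero B hw hb
    have hCBA : redMat C.1 * (redMat B.1 * redMat A.1) = redMat A.1 * redMat B.1 := by
      have : C.1 * (B.1 * A.1) = A.1 * B.1 := by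
        rw [← Units.val_mul, ← Units.val_mul, ← Units.val_mul]
        congr 1
        rw [hC]; group
      unfold redMat
      rw [← Matrix.map_mul, ← Matrix.map_mul, ← Matrix.map_mul, this]
    have e : (redMat C.1).mulVec ((redMat B.1).mulVec ((redMat A.1).mulVec w)) =
        (redMat A.1).mulVec ((redMat B.1).mulVec w) := by
      rw [Matrix.mulVec_mulVec _ (redMat B.1), Matrix.mulVec_mulVec, hCBA, Matrix.mulVec_mulVec]
    rw [ha, hb, Matrix.mulVec_smul, hb, Matrix.mulVec_smul, Matrix.mulVec_smul, Matrix.mulVec_smul,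
      ha, smul_comm b a w] at e
    exact smul_right_injective _ hb0 (smul_right_injective _ ha0 e)
  have hdetC : C.1.det = 1 := by
    have : Matrix.GeneralLinearGroup.det C = 1 := by
      simp only [hC, map_mul, map_inv]
      rw [mul_comm (Matrix.GeneralLinearGroup.det A)]
      group
    exact congrArg Units.val this
  have hdiscC : disc (redMat C.1) = 0 := by
    have hd : (redMat C.1).det = 1 := by
      unfold redMat
      have : (C.1.map (IsLocalRing.residue 𝒪[K])).det = IsLocalRing.residue 𝒪[K] C.1.det :=
        (RingHom.map_det _ _).symm
      rw [this, hdetC, map_one]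
    have hone : (redMat C.1).mulVec w = (1 : 𝓀[K]) • w := by rw [hCw, one_smul]
    have h1 := eigenvalue_eq hw hone
    rw [disc_eq_sq hw hone]
    rw [hd] at h1
    have : (redMat C.1).trace = 2 := by linear_combination -h1
    rw [this]; ring
  have hone : n * m * n⁻¹ * m⁻¹ = 1 := by
    by_contra hne
    exact IsLocalAction.disc_ne hchar hρ hne (hno _ hfixC) hρC hdiscC
  have hC1 : C = 1 := by
    rw [hone, map_one, ← map_one Matrix.ProjGenLinGroup.mk, eq_comm] at hρC
    obtain ⟨u, hu⟩ := Matrix.ProjGenLinGroup.mk_eq_mk_iff.1 hρC.symm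
    rw [one_mul] at hu
    have hentry : ∀ i j, ((C.1 i j : 𝒪[K]) : K) = if i = j then (u : K) else 0 := by
      intro i j
      have : (intGL C).1 i j = (C.1 i j : K) := rfl
      rw [← this, ← hu]
      fin_cases i <;> fin_cases j <;> simp [Matrix.GeneralLinearGroup.scalar, Matrix.scalar]
    have h01 : C.1 0 1 = 0 := Subtype.ext (by rw [hentry]; simp)
    have h10 : C.1 1 0 = 0 := Subtype.ext (by rw [hentry]; simp)
    have h11 : C.1 1 1 = C.1 0 0 := Subtype.ext (by rw [hentry, hentry]; simp)
    -- The scalar has square 1 and residue 1; this also excludes −1.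
    have h00 : C.1 0 0 = 1 := by
      refine eq_one_of_pow_eq_one hchar two_pos _ ?_ ?_
      · by_contra hne
        have h1 : redMat C.1 = IsLocalRing.residue 𝒪[K] (C.1 0 0) • 1 := by
          ext i j
          fin_cases i <;> fin_cases j <;> simp [redMat, h01, h10, h11]
        rw [h1, Matrix.smul_mulVec, Matrix.one_mulVec] at hCw
        exact hne (smul_left_injective _ hw (by simpa using hCw))
      · rw [Matrix.det_fin_two, h01, h10, h11] at hdetC
        rw [pow_two]
        simpa using hdetC
    apply Units.ext
    ext i j
    fin_cases i <;> fin_cases j <;> simp [h01, h10, h11, h00]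
  have hAB : intGL A * intGL B = intGL B * intGL A := by
    rw [← map_mul, ← map_mul]
    congr 1
    rw [hC] at hC1
    have := mul_inv_eq_one.1 hC1
    rw [mul_inv_eq_iff_eq_mul] at this
    exact this
  obtain ⟨u, hu⟩ := Matrix.ProjGenLinGroup.mk_eq_mk_iff.1 (hA.symm.trans hg.symm)
  obtain ⟨v, hv⟩ := Matrix.ProjGenLinGroup.mk_eq_mk_iff.1 (hB.symm.trans hh.symm)
  have hc : ∀ (u : Kˣ) (x : GL (Fin 2) K),
      Commute x (Matrix.GeneralLinearGroup.scalar (Fin 2) u) := fun u x => by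
    have hc : Matrix.GeneralLinearGroup.scalar (Fin 2) u ∈ Subgroup.center (GL (Fin 2) K) := by
      rw [Matrix.GeneralLinearGroup.center_eq_range_scalar]
      exact ⟨u, rfl⟩
    exact Subgroup.mem_center_iff.1 hc x
  rw [← hu, ← hv]
  have h1 : Commute (intGL A) (intGL B) := hAB
  exact (h1.mul_right (hc v _)).mul_left ((hc u _).symm.mul_right (hc v _))

end LocalAction

/-! ### Trace zero matrices at the edges of one vertex -/

section LocalEdges

variable {K : Type u} [Field K] [Valued K ℤᵐ⁰] [(Valued.v : Valuation K ℤᵐ⁰).IsNontrivial]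
  {G : Type*} [Group G] {ρ : G →* PGL(2, K)}

/-- The stabilizer of a vertex is commutative even after lifting to `GL(2)`. -/
def CommStab (ρ : G →* PGL(2, K)) (Λ : Vertex K) : Prop :=
  ∀ n m, ρ n • Λ = Λ → ρ m • Λ = Λ → ∀ g h : GL (Fin 2) K, Matrix.ProjGenLinGroup.mk g = ρ n →
    Matrix.ProjGenLinGroup.mk h = ρ m → g * h = h * g

/-- A family of endomorphisms attached to edges that start at the standard vertex. -/
structure LocalEdges (ρ : G →* PGL(2, K)) (I : Type*) [Fintype I] where
  w : I → Fin 2 → 𝓀[K]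
  w_ne : ∀ i, w i ≠ 0
  Y : I → Matrix (Fin 2) (Fin 2) 𝒪[K]
  trace_Y : ∀ i, (Y i).trace = 0
  pres : ∀ i, ∃ a : 𝓀[K], (redMat (Y i)).mulVec (w i) = a • w i
  of_trivial : ∀ i, (∀ n, ρ n • nb (w i) = nb (w i) → n = 1) → Y i = 0
  of_comm : ∀ i, CommStab ρ (nb (w i)) → (∃ n, n ≠ 1 ∧ ρ n • nb (w i) = nb (w i)) →
    ∃ n, n ≠ 1 ∧ ρ n • nb (w i) = nb (w i) ∧
      ∀ A : GL (Fin 2) 𝒪[K], ρ n = Matrix.ProjGenLinGroup.mk (intGL A) → (Y i * A.1).trace = 0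
  sep : ∀ i j, i ≠ j → ∀ n, ρ n • nb (w i) ≠ nb (w j)
  sum_Y : ∑ i, Y i = 0

theorem redMat_trace (M : Matrix (Fin 2) (Fin 2) 𝒪[K]) :
    (redMat M).trace = IsLocalRing.residue 𝒪[K] M.trace := by
  rw [Matrix.trace_fin_two, Matrix.trace_fin_two, map_add]; rfl

theorem redMat_mul (M M' : Matrix (Fin 2) (Fin 2) 𝒪[K]) : redMat (M * M') = redMat M * redMat M' :=
  Matrix.map_mul

theorem redMat_zero : redMat (0 : Matrix (Fin 2) (Fin 2) 𝒪[K]) = 0 :=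
  Matrix.map_zero _ (map_zero _)

theorem redMat_one : redMat (1 : Matrix (Fin 2) (Fin 2) 𝒪[K]) = 1 :=
  Matrix.map_one _ (map_zero _) (map_one _)

theorem redMat_add (M M' : Matrix (Fin 2) (Fin 2) 𝒪[K]) : redMat (M + M') = redMat M + redMat M' :=
  Matrix.map_add _ (map_add _) _ _

theorem redMat_sum {I : Type*} (s : Finset I) (Y : I → Matrix (Fin 2) (Fin 2) 𝒪[K]) :
    redMat (∑ i ∈ s, Y i) = ∑ i ∈ s, redMat (Y i) :=
  map_sum (RingHom.mapMatrix (IsLocalRing.residue 𝒪[K])) Y s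

namespace LocalEdges

variable {I : Type*} [Fintype I] (D : LocalEdges ρ I)

theorem red_trace (i : I) : (redMat (D.Y i)).trace = 0 := by
  rw [redMat_trace, D.trace_Y, map_zero]

theorem red_sum : ∑ i, redMat (D.Y i) = 0 := by
  rw [← redMat_sum, D.sum_Y, redMat_zero]

theorem red_symm (i : I) (x y : Fin 2 → 𝓀[K]) :
    dt ((redMat (D.Y i)).mulVec x) y = dt ((redMat (D.Y i)).mulVec y) x :=
  dt_symm (D.red_trace i) x y

theorem nontrivial_of_ne {i : I} (h : redMat (D.Y i) ≠ 0) :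
    ∃ n, n ≠ 1 ∧ ρ n • nb (D.w i) = nb (D.w i) := by
  by_contra! hno
  refine h ?_
  rw [D.of_trivial i fun n hn => by by_contra h1; exact hno n h1 hn, redMat_zero]

theorem dt_w_ne {i j : I} (h : i ≠ j) : dt (D.w i) (D.w j) ≠ 0 := by
  rw [← nb_ne_iff (D.w_ne i) (D.w_ne j)]
  have := D.sep i j h 1
  rwa [map_one, one_smul] at this

theorem dt_pres (i : I) : dt ((redMat (D.Y i)).mulVec (D.w i)) (D.w i) = 0 := by
  obtain ⟨a, ha⟩ := D.pres i
  rw [ha, dt_smul_left, dt_self, mul_zero]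

variable [Finite G] (hchar : ringChar 𝓀[K] = ringChar K) (hρ : IsLocalAction ρ)
include hchar hρ

/-- At a tame edge the endomorphism kills the direction of the edge. -/
theorem mulVec_eq_zero_of_tame {i : I}
    (hno : ∀ n, ρ n • nb (D.w i) = nb (D.w i) → ¬ IsWild (ρ n)) :
    (redMat (D.Y i)).mulVec (D.w i) = 0 := by
  by_cases h0 : redMat (D.Y i) = 0
  · rw [h0, Matrix.zero_mulVec]
  have hnt := D.nontrivial_of_ne h0
  obtain ⟨n, hn1, hn, htr⟩ := D.of_comm i
    (fun n m hn hm g h hg hh => hρ.commute_of_no_wild hchar (D.w_ne i) hno hn hm hg hh) hnt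
  obtain ⟨A, hA⟩ := exists_intGL (hρ.fixes n)
  have h1 := hρ.disc_ne hchar hn1 (hno n hn) hA
  obtain ⟨a, ha⟩ := (fixes_nb_iff hA (D.w_ne i)).1 hn
  obtain ⟨b, hb⟩ := D.pres i
  -- Here `Y` has trace zero, its product with `A` has trace zero, and they share the eigenvector
  -- `w`. This gives `b (2a − tr A) = 0`, where the second factor is a square root of the nonzero
  -- discriminant.
  have h2 := trace_mul_of_eigenvector (D.w_ne i) ha hb
  rw [← redMat_mul, redMat_trace, htr A hA, map_zero, D.red_trace] at h2
  rw [disc_eq_sq (D.w_ne i) ha] at h1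
  have h3 : b * (2 * a - (redMat A.1).trace) = 0 := by linear_combination -h2
  rw [hb, (mul_eq_zero.1 h3).resolve_right (fun h => h1 (by rw [h]; ring)), zero_smul]

-- Since the two reductions are opposite, the symmetric form of `Y j` vanishes on `w i`, and `w j`
-- lies in its radical. These vectors form a basis.
omit hchar hρ in
theorem eq_zero_of_two {i j : I} (hij : i ≠ j) (hsum : redMat (D.Y i) + redMat (D.Y j) = 0)
    (hj : (redMat (D.Y j)).mulVec (D.w j) = 0) : redMat (D.Y j) = 0 := by
  have hi : redMat (D.Y i) = -redMat (D.Y j) := eq_neg_of_add_eq_zero_left hsum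
  have hw := D.dt_w_ne hij
  refine matrix_eq_zero_of_basis hw (eq_zero_of_dt hw ?_ ?_) hj
  · have := D.dt_pres i
    rw [hi, Matrix.neg_mulVec, ← neg_one_smul 𝓀[K], dt_smul_left] at this
    simpa using this
  · rw [D.red_symm, hj, dt_zero_left]

omit hchar hρ in
theorem sum_eq_of_subset [DecidableEq I] (J : Finset I) (hJ : ∀ i ∉ J, redMat (D.Y i) = 0) :
    ∑ i ∈ J, redMat (D.Y i) = 0 := by
  rw [← D.red_sum]
  exact Finset.sum_subset (Finset.subset_univ _) fun i _ hi => hJ i hi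

/-- A vertex whose stabilizer contains no wild element. -/
theorem red_eq_zero_of_no_wild (hno : ∀ n, ¬ IsWild (ρ n)) (i : I) : redMat (D.Y i) = 0 := by
  classical
  have := Fintype.ofFinite G
  let _ : MulAction G (Vertex K) := MulAction.compHom (Vertex K) ρ
  have hsm : ∀ (n : G) (Λ : Vertex K), n • Λ = ρ n • Λ := fun _ _ => rfl
  have hker : ∀ i, (redMat (D.Y i)).mulVec (D.w i) = 0 := fun i =>
    D.mulVec_eq_zero_of_tame hchar hρ fun n _ => hno n
  set J : Finset I := Finset.univ.filter fun i => redMat (D.Y i) ≠ 0 with hJ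
  have hJsum := D.sum_eq_of_subset J fun i hi => by simpa [hJ] using hi
  have hcard : J.card ≤ 3 := by
    have h := card_orbits_le_three (G := G) (ι := J) (w := fun i => nb (D.w i.1))
      (fun i j hij g => D.sep i.1 j.1 (fun h => hij (Subtype.ext h)) g)
      (P := fun Λ => (bruhatTits K).Adj (stdVertex K) Λ)
      (fun i g => by
        have := adj_smul (ρ g) (adj_nb (D.w_ne i.1))
        rwa [hρ.fixes] at this)
      (fun g hg a b c ha hb hc h1 h2 h3 => by
        obtain ⟨x, hx, rfl⟩ := exists_nb ha
        obtain ⟨y, hy, rfl⟩ := exists_nb hb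
        obtain ⟨z, hz, rfl⟩ := exists_nb hc
        by_contra! hne
        obtain ⟨A, hA⟩ := exists_intGL (hρ.fixes g)
        obtain ⟨s, hs⟩ := fixes_all_of_three hx hy hz hne.1 hne.2.1 hne.2.2 h1 h2 h3 hA
        exact hρ.disc_ne hchar hg (hno g) hA (by rw [hs, disc_smul_one]))
      (fun i => D.nontrivial_of_ne (Finset.mem_filter.1 i.2).2)
    rwa [Fintype.card_coe] at h
  by_contra hi
  have hiJ : i ∈ J := by simp [hJ, hi]
  have hec : (J.erase i).card ≤ 2 := by rw [Finset.card_erase_of_mem hiJ]; omega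
  rw [← Finset.add_sum_erase _ _ hiJ] at hJsum
  interval_cases h : (J.erase i).card
  · rw [Finset.card_eq_zero.1 h, Finset.sum_empty, add_zero] at hJsum
    exact hi hJsum
  · obtain ⟨j, hj⟩ := Finset.card_eq_one.1 h
    have hne : j ≠ i := (Finset.mem_erase.1 (hj ▸ Finset.mem_singleton_self j)).1
    rw [hj, Finset.sum_singleton, add_comm] at hJsum
    exact hi (D.eq_zero_of_two hne hJsum (hker i))
  · obtain ⟨j, l, hjl, hjl'⟩ := Finset.card_eq_two.1 h
    have hji : j ≠ i := (Finset.mem_erase.1 (hjl' ▸ Finset.mem_insert_self j _)).1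
    have hli : l ≠ i := (Finset.mem_erase.1
      (hjl' ▸ Finset.mem_insert_of_mem (Finset.mem_singleton_self l))).1
    rw [hjl', Finset.sum_pair hjl] at hJsum
    have hw := D.dt_w_ne hji
    -- With three edges every `Y` kills its own direction. As `Y i = −(Y j + Y l)`, the vector `Y i
    -- w_j` equals `−Y l w_j`; by symmetry of the forms it pairs to zero with the independent
    -- vectors `w_l` and `w_i`.
    refine hi (matrix_eq_zero_of_basis hw (eq_zero_of_dt (D.dt_w_ne hli) ?_ ?_) (hker i))
    · have e : redMat (D.Y i) = -(redMat (D.Y j) + redMat (D.Y l)) :=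
        eq_neg_of_add_eq_zero_left hJsum
      rw [e, Matrix.neg_mulVec, Matrix.add_mulVec, hker j, zero_add, ← neg_one_smul 𝓀[K],
        dt_smul_left, D.red_symm, hker l, dt_zero_left, mul_zero]
    · rw [D.red_symm, hker i, dt_zero_left]

/-- A vertex whose stabilizer contains wild elements, such that no wild element acts trivially on
the neighbours. -/
theorem red_eq_zero_of_faithful {n₀ : G} (hn₀ : IsWild (ρ n₀))
    (hone : ∀ n, IsWild (ρ n) → ∀ x y : Fin 2 → 𝓀[K], x ≠ 0 → y ≠ 0 → ρ n • nb x = nb x →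
      ρ n • nb y = nb y → nb x = nb y) (i : I) : redMat (D.Y i) = 0 := by
  classical
  have := Fintype.ofFinite G
  let _ : MulAction G (Vertex K) := MulAction.compHom (Vertex K) ρ
  have hsm : ∀ (n : G) (Λ : Vertex K), n • Λ = ρ n • Λ := fun _ _ => rfl
  obtain ⟨A₀, P, hAP, hP, hsq, hA₀⟩ := hn₀.exists_int (hρ.fixes n₀)
  obtain ⟨a, ha, hPa⟩ := exists_kernel_of_sq (P := redMat P) (by
    rw [← redMat_mul, hsq, redMat_zero])
  have hfa : ρ n₀ • nb a = nb a := (fixes_nb_iff hA₀ ha).2 ⟨1, by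
    rw [hAP, redMat_add, redMat_one, Matrix.add_mulVec, hPa, Matrix.one_mulVec, add_zero, one_smul]⟩
  set J' : Finset I := Finset.univ.filter fun i => redMat (D.Y i) ≠ 0 ∧
    ∀ g, ρ g • nb a ≠ nb (D.w i) with hJ'
  -- The index `none` stands for the direction fixed by the wild element `n₀`. It enters the count
  -- as an orbit with wild stabilizer even if no edge of the family points there.
  let w : Option J' → Vertex K := fun o => o.elim (nb a) fun i => nb (D.w i.1)
  have hw : ∀ o o', o ≠ o' → ∀ g : G, g • w o ≠ w o' := by
    rintro (_ | i) (_ | j) hne g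
    · exact absurd rfl hne
    · have := j.2
      simp only [hJ', Finset.mem_filter] at this
      exact this.2.2 g
    · have := i.2
      simp only [hJ', Finset.mem_filter] at this
      intro h
      exact this.2.2 g⁻¹ (by rw [map_inv, inv_smul_eq_iff]; exact h.symm)
    · exact D.sep i.1 j.1 (fun h => hne (congrArg some (Subtype.ext h))) g
  have hwP : ∀ o (g : G), (bruhatTits K).Adj (stdVertex K) (g • w o) := by
    have : ∀ (g : G) Λ, (bruhatTits K).Adj (stdVertex K) Λ →
        (bruhatTits K).Adj (stdVertex K) (g • Λ) := fun g Λ h => by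
      have := adj_smul (ρ g) h
      rwa [hρ.fixes] at this
    rintro (_ | i) g
    · exact this g _ (adj_nb ha)
    · exact this g _ (adj_nb (D.w_ne _))
  have hnt : ∀ o, ∃ g : G, g ≠ 1 ∧ g • w o = w o := by
    rintro (_ | i)
    · refine ⟨n₀, fun h => ?_, hfa⟩
      rw [h, map_one] at hn₀
      exact not_isWild_one hn₀
    · have := i.2
      simp only [hJ', Finset.mem_filter] at this
      exact D.nontrivial_of_ne this.2.1
  have count := card_orbits_le_of_wild hw (P := fun Λ => (bruhatTits K).Adj (stdVertex K) Λ) hwP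
    (W := fun g => IsWild (ρ g)) (by rw [map_one]; exact not_isWild_one)
    (fun g h hg => by rw [map_mul, map_mul, map_inv]; exact hg.conj _)
    (fun g hg Λ Λ' Λ'' hΛ hΛ' hΛ'' h1 h2 h3 => by
        obtain ⟨x, hx, rfl⟩ := exists_nb hΛ
        obtain ⟨y, hy, rfl⟩ := exists_nb hΛ'
        obtain ⟨z, hz, rfl⟩ := exists_nb hΛ''
        by_contra! hne
        by_cases hgw : IsWild (ρ g)
        · exact hne.1 (hone g hgw x y hx hy h1 h2)
        · obtain ⟨A, hA⟩ := exists_intGL (hρ.fixes g)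
          obtain ⟨s, hs⟩ := fixes_all_of_three hx hy hz hne.1 hne.2.1 hne.2.2 h1 h2 h3 hA
          exact hρ.disc_ne hchar hg hgw hA (by rw [hs, disc_smul_one]))
    (fun g hg Λ Λ' hΛ hΛ' h1 h2 => by
        obtain ⟨x, hx, rfl⟩ := exists_nb hΛ
        obtain ⟨y, hy, rfl⟩ := exists_nb hΛ'
        exact hone g hg x y hx hy h1 h2)
  have hcardO : Fintype.card (Option J') = J'.card + 1 := by
    rw [Fintype.card_option, Fintype.card_coe]
  have hJ'1 : J'.card ≤ 1 := by
    have h := count {none} ⟨none, by simp⟩ (fun o ho => by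
      rw [Finset.mem_singleton.1 ho]; exact ⟨n₀, hn₀, hfa⟩) hnt
    rw [hcardO, Finset.card_singleton] at h
    omega
  -- A wild element fixing this edge would produce a second wild orbit, and the count with both
  -- allows none.
  have htame : ∀ j ∈ J', (redMat (D.Y j)).mulVec (D.w j) = 0 := by
    intro j hj
    refine D.mulVec_eq_zero_of_tame hchar hρ fun n hn hnw => ?_
    have h := count {none, some ⟨j, hj⟩} ⟨none, by simp⟩ (fun o ho => by
      rcases Finset.mem_insert.1 ho with rfl | ho
      · exact ⟨n₀, hn₀, hfa⟩
      · rw [Finset.mem_singleton.1 ho]; exact ⟨n, hnw, hn⟩) hnt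
    rw [hcardO, Finset.card_pair (by simp)] at h
    have : 0 < J'.card := Finset.card_pos.2 ⟨j, hj⟩
    omega
  -- at most one further edge, in the orbit of the wild direction
  have hunique : ∀ i j, redMat (D.Y i) ≠ 0 → redMat (D.Y j) ≠ 0 → i ∉ J' → j ∉ J' → i = j := by
    intro i j hi hj hiJ hjJ
    simp only [hJ', Finset.mem_filter, Finset.mem_univ, true_and, not_and, not_forall, not_not]
      at hiJ hjJ
    obtain ⟨g, hg⟩ := hiJ hi
    obtain ⟨h, hh⟩ := hjJ hj
    by_contra hne
    refine D.sep i j hne (h * g⁻¹) ?_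
    rw [← hg, ← hh, map_mul, map_inv, mul_smul, inv_smul_smul]
  by_contra hi
  set J : Finset I := Finset.univ.filter fun i => redMat (D.Y i) ≠ 0 with hJ
  have hJsum := D.sum_eq_of_subset J fun i hi => by simpa [hJ] using hi
  have hiJ : i ∈ J := by simp [hJ, hi]
  have hne0 : ∀ j ∈ J, redMat (D.Y j) ≠ 0 := fun j hj => by simpa [hJ] using hj
  have hother : ∃ j ∈ J, j ≠ i := by
    by_contra! hno
    rw [Finset.eq_singleton_iff_unique_mem.2 ⟨hiJ, hno⟩, Finset.sum_singleton] at hJsum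
    exact hi hJsum
  obtain ⟨j, hj, hji⟩ := hother
  have hJ'u : ∀ a ∈ J', ∀ b ∈ J', a = b := Finset.card_le_one.1 hJ'1
  -- exactly one of `i`, `j` is tame, and there is no third one
  have key : ∀ i j, i ∈ J → j ∈ J → i ≠ j → i ∉ J' → j ∈ J' → False := by
    intro i j hi hj hij hiJ hjJ
    have hJe : J = {i, j} := by
      ext l
      rw [Finset.mem_insert, Finset.mem_singleton]
      constructor
      · intro hl
        by_cases hlJ : l ∈ J'
        · exact Or.inr (hJ'u _ hlJ _ hjJ)
        · exact Or.inl (hunique l i (hne0 l hl) (hne0 i hi) hlJ hiJ)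
      · rintro (rfl | rfl) <;> assumption
    rw [hJe, Finset.sum_pair hij] at hJsum
    exact hne0 j hj (D.eq_zero_of_two hij hJsum (htame j hjJ))
  by_cases h1 : i ∈ J' <;> by_cases h2 : j ∈ J'
  · exact hji (hJ'u _ h2 _ h1)
  · exact key j i hj hiJ hji h2 h1
  · exact key i j hiJ hj hji.symm h1 h2
  · exact hji (hunique j i (hne0 j hj) hi h2 h1)

end LocalEdges

end LocalEdges

/-! ### Vertices at which a wild element acts trivially on the neighbours -/

section WildKernel

variable {K : Type u} [Field K] [Valued K ℤᵐ⁰] [(Valued.v : Valuation K ℤᵐ⁰).IsNontrivial]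
  {G : Type*} [Group G] [Finite G] {ρ : G →* PGL(2, K)}

theorem commute_of_mk_eq {g h g' h' : GL (Fin 2) K}
    (hg : Matrix.ProjGenLinGroup.mk g = Matrix.ProjGenLinGroup.mk g')
    (hh : Matrix.ProjGenLinGroup.mk h = Matrix.ProjGenLinGroup.mk h') (hc : Commute g h) :
    Commute g' h' := by
  obtain ⟨u, rfl⟩ := Matrix.ProjGenLinGroup.mk_eq_mk_iff.1 hg
  obtain ⟨v, rfl⟩ := Matrix.ProjGenLinGroup.mk_eq_mk_iff.1 hh
  have key : ∀ (u : Kˣ) (x : GL (Fin 2) K),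
      Commute x (Matrix.GeneralLinearGroup.scalar (Fin 2) u) := fun u x => by
    have hc : Matrix.GeneralLinearGroup.scalar (Fin 2) u ∈ Subgroup.center (GL (Fin 2) K) := by
      rw [Matrix.GeneralLinearGroup.center_eq_range_scalar]
      exact ⟨u, rfl⟩
    exact Subgroup.mem_center_iff.1 hc x
  exact (hc.mul_right (key v _)).mul_left ((key u _).symm.mul_right (key v _))

theorem dt_ofInt (x y : Fin 2 → 𝒪[K]) : dt (ofInt x) (ofInt y) = (dt x y : 𝒪[K]) := rfl

theorem dt_redVec (x y : Fin 2 → 𝒪[K]) :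
    dt (redVec x) (redVec y) = IsLocalRing.residue 𝒪[K] (dt x y) := by
  simp [dt, redVec]

theorem mk_eq_one_of_scalar {g : GL (Fin 2) K} {a : K} (h : g.1 = a • 1) :
    Matrix.ProjGenLinGroup.mk g = 1 := by
  have ha : a ≠ 0 := by
    rintro rfl
    have := g.isUnit.ne_zero
    exact this (by rw [h, zero_smul])
  rw [← map_one Matrix.ProjGenLinGroup.mk]
  refine (Matrix.ProjGenLinGroup.mk_eq_mk_iff.2 ⟨Units.mk0 a ha, Units.ext ?_⟩).symm
  rw [h, one_mul]
  ext i j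
  fin_cases i <;> fin_cases j <;> simp [Matrix.GeneralLinearGroup.scalar, Matrix.scalar]

theorem mk_scalar_smul {g g' : GL (Fin 2) K}
    (h : Matrix.ProjGenLinGroup.mk g = Matrix.ProjGenLinGroup.mk g') :
    ∃ c : K, c ≠ 0 ∧ g'.1 = c • g.1 := by
  obtain ⟨u, rfl⟩ := Matrix.ProjGenLinGroup.mk_eq_mk_iff.1 h
  refine ⟨u, u.ne_zero, ?_⟩
  rw [Units.val_mul]
  ext i j
  fin_cases i <;> fin_cases j <;>
    simp [Matrix.GeneralLinearGroup.scalar, Matrix.scalar, mul_comm]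

variable (hchar : ringChar 𝓀[K] = ringChar K) (hρ : IsLocalAction ρ)
include hchar hρ

/-- If a wild element acts trivially modulo the maximal ideal, then all unipotent elements have
the same fixed line. -/
theorem IsLocalAction.unipotent_mulVec {n₀ : G} {A₀ : GL (Fin 2) 𝒪[K]}
    {P₀ : Matrix (Fin 2) (Fin 2) 𝒪[K]} (hA₀ : ρ n₀ = Matrix.ProjGenLinGroup.mk (intGL A₀))
    (hAP₀ : A₀.1 = 1 + P₀) (hsq₀ : P₀ * P₀ = 0) (hP₀ : P₀ ≠ 0) (hred : redMat P₀ = 0)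
    {u : Fin 2 → K} (hu : u ≠ 0) (hPu : (P₀.map (algebraMap 𝒪[K] K)).mulVec u = 0)
    {n : G} {g : GL (Fin 2) K} (hg : Matrix.ProjGenLinGroup.mk g = ρ n)
    (hgu : (g.1 - 1) * (g.1 - 1) = 0) : g.1.mulVec u = u := by
  by_cases hg1 : g.1 = 1
  · rw [hg1, Matrix.one_mulVec]
  obtain ⟨A, P, hAP, hP, hsq, hA⟩ := IsWild.exists_int ⟨g, hg, hgu, hg1⟩ (hρ.fixes n)
  have hPK : (P.map (algebraMap 𝒪[K] K)) * (P.map (algebraMap 𝒪[K] K)) = 0 := by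
    rw [← Matrix.map_mul, hsq, Matrix.map_zero _ (map_zero _)]
  have hPK₀ : (P₀.map (algebraMap 𝒪[K] K)) * (P₀.map (algebraMap 𝒪[K] K)) = 0 := by
    rw [← Matrix.map_mul, hsq₀, Matrix.map_zero _ (map_zero _)]
  have hP₀' : P₀.map (algebraMap 𝒪[K] K) ≠ 0 := fun h => hP₀ (by
    ext i j
    exact congrFun₂ h i j)
  obtain ⟨ht, hd⟩ := trace_eq_zero_of_sq hPK
  obtain ⟨ht₀, hd₀⟩ := trace_eq_zero_of_sq hPK₀
  set a := P.map (algebraMap 𝒪[K] K) with ha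
  set a₀ := P₀.map (algebraMap 𝒪[K] K) with ha₀
  have hC : (intGL (A₀ * A)).1 = (1 + a₀) * (1 + a) := by
    rw [map_mul, Units.val_mul, intGL_val, intGL_val, hAP, hAP₀, Matrix.map_add _ (map_add _),
      Matrix.map_add _ (map_add _), Matrix.map_one _ (map_zero _) (map_one _)]
  have htrC : (intGL (A₀ * A)).1.trace = 2 + (a₀ * a).trace := by
    rw [hC, show (1 + a₀) * (1 + a) = 1 + a₀ + a + a₀ * a by noncomm_ring, Matrix.trace_add,
      Matrix.trace_add, Matrix.trace_add, ht, ht₀, Matrix.trace_one]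
    simp
  have hdet1 : ∀ b : Matrix (Fin 2) (Fin 2) K, b.trace = 0 → b.det = 0 → (1 + b).det = 1 := by
    intro b h1 h2
    rw [Matrix.trace_fin_two] at h1
    rw [Matrix.det_fin_two] at h2 ⊢
    simp only [Matrix.add_apply, Matrix.one_apply_eq, ne_eq, zero_ne_one, not_false_eq_true,
      Matrix.one_apply_ne, one_ne_zero, zero_add]
    linear_combination h1 + h2
  have hdetC : (intGL (A₀ * A)).1.det = 1 := by
    rw [hC, Matrix.det_mul, hdet1 _ ht₀ hd₀, hdet1 _ ht hd, one_mul]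
  have hx : IsLocalRing.residue 𝒪[K] (P₀ * P).trace = 0 := by
    rw [← redMat_trace, redMat_mul, hred, zero_mul, Matrix.trace_zero]
  have hxK : ((P₀ * P).trace : K) = (a₀ * a).trace := by
    rw [ha, ha₀, ← Matrix.map_mul, Matrix.trace_fin_two, Matrix.trace_fin_two]; rfl
  set x : K := (a₀ * a).trace with hxdef
  have hdiscK : ((disc (A₀ * A).1 : 𝒪[K]) : K) = disc (intGL (A₀ * A)).1 := by
    unfold disc
    rw [Matrix.trace_fin_two, Matrix.trace_fin_two, Matrix.det_fin_two, Matrix.det_fin_two]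
    rfl
  -- The product of the two unipotent matrices has discriminant `x (x + 4)` with `x = tr(P₀ P)`.
  -- This reduces to zero because `P₀` does, so the eigenvalues of the product coincide and `x (x +
  -- 4) = 0`.
  have hdiscx : disc (A₀ * A).1 = (P₀ * P).trace * ((P₀ * P).trace + 4) := by
    apply Subtype.ext
    rw [hdiscK]
    change disc _ = ((P₀ * P).trace : K) * (((P₀ * P).trace : K) + 4)
    rw [hxK]
    unfold disc
    rw [htrC, hdetC]; ring
  obtain ⟨k, hk, hk1⟩ := isOfFinOrder_iff_pow_eq_one.1 (isOfFinOrder_of_finite (n₀ * n))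
  have hρC : ρ (n₀ * n) = Matrix.ProjGenLinGroup.mk (intGL (A₀ * A)) := by
    rw [map_mul, map_mul, map_mul, hA₀, hA]
  have hx0 : x = 0 := by
    rcases disc_dichotomy hchar hk (A := A₀ * A) (by rw [← hρC, ← map_pow, hk1, map_one])
      (hρ.splits _ _ hρC.symm) with h | ⟨l, -, hl⟩
    · rw [hdiscx, map_mul, hx, zero_mul] at h
      exact absurd rfl h
    · obtain ⟨h1, h2⟩ := trace_eq_zero_of_sq hl
      have h0 : disc (intGL (A₀ * A)).1 = 0 := by
        rw [Matrix.trace_fin_two] at h1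
        rw [Matrix.det_fin_two] at h2
        unfold disc
        rw [Matrix.trace_fin_two, Matrix.det_fin_two]
        simp only [Matrix.sub_apply, Matrix.smul_apply, Matrix.one_apply_eq, smul_eq_mul, mul_one,
          ne_eq, zero_ne_one, not_false_eq_true, Matrix.one_apply_ne, mul_zero, sub_zero,
          one_ne_zero] at h1 h2
        linear_combination ((intGL (A₀ * A)).1 0 0 + (intGL (A₀ * A)).1 1 1 - 2 * l) * h1 - 4 * h2
      rw [← hdiscK, hdiscx] at h0
      rcases mul_eq_zero.1 (Subtype.ext h0 :
        (P₀ * P).trace * ((P₀ * P).trace + 4) = 0) with h | h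
      · rw [← hxK, h]; rfl
      -- In this case `x = −4`. Since `x` reduces to zero, so does 4; the characteristics agree, so
      -- 4 = 0 in `K` as well.
      · have h4 : (4 : 𝓀[K]) = 0 := by
          have := congrArg (IsLocalRing.residue 𝒪[K]) h
          rwa [map_add, hx, zero_add, map_ofNat, map_zero] at this
        have h4K : (4 : K) = 0 := by
          have := (ringChar.spec 𝓀[K] 4).1 (by exact_mod_cast h4)
          rw [hchar] at this
          exact_mod_cast (ringChar.spec K 4).2 this
        rw [← hxK, eq_neg_of_add_eq_zero_left h]
        change -(4 : K) = 0
        rw [h4K, neg_zero]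
  -- Vanishing of the trace of `a₀ a` means that `a` preserves the line of `u`, on which a nilpotent
  -- matrix acts by zero.
  have hau : a.mulVec u = 0 := by
    obtain ⟨c, hc, -, htr⟩ := nilpotent_mulVec hP₀' hPK₀ hu hPu
    have h1 := htr a
    rw [← hxdef, hx0, eq_comm, mul_eq_zero] at h1
    obtain ⟨e, he⟩ := (dt_eq_zero_iff hu).1 (h1.resolve_left hc)
    have h2 : a.mulVec (a.mulVec u) = 0 := by rw [Matrix.mulVec_mulVec, hPK, Matrix.zero_mulVec]
    rw [he, Matrix.mulVec_smul, he, smul_smul] at h2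
    have h3 : e = 0 := mul_self_eq_zero.1 ((smul_eq_zero.1 h2).resolve_right hu)
    rw [he, h3, zero_smul]
  obtain ⟨c, hc, hgc⟩ := mk_scalar_smul (hA.symm.trans hg.symm)
  have hgu' : g.1.mulVec u = c • u := by
    rw [hgc, Matrix.smul_mulVec, intGL_val, hAP, Matrix.map_add _ (map_add _),
      Matrix.map_one _ (map_zero _) (map_one _), Matrix.add_mulVec, Matrix.one_mulVec]
    change c • (u + a.mulVec u) = _
    rw [hau, add_zero]
  have h1 : (g.1 - 1).mulVec u = (c - 1) • u := by
    rw [Matrix.sub_mulVec, hgu', Matrix.one_mulVec, sub_smul, one_smul]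
  have h2 : (g.1 - 1).mulVec ((g.1 - 1).mulVec u) = 0 := by
    rw [Matrix.mulVec_mulVec, hgu, Matrix.zero_mulVec]
  rw [h1, Matrix.mulVec_smul, h1, smul_smul] at h2
  have h3 : c - 1 = 0 := mul_self_eq_zero.1 ((smul_eq_zero.1 h2).resolve_right hu)
  rw [hgu', sub_eq_zero.1 h3, one_smul]

/-- Under the assumptions of `IsLocalAction.unipotent_mulVec` the whole group fixes this line. -/
theorem IsLocalAction.mulVec_eq_smul {n₀ : G} {A₀ : GL (Fin 2) 𝒪[K]}
    {P₀ : Matrix (Fin 2) (Fin 2) 𝒪[K]} (hA₀ : ρ n₀ = Matrix.ProjGenLinGroup.mk (intGL A₀))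
    (hAP₀ : A₀.1 = 1 + P₀) (hsq₀ : P₀ * P₀ = 0) (hP₀ : P₀ ≠ 0) (hred : redMat P₀ = 0)
    {u : Fin 2 → K} (hu : u ≠ 0) (hPu : (P₀.map (algebraMap 𝒪[K] K)).mulVec u = 0)
    {n : G} {g : GL (Fin 2) K} (hg : Matrix.ProjGenLinGroup.mk g = ρ n) :
    ∃ a : K, g.1.mulVec u = a • u := by
  set a₀ := P₀.map (algebraMap 𝒪[K] K) with ha₀
  have hPK₀ : a₀ * a₀ = 0 := by
    rw [ha₀, ← Matrix.map_mul, hsq₀, Matrix.map_zero _ (map_zero _)]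
  have hP₀' : a₀ ≠ 0 := fun h => hP₀ (by
    ext i j
    exact congrFun₂ h i j)
  have hA₀v : (intGL A₀).1 = 1 + a₀ := by
    rw [intGL_val, hAP₀, Matrix.map_add _ (map_add _), Matrix.map_one _ (map_zero _) (map_one _)]
  have hi : (g⁻¹).1 * g.1 = 1 := by rw [← Units.val_mul, inv_mul_cancel, Units.val_one]
  have hi' : g.1 * (g⁻¹).1 = 1 := by rw [← Units.val_mul, mul_inv_cancel, Units.val_one]
  -- The conjugate of `A₀` by `g⁻¹` is unipotent and so fixes `u`; equivalently, `g u` lies in the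
  -- kernel of `a₀`, which is the line of `u`.
  have e : (g⁻¹ * intGL A₀ * g).1 - 1 = (g⁻¹).1 * a₀ * g.1 := by
    rw [Units.val_mul, Units.val_mul, hA₀v, mul_add, add_mul, mul_one, hi, add_sub_cancel_left]
  have h := hρ.unipotent_mulVec hchar hA₀ hAP₀ hsq₀ hP₀ hred hu hPu (n := n⁻¹ * n₀ * n)
    (g := g⁻¹ * intGL A₀ * g) (by simp only [map_mul, map_inv, hg, hA₀]) (by
      rw [e]
      calc _ = (g⁻¹).1 * a₀ * (g.1 * (g⁻¹).1) * a₀ * g.1 := by noncomm_ring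
        _ = (g⁻¹).1 * (a₀ * a₀) * g.1 := by rw [hi']; noncomm_ring
        _ = 0 := by rw [hPK₀]; simp)
  have h1 : ((g⁻¹ * intGL A₀ * g).1 - 1).mulVec u = 0 := by
    rw [Matrix.sub_mulVec, h, Matrix.one_mulVec, sub_self]
  rw [e, ← Matrix.mulVec_mulVec, ← Matrix.mulVec_mulVec] at h1
  have h2 : a₀.mulVec (g.1.mulVec u) = 0 := by
    have := congrArg g.1.mulVec h1
    rwa [Matrix.mulVec_mulVec, hi', Matrix.one_mulVec, Matrix.mulVec_zero] at this
  obtain ⟨c, hc, hz, -⟩ := nilpotent_mulVec hP₀' hPK₀ hu hPu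
  rw [hz, smul_eq_zero, mul_eq_zero] at h2
  exact (dt_eq_zero_iff hu).1 ((h2.resolve_right hu).resolve_left hc)

/-- An edge that starts at a vertex with a nonzero reduced endomorphism: the vertex has a
distinguished line, and some edge in another direction has a nonzero eigenvalue. -/
theorem LocalEdges.exists_down {I : Type*} [Fintype I] (D : LocalEdges ρ I) {i₀ : I}
    (hi₀ : redMat (D.Y i₀) ≠ 0) :
    (∃ (n : G) (g : GL (Fin 2) K), Matrix.ProjGenLinGroup.mk g = ρ n ∧
      (g.1 - 1) * (g.1 - 1) = 0 ∧ g.1 ≠ 1 ∧ ∀ i j, Valued.v ((g.1 - 1) i j) < 1) ∧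
    ∃ U : Fin 2 → 𝒪[K], redVec U ≠ 0 ∧
      (∀ (n : G) (g : GL (Fin 2) K), Matrix.ProjGenLinGroup.mk g = ρ n →
        (g.1 - 1) * (g.1 - 1) = 0 → g.1.mulVec (ofInt U) = ofInt U) ∧
      ∃ i, dt (redVec U) (D.w i) ≠ 0 ∧ (redMat (D.Y i)).mulVec (D.w i) ≠ 0 := by
  classical
  -- The two previous vanishing results exclude groups without wild elements and groups in which
  -- each wild element fixes at most one neighbour. A wild element that fixes two neighbours is
  -- trivial modulo the maximal ideal.
  have hex : ∃ n₀, IsWild (ρ n₀) := by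
    by_contra! hno
    exact hi₀ (D.red_eq_zero_of_no_wild hchar hρ hno i₀)
  obtain ⟨m₀, hm₀⟩ := hex
  have hex : ∃ n₀, IsWild (ρ n₀) ∧ ∃ x y : Fin 2 → 𝓀[K], x ≠ 0 ∧ y ≠ 0 ∧ ρ n₀ • nb x = nb x ∧
      ρ n₀ • nb y = nb y ∧ nb x ≠ nb y := by
    by_contra! hno
    exact hi₀ (D.red_eq_zero_of_faithful hchar hρ hm₀
      (fun n hn x y hx hy h1 h2 => hno n hn x y hx hy h1 h2) i₀)
  obtain ⟨n₀, hn₀, x, y, hx, hy, hfx, hfy, hxy⟩ := hex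
  obtain ⟨A₀, P₀, hAP₀, hP₀, hsq₀, hA₀⟩ := hn₀.exists_int (hρ.fixes n₀)
  have hPbar : ∀ z : Fin 2 → 𝓀[K], z ≠ 0 → ρ n₀ • nb z = nb z → (redMat P₀).mulVec z = 0 := by
    intro z hz hfz
    obtain ⟨c, hc⟩ := (fixes_nb_iff hA₀ hz).1 hfz
    rw [hAP₀, redMat_add, redMat_one, Matrix.add_mulVec, Matrix.one_mulVec] at hc
    have h1 : (redMat P₀).mulVec z = (c - 1) • z := by
      rw [sub_smul, one_smul, ← hc]; abel
    have h2 : (redMat P₀).mulVec ((redMat P₀).mulVec z) = 0 := by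
      rw [Matrix.mulVec_mulVec, ← redMat_mul, hsq₀, redMat_zero, Matrix.zero_mulVec]
    rw [h1, Matrix.mulVec_smul, h1, smul_smul] at h2
    have h3 : c - 1 = 0 := mul_self_eq_zero.1 ((smul_eq_zero.1 h2).resolve_right hz)
    rw [h1, h3, zero_smul]
  have hred : redMat P₀ = 0 :=
    matrix_eq_zero_of_basis ((nb_ne_iff hx hy).1 hxy) (hPbar x hx hfx) (hPbar y hy hfy)
  set a₀ := P₀.map (algebraMap 𝒪[K] K) with ha₀
  have hPK₀ : a₀ * a₀ = 0 := by
    rw [ha₀, ← Matrix.map_mul, hsq₀, Matrix.map_zero _ (map_zero _)]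
  have hP₀' : a₀ ≠ 0 := fun h => hP₀ (by
    ext i j
    exact congrFun₂ h i j)
  have hA₀v : (intGL A₀).1 = 1 + a₀ := by
    rw [intGL_val, hAP₀, Matrix.map_add _ (map_add _), Matrix.map_one _ (map_zero _) (map_one _)]
  obtain ⟨u₀, hu₀, hPu₀⟩ := exists_kernel_of_sq hPK₀
  obtain ⟨U, hU, hUu, -⟩ := exists_redVec_dir (Projectivization.mk K u₀ hu₀)
  obtain ⟨c₀, hc₀⟩ := (Projectivization.mk_eq_mk_iff' K _ _ _ _).1 hUu.symm
  have hu := ofInt_ne_zero hU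
  set u := ofInt U with hudef
  have hPu : a₀.mulVec u = 0 := by rw [← hc₀, Matrix.mulVec_smul, hPu₀, smul_zero]
  have hunip : ∀ (n : G) (g : GL (Fin 2) K), Matrix.ProjGenLinGroup.mk g = ρ n →
      (g.1 - 1) * (g.1 - 1) = 0 → g.1.mulVec u = u := fun n g hg h =>
    hρ.unipotent_mulVec hchar hA₀ hAP₀ hsq₀ hP₀ hred hu hPu hg h
  have hline : ∀ (n : G) (g : GL (Fin 2) K), Matrix.ProjGenLinGroup.mk g = ρ n →
      ∃ a : K, g.1.mulVec u = a • u := fun n g hg =>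
    hρ.mulVec_eq_smul hchar hA₀ hAP₀ hsq₀ hP₀ hred hu hPu hg
  have hfixu : ∀ n, ρ n • nb (redVec U) = nb (redVec U) := by
    intro n
    obtain ⟨A, hA⟩ := exists_intGL (hρ.fixes n)
    obtain ⟨a, ha⟩ := hline n _ hA.symm
    have h1 : dt u ((intGL A).1.mulVec u) = 0 := by rw [ha, dt_smul_right, dt_self, mul_zero]
    rw [intGL_val, hudef, ← ofInt_mulVec, dt_ofInt] at h1
    have h2 : dt U (A.1.mulVec U) = 0 := Subtype.ext h1
    rw [fixes_nb_iff hA hU, ← dt_eq_zero_iff hU]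
    have h3 := dt_redVec U (A.1.mulVec U)
    rw [h2, map_zero, redVec_mulVec] at h3
    exact h3
  have hfix₀ : ∀ z : Fin 2 → 𝓀[K], z ≠ 0 → ρ n₀ • nb z = nb z := fun z hz =>
    (fixes_nb_iff hA₀ hz).2 ⟨1, by
      rw [hAP₀, redMat_add, redMat_one, hred, add_zero, Matrix.one_mulVec, one_smul]⟩
  refine ⟨⟨n₀, intGL A₀, hA₀.symm, by rw [hA₀v, add_sub_cancel_left, hPK₀], fun h => hP₀' (by
      rw [hA₀v] at h; simpa using h), fun i j => by
      rw [hA₀v, add_sub_cancel_left]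
      exact (residue_eq_zero_iff_v_lt _).1 (congrFun₂ hred i j)⟩, U, hU, hunip, ?_⟩
  -- Suppose that each `Y i` with direction off the line `U` kills its direction. The proof shows
  -- that the symmetric form of every `Y i` vanishes on `U`, and then that all `Y i` vanish.
  by_contra! hdown
  -- the value of the symmetric form on the distinguished line
  have hcomm : ∀ i, CommStab ρ (nb (D.w i)) →
      dt (redVec U) ((redMat (D.Y i)).mulVec (redVec U)) = 0 := by
    intro i hcs
    by_cases h0 : redMat (D.Y i) = 0
    · rw [h0, Matrix.zero_mulVec, dt_swap, dt_zero_left, neg_zero]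
    obtain ⟨n, hn1, hn, htr⟩ := D.of_comm i hcs (D.nontrivial_of_ne h0)
    obtain ⟨A, hA⟩ := exists_intGL (hρ.fixes n)
    -- The element `n₀` fixes every neighbour, so it lies in this commutative stabilizer and
    -- commutes with `A`. Hence both eigenvalues of `A` equal its eigenvalue at `u`.
    have hAA₀ := hcs n n₀ hn (hfix₀ _ (D.w_ne i)) _ _ hA.symm hA₀.symm
    obtain ⟨a, ha⟩ := hline n _ hA.symm
    obtain ⟨z, hz⟩ := exists_dt_ne_zero hu
    obtain ⟨c, hc, hcz, -⟩ := nilpotent_mulVec hP₀' hPK₀ hu hPu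
    have hcommK : (intGL A).1 * a₀ = a₀ * (intGL A).1 := by
      have := congrArg Units.val hAA₀
      rw [Units.val_mul, Units.val_mul, hA₀v, mul_add, add_mul, mul_one, one_mul] at this
      exact add_left_cancel this
    have h1 : dt u ((intGL A).1.mulVec z) = a * dt u z := by
      have h := congrArg (fun M => Matrix.mulVec M z) hcommK
      simp only [← Matrix.mulVec_mulVec] at h
      rw [hcz z, hcz, Matrix.mulVec_smul, ha, smul_smul] at h
      have := smul_left_injective K hu h
      have : c * (dt u z * a) = c * dt u ((intGL A).1.mulVec z) := by rw [← this]; ring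
      rw [← mul_left_cancel₀ hc this, mul_comm]
    have htrA : (intGL A).1.trace = 2 * a := by
      have := dt_mulVec_add (intGL A).1 u z
      rw [ha, h1, dt_smul_left] at this
      exact mul_right_cancel₀ hz (by rw [← this]; ring)
    -- `Q` is a nonzero nilpotent matrix that kills `u`. As `Y i` is orthogonal to `A` and to
    -- scalars, it is orthogonal to `Q`, which says that its form vanishes on `u`.
    set Q : Matrix (Fin 2) (Fin 2) K := (intGL A).1 - a • 1 with hQ
    have hQu : Q.mulVec u = 0 := by
      rw [hQ, Matrix.sub_mulVec, ha, Matrix.smul_mulVec, Matrix.one_mulVec, sub_self]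
    have hQ0 : Q ≠ 0 := fun h =>
      hn1 (hρ.injective (by rw [hA, map_one, mk_eq_one_of_scalar (sub_eq_zero.1 h)]))
    have hQsq : Q * Q = 0 := sq_eq_zero_of_trace_det (by
      rw [hQ, Matrix.trace_sub, htrA, Matrix.trace_smul, Matrix.trace_one]
      simp [mul_comm]) (Matrix.exists_mulVec_eq_zero_iff.1 ⟨u, hu, hQu⟩)
    obtain ⟨c', hc', -, h2⟩ := nilpotent_mulVec hQ0 hQsq hu hQu
    set y := (D.Y i).map (algebraMap 𝒪[K] K) with hy
    have hytr : y.trace = 0 := by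
      have := congrArg (algebraMap 𝒪[K] K) (D.trace_Y i)
      rw [Matrix.trace_fin_two, map_add, map_zero] at this
      rw [Matrix.trace_fin_two]
      exact this
    have hyA : (y * (intGL A).1).trace = 0 := by
      have := congrArg (algebraMap 𝒪[K] K) (htr A hA)
      rw [hy, intGL_val, ← Matrix.map_mul]
      rw [Matrix.trace_fin_two, map_add, map_zero] at this
      rw [Matrix.trace_fin_two]
      exact this
    have h3 := h2 y
    rw [hQ, sub_mul, Matrix.trace_sub, Matrix.trace_mul_comm, hyA, Matrix.smul_mul, one_mul,
      Matrix.trace_smul, hytr, smul_zero, sub_zero, eq_comm, mul_eq_zero] at h3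
    have h4 := h3.resolve_left hc'
    rw [hy, hudef, ← ofInt_mulVec, dt_ofInt] at h4
    have h5 := dt_redVec U ((D.Y i).mulVec U)
    rw [(Subtype.ext h4 : dt U ((D.Y i).mulVec U) = 0), map_zero, redVec_mulVec] at h5
    exact h5
  have hup : ∀ i, dt (redVec U) (D.w i) = 0 →
      dt (redVec U) ((redMat (D.Y i)).mulVec (redVec U)) = 0 := by
    intro i hi
    obtain ⟨c, hc⟩ := (dt_eq_zero_iff hU).1 hi
    have hc0 : c ≠ 0 := by
      rintro rfl
      exact D.w_ne i (by rw [hc, zero_smul])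
    have h := D.dt_pres i
    rw [hc, Matrix.mulVec_smul, dt_smul_left, dt_smul_right] at h
    rw [dt_swap]
    simpa [hc0] using h
  -- At most one edge off the line `U` has a stabilizer that is not commutative. Let `Z` be the
  -- kernel of the action on neighbours. All elements fix `nb (redVec U)`, so an element outside `Z`
  -- fixes at most one other neighbour and `same_orbit_of_fixed_le_one` applies.
  have hstab : ∀ i j, dt (redVec U) (D.w i) ≠ 0 → dt (redVec U) (D.w j) ≠ 0 →
      ¬ CommStab ρ (nb (D.w i)) → ¬ CommStab ρ (nb (D.w j)) → i = j := by
    intro i j hi hj hci hcj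
    have := Fintype.ofFinite G
    let _ : MulAction G (Vertex K) := MulAction.compHom (Vertex K) ρ
    let Z : Subgroup G :=
      { carrier := {n | ∀ z : Fin 2 → 𝓀[K], z ≠ 0 → ρ n • nb z = nb z}
        one_mem' := fun z _ => by rw [map_one, one_smul]
        mul_mem' := fun {a b} ha hb z hz => by rw [map_mul, mul_smul, hb z hz, ha z hz]
        inv_mem' := fun {a} ha z hz => by rw [map_inv, inv_smul_eq_iff, ha z hz] }
    -- Elements of `Z` reduce to scalars, so they are trivial or wild; their unipotent
    -- representatives share the fixed line of `u` and commute. A noncommutative stabilizer is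
    -- therefore not contained in `Z`.
    have hout : ∀ i, ¬ CommStab ρ (nb (D.w i)) → ∃ s ∉ Z, ρ s • nb (D.w i) = nb (D.w i) := by
      intro i hci
      by_contra! hall
      have hZ : ∀ s, ρ s • nb (D.w i) = nb (D.w i) → s ∈ Z := fun s hs => by
        by_contra h; exact hall s h hs
      have huni : ∀ s, s ∈ Z → ∃ g : GL (Fin 2) K, Matrix.ProjGenLinGroup.mk g = ρ s ∧
          (g.1 - 1) * (g.1 - 1) = 0 := by
        intro s hs
        by_cases hs1 : s = 1
        · exact ⟨1, by rw [hs1, map_one, map_one], by simp⟩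
        by_cases hw : IsWild (ρ s)
        · obtain ⟨g, h1, h2, -⟩ := hw
          exact ⟨g, h1, h2⟩
        obtain ⟨A, hA⟩ := exists_intGL (hρ.fixes s)
        have he : ∀ z : Fin 2 → 𝓀[K], z ≠ 0 → ∃ c : 𝓀[K], (redMat A.1).mulVec z = c • z :=
          fun z hz => (fixes_nb_iff hA hz).1 (hs z hz)
        obtain ⟨b, hb⟩ := scalar_of_three_eigenvectors (M := redMat A.1) (x := ![1, 0])
          (y := ![0, 1]) (z := ![1, 1]) (by simp [dt]) (by simp [dt]) (by simp [dt])
          (he _ fun h => by simpa using congrFun h 0) (he _ fun h => by simpa using congrFun h 1)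
          (he _ fun h => by simpa using congrFun h 0)
        exact absurd (by rw [hb, disc_smul_one]) (hρ.disc_ne hchar hs1 hw hA)
      refine hci fun n m hn hm g h hg hh => ?_
      obtain ⟨g', hg', hgu⟩ := huni n (hZ n hn)
      obtain ⟨h', hh', hhu⟩ := huni m (hZ m hm)
      refine commute_of_mk_eq (hg'.trans hg.symm) (hh'.trans hh.symm) (Units.ext ?_)
      have e1 : (g'.1 - 1).mulVec u = 0 := by
        rw [Matrix.sub_mulVec, hunip n g' hg' hgu, Matrix.one_mulVec, sub_self]
      have e2 : (h'.1 - 1).mulVec u = 0 := by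
        rw [Matrix.sub_mulVec, hunip m h' hh' hhu, Matrix.one_mulVec, sub_self]
      have e3 : ∀ a b : Matrix (Fin 2) (Fin 2) K, a * a = 0 → b * b = 0 → a.mulVec u = 0 →
          b.mulVec u = 0 → a * b = 0 := by
        intro a b ha hb hau hbu
        by_cases hb0 : b = 0
        · rw [hb0, mul_zero]
        obtain ⟨c, -, hz, -⟩ := nilpotent_mulVec hb0 hb hu hbu
        refine Matrix.ext_of_mulVec_single fun i => ?_
        rw [← Matrix.mulVec_mulVec, hz, Matrix.mulVec_smul, hau, smul_zero, Matrix.zero_mulVec]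
      have e4 := e3 _ _ hgu hhu e1 e2
      have e5 := e3 _ _ hhu hgu e2 e1
      rw [Units.val_mul, Units.val_mul, ← sub_eq_zero]
      calc _ = (g'.1 - 1) * (h'.1 - 1) - (h'.1 - 1) * (g'.1 - 1) := by noncomm_ring
        _ = 0 := by rw [e4, e5, sub_zero]
    by_contra hij
    obtain ⟨n, hn⟩ := same_orbit_of_fixed_le_one (G := G)
      (P := fun Λ => (bruhatTits K).Adj (stdVertex K) Λ ∧ Λ ≠ nb (redVec U))
      (fun g Λ h => ⟨by
        have := adj_smul (ρ g) h.1
        rwa [hρ.fixes] at this, fun h2 => h.2 (smul_left_cancel (ρ g) (h2.trans (hfixu g).symm))⟩)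
      Z (fun g hg a b ha hb h1 h2 => by
        obtain ⟨x, hx, rfl⟩ := exists_nb ha.1
        obtain ⟨y, hy, rfl⟩ := exists_nb hb.1
        by_contra hne
        obtain ⟨A, hA⟩ := exists_intGL (hρ.fixes g)
        obtain ⟨s, hs⟩ := fixes_all_of_three hx hy hU hne ha.2 hb.2 h1 h2 (hfixu g) hA
        exact hg fun z hz => (fixes_nb_iff hA hz).2 ⟨s, by
          rw [hs, Matrix.smul_mulVec, Matrix.one_mulVec]⟩)
      (a := nb (D.w i)) (b := nb (D.w j))
      ⟨adj_nb (D.w_ne i), fun h => (nb_ne_iff hU (D.w_ne i)).2 hi h.symm⟩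
      ⟨adj_nb (D.w_ne j), fun h => (nb_ne_iff hU (D.w_ne j)).2 hj h.symm⟩
      (fun z hz => hz _ (D.w_ne i)) (fun z hz => hz _ (D.w_ne j)) (hout i hci) (hout j hcj)
    exact D.sep i j hij n hn
  -- The values of the forms on `U` add up to zero, and at most one of them could be nonzero.
  have hzero : ∀ i, dt (redVec U) ((redMat (D.Y i)).mulVec (redVec U)) = 0 := by
    intro i
    by_contra hi
    have hsum : ∑ j, dt (redVec U) ((redMat (D.Y j)).mulVec (redVec U)) = 0 := by
      have h : dt (redVec U) ((∑ j, redMat (D.Y j)).mulVec (redVec U)) = 0 := by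
        rw [D.red_sum, Matrix.zero_mulVec, dt_swap, dt_zero_left, neg_zero]
      rw [← h]
      simp only [dt, Matrix.mulVec, dotProduct, Fin.sum_univ_two, Matrix.sum_apply,
        Finset.sum_sub_distrib, Finset.mul_sum, Finset.sum_add_distrib, mul_add, Finset.sum_mul]
    rw [Finset.sum_eq_single i (fun j _ hji => ?_) (by simp)] at hsum
    · exact hi hsum
    · by_contra hj
      exact hji (hstab j i (fun h => hj (hup j h)) (fun h => hi (hup i h))
        (fun h => hj (hcomm j h)) (fun h => hi (hcomm i h)))
  have hdz : ∀ i, dt (redVec U) (D.w i) ≠ 0 → redMat (D.Y i) = 0 := by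
    intro i hi
    refine matrix_eq_zero_of_basis hi (eq_zero_of_dt hi ?_ ?_) (hdown i hi)
    · rw [dt_swap, hzero, neg_zero]
    · rw [D.red_symm, hdown i hi, dt_zero_left]
  have h0 := D.red_sum
  -- Only an edge in the direction of `U` can still contribute, and edges in the same direction
  -- coincide by `sep`; the vanishing sum then has a single term.
  rw [Finset.sum_eq_single i₀ (fun j _ hj => ?_) (by simp)] at h0
  · exact hi₀ h0
  · refine hdz j fun h => D.sep j i₀ hj 1 ?_
    have h' : dt (redVec U) (D.w i₀) = 0 := by
      by_contra h'; exact hi₀ (hdz i₀ h')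
    rw [map_one, one_smul]
    exact ((nb_eq_iff hU (D.w_ne j)).2 ((dt_eq_zero_iff hU).1 h)).symm.trans
      ((nb_eq_iff hU (D.w_ne i₀)).2 ((dt_eq_zero_iff hU).1 h'))

end WildKernel

/-! ### Integral frames and conjugation across an edge -/

section Frames

variable {K : Type u} [Field K] [Valued K ℤᵐ⁰] [(Valued.v : Valuation K ℤᵐ⁰).IsNontrivial]

theorem exists_mk_smul_std (Λ : Vertex K) :
    ∃ g : GL (Fin 2) K, Matrix.ProjGenLinGroup.mk g • stdVertex K = Λ := by
  obtain ⟨L, rfl⟩ := vtx_surjective Λ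
  obtain ⟨x, y, h⟩ := L.exists_isBasisOf
  have hx : x ≠ 0 := h.lin.ne_zero 0
  have hd : dt x y ≠ 0 := by
    intro h0
    obtain ⟨c, rfl⟩ := (dt_eq_zero_iff hx).1 h0
    have := LinearIndependent.pair_iff.1 h.lin c (-1) (by simp)
    simpa using this.2
  let g : GL (Fin 2) K := Matrix.GeneralLinearGroup.mkOfDetNeZero !![x 0, y 0; x 1, y 1] (by
    rw [Matrix.det_fin_two_of, mul_comm (y 0)]
    intro h; exact hd (by unfold dt; linear_combination h))
  have h1 : g.1.mulVec ![1, 0] = x := by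
    change Matrix.mulVec !![x 0, y 0; x 1, y 1] _ = _
    ext i; fin_cases i <;> simp [Matrix.mulVec, dotProduct, Fin.sum_univ_two]
  have h2 : g.1.mulVec ![0, 1] = y := by
    change Matrix.mulVec !![x 0, y 0; x 1, y 1] _ = _
    ext i; fin_cases i <;> simp [Matrix.mulVec, dotProduct, Fin.sum_univ_two]
  refine ⟨g, ?_⟩
  unfold stdVertex
  rw [mk_smul_vtx]
  congr 1
  apply Subtype.ext
  have := ((isBasisOf_std K).mapGL g).eq
  rw [h1, h2] at this
  exact this.trans h.eq.symm

variable {ϖ : K} (hϖ : IsUniformizer ϖ)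

/-- The diagonal matrix with entries `1` and `ϖ`. -/
def diagGL : GL (Fin 2) K := Matrix.GeneralLinearGroup.mkOfDetNeZero !![1, 0; 0, ϖ] (by
  rw [Matrix.det_fin_two_of]
  simpa using hϖ.ne_zero)

theorem diagGL_val : (diagGL hϖ).1 = !![1, 0; 0, ϖ] := rfl

theorem mk_diagGL_smul :
    Matrix.ProjGenLinGroup.mk (diagGL hϖ) • stdVertex K = nb (redVec ![1, 0]) := by
  have h0 : redVec (K := K) ![1, 0] ≠ 0 := fun h => by simpa [redVec] using congrFun h 0
  have e0 : ofInt (K := K) ![1, 0] = ![1, 0] := by ext i; fin_cases i <;> rfl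
  rw [nb_redVec h0]
  unfold stdVertex
  rw [dir_vtx hϖ _ (ofInt_mem _) (mt (ofInt_mem_smul_iff hϖ _).1 h0), mk_smul_vtx]
  congr 1
  apply Subtype.ext
  rw [nbrLat_val, e0]
  have h1 := ((isBasisOf_std K).mapGL (diagGL hϖ)).eq
  have h2 := ((isBasisOf_std K).nbr hϖ).eq
  have h3 : (diagGL hϖ).1.mulVec ![1, 0] = ![1, 0] := by
    rw [diagGL_val]; ext i; fin_cases i <;> simp [Matrix.mulVec, dotProduct, Fin.sum_univ_two]
  have h4 : (diagGL hϖ).1.mulVec ![0, 1] = ϖ • ![0, 1] := by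
    rw [diagGL_val]; ext i; fin_cases i <;> simp [Matrix.mulVec, dotProduct, Fin.sum_univ_two]
  rw [h3, h4] at h1
  exact h1.trans h2.symm

/-- The integral matrix with given columns. -/
def columnsGL (W Z : Fin 2 → 𝒪[K]) (h : dt (redVec W) (redVec Z) ≠ 0) : GL (Fin 2) 𝒪[K] :=
  Matrix.GeneralLinearGroup.mk'' !![W 0, Z 0; W 1, Z 1] (by
    rw [Matrix.det_fin_two_of]
    rw [dt_redVec, IsLocalRing.residue_ne_zero_iff_isUnit] at h
    have : W 0 * Z 1 - Z 0 * W 1 = dt W Z := by unfold dt; ring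
    rwa [this])

theorem columnsGL_val (W Z : Fin 2 → 𝒪[K]) (h : dt (redVec W) (redVec Z) ≠ 0) :
    (columnsGL W Z h).1 = !![W 0, Z 0; W 1, Z 1] := rfl

theorem v_mul_int_le {r : ℤᵐ⁰} (A : Matrix (Fin 2) (Fin 2) 𝒪[K]) {M : Matrix (Fin 2) (Fin 2) K}
    (hM : ∀ i j, Valued.v (M i j) ≤ r) (i j : Fin 2) :
    Valued.v ((A.map (algebraMap 𝒪[K] K) * M) i j) ≤ r := by
  rw [Matrix.mul_apply]
  refine Valuation.map_sum_le _ fun k _ => ?_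
  rw [map_mul]
  exact (mul_le_mul' (A i k).2 (hM k j)).trans (one_mul r).le

theorem v_mul_int_le' {r : ℤᵐ⁰} (A : Matrix (Fin 2) (Fin 2) 𝒪[K]) {M : Matrix (Fin 2) (Fin 2) K}
    (hM : ∀ i j, Valued.v (M i j) ≤ r) (i j : Fin 2) :
    Valued.v ((M * A.map (algebraMap 𝒪[K] K)) i j) ≤ r := by
  rw [Matrix.mul_apply]
  refine Valuation.map_sum_le _ fun k _ => ?_
  rw [map_mul]
  exact (mul_le_mul' (hM i k) (A k j).2).trans (mul_one r).le

include hϖ in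
/-- Conjugation of an endomorphism from a neighbour `h` of the standard vertex. -/
theorem exists_conj_coords {W Z : Fin 2 → 𝒪[K]} (hWZ : dt (redVec W) (redVec Z) ≠ 0)
    {h : GL (Fin 2) K} (hh : Matrix.ProjGenLinGroup.mk h • stdVertex K = nb (redVec W))
    {M : Matrix (Fin 2) (Fin 2) K} {r : ℤᵐ⁰} (hM : ∀ i j, Valued.v (M i j) ≤ r) :
    ∃ X : Matrix (Fin 2) (Fin 2) K, (∀ i j, Valued.v (X i j) ≤ r) ∧
      (h.1 * M * (h⁻¹).1).mulVec (ofInt W) = X 0 0 • ofInt W + (ϖ * X 1 0) • ofInt Z ∧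
      (h.1 * M * (h⁻¹).1).mulVec (ofInt Z) = (ϖ⁻¹ * X 0 1) • ofInt W + X 1 1 • ofInt Z := by
  set c := columnsGL W Z hWZ with hc
  -- The frame `b` has the columns `W` and `ϖ Z` and carries the standard vertex to the same
  -- neighbour as `h`. Hence `h` is a multiple of `b` times an integral invertible matrix, and
  -- conjugation by the latter keeps the bound `r`. Only the factor `diag(1, ϖ)` distorts the
  -- coordinates.
  set b : GL (Fin 2) K := intGL c * diagGL hϖ with hb
  have hbs : Matrix.ProjGenLinGroup.mk b • stdVertex K = nb (redVec W) := by
    have h0 : redVec (K := K) ![1, 0] ≠ 0 := fun h => by simpa [redVec] using congrFun h 0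
    rw [hb, map_mul, mul_smul, mk_diagGL_smul, mk_smul_nb _ h0]
    congr 1
    have : (redMat c.1).mulVec (redVec ![1, 0]) = redVec (c.1.mulVec ![1, 0]) :=
      (redVec_mulVec _ _).symm
    rw [this]
    congr 1
    rw [hc, columnsGL_val]
    ext i; fin_cases i <;> simp [Matrix.mulVec, dotProduct, Fin.sum_univ_two]
  obtain ⟨A, hA⟩ := exists_intGL (h := Matrix.ProjGenLinGroup.mk (b⁻¹ * h)) (by
    rw [map_mul, map_inv, mul_smul, hh, inv_smul_eq_iff, hbs])
  obtain ⟨k, hk, hkA⟩ := mk_scalar_smul hA.symm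
  have hbi : b.1 * (b⁻¹).1 = 1 := by rw [← Units.val_mul, mul_inv_cancel, Units.val_one]
  have hbi' : (b⁻¹).1 * b.1 = 1 := by rw [← Units.val_mul, inv_mul_cancel, Units.val_one]
  have hAi : (intGL A).1 * (intGL A⁻¹).1 = 1 := by
    rw [← Units.val_mul, ← map_mul, mul_inv_cancel, map_one, Units.val_one]
  set X := (intGL A).1 * M * (intGL A⁻¹).1 with hX
  have hh1 : h.1 = k • (b.1 * (intGL A).1) := by
    have : h = b * (b⁻¹ * h) := by group
    rw [this, Units.val_mul, hkA, Matrix.mul_smul]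
  have hh2 : (h⁻¹).1 = k⁻¹ • ((intGL A⁻¹).1 * (b⁻¹).1) := by
    rw [Matrix.coe_units_inv]
    refine Matrix.inv_eq_right_inv ?_
    rw [hh1, Matrix.smul_mul, Matrix.mul_smul, smul_smul, mul_inv_cancel₀ hk, one_smul]
    calc _ = b.1 * ((intGL A).1 * (intGL A⁻¹).1) * (b⁻¹).1 := by noncomm_ring
      _ = 1 := by rw [hAi, mul_one, hbi]
  have hconj : h.1 * M * (h⁻¹).1 = b.1 * X * (b⁻¹).1 := by
    rw [hh1, hh2, Matrix.smul_mul, Matrix.smul_mul, Matrix.mul_smul, smul_smul,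
      mul_inv_cancel₀ hk, one_smul, hX]
    noncomm_ring
  have hbW : b.1.mulVec ![1, 0] = ofInt W := by
    rw [hb, Units.val_mul, ← Matrix.mulVec_mulVec, diagGL_val, intGL_val, hc, columnsGL_val]
    ext i; fin_cases i <;> simp [Matrix.mulVec, dotProduct, Fin.sum_univ_two, ofInt] <;> rfl
  have hbZ : b.1.mulVec ![0, 1] = ϖ • ofInt Z := by
    rw [hb, Units.val_mul, ← Matrix.mulVec_mulVec, diagGL_val, intGL_val, hc, columnsGL_val]
    ext i; fin_cases i <;>
      simp [Matrix.mulVec, dotProduct, Fin.sum_univ_two, ofInt] <;> exact mul_comm _ _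
  have hbx : ∀ x : Fin 2 → K, b.1.mulVec x = x 0 • ofInt W + (ϖ * x 1) • ofInt Z := by
    intro x
    have : x = x 0 • ![1, 0] + x 1 • ![0, 1] := by
      ext i; fin_cases i <;> simp
    conv_lhs => rw [this]
    rw [Matrix.mulVec_add, Matrix.mulVec_smul, Matrix.mulVec_smul, hbW, hbZ, smul_smul, mul_comm ϖ]
  have hcx : ∀ x : Fin 2 → K, (h.1 * M * (h⁻¹).1).mulVec (b.1.mulVec x) =
      b.1.mulVec (X.mulVec x) := by
    intro x
    rw [hconj, Matrix.mulVec_mulVec, Matrix.mulVec_mulVec, mul_assoc, hbi', mul_one]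
  refine ⟨X, ?_, ?_, ?_⟩
  · intro i j
    exact v_mul_int_le' _ (v_mul_int_le _ hM) i j
  · conv_lhs => rw [← hbW]
    rw [hcx, hbx]
    simp [Matrix.mulVec, dotProduct, Fin.sum_univ_two]
  · have h1 : ofInt Z = ϖ⁻¹ • b.1.mulVec ![0, 1] := by
      rw [hbZ, inv_smul_smul₀ hϖ.ne_zero]
    conv_lhs => rw [h1]
    rw [Matrix.mulVec_smul, hcx, hbx, smul_add, smul_smul, smul_smul, ← mul_assoc,
      inv_mul_cancel₀ hϖ.ne_zero, one_mul]
    simp [Matrix.mulVec, dotProduct, Fin.sum_univ_two]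

/-- The vectors `W`, `Z` form an integral basis, and a change between integral bases does not
increase the values of the entries. -/
theorem v_entries_le {W Z : Fin 2 → 𝒪[K]} (hWZ : dt (redVec W) (redVec Z) ≠ 0)
    {P : Matrix (Fin 2) (Fin 2) K} {r : ℤᵐ⁰} {a b c d : K} (ha : Valued.v a ≤ r)
    (hb : Valued.v b ≤ r) (hc : Valued.v c ≤ r) (hd : Valued.v d ≤ r)
    (hW : P.mulVec (ofInt W) = a • ofInt W + b • ofInt Z)
    (hZ : P.mulVec (ofInt Z) = c • ofInt W + d • ofInt Z) (i j : Fin 2) :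
    Valued.v (P i j) ≤ r := by
  set C := columnsGL W Z hWZ with hC
  have hCW : (intGL C).1 = !![(W 0 : K), Z 0; W 1, Z 1] := by
    rw [intGL_val, hC, columnsGL_val]
    ext i j; fin_cases i <;> fin_cases j <;> rfl
  have h1 : P * (intGL C).1 = (intGL C).1 * !![a, c; b, d] := by
    rw [hCW]
    have w0 := congrFun hW 0
    have w1 := congrFun hW 1
    have z0 := congrFun hZ 0
    have z1 := congrFun hZ 1
    simp only [Matrix.mulVec, dotProduct, Fin.sum_univ_two, ofInt, Pi.add_apply, Pi.smul_apply,
      smul_eq_mul] at w0 w1 z0 z1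
    ext i j
    fin_cases i <;> fin_cases j <;> simp [Matrix.mul_apply, Fin.sum_univ_two]
    · rw [w0]; ring
    · rw [z0]; ring
    · rw [w1]; ring
    · rw [z1]; ring
  have h2 : (intGL C).1 * (intGL C⁻¹).1 = 1 := by
    rw [← Units.val_mul, ← map_mul, mul_inv_cancel, map_one, Units.val_one]
  have h3 : P = (intGL C).1 * !![a, c; b, d] * (intGL C⁻¹).1 := by
    rw [← h1, mul_assoc, h2, mul_one]
  rw [h3]
  refine v_mul_int_le' _ (v_mul_int_le _ fun i j => ?_) i j
  fin_cases i <;> fin_cases j <;> assumption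

theorem fixes_std_of_unipotent {g : GL (Fin 2) K} (hg : (g.1 - 1) * (g.1 - 1) = 0)
    (hint : ∀ i j, Valued.v ((g.1 - 1) i j) ≤ 1) :
    Matrix.ProjGenLinGroup.mk g • stdVertex K = stdVertex K := by
  obtain ⟨ht, hd⟩ := trace_eq_zero_of_sq hg
  let P : Matrix (Fin 2) (Fin 2) 𝒪[K] := Matrix.of fun i j => ⟨(g.1 - 1) i j, hint i j⟩
  have hP : P.map (algebraMap 𝒪[K] K) = g.1 - 1 := rfl
  have hdet : (1 + P).det = 1 := by
    apply Subtype.ext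
    rw [Matrix.trace_fin_two] at ht
    rw [Matrix.det_fin_two] at hd
    rw [Matrix.det_fin_two]
    change (1 + (g.1 - 1) 0 0) * (1 + (g.1 - 1) 1 1) - (0 + (g.1 - 1) 0 1) * (0 + (g.1 - 1) 1 0) = 1
    linear_combination ht + hd
  have : g = intGL (Matrix.GeneralLinearGroup.mk'' (1 + P) (by rw [hdet]; exact isUnit_one)) := by
    apply Units.ext
    rw [intGL_val]
    change g.1 = (1 + P).map _
    rw [Matrix.map_add _ (map_add _), Matrix.map_one _ (map_zero _) (map_one _), hP,
      add_sub_cancel]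
  rw [this]
  exact mk_smul_std _

include hϖ in
/-- A power of the uniformizer that does not divide a nonzero matrix. -/
theorem exists_pow_not_le {P : Matrix (Fin 2) (Fin 2) K} (hP : P ≠ 0) :
    ∃ m : ℕ, ¬ ∀ i j, Valued.v (P i j) ≤ Valued.v ϖ ^ m := by
  by_contra! h
  refine hP ?_
  ext i j
  by_contra h0
  obtain ⟨m, hm⟩ := exists_pow_lt₀ (a := Valued.v ϖ) hϖ.lt_one
    (Units.mk0 (Valued.v (P i j)) ((Valuation.ne_zero_iff _).2 h0))
  exact (h m i j).not_gt hm

/-- The two matrices differ by a scalar, and comparing eigenvalues, all equal to 1, shows that the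
scalar is 1. -/
theorem unipotent_unique {g g' : GL (Fin 2) K} (hg : (g.1 - 1) * (g.1 - 1) = 0)
    (hg' : (g'.1 - 1) * (g'.1 - 1) = 0)
    (h : Matrix.ProjGenLinGroup.mk g = Matrix.ProjGenLinGroup.mk g') : g = g' := by
  obtain ⟨c, hc, e⟩ := mk_scalar_smul h
  obtain ⟨u, hu, h1⟩ := exists_kernel_of_sq hg
  have h2 : g.1.mulVec u = u := by
    rwa [Matrix.sub_mulVec, Matrix.one_mulVec, sub_eq_zero] at h1
  have h3 : (g'.1 - 1).mulVec u = (c - 1) • u := by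
    rw [Matrix.sub_mulVec, e, Matrix.smul_mulVec, h2, Matrix.one_mulVec, sub_smul, one_smul]
  have h4 : (g'.1 - 1).mulVec ((g'.1 - 1).mulVec u) = 0 := by
    rw [Matrix.mulVec_mulVec, hg', Matrix.zero_mulVec]
  rw [h3, Matrix.mulVec_smul, h3, smul_smul] at h4
  have h5 : c - 1 = 0 := mul_self_eq_zero.1 ((smul_eq_zero.1 h4).resolve_right hu)
  apply Units.ext
  rw [e, sub_eq_zero.1 h5, one_smul]

end Frames

/-! ### Rigidity of harmonic families on half-edges -/

section HalfEdges

variable {K : Type u} [Field K] [Valued K ℤᵐ⁰] {N : Type u} [Group N]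

/-- A finite family of endomorphisms attached to the half-edges of a graph of groups. -/
structure HalfEdges (φ : N →* PGL(2, K)) (V H : Type*) where
  p : V → Vertex K
  base : H → V
  far : H → Vertex K
  adj : ∀ η, (bruhatTits K).Adj (p (base η)) (far η)
  mat : H → Matrix (Fin 2) (Fin 2) K
  opp : H → H
  δ : H → N
  Δ : H → GL (Fin 2) K
  mk_Δ : ∀ η, Matrix.ProjGenLinGroup.mk (Δ η) = φ (δ η)
  smul_far : ∀ η, φ (δ η) • far η = p (base (opp η))
  mat_opp : ∀ η, mat (opp η) = -((Δ η).1 * mat η * ((Δ η)⁻¹).1)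
  trace_mat : ∀ η, (mat η).trace = 0
  of_trivial : ∀ η, (∀ n ∈ stab φ (p (base η)), n ∈ stab φ (far η) → n = 1) → mat η = 0
  of_comm : ∀ η, (∀ n ∈ stab φ (p (base η)) ⊓ stab φ (far η),
      ∀ m ∈ stab φ (p (base η)) ⊓ stab φ (far η), ∀ g h : GL (Fin 2) K,
        Matrix.ProjGenLinGroup.mk g = φ n → Matrix.ProjGenLinGroup.mk h = φ m → g * h = h * g) →
    (∃ n ∈ stab φ (p (base η)) ⊓ stab φ (far η), n ≠ 1) →
    ∃ n ∈ stab φ (p (base η)) ⊓ stab φ (far η), n ≠ 1 ∧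
      ∀ g : GL (Fin 2) K, Matrix.ProjGenLinGroup.mk g = φ n → (mat η * g.1).trace = 0
  sep : ∀ η η', η ≠ η' → base η = base η' → ∀ n ∈ stab φ (p (base η)), φ n • far η ≠ far η'
  sum_mat : ∀ (v : V) [Fintype {η // base η = v}], ∑ η : {η // base η = v}, mat η.1 = 0

/-- The action of the stabilizer of a vertex, moved to the standard vertex. -/
def localRep (φ : N →* PGL(2, K)) (Λ : Vertex K) (g : GL (Fin 2) K) : stab φ Λ →* PGL(2, K) :=
  (MulAut.conj (Matrix.ProjGenLinGroup.mk g)⁻¹).toMonoidHom.comp (φ.comp (stab φ Λ).subtype)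

theorem localRep_apply (φ : N →* PGL(2, K)) (Λ : Vertex K) (g : GL (Fin 2) K) (n : stab φ Λ) :
    localRep φ Λ g n = (Matrix.ProjGenLinGroup.mk g)⁻¹ * φ n * Matrix.ProjGenLinGroup.mk g := by
  simp [localRep]

theorem mk_conj_eq {φ : N →* PGL(2, K)} {Λ : Vertex K} {g : GL (Fin 2) K} {n : stab φ Λ}
    {h : GL (Fin 2) K} : Matrix.ProjGenLinGroup.mk h = localRep φ Λ g n ↔
      Matrix.ProjGenLinGroup.mk (g * h * g⁻¹) = φ n := by
  rw [localRep_apply, map_mul, map_mul, map_inv]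
  constructor
  · intro h; rw [h]; group
  · intro h; rw [← h]; group

variable [(Valued.v : Valuation K ℤᵐ⁰).IsNontrivial]

theorem isLocalAction_localRep {φ : N →* PGL(2, K)} (hφ : Function.Injective φ)
    (hfix : FixedPointsRational φ) {Λ : Vertex K} {g : GL (Fin 2) K}
    (hg : Matrix.ProjGenLinGroup.mk g • stdVertex K = Λ) : IsLocalAction (localRep φ Λ g) where
  injective n m h := by
    rw [localRep_apply, localRep_apply] at h
    exact Subtype.ext (hφ (mul_left_cancel (mul_right_cancel h)))
  fixes n := by
    have hn : φ n • Λ = Λ := n.2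
    rw [localRep_apply, mul_smul, mul_smul, hg, hn, inv_smul_eq_iff, hg]
  splits n h hh := by
    have := hfix _ ⟨n.1, (mk_conj_eq.1 hh).symm⟩
    rwa [Units.val_mul, Units.val_mul, Matrix.coe_units_inv, Matrix.charpoly_units_conj] at this

/-- The group contains a unipotent element whose nilpotent part has entries divisible by the
`j`-th power of `ϖ`. -/
def HasDeepElement {G : Type*} [Group G] (ρ : G →* PGL(2, K)) (ϖ : K) (j : ℕ) : Prop :=
  ∃ (n : G) (g : GL (Fin 2) K), Matrix.ProjGenLinGroup.mk g = ρ n ∧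
    (g.1 - 1) * (g.1 - 1) = 0 ∧ g.1 ≠ 1 ∧ ∀ i j', Valued.v ((g.1 - 1) i j') ≤ Valued.v ϖ ^ j

theorem HasDeepElement.mono {G : Type*} [Group G] {ρ : G →* PGL(2, K)} {ϖ : K}
    (hϖ : IsUniformizer ϖ) {i j : ℕ} (hij : i ≤ j) (h : HasDeepElement ρ ϖ j) :
    HasDeepElement ρ ϖ i := by
  obtain ⟨n, g, h1, h2, h3, h4⟩ := h
  exact ⟨n, g, h1, h2, h3, fun a b => (h4 a b).trans (pow_le_pow_right_of_le_one' hϖ.lt_one.le hij)⟩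

/-- In a finite group one element would serve infinitely many `j`. Its unipotent representative is
unique, so all entries of its nilpotent part would be divisible by every power of `ϖ`. -/
theorem exists_not_hasDeepElement {G : Type*} [Group G] [Finite G] (ρ : G →* PGL(2, K)) {ϖ : K}
    (hϖ : IsUniformizer ϖ) : ∃ j, ¬ HasDeepElement ρ ϖ j := by
  by_contra! h
  choose n g h1 h2 h3 h4 using h
  obtain ⟨m, hm⟩ := Finite.exists_infinite_fiber n
  have hinf : (n ⁻¹' {m}).Infinite := Set.infinite_coe_iff.1 hm
  obtain ⟨j₀, hj₀⟩ := hinf.nonempty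
  obtain ⟨k, hk⟩ := exists_pow_not_le hϖ (P := (g j₀).1 - 1) (sub_ne_zero.2 (h3 j₀))
  obtain ⟨j, hj, hkj⟩ := hinf.exists_gt k
  have hgj : g j = g j₀ := unipotent_unique (h2 j) (h2 j₀) (by
    rw [h1, h1, (hj : n j = m), (hj₀ : n j₀ = m)])
  refine hk fun a b => ?_
  rw [← hgj]
  exact (h4 j a b).trans (pow_le_pow_right_of_le_one' hϖ.lt_one.le hkj.le)

namespace HalfEdges

variable {φ : N →* PGL(2, K)} {V H : Type*} (S : HalfEdges φ V H) {g : V → GL (Fin 2) K}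
  (hg : ∀ v, Matrix.ProjGenLinGroup.mk (g v) • stdVertex K = S.p v)

/-- The endomorphisms in the coordinates of the standard vertex. -/
def hat (g : V → GL (Fin 2) K) (η : H) : Matrix (Fin 2) (Fin 2) K :=
  (g (S.base η))⁻¹.1 * S.mat η * (g (S.base η)).1

/-- The frame at the far end of a half-edge. -/
def frame (g : V → GL (Fin 2) K) (η : H) : GL (Fin 2) K :=
  (g (S.base η))⁻¹ * (S.Δ η)⁻¹ * g (S.base (S.opp η))

/-- The matrices at the two ends of an edge are opposite conjugates of each other under the frame of
the edge; this is the only link between neighbouring vertices. -/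
theorem hat_eq (η : H) :
    S.hat g η = -((S.frame g η).1 * S.hat g (S.opp η) * (S.frame g η)⁻¹.1) := by
  have key : ∀ (a d b : GL (Fin 2) K) (M : Matrix (Fin 2) (Fin 2) K),
      (a⁻¹ * d⁻¹ * b).1 * (b⁻¹.1 * (-(d.1 * M * d⁻¹.1)) * b.1) * (a⁻¹ * d⁻¹ * b)⁻¹.1 =
        -(a⁻¹.1 * M * a.1) := by
    intro a d b M
    have e1 : (a⁻¹ * d⁻¹ * b)⁻¹ = b⁻¹ * d * a := by group
    have hb : b.1 * b⁻¹.1 = 1 := by rw [← Units.val_mul, mul_inv_cancel, Units.val_one]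
    have hd : d⁻¹.1 * d.1 = 1 := by rw [← Units.val_mul, inv_mul_cancel, Units.val_one]
    rw [e1]
    simp only [Units.val_mul]
    calc _ = -(a⁻¹.1 * (d⁻¹.1 * (b.1 * b⁻¹.1) * d.1) * M * (d⁻¹.1 * (b.1 * b⁻¹.1) * d.1) * a.1) := by
          noncomm_ring
      _ = _ := by rw [hb, mul_one, hd, mul_one, mul_one]
  unfold hat frame
  rw [S.mat_opp, key, neg_neg]

include hg

theorem exists_dirVec (η : H) : ∃ x : Fin 2 → 𝓀[K], x ≠ 0 ∧
    nb x = (Matrix.ProjGenLinGroup.mk (g (S.base η)))⁻¹ • S.far η :=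
  exists_nb (by
    have := adj_smul (Matrix.ProjGenLinGroup.mk (g (S.base η)))⁻¹ (S.adj η)
    rwa [← hg, inv_smul_smul] at this)

/-- The direction of a half-edge. -/
def dirVec (η : H) : Fin 2 → 𝓀[K] := (S.exists_dirVec hg η).choose

theorem dirVec_ne (η : H) : S.dirVec hg η ≠ 0 := (S.exists_dirVec hg η).choose_spec.1

theorem nb_dirVec (η : H) :
    nb (S.dirVec hg η) = (Matrix.ProjGenLinGroup.mk (g (S.base η)))⁻¹ • S.far η :=
  (S.exists_dirVec hg η).choose_spec.2

theorem frame_smul (η : H) :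
    Matrix.ProjGenLinGroup.mk (S.frame g η) • stdVertex K = nb (S.dirVec hg η) := by
  unfold frame
  rw [map_mul, map_mul, map_inv, map_inv, mul_smul, mul_smul, hg, nb_dirVec, S.mk_Δ, ← S.smul_far,
    inv_smul_smul]

theorem localRep_smul_dirVec_iff {v : V} (n : stab φ (S.p v)) {η η' : H} (h : S.base η = v)
    (h' : S.base η' = v) :
    localRep φ (S.p v) (g v) n • nb (S.dirVec hg η) = nb (S.dirVec hg η') ↔
      φ n • S.far η = S.far η' := by
  rw [nb_dirVec, nb_dirVec, localRep_apply, h, h', mul_smul, mul_smul, smul_inv_smul]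
  exact smul_left_cancel_iff _

variable (hint : ∀ η i j, Valued.v (S.hat g η i j) ≤ 1)

omit hg in
/-- The endomorphisms as integral matrices. -/
def intMat (η : H) : Matrix (Fin 2) (Fin 2) 𝒪[K] :=
  Matrix.of fun i j => ⟨S.hat g η i j, hint η i j⟩

omit hg in
theorem map_intMat (η : H) : (S.intMat hint η).map (algebraMap 𝒪[K] K) = S.hat g η := rfl

include hint

/-- A matrix that is integral at both ends of the edge preserves the direction of the edge modulo
`ϖ`. Its eigenvalue there is a diagonal entry in the frame of the edge, so it is as small as the
matrix at the far end. -/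
theorem exists_eigenvalue (η : H) {r : ℤᵐ⁰} (hr : r ≤ 1)
    (hM : ∀ i j, Valued.v (S.hat g (S.opp η) i j) ≤ r) : ∃ a : 𝒪[K], Valued.v (a : K) ≤ r ∧
      (redMat (S.intMat hint η)).mulVec (S.dirVec hg η) =
        IsLocalRing.residue 𝒪[K] a • S.dirVec hg η := by
  obtain ⟨ϖ, hϖ⟩ := exists_isUniformizer K
  obtain ⟨z, hz⟩ := exists_dt_ne_zero (S.dirVec_ne hg η)
  obtain ⟨W, hW⟩ := redVec_surjective (S.dirVec hg η)
  obtain ⟨Z, rfl⟩ := redVec_surjective z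
  rw [← hW] at hz ⊢
  obtain ⟨X, hX, h1, -⟩ := exists_conj_coords hϖ hz (by rw [S.frame_smul hg, hW]) hM
  refine ⟨⟨-X 0 0, by rw [Valuation.mem_integer_iff, Valuation.map_neg]; exact (hX 0 0).trans hr⟩,
    by rw [Valuation.map_neg]; exact hX 0 0, ?_⟩
  have h2 : (S.intMat hint η).mulVec W =
      (⟨-X 0 0, by rw [Valuation.mem_integer_iff, Valuation.map_neg]; exact (hX 0 0).trans hr⟩ :
        𝒪[K]) • W + ((⟨ϖ, hϖ.lt_one.le⟩ : 𝒪[K]) *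
          ⟨-X 1 0, by rw [Valuation.mem_integer_iff, Valuation.map_neg]; exact (hX 1 0).trans hr⟩) •
            Z := by
    apply ofInt_injective
    rw [ofInt_mulVec, map_intMat, hat_eq, Matrix.neg_mulVec, h1]
    ext i
    change -(X 0 0 * (W i : K) + ϖ * X 1 0 * (Z i : K)) = -X 0 0 * (W i : K) + ϖ * -X 1 0 * (Z i : K)
    ring
  have h3 : IsLocalRing.residue 𝒪[K] ⟨ϖ, hϖ.lt_one.le⟩ = 0 := (residue_eq_zero_iff_v_lt _).2 hϖ.lt_one
  have h4 := redVec_mulVec (S.intMat hint η) W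
  rw [h2, redVec_add, redVec_smul, redVec_smul, map_mul, h3, zero_mul, zero_smul, add_zero] at h4
  exact h4.symm

/-- The half-edges at one vertex. -/
def localEdges (v : V) [Fintype {η // S.base η = v}] :
    LocalEdges (localRep φ (S.p v) (g v)) {η // S.base η = v} where
  w i := S.dirVec hg i.1
  w_ne i := S.dirVec_ne hg i.1
  Y i := S.intMat hint i.1
  trace_Y i := by
    apply Subtype.ext
    have h := S.trace_mat i.1
    have h2 : (S.hat g i.1).trace = 0 := by
      unfold hat
      rw [Matrix.trace_units_conj', h]
    rw [Matrix.trace_fin_two] at h2 ⊢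
    exact h2
  pres i := by
    obtain ⟨a, -, ha⟩ := S.exists_eigenvalue hg hint i.1 le_rfl (hint _)
    exact ⟨_, ha⟩
  of_trivial i h := by
    have h0 := S.of_trivial i.1 fun n hn hn' => by
      rw [i.2] at hn
      exact congrArg Subtype.val (h ⟨n, hn⟩ ((S.localRep_smul_dirVec_iff hg _ i.2 i.2).2 hn'))
    ext a b
    change S.hat g i.1 a b = 0
    unfold hat
    rw [h0, mul_zero, zero_mul, Matrix.zero_apply]
  of_comm i hc := by
    rintro ⟨n₁, hn₁, hn₁'⟩
    rw [S.localRep_smul_dirVec_iff hg _ i.2 i.2] at hn₁'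
    obtain ⟨n, ⟨hn, hn'⟩, hn1, htr⟩ := S.of_comm i.1 (fun n hn m hm a b ha hb => by
        have h := hc ⟨n, i.2 ▸ hn.1⟩ ⟨m, i.2 ▸ hm.1⟩
          ((S.localRep_smul_dirVec_iff hg _ i.2 i.2).2 hn.2)
          ((S.localRep_smul_dirVec_iff hg _ i.2 i.2).2 hm.2) ((g v)⁻¹ * a * g v)
          ((g v)⁻¹ * b * g v) (mk_conj_eq.2 (by rw [← ha]; congr 1; group))
          (mk_conj_eq.2 (by rw [← hb]; congr 1; group))
        have e : ∀ x y : GL (Fin 2) K, (g v)⁻¹ * x * g v * ((g v)⁻¹ * y * g v) =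
            (g v)⁻¹ * (x * y) * g v := fun x y => by group
        rw [e, e] at h
        exact mul_left_cancel (mul_right_cancel h))
      ⟨n₁, ⟨i.2.symm ▸ n₁.2, hn₁'⟩, fun h => hn₁ (Subtype.ext h)⟩
    rw [i.2] at hn
    refine ⟨⟨n, hn⟩, fun h => hn1 (congrArg Subtype.val h),
      (S.localRep_smul_dirVec_iff hg _ i.2 i.2).2 hn', fun A hA => ?_⟩
    have h := htr _ (mk_conj_eq.1 hA.symm)
    have h2 : (S.hat g i.1 * (intGL A).1).trace = 0 := by
      unfold hat
      rw [i.2]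
      rw [Units.val_mul, Units.val_mul] at h
      rw [← h, mul_assoc, mul_assoc, Matrix.trace_mul_comm, mul_assoc, mul_assoc]
    rw [← map_intMat S hint, intGL_val, ← Matrix.map_mul] at h2
    apply Subtype.ext
    rw [Matrix.trace_fin_two] at h2 ⊢
    exact h2
  sep i j hij n h := by
    rw [S.localRep_smul_dirVec_iff hg _ i.2 j.2] at h
    exact S.sep i.1 j.1 (fun h => hij (Subtype.ext h)) (i.2.trans j.2.symm) n
      (i.2.symm ▸ n.2) h
  sum_Y := by
    have h : (∑ i : {η // S.base η = v}, S.intMat hint i.1).map (algebraMap 𝒪[K] K) = 0 := by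
      change (algebraMap 𝒪[K] K).mapMatrix _ = 0
      rw [map_sum]
      calc _ = ∑ i : {η // S.base η = v}, (g v)⁻¹.1 * S.mat i.1 * (g v).1 :=
            Finset.sum_congr rfl fun i _ => by
              change S.hat g i.1 = _
              unfold hat
              rw [i.2]
        _ = 0 := by rw [← Finset.sum_mul, ← Finset.mul_sum, S.sum_mat, mul_zero, zero_mul]
    ext a b
    exact congrFun₂ h a b

variable [Finite H] (hchar : ringChar 𝓀[K] = ringChar K) (hφ : Function.Injective φ)
  (hstab : ∀ Λ : Vertex K, Finite (stab φ Λ)) (hfix : FixedPointsRational φ)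
include hchar hφ hstab hfix

/-- Induction on the depth, the power of `ϖ` dividing the nilpotent part of a unipotent element. A
nonzero reduction at a vertex already forces depth one. It also forces a nonzero reduction across an
edge off the distinguished line, where induction supplies an element of depth `j + 1`. Carried back
over the edge, this element fixes the vertex and has depth `j + 2`. -/
theorem red_eq_zero_of_not_hasDeepElement {ϖ : K} (hϖ : IsUniformizer ϖ) (j : ℕ) :
    ∀ v, ¬ HasDeepElement (localRep φ (S.p v) (g v)) ϖ (j + 1) → ∀ η, S.base η = v →
      redMat (S.intMat hint η) = 0 := by
  induction j with
  | zero =>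
    intro v hv η hη
    by_contra hne
    have := Fintype.ofFinite {η // S.base η = v}
    obtain ⟨⟨n, a, h1, h2, h3, h4⟩, -⟩ := LocalEdges.exists_down hchar
      (isLocalAction_localRep hφ hfix (hg v)) (S.localEdges hg hint v) (i₀ := ⟨η, hη⟩) hne
    exact hv ⟨n, a, h1, h2, h3, fun i j => by
      rw [zero_add, pow_one]
      exact hϖ.le_of_lt_one _ (h4 i j)⟩
  | succ j ih =>
    intro v hv η hη
    by_contra hne
    have := Fintype.ofFinite {η // S.base η = v}
    obtain ⟨-, U, hU, hunip, ⟨i, rfl⟩, hdt, hY⟩ := LocalEdges.exists_down hchar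
      (isLocalAction_localRep hφ hfix (hg v)) (S.localEdges hg hint v) (i₀ := ⟨η, hη⟩) hne
    change dt (redVec U) (S.dirVec hg i) ≠ 0 at hdt
    change (redMat (S.intMat hint i)).mulVec (S.dirVec hg i) ≠ 0 at hY
    -- The nonzero eigenvalue along this edge is bounded by the matrix at the far end, which
    -- therefore does not reduce to zero.
    have hopp : redMat (S.intMat hint (S.opp i)) ≠ 0 := by
      intro h0
      obtain ⟨a, ha, he⟩ := S.exists_eigenvalue hg hint i hϖ.lt_one.le fun a b =>
        hϖ.le_of_lt_one _ ((residue_eq_zero_iff_v_lt _).1 (congrFun₂ h0 a b))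
      rw [(residue_eq_zero_iff_v_lt a).2 (ha.trans_lt hϖ.lt_one), zero_smul] at he
      exact hY he
    have hdeep : HasDeepElement (localRep φ (S.p (S.base (S.opp i))) (g (S.base (S.opp i)))) ϖ
        (j + 1) := by
      by_contra h
      exact hopp (ih _ h _ rfl)
    obtain ⟨τ, g', hg', hsq, hg1, hval⟩ := hdeep
    obtain ⟨W, hW⟩ := redVec_surjective (S.dirVec hg i)
    rw [← hW] at hdt
    have hWU : dt (redVec W) (redVec U) ≠ 0 := by rwa [dt_swap, neg_ne_zero]
    obtain ⟨X, hX, hXW, hXU⟩ := exists_conj_coords hϖ hWU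
      (by rw [S.frame_smul hg, hW]) hval
    set h := S.frame g i with hh
    set P := h.1 * (g'.1 - 1) * h⁻¹.1 with hP
    have hh1 : h.1 * h⁻¹.1 = 1 := by rw [← Units.val_mul, mul_inv_cancel, Units.val_one]
    have hh2 : h⁻¹.1 * h.1 = 1 := by rw [← Units.val_mul, inv_mul_cancel, Units.val_one]
    have hgP : (h * g' * h⁻¹).1 - 1 = P := by
      rw [hP, mul_sub, sub_mul, mul_one, hh1, Units.val_mul, Units.val_mul]
    have hPP : P * P = 0 := by
      rw [hP]
      calc _ = h.1 * ((g'.1 - 1) * (h⁻¹.1 * h.1) * (g'.1 - 1)) * h⁻¹.1 := by noncomm_ring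
        _ = 0 := by rw [hh2, mul_one, hsq, mul_zero, zero_mul]
    have hP0 : P ≠ 0 := by
      intro h0
      have : h⁻¹.1 * P * h.1 = g'.1 - 1 := by
        rw [hP]
        calc _ = (h⁻¹.1 * h.1) * (g'.1 - 1) * (h⁻¹.1 * h.1) := by noncomm_ring
          _ = _ := by rw [hh2, mul_one, one_mul]
      rw [h0, mul_zero, zero_mul] at this
      exact hg1 (sub_eq_zero.1 this.symm)
    have hϖ1 : Valued.v ϖ ^ (j + 1) ≤ 1 := pow_le_one' hϖ.lt_one.le _
    -- Crossing the edge costs at most one factor `ϖ⁻¹`, in a single entry; the depth `j + 1 ≥ 1`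
    -- pays for it. So the transported element fixes the vertex.
    have hPint : ∀ a b, Valued.v (P a b) ≤ 1 := v_entries_le hWU ((hX 0 0).trans hϖ1)
      (by rw [map_mul]; exact mul_le_one' hϖ.lt_one.le ((hX 1 0).trans hϖ1))
      (by
        have := hX 0 1
        rw [pow_succ'] at this
        rw [map_mul, map_inv₀]
        exact ((inv_mul_le_iff₀ (zero_lt_iff.2 ((Valuation.ne_zero_iff _).2 hϖ.ne_zero))).2 this).trans
          (pow_le_one' hϖ.lt_one.le j))
      ((hX 1 1).trans hϖ1) hXW hXU
    have hstd := fixes_std_of_unipotent (g := h * g' * h⁻¹) (by rw [hgP, hPP]) (by rwa [hgP])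
    -- the transported element
    set n : N := (S.δ i)⁻¹ * τ.1 * S.δ i with hn
    have hφn : Matrix.ProjGenLinGroup.mk (g (S.base i) * (h * g' * h⁻¹) * (g (S.base i))⁻¹) =
        φ n := by
      rw [hn, map_mul φ, map_mul φ, map_inv φ, ← S.mk_Δ, ← mk_conj_eq.1 hg', ← map_inv, ← map_mul,
        ← map_mul, hh]
      congr 1
      unfold frame
      group
    have hnmem : n ∈ stab φ (S.p (S.base i)) := by
      rw [mem_stab, ← hφn, ← hg (S.base i), map_mul, mul_smul, map_mul _ (g (S.base i)), mul_smul,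
        map_inv, inv_smul_smul, hstd]
    have hrep : Matrix.ProjGenLinGroup.mk (h * g' * h⁻¹) =
        localRep φ (S.p (S.base i)) (g (S.base i)) ⟨n, hnmem⟩ := mk_conj_eq.2 hφn
    have hPU : P.mulVec (ofInt U) = 0 := by
      have := hunip _ _ hrep (by rw [hgP, hPP])
      rw [← hgP, Matrix.sub_mulVec, this, Matrix.one_mulVec, sub_self]
    have hdK : dt (ofInt W) (ofInt U) ≠ 0 := by
      rw [dt_ofInt]
      intro h0
      refine hWU ?_
      rw [dt_redVec, (Subtype.ext h0 : dt W U = 0), map_zero]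
    -- `P` kills the distinguished vector `U` and has trace zero, so only `P W = ϖ X₁₀ U` survives;
    -- this is the entry that gains a factor `ϖ`.
    have hX00 : X 0 0 = 0 := by
      have := dt_mulVec_add P (ofInt W) (ofInt U)
      rw [hPU, hXW, (trace_eq_zero_of_sq hPP).1, zero_mul, dt_add_left, dt_smul_left, dt_smul_left,
        dt_self, dt_swap _ 0, dt_zero_left] at this
      have : X 0 0 * dt (ofInt W) (ofInt U) = 0 := by linear_combination this
      exact (mul_eq_zero.1 this).resolve_right hdK
    refine hv ⟨_, _, hrep, by rw [hgP, hPP], fun h1 => hP0 (by rw [← hgP, h1, sub_self]), ?_⟩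
    rw [hgP]
    refine v_entries_le hWU (a := 0) (b := ϖ * X 1 0) (c := 0) (d := 0) (by simp) ?_ (by simp)
      (by simp) (by rw [hXW, hX00]) (by rw [hPU]; simp)
    rw [map_mul, pow_succ' _ (j + 1)]
    exact mul_le_mul_right (hX 1 0) _

theorem red_eq_zero (η : H) : redMat (S.intMat hint η) = 0 := by
  obtain ⟨ϖ, hϖ⟩ := exists_isUniformizer K
  obtain ⟨j, hj⟩ := exists_not_hasDeepElement
    (localRep φ (S.p (S.base η)) (g (S.base η))) hϖ
  exact S.red_eq_zero_of_not_hasDeepElement hg hint hchar hφ hstab hfix hϖ j _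
    (fun h => hj (h.mono hϖ (Nat.le_succ j))) η rfl

omit hg hint [Finite H] hchar hφ hstab hfix

/-- Multiplication of all endomorphisms with a scalar. -/
def smulMat (c : K) : HalfEdges φ V H :=
  { S with
    mat := fun η => c • S.mat η
    mat_opp := fun η => by rw [S.mat_opp, Matrix.mul_smul, Matrix.smul_mul, smul_neg]
    trace_mat := fun η => by rw [Matrix.trace_smul, S.trace_mat, smul_zero]
    of_trivial := fun η h => by rw [S.of_trivial η h, smul_zero]
    of_comm := fun η h h' => by
      obtain ⟨n, h1, h2, h3⟩ := S.of_comm η h h'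
      exact ⟨n, h1, h2, fun g hg => by rw [Matrix.smul_mul, Matrix.trace_smul, h3 g hg, smul_zero]⟩
    sum_mat := fun v _ => by rw [← Finset.smul_sum, S.sum_mat, smul_zero] }

include hchar hφ hstab hfix

/-- Rigidity: all endomorphisms vanish. -/
theorem mat_eq_zero [Finite H] (η : H) : S.mat η = 0 := by
  choose g hg using fun v => exists_mk_smul_std (S.p v)
  by_contra hne
  have hhat : S.hat g η ≠ 0 := by
    intro h
    refine hne ?_
    have e : (g (S.base η)).1 * S.hat g η * (g (S.base η))⁻¹.1 = S.mat η := by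
      unfold hat
      have hb : (g (S.base η)).1 * (g (S.base η))⁻¹.1 = 1 := by
        rw [← Units.val_mul, mul_inv_cancel, Units.val_one]
      calc _ = ((g (S.base η)).1 * (g (S.base η))⁻¹.1) * S.mat η *
            ((g (S.base η)).1 * (g (S.base η))⁻¹.1) := by noncomm_ring
        _ = _ := by rw [hb, mul_one, one_mul]
    rw [← e, h, mul_zero, zero_mul]
  have : Nonempty H := ⟨η⟩
  -- Division by an entry of maximal value makes all matrices integral and this entry equal to 1,
  -- contrary to the vanishing of all reductions.
  obtain ⟨⟨η₀, i, j⟩, hmax⟩ := Finite.exists_max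
    fun t : H × Fin 2 × Fin 2 => Valued.v (S.hat g t.1 t.2.1 t.2.2)
  set c := S.hat g η₀ i j with hc
  have hc0 : c ≠ 0 := by
    intro h0
    refine hhat ?_
    ext a b
    have := hmax (η, a, b)
    change _ ≤ Valued.v c at this
    rw [h0, map_zero, le_zero_iff, Valuation.zero_iff] at this
    exact this
  have hsc : ∀ η, (S.smulMat c⁻¹).hat g η = c⁻¹ • S.hat g η := by
    intro η
    change _ * (c⁻¹ • S.mat η) * _ = _
    rw [Matrix.mul_smul, Matrix.smul_mul]
    rfl
  have hint : ∀ η a b, Valued.v ((S.smulMat c⁻¹).hat g η a b) ≤ 1 := by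
    intro η a b
    rw [hsc, Matrix.smul_apply, smul_eq_mul, map_mul, map_inv₀]
    exact (inv_mul_le_one₀ (zero_lt_iff.2 ((Valuation.ne_zero_iff _).2 hc0))).2 (hmax (η, a, b))
  have h := (S.smulMat c⁻¹).red_eq_zero hg hint hchar hφ hstab hfix η₀
  have h1 := (residue_eq_zero_iff_v_lt _).1 (congrFun₂ h i j)
  change Valued.v ((S.smulMat c⁻¹).hat g η₀ i j) < 1 at h1
  rw [hsc, Matrix.smul_apply, ← hc, smul_eq_mul, inv_mul_cancel₀ hc0, map_one] at h1
  exact lt_irrefl _ h1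

end HalfEdges

end HalfEdges

/-! ### Harmonic families on the quotient graph -/

namespace GraphOfGroups

variable {K : Type u} [Field K] [Valued K ℤᵐ⁰] {N : Type u} [Group N] {φ : N →* PGL(2, K)}
  [(Valued.v : Valuation K ℤᵐ⁰).IsNontrivial] (𝒢 : GraphOfGroups φ)

/-- The preimage of an edge group in `GL(2, K)` is commutative. -/
def EdgeComm (e : QEdge φ) : Prop :=
  ∀ n ∈ 𝒢.edgeGroup e, ∀ m ∈ 𝒢.edgeGroup e, ∀ g h : GL (Fin 2) K,
    Matrix.ProjGenLinGroup.mk g = φ n → Matrix.ProjGenLinGroup.mk h = φ m → g * h = h * g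

theorem mem_edgeGroup_iff {e : QEdge φ} {n : N} : n ∈ 𝒢.edgeGroup e ↔
    n ∈ stab φ (𝒢.ι (𝒢.t e)).1 ⊓ stab φ (𝒢.lift e).org.1 := by
  rw [ι_t, inf_comm]; rfl

theorem conj_mem_edgeGroup_iff {e : QEdge φ} {n : N} : (𝒢.γ e)⁻¹ * n * 𝒢.γ e ∈ 𝒢.edgeGroup e ↔
    n ∈ stab φ (𝒢.ι (𝒢.o e)).1 ⊓ stab φ (𝒢.γ e • (𝒢.lift e).tgt).1 := by
  have h1 : n ∈ stab φ (𝒢.ι (𝒢.o e)).1 ↔ n • 𝒢.ι (𝒢.o e) = 𝒢.ι (𝒢.o e) := mem_vertexGroup 𝒢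
  have h2 : n ∈ stab φ (𝒢.γ e • (𝒢.lift e).tgt).1 ↔
    n • (𝒢.γ e • (𝒢.lift e).tgt) = 𝒢.γ e • (𝒢.lift e).tgt :=
    ⟨fun h => Subtype.ext h, fun h => congrArg Subtype.val h⟩
  rw [mem_edgeGroup, Subgroup.mem_inf, h1, h2, ← γ_smul_org, mul_smul, mul_smul, mul_smul,
    mul_smul, inv_smul_eq_iff, inv_smul_eq_iff]

/-- The half-edges of the quotient graph, with an endomorphism for every edge. -/
def halfEdges [Fintype (QEdge φ)] [DecidableEq (QVertex φ)] (hfix : FixedPointsRational φ)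
    {Γ : QEdge φ → GL (Fin 2) K} (hΓ : ∀ e, Matrix.ProjGenLinGroup.mk (Γ e) = φ (𝒢.γ e))
    (Y : QEdge φ → Matrix (Fin 2) (Fin 2) K) (htr : ∀ e, (Y e).trace = 0)
    (htriv : ∀ e, (∀ n ∈ 𝒢.edgeGroup e, n = 1) → Y e = 0)
    (hcomm : ∀ e, 𝒢.EdgeComm e → (∃ n ∈ 𝒢.edgeGroup e, n ≠ 1) →
      ∃ n ∈ 𝒢.edgeGroup e, n ≠ 1 ∧
        ∀ g : GL (Fin 2) K, Matrix.ProjGenLinGroup.mk g = φ n → (Y e * g.1).trace = 0)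
    (hsum : ∀ v (X : Matrix (Fin 2) (Fin 2) K), ∑ e, (Y e *
      ((if 𝒢.o e = v then (Γ e)⁻¹.1 * X * (Γ e).1 else 0) - if 𝒢.t e = v then X else 0)).trace = 0) :
    HalfEdges φ (QVertex φ) (QEdge φ × Bool) where
  p v := (𝒢.ι v).1
  base η := if η.2 then 𝒢.t η.1 else 𝒢.o η.1
  far η := if η.2 then (𝒢.lift η.1).org.1 else (𝒢.γ η.1 • (𝒢.lift η.1).tgt).1
  adj := by
    rintro ⟨e, _ | _⟩
    · change (bruhatTits K).Adj (𝒢.ι (𝒢.o e)).1 (𝒢.γ e • (𝒢.lift e).tgt).1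
      rw [← γ_smul_org]
      exact adj_smul _ (𝒢.lift e).adj
    · change (bruhatTits K).Adj (𝒢.ι (𝒢.t e)).1 (𝒢.lift e).org.1
      rw [ι_t]
      exact (𝒢.lift e).adj.symm
  -- The half-edge at the terminal vertex carries `Y e`. The one at the origin carries the negative
  -- conjugate, so that harmonicity becomes an unsigned sum over the half-edges at a vertex.
  mat η := if η.2 then Y η.1 else -((Γ η.1).1 * Y η.1 * (Γ η.1)⁻¹.1)
  opp η := (η.1, !η.2)
  δ η := if η.2 then 𝒢.γ η.1 else (𝒢.γ η.1)⁻¹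
  Δ η := if η.2 then Γ η.1 else (Γ η.1)⁻¹
  mk_Δ := by
    rintro ⟨e, _ | _⟩
    · simp [hΓ]
    · simp [hΓ]
  smul_far := by
    rintro ⟨e, _ | _⟩
    · change ((𝒢.γ e)⁻¹ • (𝒢.γ e • (𝒢.lift e).tgt)).1 = (𝒢.ι (𝒢.t e)).1
      rw [inv_smul_smul, ι_t]
    · change (𝒢.γ e • (𝒢.lift e).org).1 = (𝒢.ι (𝒢.o e)).1
      rw [γ_smul_org]
  mat_opp := by
    rintro ⟨e, _ | _⟩
    · have h : (Γ e)⁻¹.1 * (Γ e).1 = 1 := by rw [← Units.val_mul, inv_mul_cancel, Units.val_one]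
      change Y e = -((Γ e)⁻¹.1 * -((Γ e).1 * Y e * (Γ e)⁻¹.1) * ((Γ e)⁻¹)⁻¹.1)
      rw [inv_inv]
      calc Y e = ((Γ e)⁻¹.1 * (Γ e).1) * Y e * ((Γ e)⁻¹.1 * (Γ e).1) := by rw [h, one_mul, mul_one]
        _ = _ := by noncomm_ring
    · rfl
  trace_mat := by
    rintro ⟨e, _ | _⟩
    · change (-((Γ e).1 * Y e * (Γ e)⁻¹.1)).trace = 0
      rw [Matrix.trace_neg, Matrix.trace_units_conj, htr, neg_zero]
    · exact htr e
  of_trivial := by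
    rintro ⟨e, _ | _⟩ h
    · change -((Γ e).1 * Y e * (Γ e)⁻¹.1) = 0
      rw [htriv e fun n hn => ?_, mul_zero, zero_mul, neg_zero]
      have hn' : 𝒢.γ e * n * (𝒢.γ e)⁻¹ ∈
          stab φ (𝒢.ι (𝒢.o e)).1 ⊓ stab φ (𝒢.γ e • (𝒢.lift e).tgt).1 := by
        rw [← conj_mem_edgeGroup_iff]
        have : (𝒢.γ e)⁻¹ * (𝒢.γ e * n * (𝒢.γ e)⁻¹) * 𝒢.γ e = n := by group
        rwa [this]
      simpa using h _ hn'.1 hn'.2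
    · exact htriv e fun n hn => h n (𝒢.mem_edgeGroup_iff.1 hn).1 (𝒢.mem_edgeGroup_iff.1 hn).2
  of_comm := by
    rintro ⟨e, _ | _⟩ hc ⟨n₁, hn₁, hne⟩
    · have hmem : ∀ n ∈ 𝒢.edgeGroup e, 𝒢.γ e * n * (𝒢.γ e)⁻¹ ∈
          stab φ (𝒢.ι (𝒢.o e)).1 ⊓ stab φ (𝒢.γ e • (𝒢.lift e).tgt).1 := by
        intro n hn
        rw [← conj_mem_edgeGroup_iff]
        have : (𝒢.γ e)⁻¹ * (𝒢.γ e * n * (𝒢.γ e)⁻¹) * 𝒢.γ e = n := by group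
        rwa [this]
      obtain ⟨n, hn, hn1, h⟩ := hcomm e (fun n hn m hm g h hg hh => by
          have := hc _ (hmem n hn) _ (hmem m hm) (Γ e * g * (Γ e)⁻¹) (Γ e * h * (Γ e)⁻¹)
            (by rw [map_mul, map_mul, map_inv, hΓ, hg, map_mul, map_mul, map_inv])
            (by rw [map_mul, map_mul, map_inv, hΓ, hh, map_mul, map_mul, map_inv])
          have e1 : ∀ x y : GL (Fin 2) K, Γ e * x * (Γ e)⁻¹ * (Γ e * y * (Γ e)⁻¹) =
            Γ e * (x * y) * (Γ e)⁻¹ := fun x y => by group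
          rw [e1, e1] at this
          exact mul_left_cancel (mul_right_cancel this))
        ⟨_, 𝒢.conj_mem_edgeGroup_iff.2 hn₁, fun h => hne (by
          rw [mul_assoc, inv_mul_eq_one] at h
          simpa using h.symm)⟩
      refine ⟨_, hmem n hn, fun h => hn1 (by simpa using h), fun g hg => ?_⟩
      have := h ((Γ e)⁻¹ * g * Γ e) (by
        rw [map_mul, map_mul, map_inv, hΓ, hg, map_mul, map_mul, map_inv]; group)
      change (-((Γ e).1 * Y e * (Γ e)⁻¹.1) * g.1).trace = 0
      rw [neg_mul, Matrix.trace_neg, neg_eq_zero, ← this, Units.val_mul, Units.val_mul, mul_assoc,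
        mul_assoc, Matrix.trace_mul_comm, mul_assoc, mul_assoc]
    · obtain ⟨n, hn, hn1, h⟩ := hcomm e (fun n hn m hm => hc n (𝒢.mem_edgeGroup_iff.1 hn) m
        (𝒢.mem_edgeGroup_iff.1 hm)) ⟨n₁, 𝒢.mem_edgeGroup_iff.2 hn₁, hne⟩
      exact ⟨n, 𝒢.mem_edgeGroup_iff.1 hn, hn1, h⟩
  sep := by
    -- If the far ends of two half-edges were translates under the stabilizer of their base vertex,
    -- the edges would be translates; `translate_unique` identifies edge and orientation. In the
    -- mixed cases the orientations disagree, which would make a lift degenerate.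
    have hirr : ∀ e, (𝒢.lift e).org ≠ (𝒢.lift e).tgt := fun e h =>
      (𝒢.lift e).adj.ne (congrArg Subtype.val h)
    rintro ⟨e, _ | _⟩ ⟨e', _ | _⟩ hne hb n hn h
    · have hn2 : n • 𝒢.ι (𝒢.o e) = 𝒢.ι (𝒢.o e) := Subtype.ext hn
      have h2 : n • 𝒢.γ e • (𝒢.lift e).tgt = 𝒢.γ e' • (𝒢.lift e').tgt := Subtype.ext h
      have hb' : 𝒢.o e = 𝒢.o e' := hb
      have := (𝒢.translate_unique hfix (n := n * 𝒢.γ e) (n' := 𝒢.γ e') rfl rfl (Or.inl ⟨by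
        rw [mul_smul, γ_smul_org, γ_smul_org, hn2, hb'], by rw [mul_smul, h2]⟩)).1
      exact hne (by rw [this])
    · have hn2 : n • 𝒢.ι (𝒢.o e) = 𝒢.ι (𝒢.o e) := Subtype.ext hn
      have h2 : n • 𝒢.γ e • (𝒢.lift e).tgt = (𝒢.lift e').org := Subtype.ext h
      have hb' : 𝒢.o e = 𝒢.t e' := hb
      obtain ⟨-, h3, h4⟩ := 𝒢.translate_unique hfix (n := n * 𝒢.γ e) (n' := 1) (e' := e') rfl rfl
        (Or.inr ⟨by rw [mul_smul, h2, one_smul],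
          by rw [mul_smul, γ_smul_org, hn2, hb', ι_t, one_smul]⟩)
      rw [one_smul, mul_smul, γ_smul_org, hn2, hb', ι_t] at h3
      exact hirr e' h3
    · have hn2 : n • 𝒢.ι (𝒢.t e) = 𝒢.ι (𝒢.t e) := Subtype.ext hn
      have h2 : n • (𝒢.lift e).org = 𝒢.γ e' • (𝒢.lift e').tgt := Subtype.ext h
      have hb' : 𝒢.t e = 𝒢.o e' := hb
      obtain ⟨-, h3, h4⟩ := 𝒢.translate_unique hfix (n := n) (n' := 𝒢.γ e') (e := e) (e' := e')
        rfl rfl (Or.inr ⟨by rw [γ_smul_org, ← hb', ← ι_t, hn2], h2.symm⟩)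
      rw [h2] at h3
      exact hirr e' (smul_left_cancel _ h3)
    · have hn2 : n • 𝒢.ι (𝒢.t e) = 𝒢.ι (𝒢.t e) := Subtype.ext hn
      have h2 : n • (𝒢.lift e).org = (𝒢.lift e').org := Subtype.ext h
      have hb' : 𝒢.t e = 𝒢.t e' := hb
      have := (𝒢.translate_unique hfix (n := n) (n' := 1) (e := e) (e' := e') rfl rfl (Or.inl ⟨by
        rw [one_smul, h2], by rw [one_smul, ← ι_t, ← ι_t, hn2, hb']⟩)).1
      exact hne (by rw [this])
  sum_mat v _ := by
    -- By nondegeneracy of the trace form it suffices to test the sum against all `X`, which is the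
    -- hypothesis `hsum` up to sign and cyclic permutation under the trace.
    refine Matrix.ext_iff_trace_mul_right.2 fun X => ?_
    rw [zero_mul, Matrix.trace_zero, Finset.sum_mul, Matrix.trace_sum]
    have h := hsum v X
    rw [← neg_eq_zero, ← Finset.sum_neg_distrib] at h
    rw [← h]
    refine (Finset.sum_subtype
      (Finset.univ.filter fun η : QEdge φ × Bool => (if η.2 then 𝒢.t η.1 else 𝒢.o η.1) = v)
      (fun x => by simp) fun η => ((if η.2 then Y η.1 else
        -((Γ η.1).1 * Y η.1 * (Γ η.1)⁻¹.1)) * X).trace).symm.trans ?_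
    rw [Finset.sum_filter, Fintype.sum_prod_type]
    refine Finset.sum_congr rfl fun e _ => ?_
    rw [Fintype.sum_bool]
    have h1 : ((Γ e).1 * Y e * (Γ e)⁻¹.1 * X).trace =
        (Y e * ((Γ e)⁻¹.1 * X * (Γ e).1)).trace := by
      rw [mul_assoc, mul_assoc, Matrix.trace_mul_comm, mul_assoc, mul_assoc]
    rw [Matrix.coe_units_inv] at h1
    by_cases ht : 𝒢.t e = v <;> by_cases ho : 𝒢.o e = v <;>
      simp [ht, ho, h1, mul_add, sub_eq_add_neg]

/-- An assignment of endomorphisms to the edges that is harmonic at every vertex vanishes. -/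
theorem eq_zero_of_harmonic [Fintype (QEdge φ)] [DecidableEq (QVertex φ)]
    (hchar : ringChar 𝓀[K] = ringChar K) (hφ : Function.Injective φ)
    (hstab : ∀ Λ : Vertex K, Finite (stab φ Λ)) (hfix : FixedPointsRational φ)
    {Γ : QEdge φ → GL (Fin 2) K} (hΓ : ∀ e, Matrix.ProjGenLinGroup.mk (Γ e) = φ (𝒢.γ e))
    (Y : QEdge φ → Matrix (Fin 2) (Fin 2) K) (htr : ∀ e, (Y e).trace = 0)
    (htriv : ∀ e, (∀ n ∈ 𝒢.edgeGroup e, n = 1) → Y e = 0)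
    (hcomm : ∀ e, 𝒢.EdgeComm e → (∃ n ∈ 𝒢.edgeGroup e, n ≠ 1) →
      ∃ n ∈ 𝒢.edgeGroup e, n ≠ 1 ∧
        ∀ g : GL (Fin 2) K, Matrix.ProjGenLinGroup.mk g = φ n → (Y e * g.1).trace = 0)
    (hsum : ∀ v (X : Matrix (Fin 2) (Fin 2) K), ∑ e, (Y e *
      ((if 𝒢.o e = v then (Γ e)⁻¹.1 * X * (Γ e).1 else 0) - if 𝒢.t e = v then X else 0)).trace = 0)
    (e : QEdge φ) : Y e = 0 :=
  (𝒢.halfEdges hfix hΓ Y htr htriv hcomm hsum).mat_eq_zero hchar hφ hstab hfix (e, true)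

end GraphOfGroups

/-! ### The gluing equation as a contraction -/

section Contraction

variable {A : Type*} [CommRing A]

/-- A self-map that is contracting for the adic topology of a nilpotent ideal has exactly one
fixed point. -/
theorem existsUnique_fixedPoint {I : Ideal A} (hI : IsNilpotent I) {J : Type*}
    (Φ : (J → A) → J → A) (h0 : ∀ u, (∀ j, u j ∈ I) → ∀ j, Φ u j ∈ I)
    (h : ∀ (k : ℕ) (u u' : J → A), (∀ j, u j ∈ I) → (∀ j, u' j ∈ I) →
      (∀ j, u j - u' j ∈ I ^ (k + 1)) → ∀ j, Φ u j - Φ u' j ∈ I ^ (k + 2)) :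
    ∃! u : J → A, (∀ j, u j ∈ I) ∧ Φ u = u := by
  obtain ⟨n, hn⟩ := hI
  have hmem : ∀ k, ∀ j, Φ^[k] 0 j ∈ I := by
    intro k
    induction k with
    | zero => intro j; exact zero_mem _
    | succ k ih => rw [Function.iterate_succ_apply']; exact h0 _ ih
  have hdiff : ∀ k j, Φ^[k + 1] 0 j - Φ^[k] 0 j ∈ I ^ (k + 1) := by
    intro k
    induction k with
    | zero =>
      intro j
      rw [zero_add, pow_one]
      exact sub_mem (hmem 1 j) (hmem 0 j)
    | succ k ih =>
      intro j
      rw [Function.iterate_succ_apply' Φ (k + 1), Function.iterate_succ_apply' Φ k]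
      refine h k _ _ ?_ (hmem k) ?_ j
      · have := hmem (k + 1); rwa [Function.iterate_succ_apply'] at this
      · rwa [Function.iterate_succ_apply'] at ih
  -- Since `I ^ n = 0`, the iterates starting from 0 are stationary from the `n`-th one on.
  refine ⟨Φ^[n] 0, ⟨hmem n, ?_⟩, ?_⟩
  · funext j
    have := hdiff n j
    rw [pow_succ, hn, zero_mul, Ideal.zero_eq_bot, Ideal.mem_bot, sub_eq_zero,
      Function.iterate_succ_apply'] at this
    exact this
  · rintro u ⟨hu, hΦ⟩
    have hfix : Φ (Φ^[n] 0) = Φ^[n] 0 := by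
      funext j
      have := hdiff n j
      rw [pow_succ, hn, zero_mul, Ideal.zero_eq_bot, Ideal.mem_bot, sub_eq_zero,
        Function.iterate_succ_apply'] at this
      exact this
    have key : ∀ k j, u j - Φ^[n] 0 j ∈ I ^ (k + 1) := by
      intro k
      induction k with
      | zero => intro j; rw [zero_add, pow_one]; exact sub_mem (hu j) (hmem n j)
      | succ k ih =>
        have := h k _ _ hu (hmem n) ih
        rwa [hΦ, hfix] at this
    funext j
    have := key n j
    rwa [pow_succ, hn, zero_mul, Ideal.zero_eq_bot, Ideal.mem_bot, sub_eq_zero] at this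

/-- All entries of the matrix lie in the ideal. -/
def EntriesIn (I : Ideal A) (M : Matrix (Fin 2) (Fin 2) A) : Prop := ∀ i j, M i j ∈ I

namespace EntriesIn

variable {I J : Ideal A} {M M' : Matrix (Fin 2) (Fin 2) A}

theorem add (h : EntriesIn I M) (h' : EntriesIn I M') : EntriesIn I (M + M') :=
  fun i j => I.add_mem (h i j) (h' i j)

theorem neg (h : EntriesIn I M) : EntriesIn I (-M) := fun i j => I.neg_mem (h i j)

theorem sub (h : EntriesIn I M) (h' : EntriesIn I M') : EntriesIn I (M - M') :=
  fun i j => I.sub_mem (h i j) (h' i j)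

theorem sum {ι : Type*} {s : Finset ι} {M : ι → Matrix (Fin 2) (Fin 2) A}
    (h : ∀ i ∈ s, EntriesIn I (M i)) : EntriesIn I (∑ i ∈ s, M i) := fun a b => by
  rw [Matrix.sum_apply]
  exact I.sum_mem fun i hi => h i hi a b

theorem smul {c : A} (hc : c ∈ I) (M : Matrix (Fin 2) (Fin 2) A) : EntriesIn I (c • M) :=
  fun _ _ => I.mul_mem_right _ hc

theorem smul_mul {c : A} (hc : c ∈ I) (h : EntriesIn J M) : EntriesIn (I * J) (c • M) :=
  fun i j => Ideal.mul_mem_mul hc (h i j)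

theorem mul (h : EntriesIn I M) (h' : EntriesIn J M') : EntriesIn (I * J) (M * M') := fun i j => by
  rw [Matrix.mul_apply]
  exact (I * J).sum_mem fun k _ => Ideal.mul_mem_mul (h i k) (h' k j)

theorem mul_left (h : EntriesIn I M) (Q : Matrix (Fin 2) (Fin 2) A) : EntriesIn I (Q * M) :=
  fun i j => by
    rw [Matrix.mul_apply]
    exact I.sum_mem fun k _ => I.mul_mem_left _ (h k j)

theorem mul_right (h : EntriesIn I M) (Q : Matrix (Fin 2) (Fin 2) A) : EntriesIn I (M * Q) :=
  fun i j => by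
    rw [Matrix.mul_apply]
    exact I.sum_mem fun k _ => I.mul_mem_right _ (h i k)

theorem sub_iff_map_eq : EntriesIn I (M - M') ↔
    M.map (Ideal.Quotient.mk I) = M'.map (Ideal.Quotient.mk I) := by
  rw [← Matrix.ext_iff]
  exact forall_congr' fun i => forall_congr' fun j => (Ideal.Quotient.eq (I := I)).symm

end EntriesIn

variable {K : Type*} [Field K]

section Linear

variable {B : Type*} [Fintype B]

/-- The linear combination of constant matrices with coefficients `u`. -/
def combMat {R : Type*} [CommRing R] [Algebra K R] (X : B → Matrix (Fin 2) (Fin 2) K) (u : B → R) :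
    Matrix (Fin 2) (Fin 2) R :=
  ∑ b, u b • (X b).map (algebraMap K R)

/-- The linear combination of constants with coefficients `u`. -/
def combScal {R : Type*} [CommRing R] [Algebra K R] (l : B → K) (u : B → R) : R :=
  ∑ b, u b * algebraMap K R (l b)

variable [Algebra K A] {I : Ideal A} {u u' : B → A}

theorem combMat_mem (X : B → Matrix (Fin 2) (Fin 2) K) (hu : ∀ b, u b ∈ I) :
    EntriesIn I (combMat X u) := EntriesIn.sum fun b _ => EntriesIn.smul (hu b) _

theorem combScal_mem (l : B → K) (hu : ∀ b, u b ∈ I) : combScal l u ∈ I :=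
  I.sum_mem fun b _ => I.mul_mem_right _ (hu b)

theorem combMat_sub (X : B → Matrix (Fin 2) (Fin 2) K) :
    combMat X u - combMat X u' = combMat X (u - u') := by
  simp only [combMat, ← Finset.sum_sub_distrib, Pi.sub_apply, sub_smul]

theorem combScal_sub (l : B → K) : combScal l u - combScal l u' = combScal l (u - u') := by
  simp only [combScal, ← Finset.sum_sub_distrib, Pi.sub_apply, sub_mul]

variable {A' : Type*} [CommRing A'] [Algebra K A']

theorem map_algebraMap (f : A →ₐ[K] A') (M : Matrix (Fin 2) (Fin 2) K) :
    (M.map (algebraMap K A)).map f = M.map (algebraMap K A') := by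
  ext i j
  exact f.commutes _

theorem combMat_map (f : A →ₐ[K] A') (X : B → Matrix (Fin 2) (Fin 2) K) :
    (combMat X u).map f = combMat X (fun b => f (u b)) := by
  change (f : A →+* A').mapMatrix _ = _
  unfold combMat
  rw [map_sum]
  refine Finset.sum_congr rfl fun b _ => ?_
  ext i j
  exact (map_mul f _ _).trans (congrArg _ (f.commutes _))

theorem combScal_map (f : A →ₐ[K] A') (l : B → K) :
    f (combScal l u) = combScal l (fun b => f (u b)) := by
  unfold combScal
  rw [map_sum]
  refine Finset.sum_congr rfl fun b _ => ?_
  rw [map_mul, f.commutes]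

end Linear

variable {V E : Type*} [Fintype E] [DecidableEq E]

/-- A right inverse, in coordinates, of the linearized gluing map. -/
structure LinearSplitting (o t : E → V) (Γ : E → GL (Fin 2) K)
    (B₀ : E → Fin 2 → Fin 2 → Matrix (Fin 2) (Fin 2) K) where
  X : V → E × Fin 2 × Fin 2 → Matrix (Fin 2) (Fin 2) K
  l : E × Fin 2 × Fin 2 → E × Fin 2 × Fin 2 → K
  eq : ∀ e b, (Γ e)⁻¹.1 * X (o e) b * (Γ e).1 - X (t e) b - ∑ i, ∑ j, l (e, i, j) b • B₀ e i j =
    if b.1 = e then Matrix.single b.2.1 b.2.2 1 else 0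

namespace LinearSplitting

variable {o t : E → V} {Γ : E → GL (Fin 2) K} {B₀ : E → Fin 2 → Fin 2 → Matrix (Fin 2) (Fin 2) K}
  (S : LinearSplitting o t Γ B₀) [Algebra K A]

/-- The matrix `G_v`. -/
def vMat {R : Type*} [CommRing R] [Algebra K R] (u : E × Fin 2 × Fin 2 → R) (v : V) :
    Matrix (Fin 2) (Fin 2) R :=
  1 + combMat (S.X v) u

/-- The matrix `C_e`. -/
def eMat {R : Type*} [CommRing R] [Algebra K R] (u : E × Fin 2 × Fin 2 → R)
    (B : E → Fin 2 → Fin 2 → Matrix (Fin 2) (Fin 2) R) (e : E) : Matrix (Fin 2) (Fin 2) R :=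
  1 + ∑ i, ∑ j, combScal (S.l (e, i, j)) u • B e i j

/-- In the coordinates of the splitting the linearized gluing map is the identity, also with
coefficients in `A`. -/
theorem comb_eq (u : E × Fin 2 × Fin 2 → A) (e : E) :
    (Γ e)⁻¹.1.map (algebraMap K A) * combMat (S.X (o e)) u * (Γ e).1.map (algebraMap K A) -
      combMat (S.X (t e)) u -
      ∑ i, ∑ j, combScal (S.l (e, i, j)) u • (B₀ e i j).map (algebraMap K A) =
    Matrix.of fun i j => u (e, i, j) := by
  have h : ∑ b, u b • ((Γ e)⁻¹.1 * S.X (o e) b * (Γ e).1 - S.X (t e) b -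
      ∑ i, ∑ j, S.l (e, i, j) b • B₀ e i j).map (algebraMap K A) =
      Matrix.of fun i j => u (e, i, j) := by
    simp only [S.eq]
    ext i j
    rw [Matrix.sum_apply, Finset.sum_eq_single (e, i, j)]
    · simp
    · rintro ⟨e', i', j'⟩ - hne
      by_cases he : e' = e
      · subst he
        have : ¬ (i' = i ∧ j' = j) := fun h => hne (by rw [h.1, h.2])
        simp [this]
      · simp [he]
    · simp
  rw [← h]
  unfold combMat combScal
  simp only [Matrix.mul_sum, Matrix.sum_mul, Finset.sum_smul]
  have hmap : ∀ M : Matrix (Fin 2) (Fin 2) K, M.map (algebraMap K A) =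
    (algebraMap K A).mapMatrix M := fun _ => rfl
  have e1 : ∀ b, (u b • ((Γ e)⁻¹.1 * S.X (o e) b * (Γ e).1 - S.X (t e) b -
      ∑ i, ∑ j, S.l (e, i, j) b • B₀ e i j).map (algebraMap K A)) =
      (Γ e)⁻¹.1.map (algebraMap K A) * u b • (S.X (o e) b).map (algebraMap K A) *
        (Γ e).1.map (algebraMap K A) - u b • (S.X (t e) b).map (algebraMap K A) -
      ∑ i, ∑ j, (u b * algebraMap K A (S.l (e, i, j) b)) • (B₀ e i j).map (algebraMap K A) := by
    intro b
    simp only [hmap, map_sub, map_mul, map_sum, smul_sub, Matrix.mul_smul, Matrix.smul_mul,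
      Finset.smul_sum]
    congr 1
    refine Finset.sum_congr rfl fun i _ => Finset.sum_congr rfl fun j _ => ?_
    rw [mul_smul]
    congr 1
    ext a c
    simp
  rw [Finset.sum_congr rfl fun b _ => e1 b, Finset.sum_sub_distrib, Finset.sum_sub_distrib]
  congr 1
  refine Eq.symm ?_
  rw [Finset.sum_comm]
  exact Finset.sum_congr rfl fun i _ => Finset.sum_comm

/-- The gluing equation. -/
def IsSolution {R : Type*} [CommRing R] [Algebra K R]
    (B : E → Fin 2 → Fin 2 → Matrix (Fin 2) (Fin 2) R) (T : E → Matrix (Fin 2) (Fin 2) R)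
    (u : E × Fin 2 × Fin 2 → R) : Prop :=
  ∀ e, (Γ e).1.map (algebraMap K R) * S.eMat u B e * S.vMat u (t e) = S.vMat u (o e) * T e

/-- Multiplied by Γ_e⁻¹, the equation has the linear part `u` by `comb_eq`. Apart from a fixed
inhomogeneous term, what remains consists of products with at least two factors in `I`, so it
contracts. The matrices `B` may depend on `u`, in a Lipschitz way, because in one application the
edge centralizers move with the unknown. -/
theorem existsUnique_isSolution {I : Ideal A} (hI : IsNilpotent I)
    (B : (E × Fin 2 × Fin 2 → A) → E → Fin 2 → Fin 2 → Matrix (Fin 2) (Fin 2) A)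
    (hB : ∀ u, (∀ b, u b ∈ I) → ∀ e i j,
      EntriesIn I (B u e i j - (B₀ e i j).map (algebraMap K A)))
    (hB' : ∀ (k : ℕ) u u', (∀ b, u b ∈ I) → (∀ b, u' b ∈ I) → (∀ b, u b - u' b ∈ I ^ k) →
      ∀ e i j, EntriesIn (I ^ k) (B u e i j - B u' e i j))
    (T : E → Matrix (Fin 2) (Fin 2) A)
    (hT : ∀ e, EntriesIn I (T e - (Γ e).1.map (algebraMap K A))) :
    ∃! u : E × Fin 2 × Fin 2 → A, (∀ b, u b ∈ I) ∧ S.IsSolution (B u) T u := by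
  let gi : E → Matrix (Fin 2) (Fin 2) A := fun e => (Γ e)⁻¹.1.map (algebraMap K A)
  let g : E → Matrix (Fin 2) (Fin 2) A := fun e => (Γ e).1.map (algebraMap K A)
  have hgi : ∀ e, gi e * g e = 1 := fun e => by
    rw [← Matrix.map_mul, ← Units.val_mul, inv_mul_cancel, Units.val_one,
      Matrix.map_one _ (map_zero _) (map_one _)]
  have hgi' : ∀ e, g e * gi e = 1 := fun e => by
    rw [← Matrix.map_mul, ← Units.val_mul, mul_inv_cancel, Units.val_one,
      Matrix.map_one _ (map_zero _) (map_one _)]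
  let b0 : E → Fin 2 → Fin 2 → Matrix (Fin 2) (Fin 2) A := fun e i j =>
    (B₀ e i j).map (algebraMap K A)
  let F : (E × Fin 2 × Fin 2 → A) → E → Matrix (Fin 2) (Fin 2) A := fun u e =>
    -(gi e * (T e - g e)) - gi e * (combMat (S.X (o e)) u * (T e - g e)) +
      ∑ i, ∑ j, combScal (S.l (e, i, j)) u • (B u e i j - b0 e i j) +
      ∑ i, ∑ j, combScal (S.l (e, i, j)) u • (B u e i j * combMat (S.X (t e)) u)
  let Φ : (E × Fin 2 × Fin 2 → A) → E × Fin 2 × Fin 2 → A := fun u b => F u b.1 b.2.1 b.2.2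
  have hF : ∀ u e, F u e = (Matrix.of fun i j => u (e, i, j)) -
      gi e * (S.vMat u (o e) * T e - g e * S.eMat u (B u) e * S.vMat u (t e)) := by
    intro u e
    rw [← S.comb_eq u e]
    have h1 : ∑ i, ∑ j, combScal (S.l (e, i, j)) u • (B u e i j - b0 e i j) =
        ∑ i, ∑ j, combScal (S.l (e, i, j)) u • B u e i j -
          ∑ i, ∑ j, combScal (S.l (e, i, j)) u • b0 e i j := by
      simp only [smul_sub, Finset.sum_sub_distrib]
    have h2 : ∑ i, ∑ j, combScal (S.l (e, i, j)) u • (B u e i j * combMat (S.X (t e)) u) =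
        (∑ i, ∑ j, combScal (S.l (e, i, j)) u • B u e i j) * combMat (S.X (t e)) u := by
      simp only [Finset.sum_mul, Matrix.smul_mul]
    change -(gi e * (T e - g e)) - gi e * (combMat (S.X (o e)) u * (T e - g e)) + _ + _ =
      gi e * combMat (S.X (o e)) u * g e - combMat (S.X (t e)) u -
        ∑ i, ∑ j, combScal (S.l (e, i, j)) u • b0 e i j - _
    rw [h1, h2]
    unfold vMat eMat
    set c := ∑ i, ∑ j, combScal (S.l (e, i, j)) u • B u e i j
    set d := ∑ i, ∑ j, combScal (S.l (e, i, j)) u • b0 e i j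
    have h3 : gi e * (g e * (1 + c) * (1 + combMat (S.X (t e)) u)) =
        (1 + c) * (1 + combMat (S.X (t e)) u) := by
      rw [mul_assoc, ← mul_assoc, hgi, one_mul]
    rw [mul_sub (gi e) (_ * T e), h3]
    have h4 : gi e * (T e - g e) = gi e * T e - 1 := by rw [mul_sub, hgi]
    rw [h4]
    noncomm_ring
  have hsol : ∀ u, Φ u = u ↔ S.IsSolution (B u) T u := by
    intro u
    have h1 : Φ u = u ↔ ∀ e, F u e = Matrix.of fun i j => u (e, i, j) := by
      constructor
      · intro h e
        ext i j
        exact congrFun h (e, i, j)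
      · intro h
        funext ⟨e, i, j⟩
        exact congrFun₂ (h e) i j
    rw [h1]
    refine forall_congr' fun e => ?_
    rw [hF, sub_eq_self]
    constructor
    · intro h
      have := congrArg (g e * ·) h
      simp only [← mul_assoc, hgi', one_mul, mul_zero] at this
      rw [sub_eq_zero] at this
      exact this.symm
    · intro h
      rw [← h, sub_self, mul_zero]
  have hFI : ∀ u, (∀ b, u b ∈ I) → ∀ e, EntriesIn I (F u e) := fun u hu e =>
    ((((hT e).mul_left _).neg.sub (((hT e).mul_left _).mul_left _)).add
      (EntriesIn.sum fun i _ => EntriesIn.sum fun j _ => EntriesIn.smul (combScal_mem _ hu) _)).add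
      (EntriesIn.sum fun i _ => EntriesIn.sum fun j _ => EntriesIn.smul (combScal_mem _ hu) _)
  have hFd : ∀ (k : ℕ) (u u' : E × Fin 2 × Fin 2 → A), (∀ j, u j ∈ I) → (∀ j, u' j ∈ I) →
      (∀ j, u j - u' j ∈ I ^ (k + 1)) → ∀ e, EntriesIn (I ^ (k + 2)) (F u e - F u' e) := by
    intro k u u' hu hu' hd e
    have p1 : I ^ (k + 2) = I ^ (k + 1) * I := pow_succ _ _
    have p2 : I ^ (k + 2) = I * I ^ (k + 1) := pow_succ' _ _
    have hBd := hB' (k + 1) u u' hu hu' hd e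
    have hx : ∀ v, EntriesIn (I ^ (k + 1)) (combMat (S.X v) u - combMat (S.X v) u') := fun v => by
      rw [combMat_sub]; exact combMat_mem _ hd
    have hl : ∀ i j, combScal (S.l (e, i, j)) u - combScal (S.l (e, i, j)) u' ∈ I ^ (k + 1) :=
      fun i j => by rw [combScal_sub]; exact combScal_mem _ hd
    -- Telescoping: in each product one factor at a time is replaced, so each term has one factor in
    -- `I ^ (k + 1)` and a further one in `I`.
    have e1 : F u e - F u' e =
        -(gi e * ((combMat (S.X (o e)) u - combMat (S.X (o e)) u') * (T e - g e))) +
        ∑ i, ∑ j, ((combScal (S.l (e, i, j)) u - combScal (S.l (e, i, j)) u') •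
            (B u e i j - b0 e i j) + combScal (S.l (e, i, j)) u' • (B u e i j - B u' e i j)) +
        ∑ i, ∑ j, ((combScal (S.l (e, i, j)) u - combScal (S.l (e, i, j)) u') •
            (B u e i j * combMat (S.X (t e)) u) + combScal (S.l (e, i, j)) u' •
              ((B u e i j - B u' e i j) * combMat (S.X (t e)) u) + combScal (S.l (e, i, j)) u' •
              (B u' e i j * (combMat (S.X (t e)) u - combMat (S.X (t e)) u'))) := by
      have q1 : ∀ (c c' : A) (M M' N : Matrix (Fin 2) (Fin 2) A),
          (c - c') • (M - N) + c' • (M - M') = c • (M - N) - c' • (M' - N) := by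
        intro c c' M M' N
        module
      have q2 : ∀ (c c' : A) (M M' x x' : Matrix (Fin 2) (Fin 2) A),
          (c - c') • (M * x) + c' • ((M - M') * x) + c' • (M' * (x - x')) =
            c • (M * x) - c' • (M' * x') := by
        intro c c' M M' x x'
        rw [sub_mul, mul_sub]
        module
      have q3 : ∀ x x' y z : Matrix (Fin 2) (Fin 2) A,
          z * ((x - x') * y) = z * (x * y) - z * (x' * y) := fun x x' y z => by noncomm_ring
      simp only [q1, q2, q3, Finset.sum_sub_distrib, F]
      abel
    rw [e1]
    refine (EntriesIn.add ?_ ?_).add ?_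
    · rw [p1]
      exact (((hx _).mul (hT e)).mul_left _).neg
    · refine EntriesIn.sum fun i _ => EntriesIn.sum fun j _ => EntriesIn.add ?_ ?_
      · rw [p1]; exact EntriesIn.smul_mul (hl i j) (hB u hu e i j)
      · rw [p2]; exact EntriesIn.smul_mul (combScal_mem _ hu') (hBd i j)
    · refine EntriesIn.sum fun i _ => EntriesIn.sum fun j _ =>
        EntriesIn.add (EntriesIn.add ?_ ?_) ?_
      · rw [p1]; exact EntriesIn.smul_mul (hl i j) ((combMat_mem _ hu).mul_left _)
      · rw [p2]; exact EntriesIn.smul_mul (combScal_mem _ hu') ((hBd i j).mul_right _)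
      · rw [p2]; exact EntriesIn.smul_mul (combScal_mem _ hu') ((hx _).mul_left _)
  have := existsUnique_fixedPoint hI Φ (fun u hu b => hFI u hu b.1 b.2.1 b.2.2)
    (fun k u u' hu hu' hd b => hFd k u u' hu hu' hd b.1 b.2.1 b.2.2)
  simpa only [hsol] using this

end LinearSplitting

end Contraction

/-! ### Canonical matrix representatives of elements of PGL(2) -/

section Normalize

variable {K : Type*} [Field K]

theorem exists_pivot (Γ : GL (Fin 2) K) : ∃ p : Fin 2 × Fin 2, Γ.1 p.1 p.2 ≠ 0 := by
  by_contra! h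
  exact Γ.isUnit.ne_zero (by ext i j; exact h (i, j))

/-- A position at which the matrix has a nonzero entry. -/
def pivot (Γ : GL (Fin 2) K) : Fin 2 × Fin 2 := (exists_pivot Γ).choose

theorem pivot_ne (Γ : GL (Fin 2) K) : Γ.1 (pivot Γ).1 (pivot Γ).2 ≠ 0 := (exists_pivot Γ).choose_spec

variable {R S : Type*} [CommRing R] [Algebra K R] [CommRing S] [Algebra K S]

/-- The multiple of `Q` that agrees with `Γ` at the pivot of `Γ`. -/
def normalizeGL (Γ : GL (Fin 2) K) (Q : GL (Fin 2) R) : Matrix (Fin 2) (Fin 2) R :=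
  (algebraMap K R (Γ.1 (pivot Γ).1 (pivot Γ).2) * Ring.inverse (Q.1 (pivot Γ).1 (pivot Γ).2)) • Q.1

/-- The matrix that represents an element of `PGL(2)` and agrees with `Γ` at the pivot. -/
def normalize (Γ : GL (Fin 2) K) (b : PGL(2, R)) : Matrix (Fin 2) (Fin 2) R :=
  normalizeGL Γ (Matrix.ProjGenLinGroup.mk_surjective b).choose

theorem scalar_mul_val (Q : GL (Fin 2) R) (u : Rˣ) :
    (Q * Matrix.GeneralLinearGroup.scalar (Fin 2) u).1 = (u : R) • Q.1 := by
  rw [Units.val_mul]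
  ext i j
  fin_cases i <;> fin_cases j <;>
    simp [Matrix.GeneralLinearGroup.scalar, Matrix.scalar, mul_comm]

theorem mk_eq_mk_iff_smul {Q Q' : GL (Fin 2) R} :
    Matrix.ProjGenLinGroup.mk Q = Matrix.ProjGenLinGroup.mk Q' ↔ ∃ u : Rˣ, Q'.1 = (u : R) • Q.1 := by
  rw [Matrix.ProjGenLinGroup.mk_eq_mk_iff]
  refine exists_congr fun u => ?_
  rw [← Units.val_inj, scalar_mul_val, eq_comm]

/-- Fixing the pivot entry removes the scalar ambiguity, so the matrix depends only on the
projective class. This makes the representative compatible with base change. -/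
theorem normalize_mk (Γ : GL (Fin 2) K) (Q : GL (Fin 2) R) :
    normalize Γ (Matrix.ProjGenLinGroup.mk Q) = normalizeGL Γ Q := by
  unfold normalize
  have h := (Matrix.ProjGenLinGroup.mk_surjective (Matrix.ProjGenLinGroup.mk Q)).choose_spec
  obtain ⟨u, hu⟩ := mk_eq_mk_iff_smul.1 h.symm
  unfold normalizeGL
  rw [hu, Matrix.smul_apply, smul_eq_mul, Ring.mul_inverse_rev, Ring.inverse_unit, smul_smul]
  congr 1
  rw [mul_assoc, mul_assoc, Units.inv_mul, mul_one]

theorem map_ring_inverse (f : R →ₐ[K] S) {a : R} (ha : IsUnit a) :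
    f (Ring.inverse a) = Ring.inverse (f a) := by
  obtain ⟨u, rfl⟩ := ha
  rw [Ring.inverse_unit]
  exact (Ring.inverse_unit (Units.map (f : R →* S) u)).symm

theorem normalize_map (f : R →ₐ[K] S) (Γ : GL (Fin 2) K) {Q : GL (Fin 2) R}
    (hQ : IsUnit (Q.1 (pivot Γ).1 (pivot Γ).2)) :
    (normalize Γ (Matrix.ProjGenLinGroup.mk Q)).map f =
      normalize Γ (Matrix.ProjGenLinGroup.map (f : R →+* S) (Matrix.ProjGenLinGroup.mk Q)) := by
  rw [Matrix.ProjGenLinGroup.map_mk, normalize_mk, normalize_mk]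
  unfold normalizeGL
  ext i j
  change f ((_ * _) * Q.1 i j) = (_ * Ring.inverse (f (Q.1 _ _))) * f (Q.1 i j)
  rw [map_mul, map_mul, f.commutes, map_ring_inverse f hQ]

theorem normalize_eq_smul (Γ : GL (Fin 2) K) {Q : GL (Fin 2) R}
    (hQ : IsUnit (Q.1 (pivot Γ).1 (pivot Γ).2)) :
    ∃ c : Rˣ, normalize Γ (Matrix.ProjGenLinGroup.mk Q) = (c : R) • Q.1 := by
  obtain ⟨u, hu⟩ := hQ
  have hp : IsUnit (algebraMap K R (Γ.1 (pivot Γ).1 (pivot Γ).2)) :=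
    (IsUnit.mk0 _ (pivot_ne Γ)).map (algebraMap K R)
  refine ⟨hp.unit * u⁻¹, ?_⟩
  rw [normalize_mk]
  unfold normalizeGL
  rw [← hu, Ring.inverse_unit]
  rfl

theorem normalize_congr (Γ : GL (Fin 2) K) (I : Ideal R) {Q Q' : GL (Fin 2) R}
    (hQ : IsUnit (Q.1 (pivot Γ).1 (pivot Γ).2)) (hQ' : IsUnit (Q'.1 (pivot Γ).1 (pivot Γ).2))
    (h : EntriesIn I (Q.1 - Q'.1)) : EntriesIn I (normalize Γ (Matrix.ProjGenLinGroup.mk Q) -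
      normalize Γ (Matrix.ProjGenLinGroup.mk Q')) := by
  rw [EntriesIn.sub_iff_map_eq] at h ⊢
  have h1 := normalize_map (Ideal.Quotient.mkₐ K I) Γ hQ
  have h2 := normalize_map (Ideal.Quotient.mkₐ K I) Γ hQ'
  refine h1.trans (Eq.trans ?_ h2.symm)
  rw [Matrix.ProjGenLinGroup.map_mk, Matrix.ProjGenLinGroup.map_mk]
  congr 2
  exact Units.ext h

open Classical in
/-- The matrix as an element of `GL(2)`, if it is invertible. -/
def toGL (M : Matrix (Fin 2) (Fin 2) R) : GL (Fin 2) R :=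
  if h : IsUnit M.det then Matrix.GeneralLinearGroup.mk'' M h else 1

theorem toGL_val {M : Matrix (Fin 2) (Fin 2) R} (h : IsUnit M.det) : (toGL M).1 = M := by
  unfold toGL
  rw [dif_pos h]
  rfl

theorem toGL_map (f : R →ₐ[K] S) {M : Matrix (Fin 2) (Fin 2) R} (h : IsUnit M.det) :
    Matrix.GeneralLinearGroup.map (f : R →+* S) (toGL M) = toGL (M.map f) := by
  apply Units.ext
  have h' : IsUnit (M.map f).det := by
    have : (M.map f).det = f M.det := (RingHom.map_det (f : R →+* S) M).symm
    rw [this]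
    exact h.map f
  rw [toGL_val h']
  change (toGL M).1.map f = _
  rw [toGL_val h]

end Normalize

/-! ### Lifts over local Artinian algebras -/

section Reduction

variable {K : Type u} [Field K] {A : ArtAlg K}

/-- The element `b` of `PGL(2, A)` reduces to the element `g` of `PGL(2, K)`. -/
def ReducesTo (A : ArtAlg K) (b : PGL(2, A.carrier)) (g : PGL(2, K)) : Prop :=
  Matrix.ProjGenLinGroup.map (IsLocalRing.residue A.carrier) b =
    Matrix.ProjGenLinGroup.map (algebraMap K (IsLocalRing.ResidueField A.carrier)) g

theorem isLift_iff {H : Type u} [Group H] {ρ : H →* PGL(2, K)} {ψ : H →* PGL(2, A.carrier)} :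
    IsLift ρ A ψ ↔ ∀ n, ReducesTo A (ψ n) (ρ n) :=
  DFunLike.ext_iff

namespace ReducesTo

variable {b b' : PGL(2, A.carrier)} {g g' : PGL(2, K)}

theorem mul (h : ReducesTo A b g) (h' : ReducesTo A b' g') : ReducesTo A (b * b') (g * g') := by
  unfold ReducesTo at *
  rw [map_mul, map_mul, h, h']

theorem inv (h : ReducesTo A b g) : ReducesTo A b⁻¹ g⁻¹ := by
  unfold ReducesTo at *
  rw [map_inv, map_inv, h]

theorem one : ReducesTo A 1 1 := by
  unfold ReducesTo
  rw [map_one, map_one]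

theorem const (g : PGL(2, K)) : ReducesTo A (constPGL A g) g := residue_constPGL A g

end ReducesTo

theorem residue_eq_iff_sub_mem {x y : A.carrier} :
    IsLocalRing.residue A.carrier x = IsLocalRing.residue A.carrier y ↔
      x - y ∈ IsLocalRing.maximalIdeal A.carrier := by
  rw [← sub_eq_zero, ← map_sub, IsLocalRing.residue_eq_zero_iff]

theorem entriesIn_sub_iff {M M' : Matrix (Fin 2) (Fin 2) A.carrier} :
    EntriesIn (IsLocalRing.maximalIdeal A.carrier) (M - M') ↔
      M.map (IsLocalRing.residue A.carrier) = M'.map (IsLocalRing.residue A.carrier) := by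
  rw [← Matrix.ext_iff]
  exact forall_congr' fun i => forall_congr' fun j => residue_eq_iff_sub_mem.symm

theorem isUnit_iff_residue_ne {x : A.carrier} :
    IsUnit x ↔ IsLocalRing.residue A.carrier x ≠ 0 :=
  (IsLocalRing.residue_ne_zero_iff_isUnit x).symm

theorem residue_algebraMap (c : K) : IsLocalRing.residue A.carrier (algebraMap K A.carrier c) =
    algebraMap K (IsLocalRing.ResidueField A.carrier) c := rfl

/-- A representative of an element that reduces to `mk Γ` is congruent to a multiple of `Γ`. -/
theorem ReducesTo.exists_unit {Γ : GL (Fin 2) K} {Q : GL (Fin 2) A.carrier}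
    (h : ReducesTo A (Matrix.ProjGenLinGroup.mk Q) (Matrix.ProjGenLinGroup.mk Γ)) :
    ∃ c : A.carrierˣ, EntriesIn (IsLocalRing.maximalIdeal A.carrier)
      (Q.1 - (c : A.carrier) • Γ.1.map (algebraMap K A.carrier)) := by
  unfold ReducesTo at h
  rw [Matrix.ProjGenLinGroup.map_mk, Matrix.ProjGenLinGroup.map_mk, eq_comm, mk_eq_mk_iff_smul] at h
  obtain ⟨u, hu⟩ := h
  obtain ⟨c, hc⟩ := IsLocalRing.residue_surjective (u : IsLocalRing.ResidueField A.carrier)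
  have hcu : IsUnit c := isUnit_iff_residue_ne.2 (by rw [hc]; exact u.ne_zero)
  refine ⟨hcu.unit, entriesIn_sub_iff.2 ?_⟩
  ext i j
  have := congrFun₂ hu i j
  change IsLocalRing.residue A.carrier (Q.1 i j) = u * _ at this
  change IsLocalRing.residue A.carrier (Q.1 i j) = IsLocalRing.residue A.carrier (c * _)
  rw [this, map_mul, hc]
  rfl

theorem ReducesTo.isUnit_pivot {Γ : GL (Fin 2) K} {Q : GL (Fin 2) A.carrier}
    (h : ReducesTo A (Matrix.ProjGenLinGroup.mk Q) (Matrix.ProjGenLinGroup.mk Γ)) :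
    IsUnit (Q.1 (pivot Γ).1 (pivot Γ).2) := by
  obtain ⟨c, hc⟩ := h.exists_unit
  rw [isUnit_iff_residue_ne, residue_eq_iff_sub_mem.2 (hc _ _), Matrix.smul_apply, smul_eq_mul,
    map_mul]
  refine mul_ne_zero (isUnit_iff_residue_ne.1 c.isUnit) ?_
  change algebraMap K (IsLocalRing.ResidueField A.carrier) _ ≠ 0
  rw [Ne, map_eq_zero]
  exact pivot_ne Γ

/-- A representative is congruent to a multiple of `Γ`; agreement at the pivot forces the multiple
to be 1. -/
theorem ReducesTo.normalize_sub {Γ : GL (Fin 2) K} {b : PGL(2, A.carrier)}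
    (h : ReducesTo A b (Matrix.ProjGenLinGroup.mk Γ)) :
    EntriesIn (IsLocalRing.maximalIdeal A.carrier)
      (normalize Γ b - Γ.1.map (algebraMap K A.carrier)) := by
  obtain ⟨Q, rfl⟩ := Matrix.ProjGenLinGroup.mk_surjective b
  obtain ⟨q, hq⟩ := h.isUnit_pivot
  obtain ⟨c, hc⟩ := h.exists_unit
  rw [entriesIn_sub_iff] at hc ⊢
  rw [normalize_mk]
  unfold normalizeGL
  rw [← hq, Ring.inverse_unit]
  have hr : ∀ i j, IsLocalRing.residue A.carrier (Q.1 i j) = IsLocalRing.residue A.carrier c *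
      algebraMap K _ (Γ.1 i j) := fun i j =>
    (congrFun₂ hc i j).trans (map_mul (IsLocalRing.residue A.carrier) _ _)
  have hp := hr (pivot Γ).1 (pivot Γ).2
  have hq1 : IsLocalRing.residue A.carrier (q : A.carrier) *
      IsLocalRing.residue A.carrier ((q⁻¹ : A.carrierˣ) : A.carrier) = 1 := by
    rw [← map_mul, Units.mul_inv, map_one]
  rw [← hq] at hp
  ext i j
  change IsLocalRing.residue A.carrier ((_ * _) * Q.1 i j) = algebraMap K _ (Γ.1 i j)
  rw [map_mul, map_mul, hr, residue_algebraMap]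
  rw [hp] at hq1
  linear_combination algebraMap K (IsLocalRing.ResidueField A.carrier) (Γ.1 i j) * hq1

theorem ReducesTo.exists_normalize_eq {Γ : GL (Fin 2) K} {Q : GL (Fin 2) A.carrier}
    (h : ReducesTo A (Matrix.ProjGenLinGroup.mk Q) (Matrix.ProjGenLinGroup.mk Γ)) :
    ∃ c : A.carrierˣ, normalize Γ (Matrix.ProjGenLinGroup.mk Q) = (c : A.carrier) • Q.1 :=
  normalize_eq_smul Γ h.isUnit_pivot

theorem ReducesTo.normalize_map {Γ : GL (Fin 2) K} {b : PGL(2, A.carrier)}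
    (h : ReducesTo A b (Matrix.ProjGenLinGroup.mk Γ)) {B : ArtAlg K}
    (f : A.carrier →ₐ[K] B.carrier) : (normalize Γ b).map f =
      normalize Γ (Matrix.ProjGenLinGroup.map (f : A.carrier →+* B.carrier) b) := by
  obtain ⟨Q, rfl⟩ := Matrix.ProjGenLinGroup.mk_surjective b
  exact MumfordDeformation.normalize_map f Γ h.isUnit_pivot

theorem isUnit_det_of_near_one {M : Matrix (Fin 2) (Fin 2) A.carrier}
    (h : EntriesIn (IsLocalRing.maximalIdeal A.carrier) (M - 1)) : IsUnit M.det := by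
  rw [entriesIn_sub_iff] at h
  have h1 : IsLocalRing.residue A.carrier M.det = (M.map (IsLocalRing.residue A.carrier)).det :=
    RingHom.map_det _ _
  rw [isUnit_iff_residue_ne, h1, h, Matrix.map_one _ (map_zero _) (map_one _), Matrix.det_one]
  exact one_ne_zero

theorem reducesTo_one_of_near_one {M : Matrix (Fin 2) (Fin 2) A.carrier}
    (h : EntriesIn (IsLocalRing.maximalIdeal A.carrier) (M - 1)) :
    ReducesTo A (Matrix.ProjGenLinGroup.mk (toGL M)) 1 := by
  have hu := isUnit_det_of_near_one h
  rw [entriesIn_sub_iff] at h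
  unfold ReducesTo
  rw [map_one, Matrix.ProjGenLinGroup.map_mk, ← map_one Matrix.ProjGenLinGroup.mk]
  congr 1
  apply Units.ext
  change (toGL M).1.map _ = 1
  rw [toGL_val hu, h, Matrix.map_one _ (map_zero _) (map_one _)]

/-- The off-diagonal entries of `P²`, and the difference of its diagonal entries, are the
corresponding expressions in `P` times the trace. One of these expressions is a unit. -/
theorem trace_eq_zero_of_sq_scalar {R : Type*} [CommRing R] {P : Matrix (Fin 2) (Fin 2) R} {s : R}
    (h : P * P = s • 1) (hP : IsUnit (P 0 1) ∨ IsUnit (P 1 0) ∨ IsUnit (P 0 0 - P 1 1)) :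
    P.trace = 0 := by
  have h00 := congrFun₂ h 0 0
  have h01 := congrFun₂ h 0 1
  have h10 := congrFun₂ h 1 0
  have h11 := congrFun₂ h 1 1
  simp only [Matrix.mul_apply, Fin.sum_univ_two, Matrix.smul_apply, Matrix.one_apply_eq, smul_eq_mul,
    ne_eq, zero_ne_one, not_false_eq_true, Matrix.one_apply_ne, mul_zero, one_ne_zero] at h00 h01 h10 h11
  rw [Matrix.trace_fin_two]
  rcases hP with h | h | h
  · exact (h.mul_right_eq_zero).1 (by linear_combination h01)
  · exact (h.mul_right_eq_zero).1 (by linear_combination h10)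
  · exact (h.mul_right_eq_zero).1 (by linear_combination h00 - h11)

/-- Lifts of elements with commuting representatives have commuting representatives. -/
theorem commute_of_isLift {H : Type u} [Group H] {ρ : H →* PGL(2, K)} (hρ : Function.Injective ρ)
    {ψ : H →* PGL(2, A.carrier)} (hψ : IsLift ρ A ψ) {n m : H}
    (hc : ∀ g h : GL (Fin 2) K, Matrix.ProjGenLinGroup.mk g = ρ n →
      Matrix.ProjGenLinGroup.mk h = ρ m → g * h = h * g) {Q R : GL (Fin 2) A.carrier}
    (hQ : Matrix.ProjGenLinGroup.mk Q = ψ n) (hR : Matrix.ProjGenLinGroup.mk R = ψ m) :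
    Q.1 * R.1 = R.1 * Q.1 := by
  obtain ⟨g, hg⟩ := Matrix.ProjGenLinGroup.mk_surjective (ρ n)
  obtain ⟨h, hh⟩ := Matrix.ProjGenLinGroup.mk_surjective (ρ m)
  have hgh := hc g h hg hh
  rw [isLift_iff] at hψ
  have hnm : n * m = m * n := hρ (by rw [map_mul, map_mul, ← hg, ← hh, ← map_mul, hgh, map_mul])
  -- The lifts commute up to a scalar `c`. Determinants give `c² = 1`, and commutativity over `K`
  -- gives `c ≡ 1`. This forces `c = 1` unless 2 = 0.
  obtain ⟨c, hcQ⟩ : ∃ c : A.carrierˣ, (Q * R).1 = (c : A.carrier) • (R * Q).1 :=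
    mk_eq_mk_iff_smul.1 (by rw [map_mul, map_mul, hQ, hR, ← map_mul, ← hnm, map_mul])
  rw [Units.val_mul, Units.val_mul] at hcQ
  suffices hs : (c : A.carrier) = 1 ∨ Q.1 * R.1 = R.1 * Q.1 by
    rcases hs with hs | hs
    · rw [hcQ, hs, one_smul]
    · exact hs
  have hred : ∀ (k : H) (P : GL (Fin 2) A.carrier) (a : GL (Fin 2) K),
      Matrix.ProjGenLinGroup.mk P = ψ k → Matrix.ProjGenLinGroup.mk a = ρ k →
      ∃ d : IsLocalRing.ResidueField A.carrier, d ≠ 0 ∧ ∀ i j,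
        IsLocalRing.residue A.carrier (P.1 i j) = d * algebraMap K _ (a.1 i j) := by
    intro k P a hP ha
    have := hψ k
    rw [← hP, ← ha] at this
    obtain ⟨d, hd⟩ := this.exists_unit
    rw [entriesIn_sub_iff] at hd
    exact ⟨_, isUnit_iff_residue_ne.1 d.isUnit, fun i j =>
      (congrFun₂ hd i j).trans (map_mul (IsLocalRing.residue A.carrier) _ _)⟩
  have hdetQ : IsUnit (Q.1.det) := (Matrix.isUnit_iff_isUnit_det _).1 Q.isUnit
  have hdetR : IsUnit (R.1.det) := (Matrix.isUnit_iff_isUnit_det _).1 R.isUnit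
  have hc2 : ((c : A.carrier) - 1) * ((c : A.carrier) + 1) = 0 := by
    have := congrArg Matrix.det hcQ
    rw [Matrix.det_mul, Matrix.det_smul, Matrix.det_mul, Fintype.card_fin] at this
    exact ((hdetQ.mul hdetR).mul_right_eq_zero).1 (by linear_combination -this)
  have hc1 : IsLocalRing.residue A.carrier (c : A.carrier) = 1 := by
    obtain ⟨d, hd, hdQ⟩ := hred n Q g hQ hg
    obtain ⟨d', hd', hdR⟩ := hred m R h hR hh
    have e1 : ∀ i j, IsLocalRing.residue A.carrier ((Q.1 * R.1) i j) =
        d * d' * algebraMap K _ ((g.1 * h.1) i j) := by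
      intro i j
      simp only [Matrix.mul_apply, Fin.sum_univ_two, map_add, map_mul, hdQ, hdR]
      ring
    have e2 : ∀ i j, IsLocalRing.residue A.carrier ((R.1 * Q.1) i j) =
        d * d' * algebraMap K _ ((g.1 * h.1) i j) := by
      intro i j
      have : g.1 * h.1 = h.1 * g.1 := congrArg Units.val hgh
      rw [this]
      simp only [Matrix.mul_apply, Fin.sum_univ_two, map_add, map_mul, hdQ, hdR]
      ring
    obtain ⟨⟨i, j⟩, hij⟩ := exists_pivot (g * h)
    have := congrArg (IsLocalRing.residue A.carrier) (congrFun₂ hcQ i j)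
    rw [e1, Matrix.smul_apply, smul_eq_mul, map_mul, e2] at this
    have hne : d * d' * algebraMap K (IsLocalRing.ResidueField A.carrier) ((g.1 * h.1) i j) ≠ 0 :=
      mul_ne_zero (mul_ne_zero hd hd') ((map_ne_zero _).2 hij)
    exact (mul_right_cancel₀ hne (by rw [one_mul]; exact this)).symm
  by_cases h2 : (2 : K) = 0
  · have h2A : (2 : A.carrier) = 0 := by
      have := congrArg (algebraMap K A.carrier) h2
      rwa [map_ofNat, map_zero] at this
    -- In characteristic 2, `Q`, `R` and `Q R` have the same traces as `c` times themselves, by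
    -- conjugation or cyclicity. So one unit among these traces forces `c = 1`.
    by_cases hu : IsUnit Q.1.trace ∨ IsUnit R.1.trace ∨ IsUnit (Q.1 * R.1).trace
    · left
      have key : ∀ x : A.carrier, IsUnit x → x = c * x → (c : A.carrier) = 1 := by
        intro x hx h
        exact (hx.mul_right_cancel (by rw [one_mul]; exact h)).symm
      have hRi : R.1 * R⁻¹.1 = 1 := by rw [← Units.val_mul, mul_inv_cancel, Units.val_one]
      have hRi' : R⁻¹.1 * R.1 = 1 := by rw [← Units.val_mul, inv_mul_cancel, Units.val_one]
      have hQi : Q.1 * Q⁻¹.1 = 1 := by rw [← Units.val_mul, mul_inv_cancel, Units.val_one]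
      have hQi' : Q⁻¹.1 * Q.1 = 1 := by rw [← Units.val_mul, inv_mul_cancel, Units.val_one]
      rcases hu with hu | hu | hu
      · refine key _ hu ?_
        have : R⁻¹.1 * (Q.1 * R.1) = (c : A.carrier) • Q.1 := by
          rw [hcQ, Matrix.mul_smul, ← mul_assoc, hRi', one_mul]
        have := congrArg Matrix.trace this
        rwa [Matrix.trace_mul_comm, mul_assoc, hRi, mul_one, Matrix.trace_smul] at this
      · refine key _ hu ?_
        have : (Q.1 * R.1) * Q⁻¹.1 = (c : A.carrier) • R.1 := by
          rw [hcQ, Matrix.smul_mul, mul_assoc, hQi, mul_one]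
        have := congrArg Matrix.trace this
        rwa [Matrix.trace_mul_comm, ← mul_assoc, hQi', one_mul, Matrix.trace_smul] at this
      · refine key _ hu ?_
        have := congrArg Matrix.trace hcQ
        rwa [Matrix.trace_smul, Matrix.trace_mul_comm R.1] at this
    · right
      push Not at hu
      have scal : ∀ (k : H) (P : GL (Fin 2) A.carrier), Matrix.ProjGenLinGroup.mk P = ψ k →
          k = 1 → ∃ d : A.carrier, P.1 = d • 1 := by
        rintro k P hP rfl
        rw [map_one, ← map_one Matrix.ProjGenLinGroup.mk, eq_comm, mk_eq_mk_iff_smul] at hP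
        obtain ⟨d, hd⟩ := hP
        exact ⟨d, hd⟩
      -- A trace that is not a unit reduces to zero, so the reduced matrix squares to a scalar and
      -- `k` is an involution. Then the lift squares to a scalar too; as it is not scalar modulo the
      -- maximal ideal, its trace is exactly zero.
      have tr0 : ∀ (k : H) (P : GL (Fin 2) A.carrier), Matrix.ProjGenLinGroup.mk P = ψ k →
          k ≠ 1 → ¬ IsUnit P.1.trace → P.1.trace = 0 := by
        intro k P hP hk htr
        obtain ⟨a, ha⟩ := Matrix.ProjGenLinGroup.mk_surjective (ρ k)
        obtain ⟨d, hd, hda⟩ := hred k P a hP ha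
        have hatr : a.1.trace = 0 := by
          rw [isUnit_iff_residue_ne, not_not, Matrix.trace_fin_two, map_add, hda, hda, ← mul_add,
            ← map_add, mul_eq_zero, map_eq_zero] at htr
          rw [Matrix.trace_fin_two]
          exact htr.resolve_left hd
        have hasq : a.1 * a.1 = (-a.1.det) • 1 := by
          rw [Matrix.trace_fin_two] at hatr
          rw [Matrix.det_fin_two]
          ext i j
          fin_cases i <;> fin_cases j <;> simp [Matrix.mul_apply, Fin.sum_univ_two]
          · linear_combination a.1 0 0 * hatr
          · linear_combination a.1 0 1 * hatr
          · linear_combination a.1 1 0 * hatr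
          · linear_combination a.1 1 1 * hatr
        have hk2 : k * k = 1 := by
          refine hρ ?_
          have hu : (-a.1.det) ≠ 0 :=
            neg_ne_zero.2 ((Matrix.isUnit_iff_isUnit_det _).1 a.isUnit).ne_zero
          rw [map_mul, ← ha, map_one, ← map_mul, ← map_one Matrix.ProjGenLinGroup.mk, eq_comm,
            mk_eq_mk_iff_smul]
          exact ⟨Units.mk0 _ hu, by rw [Units.val_mul, hasq]; rfl⟩
        obtain ⟨s, hs⟩ := scal (k * k) (P * P) (by rw [map_mul, map_mul, hP]) hk2
        refine trace_eq_zero_of_sq_scalar hs ?_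
        by_contra! hno
        simp only [isUnit_iff_residue_ne, not_not] at hno
        obtain ⟨h01, h10, hdd⟩ := hno
        rw [hda, mul_eq_zero, map_eq_zero] at h01 h10
        rw [map_sub, hda, hda, ← mul_sub, ← map_sub, mul_eq_zero, map_eq_zero] at hdd
        have h01 := h01.resolve_left hd
        have h10 := h10.resolve_left hd
        have hdd := sub_eq_zero.1 (hdd.resolve_left hd)
        have hone : a.1 = a.1 0 0 • 1 := by
          ext i j
          fin_cases i <;> fin_cases j <;> simp [h01, h10, hdd]
        refine hk (hρ ?_)
        have ha0 : a.1 0 0 ≠ 0 := fun h => a.isUnit.ne_zero (by rw [hone, h, zero_smul])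
        rw [← ha, map_one, ← map_one Matrix.ProjGenLinGroup.mk, eq_comm, mk_eq_mk_iff_smul]
        exact ⟨Units.mk0 _ ha0, hone⟩
      by_cases hn1 : n = 1
      · obtain ⟨d, hd⟩ := scal n Q hQ hn1
        rw [hd, Matrix.smul_mul, Matrix.mul_smul, one_mul, mul_one]
      by_cases hm1 : m = 1
      · obtain ⟨d, hd⟩ := scal m R hR hm1
        rw [hd, Matrix.smul_mul, Matrix.mul_smul, one_mul, mul_one]
      by_cases hnm1 : n * m = 1
      · obtain ⟨d, hd⟩ := scal (n * m) (Q * R) (by rw [map_mul, map_mul, hQ, hR]) hnm1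
        obtain ⟨d', hd'⟩ := scal (m * n) (R * Q) (by rw [map_mul, map_mul, hQ, hR])
          (by rw [← hnm, hnm1])
        rw [Units.val_mul] at hd hd'
        have hQi : Q⁻¹.1 * Q.1 = 1 := by rw [← Units.val_mul, inv_mul_cancel, Units.val_one]
        have e : R.1 = d • Q⁻¹.1 := by
          rw [← one_mul R.1, ← hQi, mul_assoc, hd, Matrix.mul_smul, mul_one]
        rw [hd, e, Matrix.smul_mul, hQi]
      have t1 := tr0 n Q hQ hn1 hu.1
      have t2 := tr0 m R hR hm1 hu.2.1
      have t3 := tr0 (n * m) (Q * R) (by rw [map_mul, map_mul, hQ, hR]) hnm1 hu.2.2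
      rw [Units.val_mul] at t3
      rw [Matrix.trace_fin_two] at t1 t2 t3
      simp only [Matrix.mul_apply, Fin.sum_univ_two] at t3
      have e1 : Q.1 1 1 = Q.1 0 0 := by linear_combination t1 - Q.1 0 0 * h2A
      have e2 : R.1 1 1 = R.1 0 0 := by linear_combination t2 - R.1 0 0 * h2A
      rw [e1, e2] at t3
      -- With all three traces zero and 2 = 0, the diagonal entries of `Q` and of `R` agree, and the
      -- vanishing trace of the product is precisely the missing commutation relation.
      have e3 : Q.1 0 1 * R.1 1 0 = R.1 0 1 * Q.1 1 0 := by
        linear_combination t3 - (Q.1 0 0 * R.1 0 0 + Q.1 1 0 * R.1 0 1) * h2A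
      ext i j
      rw [Matrix.mul_apply, Matrix.mul_apply, Fin.sum_univ_two, Fin.sum_univ_two]
      fin_cases i <;> fin_cases j <;> dsimp only [Fin.zero_eta, Fin.mk_one, Fin.isValue]
      · linear_combination e3
      · rw [e1, e2]; ring
      · rw [e1, e2]; ring
      · rw [e1, e2]; linear_combination -e3
  · left
    have hu : IsUnit ((c : A.carrier) + 1) := by
      rw [isUnit_iff_residue_ne, map_add, hc1, map_one]
      have : (1 : IsLocalRing.ResidueField A.carrier) + 1 = algebraMap K _ 2 := by
        rw [map_ofNat]; norm_num
      rw [this]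
      exact (map_ne_zero _).2 h2
    exact sub_eq_zero.1 ((hu.mul_left_eq_zero).1 hc2)

end Reduction

/-! ### Splitting the linearized gluing map by duality -/

section Splitting

variable {K : Type*} [Field K] {V E : Type*} [Fintype E] [DecidableEq E] [DecidableEq V]

/-- The linearized gluing map. -/
def gluingMap (o t : E → V) (Γ : E → GL (Fin 2) K)
    (B₀ : E → Fin 2 → Fin 2 → Matrix (Fin 2) (Fin 2) K) :
    ((V → Matrix (Fin 2) (Fin 2) K) × (E × Fin 2 × Fin 2 → K)) →ₗ[K]
      (E → Matrix (Fin 2) (Fin 2) K) where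
  toFun x e := (Γ e)⁻¹.1 * x.1 (o e) * (Γ e).1 - x.1 (t e) - ∑ i, ∑ j, x.2 (e, i, j) • B₀ e i j
  map_add' x y := by
    funext e
    simp only [Prod.fst_add, Prod.snd_add, Pi.add_apply, mul_add, add_mul, add_smul,
      Finset.sum_add_distrib]
    abel
  map_smul' c x := by
    funext e
    simp only [Prod.smul_fst, Prod.smul_snd, Pi.smul_apply, Matrix.mul_smul, Matrix.smul_mul,
      smul_eq_mul, mul_smul, RingHom.id_apply, smul_sub, Finset.smul_sum]

theorem gluingMap_apply (o t : E → V) (Γ : E → GL (Fin 2) K)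
    (B₀ : E → Fin 2 → Fin 2 → Matrix (Fin 2) (Fin 2) K)
    (x : (V → Matrix (Fin 2) (Fin 2) K) × (E × Fin 2 × Fin 2 → K)) (e : E) :
    gluingMap o t Γ B₀ x e =
      (Γ e)⁻¹.1 * x.1 (o e) * (Γ e).1 - x.1 (t e) - ∑ i, ∑ j, x.2 (e, i, j) • B₀ e i j := rfl

theorem functional_eq_trace (f : (E → Matrix (Fin 2) (Fin 2) K) →ₗ[K] K)
    (w : E → Matrix (Fin 2) (Fin 2) K) :
    f w = ∑ e, ((Matrix.of fun i j => f (Pi.single e (Matrix.single j i 1))) * w e).trace := by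
  have hw : w = ∑ e, ∑ i, ∑ j, w e i j • Pi.single e (Matrix.single i j (1 : K)) := by
    funext e
    rw [Finset.sum_apply, Finset.sum_eq_single e]
    · ext i j
      simp only [Finset.sum_apply, Fin.sum_univ_two, Matrix.add_apply]
      fin_cases i <;> fin_cases j <;> simp
    · intro e' _ h
      simp [Finset.sum_apply, Pi.single_eq_of_ne h.symm]
    · simp
  conv_lhs => rw [hw]
  rw [map_sum]
  refine Finset.sum_congr rfl fun e _ => ?_
  simp only [Fin.sum_univ_two, map_add, LinearMap.map_smul, smul_eq_mul, Matrix.trace_fin_two,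
    Matrix.mul_apply, Matrix.of_apply]
  ring

/-- If the map were not onto, a nonzero functional would kill its image. By the trace form it is a
family `Y`; killing the edge part is orthogonality to `B₀`, killing the vertex part is harmonicity,
and `H` says that `Y = 0`. The splitting then records preimages of the elementary matrices. -/
theorem exists_linearSplitting (o t : E → V) (Γ : E → GL (Fin 2) K)
    (B₀ : E → Fin 2 → Fin 2 → Matrix (Fin 2) (Fin 2) K)
    (H : ∀ Y : E → Matrix (Fin 2) (Fin 2) K, (∀ e i j, (Y e * B₀ e i j).trace = 0) →
      (∀ v X, ∑ e, (Y e * ((if o e = v then (Γ e)⁻¹.1 * X * (Γ e).1 else 0) -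
        if t e = v then X else 0)).trace = 0) → ∀ e, Y e = 0) :
    Nonempty (LinearSplitting o t Γ B₀) := by
  have hsurj : LinearMap.range (gluingMap o t Γ B₀) = ⊤ := by
    by_contra hne
    obtain ⟨f, hf, hker⟩ := Submodule.exists_le_ker_of_lt_top _ (lt_top_iff_ne_top.2 hne)
    have h0 : ∀ x, f (gluingMap o t Γ B₀ x) = 0 := fun x => hker ⟨x, rfl⟩
    have hY := H (fun e => Matrix.of fun i j => f (Pi.single e (Matrix.single j i 1))) ?_ ?_
    · refine hf (LinearMap.ext fun w => ?_)
      rw [functional_eq_trace]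
      exact Finset.sum_eq_zero fun e _ => by rw [hY e, zero_mul, Matrix.trace_zero]
    · intro e i j
      have h := h0 (0, Pi.single (e, i, j) (-1))
      have e1 : gluingMap o t Γ B₀ (0, Pi.single (e, i, j) (-1)) = Pi.single e (B₀ e i j) := by
        funext e'
        by_cases he : e' = e
        · subst he
          rw [gluingMap_apply]
          dsimp only
          rw [Finset.sum_eq_single i, Finset.sum_eq_single j]
          · simp
          · intro j' _ hj
            simp [hj]
          · simp
          · intro i' _ hi
            simp [hi]
          · simp
        · rw [gluingMap_apply]
          simp [he]
      rw [e1, functional_eq_trace, Finset.sum_eq_single e] at h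
      · simpa using h
      · intro e' _ he
        rw [Pi.single_eq_of_ne he, mul_zero, Matrix.trace_zero]
      · simp
    · intro v X
      have h := h0 (Pi.single v X, 0)
      rw [functional_eq_trace] at h
      rw [← h]
      refine Finset.sum_congr rfl fun e _ => ?_
      congr 2
      rw [gluingMap_apply]
      by_cases h1 : o e = v <;> by_cases h2 : t e = v <;> simp [h1, h2]
  choose x hx using fun b : E × Fin 2 × Fin 2 => LinearMap.range_eq_top.1 hsurj
    (Pi.single b.1 (Matrix.single b.2.1 b.2.2 1))
  refine ⟨⟨fun v b => (x b).1 v, fun c b => (x b).2 c, fun e b => ?_⟩⟩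
  refine (congrFun (hx b) e).trans ?_
  by_cases h : b.1 = e
  · subst h
    simp
  · rw [if_neg h, Pi.single_eq_of_ne (Ne.symm h)]

end Splitting

/-! ### Spaces of infinitesimal centralizers -/

section BaseMat

open Classical in
/-- The basis of the space of infinitesimal automorphisms attached to an edge. -/
def baseMat {R : Type*} [CommRing R] (triv comm : Prop) (Q : Matrix (Fin 2) (Fin 2) R)
    (i j : Fin 2) : Matrix (Fin 2) (Fin 2) R :=
  -- The centralizer is modelled by all matrices for a trivial edge group, by the span of 1 and `Q`
  -- in the commutative case, and by scalars otherwise. Unused positions carry zero, so that all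
  -- edges share one index set.
  if triv then Matrix.single i j 1 else if i = 0 ∧ j = 0 then 1 else
    if comm ∧ i = 0 ∧ j = 1 then Q else 0

variable {R S : Type*} [CommRing R] [CommRing S]

theorem baseMat_map {F : Type*} [FunLike F R S] [RingHomClass F R S] (f : F) (triv comm : Prop)
    (Q : Matrix (Fin 2) (Fin 2) R) (i j : Fin 2) :
    (baseMat triv comm Q i j).map f = baseMat triv comm (Q.map f) i j := by
  unfold baseMat
  split_ifs
  · ext a b
    simp [Matrix.single_apply, apply_ite f]
  · exact Matrix.map_one _ (map_zero _) (map_one _)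
  · rfl
  · exact Matrix.map_zero _ (map_zero _)

theorem baseMat_sub {I : Ideal R} (triv comm : Prop) {Q Q' : Matrix (Fin 2) (Fin 2) R}
    (h : EntriesIn I (Q - Q')) (i j : Fin 2) :
    EntriesIn I (baseMat triv comm Q i j - baseMat triv comm Q' i j) := by
  have h0 : ∀ M : Matrix (Fin 2) (Fin 2) R, EntriesIn I (M - M) := fun M a b => by
    rw [sub_self]; exact I.zero_mem
  unfold baseMat
  split_ifs
  · exact h0 _
  · exact h0 _
  · exact h
  · exact h0 _

/-- A combination of the basis matrices commutes with every matrix commuting with `Q`. -/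
theorem commute_baseMat {triv comm : Prop} (ht : ¬ triv) {Q P : Matrix (Fin 2) (Fin 2) R}
    (h : comm → P * Q = Q * P) (c : Fin 2 → Fin 2 → R) :
    P * (1 + ∑ i, ∑ j, c i j • baseMat triv comm Q i j) =
      (1 + ∑ i, ∑ j, c i j • baseMat triv comm Q i j) * P := by
  have hij : ∀ i j, P * baseMat triv comm Q i j = baseMat triv comm Q i j * P := by
    intro i j
    unfold baseMat
    rw [if_neg ht]
    split_ifs with h1 h2
    · rw [mul_one, one_mul]
    · exact h h2.1
    · rw [mul_zero, zero_mul]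
  simp only [mul_add, add_mul, Finset.mul_sum, Finset.sum_mul, Matrix.mul_smul, Matrix.smul_mul,
    hij, mul_one, one_mul]

end BaseMat

/-! ### The splitting for the graph of groups -/

section Edges

variable {K : Type u} [Field K] [Valued K ℤᵐ⁰] [(Valued.v : Valuation K ℤᵐ⁰).IsNontrivial]
  {N : Type u} [Group N] {φ : N →* PGL(2, K)}

namespace GraphOfGroups

variable (𝒢 : GraphOfGroups φ)

/-- The edge group is trivial. -/
def EdgeTriv (e : QEdge φ) : Prop := ∀ n ∈ 𝒢.edgeGroup e, n = 1

theorem exists_edgeElement (e : QEdge φ) :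
    ∃ n : 𝒢.edgeGroup e, ¬ 𝒢.EdgeTriv e → n ≠ 1 := by
  by_cases h : 𝒢.EdgeTriv e
  · exact ⟨1, fun h' => (h' h).elim⟩
  · unfold EdgeTriv at h
    push Not at h
    obtain ⟨n, hn, hne⟩ := h
    exact ⟨⟨n, hn⟩, fun _ h1 => hne (congrArg Subtype.val h1)⟩

/-- A nontrivial element of the edge group, if there is one. -/
def edgeElement (e : QEdge φ) : 𝒢.edgeGroup e := (𝒢.exists_edgeElement e).choose

/-- A matrix that represents the chosen element of the edge group. -/
def edgeMat (e : QEdge φ) : GL (Fin 2) K :=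
  (Matrix.ProjGenLinGroup.mk_surjective (φ (𝒢.edgeElement e))).choose

theorem mk_edgeMat (e : QEdge φ) :
    Matrix.ProjGenLinGroup.mk (𝒢.edgeMat e) = φ (𝒢.edgeElement e) :=
  (Matrix.ProjGenLinGroup.mk_surjective (φ (𝒢.edgeElement e))).choose_spec

/-- A matrix that represents the stable letter of an edge. -/
def stableMat (e : QEdge φ) : GL (Fin 2) K :=
  (Matrix.ProjGenLinGroup.mk_surjective (φ (𝒢.γ e))).choose

theorem mk_stableMat (e : QEdge φ) : Matrix.ProjGenLinGroup.mk (𝒢.stableMat e) = φ (𝒢.γ e) :=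
  (Matrix.ProjGenLinGroup.mk_surjective (φ (𝒢.γ e))).choose_spec

/-- Orthogonality to `baseMat` translates into the hypotheses of `eq_zero_of_harmonic`: against
scalars it gives trace zero, for a trivial edge group it gives `Y e = 0`, and against `edgeMat` it
gives the condition at the chosen nontrivial element. -/
theorem nonempty_linearSplitting [Fintype (QEdge φ)] [DecidableEq (QEdge φ)]
    (hchar : ringChar 𝓀[K] = ringChar K) (hφ : Function.Injective φ)
    (hstab : ∀ Λ : Vertex K, Finite (stab φ Λ)) (hfix : FixedPointsRational φ) :
    Nonempty (LinearSplitting 𝒢.o 𝒢.t 𝒢.stableMat fun e =>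
      baseMat (𝒢.EdgeTriv e) (𝒢.EdgeComm e) (𝒢.edgeMat e).1) := by
  classical
  refine exists_linearSplitting _ _ _ _ fun Y hY hsum =>
    𝒢.eq_zero_of_harmonic hchar hφ hstab hfix 𝒢.mk_stableMat Y (fun e => ?_) (fun e he => ?_)
      (fun e he hn => ?_) hsum
  · by_cases h : 𝒢.EdgeTriv e
    · have h0 := hY e 0 0
      have h1 := hY e 1 1
      unfold baseMat at h0 h1
      rw [if_pos h] at h0 h1
      rw [← mul_one (Y e), show (1 : Matrix (Fin 2) (Fin 2) K) =
        Matrix.single 0 0 1 + Matrix.single 1 1 1 by ext i j; fin_cases i <;> fin_cases j <;> simp,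
        mul_add, Matrix.trace_add, h0, h1, add_zero]
    · have h0 := hY e 0 0
      unfold baseMat at h0
      rwa [if_neg h, if_pos ⟨rfl, rfl⟩, mul_one] at h0
  · ext i j
    have h0 := hY e j i
    unfold baseMat at h0
    rw [if_pos (show 𝒢.EdgeTriv e from he), Matrix.trace_mul_single] at h0
    simpa using h0
  · have ht : ¬ 𝒢.EdgeTriv e := by
      obtain ⟨n, hn, hne⟩ := hn
      exact fun h => hne (h n hn)
    refine ⟨𝒢.edgeElement e, (𝒢.edgeElement e).2, fun h => (𝒢.exists_edgeElement e).choose_spec ht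
      (Subtype.ext h), fun g hg => ?_⟩
    have h0 := hY e 0 1
    unfold baseMat at h0
    rw [if_neg ht, if_neg (by simp), if_pos ⟨he, rfl, rfl⟩] at h0
    rw [← mk_edgeMat, eq_comm, mk_eq_mk_iff_smul] at hg
    obtain ⟨u, hu⟩ := hg
    rw [hu, Matrix.mul_smul, Matrix.trace_smul, h0, smul_zero]

end GraphOfGroups

end Edges

/-! ### Moving a family to one glued by constants -/

section Gluing

variable {K : Type u} [Field K] [Valued K ℤᵐ⁰] [(Valued.v : Valuation K ℤᵐ⁰).IsNontrivial]
  {N : Type u} [Group N] {φ : N →* PGL(2, K)}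

/-- The homomorphism `ψ` followed by conjugation with `g`. -/
def conjHom {G H : Type*} [Group G] [Group H] (g : G) (ψ : H →* G) : H →* G :=
  (MulAut.conj g).toMonoidHom.comp ψ

theorem conjHom_apply {G H : Type*} [Group G] [Group H] (g : G) (ψ : H →* G) (n : H) :
    conjHom g ψ n = g * ψ n * g⁻¹ := rfl

theorem isLift_conjHom {H : Type u} [Group H] {ρ : H →* PGL(2, K)} {A : ArtAlg K}
    {g : PGL(2, A.carrier)} (hg : ReducesTo A g 1) {ψ : H →* PGL(2, A.carrier)}
    (hψ : IsLift ρ A ψ) : IsLift ρ A (conjHom g ψ) := by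
  rw [isLift_iff] at hψ ⊢
  intro n
  have := (hg.mul (hψ n)).mul hg.inv
  rwa [one_mul, inv_one, mul_one] at this

theorem isNilpotent_maximalIdeal (A : ArtAlg K) :
    IsNilpotent (IsLocalRing.maximalIdeal A.carrier) := by
  have := IsArtinianRing.isNilpotent_jacobson_bot (R := A.carrier)
  rwa [IsLocalRing.jacobson_eq_maximalIdeal ⊥ bot_ne_top] at this

namespace GraphOfGroups

variable (𝒢 : GraphOfGroups φ) (A : ArtAlg K)

/-- Homomorphisms on the vertex groups that are compatible with the elements `τ e`. -/
def IsGlued {Γ : Type*} [Group Γ] (ψ : ∀ v, 𝒢.vertexGroup v →* Γ) (τ : QEdge φ → Γ) : Prop :=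
  ∀ e (n : 𝒢.edgeGroup e),
    ψ (𝒢.o e) (𝒢.edgeToOrg e n) = τ e * ψ (𝒢.t e) (𝒢.edgeToTgt e n) * (τ e)⁻¹

variable {A}

/-- The matrices attached to the edges by homomorphisms on the vertex groups. -/
def edgeBase (ψ : ∀ v, 𝒢.vertexGroup v →* PGL(2, A.carrier)) (e : QEdge φ) :
    Fin 2 → Fin 2 → Matrix (Fin 2) (Fin 2) A.carrier :=
  baseMat (𝒢.EdgeTriv e) (𝒢.EdgeComm e)
    (normalize (𝒢.edgeMat e) (ψ (𝒢.t e) (𝒢.edgeToTgt e (𝒢.edgeElement e))))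

variable [Fintype (QEdge φ)] [DecidableEq (QEdge φ)]

/-- A splitting of the linearized gluing map of the graph of groups. -/
abbrev Splitting : Type u := LinearSplitting 𝒢.o 𝒢.t 𝒢.stableMat fun e =>
  baseMat (𝒢.EdgeTriv e) (𝒢.EdgeComm e) (𝒢.edgeMat e).1

variable {𝒢} (S : 𝒢.Splitting)

/-- The element of `PGL(2, A)` at the vertex `v` with coordinates `u`. -/
def vertexElt (u : QEdge φ × Fin 2 × Fin 2 → A.carrier) (v : QVertex φ) : PGL(2, A.carrier) :=
  Matrix.ProjGenLinGroup.mk (toGL (S.vMat u v))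

/-- The family `ψ` is moved to the family `ψ'` by the vertex elements with coordinates `u`, which
change `τ` to the constants. -/
def Moves (ψ ψ' : ∀ v, 𝒢.vertexGroup v →* PGL(2, A.carrier)) (τ : QEdge φ → PGL(2, A.carrier))
    (u : QEdge φ × Fin 2 × Fin 2 → A.carrier) : Prop :=
  (∀ b, u b ∈ IsLocalRing.maximalIdeal A.carrier) ∧
    S.IsSolution (𝒢.edgeBase ψ') (fun e => normalize (𝒢.stableMat e) (τ e)) u ∧
      ∀ v, ψ' v = conjHom (vertexElt S u v) (ψ v)

section

variable {u : QEdge φ × Fin 2 × Fin 2 → A.carrier}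
  (hu : ∀ b, u b ∈ IsLocalRing.maximalIdeal A.carrier)
  {ψ ψ' : ∀ v, 𝒢.vertexGroup v →* PGL(2, A.carrier)} {τ : QEdge φ → PGL(2, A.carrier)}

include hu in
theorem vMat_near (v : QVertex φ) :
    EntriesIn (IsLocalRing.maximalIdeal A.carrier) (S.vMat u v - 1) := by
  unfold LinearSplitting.vMat
  rw [add_sub_cancel_left]
  exact combMat_mem _ hu

include hu in
theorem eMat_near (B : QEdge φ → Fin 2 → Fin 2 → Matrix (Fin 2) (Fin 2) A.carrier) (e : QEdge φ) :
    EntriesIn (IsLocalRing.maximalIdeal A.carrier) (S.eMat u B e - 1) := by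
  unfold LinearSplitting.eMat
  rw [add_sub_cancel_left]
  exact EntriesIn.sum fun i _ => EntriesIn.sum fun j _ => EntriesIn.smul (combScal_mem _ hu) _

include hu in
theorem reducesTo_vertexElt (v : QVertex φ) : ReducesTo A (vertexElt S u v) 1 :=
  reducesTo_one_of_near_one (vMat_near S hu v)

theorem reducesTo_stable (hτ : ∀ e, ReducesTo A (τ e) (φ (𝒢.γ e))) (e : QEdge φ) :
    ReducesTo A (τ e) (Matrix.ProjGenLinGroup.mk (𝒢.stableMat e)) := by
  rw [mk_stableMat]
  exact hτ e

theorem reducesTo_edge (hψ : ∀ v, IsLift (𝒢.vertexRep v) A (ψ v)) (e : QEdge φ) :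
    ReducesTo A (ψ (𝒢.t e) (𝒢.edgeToTgt e (𝒢.edgeElement e)))
      (Matrix.ProjGenLinGroup.mk (𝒢.edgeMat e)) := by
  rw [mk_edgeMat]
  exact isLift_iff.1 (hψ _) _

-- The correction `C_e` centralizes the image of the edge group. It is a combination of 1 and a
-- representative of the chosen element; when the second is present, `commute_of_isLift` applies.
-- For a trivial edge group there is nothing to check.
include hu in
theorem commute_eMat (hφ : Function.Injective φ) (hψ : ∀ v, IsLift (𝒢.vertexRep v) A (ψ v))
    (e : QEdge φ) (n : 𝒢.edgeGroup e) :
    Matrix.ProjGenLinGroup.mk (toGL (S.eMat u (𝒢.edgeBase ψ) e)) * ψ (𝒢.t e) (𝒢.edgeToTgt e n) =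
      ψ (𝒢.t e) (𝒢.edgeToTgt e n) *
        Matrix.ProjGenLinGroup.mk (toGL (S.eMat u (𝒢.edgeBase ψ) e)) := by
  by_cases ht : 𝒢.EdgeTriv e
  · have hn : n = 1 := Subtype.ext (ht n n.2)
    rw [hn, map_one, map_one, mul_one, one_mul]
  obtain ⟨P, hP⟩ := Matrix.ProjGenLinGroup.mk_surjective (ψ (𝒢.t e) (𝒢.edgeToTgt e n))
  obtain ⟨Q, hQ⟩ := Matrix.ProjGenLinGroup.mk_surjective
    (ψ (𝒢.t e) (𝒢.edgeToTgt e (𝒢.edgeElement e)))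
  rw [← hP, ← map_mul, ← map_mul]
  congr 1
  apply Units.ext
  rw [Units.val_mul, Units.val_mul, toGL_val (isUnit_det_of_near_one (eMat_near S hu _ e))]
  refine (commute_baseMat ht (fun hc => ?_) _).symm
  have hred := reducesTo_edge hψ e
  rw [← hQ] at hred ⊢
  obtain ⟨c, hcQ⟩ := hred.exists_normalize_eq
  rw [hcQ, Matrix.mul_smul, Matrix.smul_mul, commute_of_isLift (ρ := 𝒢.vertexRep (𝒢.t e))
    (hφ.comp Subtype.val_injective) (hψ _) (fun g h hg hh => ?_) hP hQ]
  exact hc n n.2 _ (𝒢.edgeElement e).2 g h hg hh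

-- The matrix equation is read in PGL(2), where the scalar introduced by normalizing `τ e`
-- disappears.
include hu in
theorem stable_eq (hτ : ∀ e, ReducesTo A (τ e) (φ (𝒢.γ e))) (e : QEdge φ)
    (h : S.IsSolution (𝒢.edgeBase ψ) (fun e => normalize (𝒢.stableMat e) (τ e)) u) :
    constPGL A (φ (𝒢.γ e)) * Matrix.ProjGenLinGroup.mk (toGL (S.eMat u (𝒢.edgeBase ψ) e)) *
      vertexElt S u (𝒢.t e) = vertexElt S u (𝒢.o e) * τ e := by
  have hs := h e
  have hred := reducesTo_stable hτ e
  obtain ⟨Q, hQ⟩ := Matrix.ProjGenLinGroup.mk_surjective (τ e)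
  dsimp only at hs
  rw [← hQ] at hs hred ⊢
  obtain ⟨c, hc⟩ := hred.exists_normalize_eq
  rw [← mk_stableMat]
  unfold constPGL vertexElt
  rw [Matrix.ProjGenLinGroup.map_mk, ← map_mul, ← map_mul, ← map_mul, eq_comm, mk_eq_mk_iff_smul]
  refine ⟨c, ?_⟩
  simp only [Units.val_mul]
  rw [toGL_val (isUnit_det_of_near_one (eMat_near S hu _ e)),
    toGL_val (isUnit_det_of_near_one (vMat_near S hu _)),
    toGL_val (isUnit_det_of_near_one (vMat_near S hu _))]
  refine Eq.trans hs ?_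
  rw [hc, Matrix.mul_smul]

/-- Substituting `τ e = g_o⁻¹ φ(γ_e) C_e g_t` turns one gluing condition into the other, since `C_e`
commutes with the image of the edge group under `ψ'`. -/
theorem Moves.isGlued_iff (hφ : Function.Injective φ) (h : Moves S ψ ψ' τ u)
    (hψ : ∀ v, IsLift (𝒢.vertexRep v) A (ψ' v)) (hτ : ∀ e, ReducesTo A (τ e) (φ (𝒢.γ e))) :
    𝒢.IsGlued ψ τ ↔ 𝒢.IsGlued ψ' fun e => constPGL A (φ (𝒢.γ e)) := by
  refine forall_congr' fun e => forall_congr' fun n => ?_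
  have h1 := stable_eq S h.1 hτ e h.2.1
  have h2 := commute_eMat S h.1 hφ hψ e n
  have h3 : ψ' (𝒢.o e) (𝒢.edgeToOrg e n) = _ := DFunLike.congr_fun (h.2.2 (𝒢.o e)) _
  have h4 : ψ' (𝒢.t e) (𝒢.edgeToTgt e n) = _ := DFunLike.congr_fun (h.2.2 (𝒢.t e)) _
  rw [conjHom_apply] at h3 h4
  set a := ψ (𝒢.o e) (𝒢.edgeToOrg e n)
  set b := ψ (𝒢.t e) (𝒢.edgeToTgt e n)
  set b' := ψ' (𝒢.t e) (𝒢.edgeToTgt e n)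
  set g := vertexElt S u (𝒢.o e)
  set k := vertexElt S u (𝒢.t e)
  set c := Matrix.ProjGenLinGroup.mk (toGL (S.eMat u (𝒢.edgeBase ψ') e))
  set z := constPGL A (φ (𝒢.γ e))
  have h5 : τ e = g⁻¹ * (z * c * k) := by rw [h1, inv_mul_cancel_left]
  have h6 : τ e * b * (τ e)⁻¹ = g⁻¹ * (z * b' * z⁻¹) * g := by
    have e1 : c * b' * c⁻¹ = b' := by rw [h2, mul_inv_cancel_right]
    rw [h5, ← e1, h4]
    group
  rw [h3, h6]
  constructor
  · intro h
    rw [h]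
    change _ = z * b' * z⁻¹
    group
  · intro h
    have h7 : g * a * g⁻¹ = z * b' * z⁻¹ := h
    rw [← h7]
    group

end

variable {ψ ψ' : ∀ v, 𝒢.vertexGroup v →* PGL(2, A.carrier)} {τ : QEdge φ → PGL(2, A.carrier)}

theorem edgeBase_near (hψ : ∀ v, IsLift (𝒢.vertexRep v) A (ψ v)) (e : QEdge φ) (i j : Fin 2) :
    EntriesIn (IsLocalRing.maximalIdeal A.carrier) (𝒢.edgeBase ψ e i j -
      (baseMat (𝒢.EdgeTriv e) (𝒢.EdgeComm e) (𝒢.edgeMat e).1 i j).map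
        (algebraMap K A.carrier)) := by
  rw [baseMat_map]
  exact baseMat_sub _ _ (reducesTo_edge hψ e).normalize_sub _ _

/-- Here the straightened family is prescribed, so the edge matrices do not depend on the unknown.
The original family is recovered by undoing the conjugations; this gives the inverse of the
comparison map. -/
theorem exists_moves_to (hψ' : ∀ v, IsLift (𝒢.vertexRep v) A (ψ' v))
    (hτ : ∀ e, ReducesTo A (τ e) (φ (𝒢.γ e))) :
    ∃! u : QEdge φ × Fin 2 × Fin 2 → A.carrier,
      (∀ b, u b ∈ IsLocalRing.maximalIdeal A.carrier) ∧
        S.IsSolution (𝒢.edgeBase ψ') (fun e => normalize (𝒢.stableMat e) (τ e)) u := by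
  refine S.existsUnique_isSolution (isNilpotent_maximalIdeal A) (fun _ => 𝒢.edgeBase ψ')
    (fun u _ e i j => edgeBase_near hψ' e i j) (fun k u u' _ _ _ e i j a b => ?_) _
    fun e => (reducesTo_stable hτ e).normalize_sub
  rw [sub_self]
  exact Ideal.zero_mem _

/-- Here the original family is prescribed and the edge matrices belong to its conjugate by the
unknown vertex elements. Coordinates congruent modulo a power of the maximal ideal give congruent
vertex elements, and normalization preserves this; so the dependence is Lipschitz. -/
theorem exists_moves_from (hψ : ∀ v, IsLift (𝒢.vertexRep v) A (ψ v))
    (hτ : ∀ e, ReducesTo A (τ e) (φ (𝒢.γ e))) :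
    ∃! u : QEdge φ × Fin 2 × Fin 2 → A.carrier,
      (∀ b, u b ∈ IsLocalRing.maximalIdeal A.carrier) ∧
        S.IsSolution (𝒢.edgeBase fun v => conjHom (vertexElt S u v) (ψ v))
          (fun e => normalize (𝒢.stableMat e) (τ e)) u := by
  have hlift : ∀ u : QEdge φ × Fin 2 × Fin 2 → A.carrier,
      (∀ b, u b ∈ IsLocalRing.maximalIdeal A.carrier) →
      ∀ v, IsLift (𝒢.vertexRep v) A (conjHom (vertexElt S u v) (ψ v)) :=
    fun u hu v => isLift_conjHom (reducesTo_vertexElt S hu v) (hψ v)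
  refine S.existsUnique_isSolution (isNilpotent_maximalIdeal A)
    (fun u => 𝒢.edgeBase fun v => conjHom (vertexElt S u v) (ψ v))
    (fun u hu e i j => edgeBase_near (hlift u hu) e i j)
    (fun k u u' hu hu' hd e i j => ?_) _ fun e => (reducesTo_stable hτ e).normalize_sub
  refine baseMat_sub _ _ ?_ i j
  have h1 := reducesTo_edge (hlift u hu) e
  have h2 := reducesTo_edge (hlift u' hu') e
  rw [conjHom_apply] at h1 h2 ⊢
  rw [conjHom_apply]
  obtain ⟨P, hP⟩ := Matrix.ProjGenLinGroup.mk_surjective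
    (ψ (𝒢.t e) (𝒢.edgeToTgt e (𝒢.edgeElement e)))
  rw [← hP] at h1 h2 ⊢
  unfold vertexElt at h1 h2 ⊢
  rw [← map_inv, ← map_mul, ← map_mul] at h1 h2 ⊢
  rw [← map_inv, ← map_mul, ← map_mul]
  refine normalize_congr _ _ h1.isUnit_pivot h2.isUnit_pivot (EntriesIn.sub_iff_map_eq.2 ?_)
  have key : Matrix.GeneralLinearGroup.map (Ideal.Quotient.mk (IsLocalRing.maximalIdeal A.carrier ^ k))
      (toGL (S.vMat u (𝒢.t e))) = Matrix.GeneralLinearGroup.map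
        (Ideal.Quotient.mk (IsLocalRing.maximalIdeal A.carrier ^ k)) (toGL (S.vMat u' (𝒢.t e))) := by
    apply Units.ext
    change (toGL (S.vMat u (𝒢.t e))).1.map _ = (toGL (S.vMat u' (𝒢.t e))).1.map _
    rw [toGL_val (isUnit_det_of_near_one (vMat_near S hu _)),
      toGL_val (isUnit_det_of_near_one (vMat_near S hu' _)), ← EntriesIn.sub_iff_map_eq]
    unfold LinearSplitting.vMat
    rw [add_sub_add_left_eq_sub, combMat_sub]
    exact combMat_mem _ hd
  refine congrArg Units.val (?_ : Matrix.GeneralLinearGroup.map _ _ =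
    Matrix.GeneralLinearGroup.map _ _)
  rw [map_mul, map_mul, map_inv, key, map_mul, map_mul, map_inv]

/-- The splitting, the stable matrices and the pivots are defined over `K`, so each ingredient of
the gluing equation commutes with a morphism of `C_K`. With uniqueness of the solution this gives
naturality of the comparison. -/
theorem Moves.map {B : ArtAlg K} (f : A.carrier →ₐ[K] B.carrier)
    {u : QEdge φ × Fin 2 × Fin 2 → A.carrier} (h : Moves S ψ ψ' τ u)
    (hψ' : ∀ v, IsLift (𝒢.vertexRep v) A (ψ' v)) (hτ : ∀ e, ReducesTo A (τ e) (φ (𝒢.γ e))) :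
    Moves S (fun v => (Matrix.ProjGenLinGroup.map (f : A.carrier →+* B.carrier)).comp (ψ v))
      (fun v => (Matrix.ProjGenLinGroup.map (f : A.carrier →+* B.carrier)).comp (ψ' v))
      (fun e => Matrix.ProjGenLinGroup.map (f : A.carrier →+* B.carrier) (τ e))
      fun b => f (u b) := by
  have hloc : IsLocalHom (f : A.carrier →+* B.carrier) := isLocalHom_of_artinian _
  have hvm : ∀ v, (S.vMat u v).map f = S.vMat (fun b => f (u b)) v := by
    intro v
    unfold LinearSplitting.vMat
    rw [← combMat_map, Matrix.map_add _ (map_add f), Matrix.map_one _ (map_zero f) (map_one f)]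
  have hbase : ∀ e i j, (𝒢.edgeBase ψ' e i j).map f = 𝒢.edgeBase (fun v =>
      (Matrix.ProjGenLinGroup.map (f : A.carrier →+* B.carrier)).comp (ψ' v)) e i j := by
    intro e i j
    unfold edgeBase
    rw [baseMat_map, (reducesTo_edge hψ' e).normalize_map f]
    rfl
  have hem : ∀ e, (S.eMat u (𝒢.edgeBase ψ') e).map f = S.eMat (fun b => f (u b)) (𝒢.edgeBase fun v =>
      (Matrix.ProjGenLinGroup.map (f : A.carrier →+* B.carrier)).comp (ψ' v)) e := by
    intro e
    unfold LinearSplitting.eMat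
    change (f : A.carrier →+* B.carrier).mapMatrix _ = _
    rw [map_add, map_one, map_sum]
    simp only [map_sum]
    congr 1
    refine Finset.sum_congr rfl fun i _ => Finset.sum_congr rfl fun j _ => ?_
    rw [← hbase, ← combScal_map]
    ext a b
    exact map_mul f _ _
  refine ⟨fun b => ?_, fun e => ?_, fun v => ?_⟩
  · exact (IsLocalRing.mem_maximalIdeal _).2 fun hu => (IsLocalRing.mem_maximalIdeal _).1 (h.1 b)
      (isUnit_of_map_unit (f : A.carrier →+* B.carrier) _ hu)
  · have := congrArg (f : A.carrier →+* B.carrier).mapMatrix (h.2.1 e)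
    rw [map_mul, map_mul, map_mul] at this
    refine Eq.trans ?_ (this.trans ?_)
    · rw [← hem, ← hvm, ← map_algebraMap f]
      rfl
    · rw [← hvm]
      congr 1
      exact (reducesTo_stable hτ e).normalize_map f
  · refine MonoidHom.ext fun n => ?_
    have := congrArg (Matrix.ProjGenLinGroup.map (f : A.carrier →+* B.carrier))
      (DFunLike.congr_fun (h.2.2 v) n)
    refine this.trans ?_
    rw [conjHom_apply, conjHom_apply, map_mul, map_mul, map_inv]
    have e1 : Matrix.ProjGenLinGroup.map (f : A.carrier →+* B.carrier) (vertexElt S u v) =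
        vertexElt S (fun b => f (u b)) v := by
      unfold vertexElt
      rw [Matrix.ProjGenLinGroup.map_mk, toGL_map f (isUnit_det_of_near_one (vMat_near S h.1 v)),
        hvm]
    rw [e1]
    rfl

end GraphOfGroups

end Gluing

/-! ### The inverse limit as a functor of compatible families -/

section Functors

variable {K : Type u} [Field K] [Valued K ℤᵐ⁰] {N : Type u} [Group N] {φ : N →* PGL(2, K)}

namespace GraphOfGroups

variable (𝒢 : GraphOfGroups φ)

/-- Compatible families of lifts on the vertex groups. -/
def GluedFamily (A : ArtAlg K) : Type u :=
  {ψ : ∀ v, 𝒢.vertexGroup v →* PGL(2, A.carrier) //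
    (∀ v, IsLift (𝒢.vertexRep v) A (ψ v)) ∧ 𝒢.IsGlued ψ fun e => constPGL A (φ (𝒢.γ e))}

variable {𝒢}

theorem IsGlued.map {A B : ArtAlg K} (f : A.carrier →ₐ[K] B.carrier)
    {ψ : ∀ v, 𝒢.vertexGroup v →* PGL(2, A.carrier)}
    (h : 𝒢.IsGlued ψ fun e => constPGL A (φ (𝒢.γ e))) :
    𝒢.IsGlued (fun v => (Matrix.ProjGenLinGroup.map (f : A.carrier →+* B.carrier)).comp (ψ v))
      fun e => constPGL B (φ (𝒢.γ e)) := by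
  intro e n
  have := congrArg (Matrix.ProjGenLinGroup.map (f : A.carrier →+* B.carrier)) (h e n)
  rw [map_mul, map_mul, map_inv, map_constPGL] at this
  exact this

variable (𝒢)

/-- The functor of compatible families of lifts on the vertex groups. -/
def gluedFunctor : ArtAlg K ⥤ Type u where
  obj A := 𝒢.GluedFamily A
  map {A B} f := TypeCat.ofHom fun ψ => ⟨fun v => (Matrix.ProjGenLinGroup.map
    ((show A.carrier →ₐ[K] B.carrier from f) : A.carrier →+* B.carrier)).comp (ψ.1 v),
    fun v => (ψ.2.1 v).map _, ψ.2.2.map _⟩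
  map_id A := by
    apply ConcreteCategory.hom_ext
    intro ψ
    apply Subtype.ext
    funext v
    change (Matrix.ProjGenLinGroup.map (RingHom.id A.carrier)).comp (ψ.1 v) = ψ.1 v
    rw [Matrix.ProjGenLinGroup.map_id]
    rfl
  map_comp {A B C} f g := by
    apply ConcreteCategory.hom_ext
    intro ψ
    apply Subtype.ext
    funext v
    change (Matrix.ProjGenLinGroup.map
      (((show B.carrier →ₐ[K] C.carrier from g) : B.carrier →+* C.carrier).comp
        ((show A.carrier →ₐ[K] B.carrier from f) : A.carrier →+* B.carrier))).comp (ψ.1 v) = _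
    rw [Matrix.ProjGenLinGroup.map_comp]
    rfl

variable {𝒢}

theorem isGlued_iff {A : ArtAlg K} (ψ : ∀ v, (deform (𝒢.vertexRep v)).obj A) :
    (𝒢.IsGlued (fun v => (ψ v).1) fun e => constPGL A (φ (𝒢.γ e))) ↔
      ∀ e, (𝒢.diagram.fst e).app A (ψ (𝒢.o e)) = (𝒢.diagram.snd e).app A (ψ (𝒢.t e)) := by
  refine forall_congr' fun e => Iff.trans ?_ Subtype.ext_iff.symm
  refine Iff.trans ?_ MonoidHom.ext_iff.symm
  refine forall_congr' fun n => ?_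
  change _ ↔ constPGL A (φ (𝒢.γ e))⁻¹ * (ψ (𝒢.o e)).1 (𝒢.edgeToOrg e n) *
    (constPGL A (φ (𝒢.γ e))⁻¹)⁻¹ =
      constPGL A 1 * (ψ (𝒢.t e)).1 (𝒢.edgeToTgt e n) * (constPGL A 1)⁻¹
  rw [map_inv, map_one]
  have key : ∀ x y z : PGL(2, A.carrier), x = z * y * z⁻¹ ↔ z⁻¹ * x * z⁻¹⁻¹ = 1 * y * 1⁻¹ := by
    intro x y z
    rw [one_mul, inv_one, mul_one, inv_inv, mul_assoc, mul_assoc, inv_mul_eq_iff_eq_mul,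
      eq_comm, ← mul_assoc, mul_inv_eq_iff_eq_mul, eq_comm]
  exact key _ _ _

variable (𝒢)

/-- The cone of compatible families. -/
def gluedFork : Multifork 𝒢.diagram :=
  Multifork.ofι 𝒢.diagram 𝒢.gluedFunctor
    (fun v => { app := fun A => TypeCat.ofHom fun ψ => ⟨ψ.1 v, ψ.2.1 v⟩ })
    (fun e => by
      ext A ψ
      exact (isGlued_iff fun v => ⟨ψ.1 v, ψ.2.1 v⟩).1 ψ.2.2 e)

/-- The functor of compatible families is the inverse limit over the graph of groups. -/
def isLimitGluedFork : IsLimit 𝒢.gluedFork :=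
  Multifork.IsLimit.mk _
    (fun E =>
      { app := fun A => TypeCat.ofHom fun x => ⟨fun v => ((E.ι v).app A x).1,
          fun v => ((E.ι v).app A x).2,
          (isGlued_iff fun v => (E.ι v).app A x).2 fun e =>
            ConcreteCategory.congr_hom (NatTrans.congr_app (E.condition e) A) x⟩
        naturality := fun A B f => by
          ext x
          apply Subtype.ext
          funext v
          exact congrArg Subtype.val (ConcreteCategory.congr_hom ((E.ι v).naturality f) x) })
    (fun E v => rfl)
    (fun E m hm => by
      ext A x
      apply Subtype.ext
      funext v
      exact congrArg Subtype.val
        (ConcreteCategory.congr_hom (NatTrans.congr_app (hm v) A) x))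

/-- The inverse limit is the functor of compatible families. -/
def limitFunctorIso : 𝒢.limitFunctor ≅ 𝒢.gluedFunctor :=
  (limit.isLimit _).conePointUniqueUpToIso 𝒢.isLimitGluedFork

end GraphOfGroups

end Functors

/-! ### The comparison morphism and its inverse -/

section Comparison

variable {K : Type u} [Field K] [Valued K ℤᵐ⁰] [(Valued.v : Valuation K ℤᵐ⁰).IsNontrivial]
  {N : Type u} [Group N] {φ : N →* PGL(2, K)}

namespace GraphOfGroups

variable (𝒢 : GraphOfGroups φ) {A : ArtAlg K}

/-- The restrictions of a homomorphism to the vertex groups. -/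
def restrictions {Γ : Type*} [Group Γ] (ψ : N →* Γ) (v : QVertex φ) : 𝒢.vertexGroup v →* Γ :=
  ψ.comp (𝒢.vertexGroup v).subtype

theorem isGlued_restrictions {Γ : Type*} [Group Γ] (ψ : N →* Γ) :
    𝒢.IsGlued (𝒢.restrictions ψ) fun e => ψ (𝒢.γ e) := by
  intro e n
  change ψ (𝒢.γ e * n.1 * (𝒢.γ e)⁻¹) = ψ (𝒢.γ e) * ψ n.1 * (ψ (𝒢.γ e))⁻¹
  rw [map_mul, map_mul, map_inv]

theorem isLift_restrictions {ψ : N →* PGL(2, A.carrier)} (h : IsLift φ A ψ) (v : QVertex φ) :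
    IsLift (𝒢.vertexRep v) A (𝒢.restrictions ψ v) :=
  isLift_iff.2 fun n => isLift_iff.1 h n

variable (s : 𝒢.FreePart →* N)

/-- The lift on the free part determined by a lift on `N`. -/
def freeLift (ψ : N →* PGL(2, A.carrier)) : 𝒢.FreePart →* PGL(2, A.carrier) :=
  -- The constant factor corrects the reduction from `φ(γ_e)` to `φ(s(e))`, so that a lift of `φ ∘
  -- s` results; being invertible, it loses no information about `ψ(γ_e)`.
  FreeGroup.lift fun e => constPGL A (φ (s (FreeGroup.of e)) * (φ (𝒢.γ e.1))⁻¹) * ψ (𝒢.γ e.1)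

theorem freeLift_of (ψ : N →* PGL(2, A.carrier)) (e : {e : QEdge φ // ¬ 𝒢.InSpanningTree e}) :
    𝒢.freeLift s ψ (FreeGroup.of e) =
      constPGL A (φ (s (FreeGroup.of e)) * (φ (𝒢.γ e.1))⁻¹) * ψ (𝒢.γ e.1) :=
  FreeGroup.lift_apply_of

theorem isLift_freeLift {ψ : N →* PGL(2, A.carrier)} (h : IsLift φ A ψ) :
    IsLift (φ.comp s) A (𝒢.freeLift s ψ) := by
  refine FreeGroup.ext_hom _ _ fun e => ?_
  change ReducesTo A (𝒢.freeLift s ψ (FreeGroup.of e)) (φ (s (FreeGroup.of e)))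
  rw [freeLift_of]
  have := (ReducesTo.const (A := A) (φ (s (FreeGroup.of e)) * (φ (𝒢.γ e.1))⁻¹)).mul
    (isLift_iff.1 h (𝒢.γ e.1))
  rwa [inv_mul_cancel_right] at this

theorem freeLift_map {B : ArtAlg K} (f : A.carrier →ₐ[K] B.carrier) (ψ : N →* PGL(2, A.carrier)) :
    𝒢.freeLift s ((Matrix.ProjGenLinGroup.map (f : A.carrier →+* B.carrier)).comp ψ) =
      (Matrix.ProjGenLinGroup.map (f : A.carrier →+* B.carrier)).comp (𝒢.freeLift s ψ) := by
  refine FreeGroup.ext_hom _ _ fun e => ?_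
  rw [MonoidHom.comp_apply, freeLift_of, freeLift_of,
    map_mul (Matrix.ProjGenLinGroup.map (f : A.carrier →+* B.carrier)), map_constPGL]
  rfl

variable [Fintype (QEdge φ)] [DecidableEq (QEdge φ)] {𝒢} (S : 𝒢.Splitting)

/-- The coordinates of the vertex elements that move a lift to a compatible family. -/
def coords {ψ : N →* PGL(2, A.carrier)} (h : IsLift φ A ψ) : QEdge φ × Fin 2 × Fin 2 → A.carrier :=
  (exists_moves_from S (𝒢.isLift_restrictions h) fun e => isLift_iff.1 h (𝒢.γ e)).exists.choose

/-- The compatible family that corresponds to a lift. -/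
def glue {ψ : N →* PGL(2, A.carrier)} (h : IsLift φ A ψ) (v : QVertex φ) :
    𝒢.vertexGroup v →* PGL(2, A.carrier) :=
  conjHom (vertexElt S (coords S h) v) (𝒢.restrictions ψ v)

theorem moves_glue {ψ : N →* PGL(2, A.carrier)} (h : IsLift φ A ψ) :
    Moves S (𝒢.restrictions ψ) (glue S h) (fun e => ψ (𝒢.γ e)) (coords S h) := by
  have := (exists_moves_from S (𝒢.isLift_restrictions h)
    fun e => isLift_iff.1 h (𝒢.γ e)).exists.choose_spec
  exact ⟨this.1, this.2, fun v => rfl⟩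

/-- Uniqueness in `exists_moves_from` characterizes `glue`: any coordinates that move the
restrictions of `ψ` are the chosen ones. -/
theorem eq_glue {ψ : N →* PGL(2, A.carrier)} (h : IsLift φ A ψ)
    {ψ' : ∀ v, 𝒢.vertexGroup v →* PGL(2, A.carrier)} {u : QEdge φ × Fin 2 × Fin 2 → A.carrier}
    (hm : Moves S (𝒢.restrictions ψ) ψ' (fun e => ψ (𝒢.γ e)) u) : ψ' = glue S h := by
  obtain ⟨h1, h2, h3⟩ := hm
  obtain rfl : ψ' = _ := funext h3
  obtain ⟨g1, g2, -⟩ := moves_glue S h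
  obtain rfl := (exists_moves_from S (𝒢.isLift_restrictions h)
    fun e => isLift_iff.1 h (𝒢.γ e)).unique ⟨h1, h2⟩ ⟨g1, g2⟩
  rfl

theorem isLift_glue {ψ : N →* PGL(2, A.carrier)} (h : IsLift φ A ψ) (v : QVertex φ) :
    IsLift (𝒢.vertexRep v) A (glue S h v) :=
  isLift_conjHom (reducesTo_vertexElt S (moves_glue S h).1 v) (𝒢.isLift_restrictions h v)

theorem isGlued_glue (hφ : Function.Injective φ) {ψ : N →* PGL(2, A.carrier)} (h : IsLift φ A ψ) :
    𝒢.IsGlued (glue S h) fun e => constPGL A (φ (𝒢.γ e)) :=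
  ((moves_glue S h).isGlued_iff S hφ (isLift_glue S h) fun e => isLift_iff.1 h (𝒢.γ e)).1
    (𝒢.isGlued_restrictions ψ)

theorem glue_map {B : ArtAlg K} (f : A.carrier →ₐ[K] B.carrier) {ψ : N →* PGL(2, A.carrier)}
    (h : IsLift φ A ψ) (v : QVertex φ) : glue S (h.map f) v =
      (Matrix.ProjGenLinGroup.map (f : A.carrier →+* B.carrier)).comp (glue S h v) :=
  (congrFun (eq_glue S (h.map f) ((moves_glue S h).map S f (isLift_glue S h)
    fun e => isLift_iff.1 h (𝒢.γ e))) v).symm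

/-- The free part determines the values at all `γ_e`. Together with the straightened family these
determine the coordinates, by the uniqueness in `exists_moves_to`, so the conjugations can be
undone; `hom_ext` concludes. -/
theorem eq_of_glue_eq [Nonempty (TreeVertex φ)] {ψ₁ ψ₂ : N →* PGL(2, A.carrier)}
    (h₁ : IsLift φ A ψ₁) (h₂ : IsLift φ A ψ₂) (hg : glue S h₁ = glue S h₂)
    (hf : 𝒢.freeLift s ψ₁ = 𝒢.freeLift s ψ₂) : ψ₁ = ψ₂ := by
  have hγ : ∀ e, ψ₁ (𝒢.γ e) = ψ₂ (𝒢.γ e) := by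
    intro e
    by_cases he : 𝒢.InSpanningTree e
    · rw [𝒢.γ_eq_one he, map_one, map_one]
    · have := DFunLike.congr_fun hf (FreeGroup.of ⟨e, he⟩)
      rw [freeLift_of, freeLift_of] at this
      exact mul_left_cancel this
  refine 𝒢.hom_ext (fun v n hn => ?_) hγ
  obtain ⟨a1, a2, a3⟩ := moves_glue S h₁
  obtain ⟨b1, b2, b3⟩ := moves_glue S h₂
  rw [← hg, ← funext hγ] at b2
  have hu := (exists_moves_to S (isLift_glue S h₁) fun e => isLift_iff.1 h₁ (𝒢.γ e)).unique
    ⟨a1, a2⟩ ⟨b1, b2⟩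
  have := DFunLike.congr_fun (congrFun hg v) ⟨n, hn⟩
  unfold glue at this
  rw [hu, conjHom_apply, conjHom_apply] at this
  exact mul_left_cancel (mul_right_cancel this)

/-- The elements `τ e` are read off from `χ`, with value 1 on the spanning tree. Solving the gluing
equation for the prescribed target and conjugating back gives homomorphisms on the vertex groups
glued by `τ`, which `exists_extension` assembles on `N`. By `eq_glue`, the straightening of the
result is the given family. -/
theorem exists_lift [Nonempty (TreeVertex φ)] (hφ : Function.Injective φ)
    (hfix : FixedPointsRational φ) {ψ' : ∀ v, 𝒢.vertexGroup v →* PGL(2, A.carrier)}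
    (hψ' : ∀ v, IsLift (𝒢.vertexRep v) A (ψ' v))
    (hg : 𝒢.IsGlued ψ' fun e => constPGL A (φ (𝒢.γ e))) {χ : 𝒢.FreePart →* PGL(2, A.carrier)}
    (hχ : IsLift (φ.comp s) A χ) :
    ∃ (ψ : N →* PGL(2, A.carrier)) (h : IsLift φ A ψ), glue S h = ψ' ∧ 𝒢.freeLift s ψ = χ := by
  classical
  let τ : QEdge φ → PGL(2, A.carrier) := fun e => if he : 𝒢.InSpanningTree e then 1 else
    constPGL A (φ (𝒢.γ e) * (φ (s (FreeGroup.of ⟨e, he⟩)))⁻¹) * χ (FreeGroup.of ⟨e, he⟩)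
  have hτ : ∀ e, ReducesTo A (τ e) (φ (𝒢.γ e)) := by
    intro e
    by_cases he : 𝒢.InSpanningTree e
    · rw [show τ e = 1 from dif_pos he, 𝒢.γ_eq_one he, map_one]
      exact ReducesTo.one
    · rw [show τ e = _ from dif_neg he]
      have := (ReducesTo.const (A := A) (φ (𝒢.γ e) * (φ (s (FreeGroup.of ⟨e, he⟩)))⁻¹)).mul
        (isLift_iff.1 hχ (FreeGroup.of ⟨e, he⟩))
      rwa [MonoidHom.comp_apply, inv_mul_cancel_right] at this
  obtain ⟨u, ⟨hu, hsol⟩, -⟩ := exists_moves_to S hψ' hτ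
  have hm : Moves S (fun v => conjHom (vertexElt S u v)⁻¹ (ψ' v)) ψ' τ u := by
    refine ⟨hu, hsol, fun v => MonoidHom.ext fun n => ?_⟩
    rw [conjHom_apply, conjHom_apply]
    group
  obtain ⟨Ψ, hΨ, hΨγ⟩ := 𝒢.exists_extension hfix (fun v => conjHom (vertexElt S u v)⁻¹ (ψ' v)) τ
    (fun e he => dif_pos he)
    ((hm.isGlued_iff S hφ hψ' hτ).2 hg)
  have hres : 𝒢.restrictions Ψ = fun v => conjHom (vertexElt S u v)⁻¹ (ψ' v) :=
    funext fun v => MonoidHom.ext fun n => hΨ v n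
  have hlift : IsLift φ A Ψ := by
    refine 𝒢.hom_ext (fun v n hn => ?_) fun e => ?_
    · change ReducesTo A (Ψ n) (φ n)
      rw [hΨ v ⟨n, hn⟩]
      have h1 := (reducesTo_vertexElt S hu v).inv
      rw [inv_one] at h1
      exact isLift_iff.1 (isLift_conjHom h1 (hψ' v)) ⟨n, hn⟩
    · change ReducesTo A (Ψ (𝒢.γ e)) (φ (𝒢.γ e))
      rw [hΨγ]
      exact hτ e
  refine ⟨Ψ, hlift, (eq_glue S hlift (u := u) ?_).symm, FreeGroup.ext_hom _ _ fun e => ?_⟩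
  · rwa [hres, funext hΨγ]
  · rw [freeLift_of, hΨγ, show τ e.1 = _ from dif_neg e.2, ← mul_assoc, ← map_mul, mul_assoc,
      inv_mul_cancel_left, mul_inv_cancel, map_one, one_mul]

/-- The natural transformation from the deformation functor of `N` to the product. -/
def comparison (hφ : Function.Injective φ) : deform φ ⟶
    FunctorToTypes.prod 𝒢.gluedFunctor (deform (φ.comp s)) where
  app A := TypeCat.ofHom fun ψ => ⟨⟨glue S ψ.2, isLift_glue S ψ.2, isGlued_glue S hφ ψ.2⟩,
    ⟨𝒢.freeLift s ψ.1, 𝒢.isLift_freeLift s ψ.2⟩⟩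
  naturality A B f := by
    ext ψ
    · apply Subtype.ext
      funext v
      exact glue_map S (show A.carrier →ₐ[K] B.carrier from f) ψ.2 v
    · apply Subtype.ext
      exact 𝒢.freeLift_map s (show A.carrier →ₐ[K] B.carrier from f) ψ.1

theorem isIso_comparison [Nonempty (TreeVertex φ)] (hφ : Function.Injective φ)
    (hfix : FixedPointsRational φ) : IsIso (comparison s S hφ) := by
  rw [NatTrans.isIso_iff_isIso_app]
  intro A
  rw [isIso_iff_bijective]
  constructor
  · intro ψ₁ ψ₂ h
    exact Subtype.ext (eq_of_glue_eq s S ψ₁.2 ψ₂.2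
      (congrArg Subtype.val (congrArg Prod.fst h)) (congrArg Subtype.val (congrArg Prod.snd h)))
  · rintro ⟨⟨ψ', hψ', hg⟩, χ, hχ⟩
    obtain ⟨ψ, h, h1, h2⟩ := exists_lift s S hφ hfix hψ' hg hχ
    exact ⟨⟨ψ, h⟩, Prod.ext (Subtype.ext h1) (Subtype.ext h2)⟩

end GraphOfGroups

end Comparison

end MumfordDeformation

end

/-! ### The proposition -/

theorem mainTheorem5 {K : Type u} [Field K] [Valued K ℤᵐ⁰] [CompleteSpace K]
    [(Valued.v : Valuation K ℤᵐ⁰).IsNontrivial]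
    (hchar : ringChar 𝓀[K] = ringChar K)
    {N : Type u} [Group N] [Group.FG N] [Infinite N]
    (φ : N →* PGL(2, K)) (hφ : MumfordDeformation.IsDiscreteEmbedding φ)
    (hstab : ∀ Λ : MumfordDeformation.Vertex K, Finite (MumfordDeformation.stab φ Λ))
    (hfix : MumfordDeformation.FixedPointsRational φ)
    (𝒢 : MumfordDeformation.GraphOfGroups φ)
    (s : 𝒢.FreePart →* N) (hs : 𝒢.IsSplitting s) :
    Nonempty (MumfordDeformation.deform φ ≅
      𝒢.limitFunctor ⨯ MumfordDeformation.deform (φ.comp s)) := by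
  classical
  have hV := MumfordDeformation.nonempty_treeVertex hstab hfix
  have hE := MumfordDeformation.finite_qEdge hstab
  have := Fintype.ofFinite (MumfordDeformation.QEdge φ)
  obtain ⟨S⟩ := 𝒢.nonempty_linearSplitting hchar hφ.1 hstab hfix
  have := MumfordDeformation.GraphOfGroups.isIso_comparison s S hφ.1 hfix
  exact ⟨asIso (MumfordDeformation.GraphOfGroups.comparison s S hφ.1) ≪≫
    (FunctorToTypes.binaryProductIso _ _).symm ≪≫ prod.mapIso 𝒢.limitFunctorIso.symm (Iso.refl _)⟩
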